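/- Let $r,t\in\mathbb{N}$ and let $\boldsymbol\omega=(\omega_k)_{k\ge 0}$ be a sequence of complex numbers. An $(r,t)$-sequence is a permutation $A=(a_1,\dots,a_{r+t})$ of $(1^r,(-1)^t)$; $\mathbb{S}_{r+t}$ acts on such sequences by permuting positions, with simple reflections $\mathsf{s}_i=(i\ i{+}1)$. The degenerate affine walled Brauer category is the $\mathbb{C}$-linear category whose objects are the $(r,t)$-sequences, whose morphisms are generated by $y_i\colon A\to A$ $(1\le i\le r+t)$; $s_i\colon A\to A$ if $a_i=a_{i+1}$; and, if $a_i\ne a_{i+1}$, $e_i\colon A\to A$ and $\hat s_i,\hat e_i\colon A\to \mathsf{s}_iA$ $(1\le i\le r+t-1)$, subject to the following relations. Here $\dot s_i$ stands for $s_i$ or $\hat s_i$, and $\dot e_i$ for $e_i$ or $\hat e_i$, chosen independently at each occurrence, and the relations are imposed for all choices for which both sides are defined and have the same source and target: 1. $\dot s_i\dot s_i=1$; $\dot s_i\dot s_j=\dot s_j\dot s_i$ for $|i-j|>1$; $\dot s_i\dot s_{i+1}\dot s_i=\dot s_{i+1}\dot s_i\dot s_{i+1}$; $\dot s_iy_j=y_j\dot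 s_i$ for $j\ne i,i+1$; 2. $e_i^2=\omega_0e_i$; and $e_1y_1^ke_1=\omega_ke_1$ for all $k\ge 0$ on objects with $a_1=1$, $a_2=-1$; 3. $\dot s_i\dot e_j=\dot e_j\dot s_i$ and $\dot e_i\dot e_j=\dot e_j\dot e_i$ for $|i-j|>1$; $\dot e_iy_j=y_j\dot e_i$ for $j\ne i,i+1$; $y_iy_j=y_jy_i$; 4. $\hat s_i\dot e_i=\dot e_i=\dot e_i\hat s_i$; $\dot s_i\dot e_{i+1}\dot e_i=\dot s_{i+1}\dot e_i$; $\dot e_i\dot e_{i+1}\dot s_i=\dot e_i\dot s_{i+1}$; $\dot e_{i+1}\dot e_i\dot s_{i+1}=\dot e_{i+1}\dot s_i$; $\dot s_{i+1}\dot e_i\dot e_{i+1}=\dot s_i\dot e_{i+1}$; $\dot e_{i+1}\dot e_i\dot e_{i+1}=\dot e_{i+1}$; $\dot e_i\dot e_{i+1}\dot e_i=\dot e_i$; 5. $s_iy_i-y_{i+1}s_i=-1$; $s_iy_{i+1}-y_is_i=1$; $\hat s_iy_i-y_{i+1}\hat s_i=\hat e_i$; $\hat s_iy_{i+1}-y_i\hat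 s_i=-\hat e_i$; 6. $\dot e_i(y_i+y_{i+1})=0$; $(y_i+y_{i+1})\dot e_i=0$. For an $(r,t)$-sequence $A$, the degenerate affine walled Brauer algebra $\mathrm{VVB}_A(\boldsymbol\omega)$ is the endomorphism algebra of $A$ in this category. Let $R=\mathbb{C}[y_1,\dots,y_{r+t}]$, on which $\mathbb{S}_{r+t}$ acts by permuting the variables, and let $W_A\subseteq\mathbb{S}_{r+t}$ be the stabiliser of $A$. A polynomial $p\in R$ satisfies $Q$-cancellation with respect to $y_i,y_j$ ($i\ne j$) if substituting $y_j\mapsto -y_i$ in $p$ gives the same polynomial as substituting $y_i\mapsto 0$, $y_j\mapsto 0$. Let $A$ be an $(r,t)$-sequence and let $i,j$ be any two indices with $a_i\ne a_j$. Then the algebra homomorphism $R\to\mathrm{VVB}_A(\boldsymbol\omega)$, $y_k\mapsto y_k$, is injective, and, regarding $R$ as a subalgebra through it, the centre of $\mathrm{VVB}_A(\boldsymbol\omega)$ consists exactly of the polynomials $p\in R^{W_A}$ that satisfy $Q$-cancellation with respect to $y_i,y_j$. -/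

import Mathlib

namespace WalledBrauer

open CategoryTheory

/-- The sequence `(1, …, 1, -1, …, -1)` with `r` entries `1` followed by `t` entries `-1`. -/
def stdSeq (r t : ℕ) : Fin (r + t) → ℤ := fun i => if i.val < r then 1 else -1

/-- `(r,t)`-sequences: the permutations of `(1, …, 1, -1, …, -1)`. -/
def Seq (r t : ℕ) : Type :=
  {a : Fin (r + t) → ℤ // ∃ w : Equiv.Perm (Fin (r + t)), a = stdSeq r t ∘ w}

variable {r t : ℕ}

instance : CoeFun (Seq r t) (fun _ => Fin (r + t) → ℤ) := ⟨Subtype.val⟩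

/-- The symmetric group acts on `(r,t)`-sequences by permuting the positions. -/
instance : MulAction (Equiv.Perm (Fin (r + t))) (Seq r t) where
  smul w A := ⟨fun i => A (w⁻¹ i), by
    obtain ⟨v, hv⟩ := A.2
    refine ⟨v * w⁻¹, ?_⟩
    funext i
    exact congrFun hv _⟩
  one_smul _ := rfl
  mul_smul v w A := by
    apply Subtype.ext
    funext i
    change A.1 ((v * w)⁻¹ i) = A.1 (w⁻¹ (v⁻¹ i))
    rw [mul_inv_rev]
    rfl

/-- For an index `i` of a simple reflection, the first of the two positions it exchanges
(the `i`-th position; everything is numbered from `0`). -/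
def lo (i : Fin (r + t - 1)) : Fin (r + t) := ⟨i.val, by omega⟩

/-- For an index `i` of a simple reflection, the second of the two positions it exchanges
(the `(i+1)`-st position). -/
def hi (i : Fin (r + t - 1)) : Fin (r + t) := ⟨i.val + 1, by omega⟩

/-- The simple reflections of the symmetric group. -/
def refl (i : Fin (r + t - 1)) : Equiv.Perm (Fin (r + t)) := Equiv.swap (lo i) (hi i)

/-- The generating morphisms `A → B` (the condition `a_i ≠ a_{i+1}` says that the simple
reflection `i` does not fix `A`). -/
inductive Gen : Seq r t → Seq r t → Type
  | y (A : Seq r t) (i : Fin (r + t)) : Gen A A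
  | s (A : Seq r t) (i : Fin (r + t - 1)) (h : A (lo i) = A (hi i)) : Gen A A
  | e (A : Seq r t) (i : Fin (r + t - 1)) (h : A (lo i) ≠ A (hi i)) : Gen A A
  | sHat (A : Seq r t) (i : Fin (r + t - 1)) (h : A (lo i) ≠ A (hi i)) : Gen A (refl i • A)
  | eHat (A : Seq r t) (i : Fin (r + t - 1)) (h : A (lo i) ≠ A (hi i)) : Gen A (refl i • A)

/-- Formal `ℂ`-linear combinations of formal composites of generating morphisms. -/
inductive Pre : Seq r t → Seq r t → Type
  | gen {A B : Seq r t} (g : Gen A B) : Pre A B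
  | id (A : Seq r t) : Pre A A
  /-- The composite `g f`: first `f`, then `g`. -/
  | mul {A B C : Seq r t} (g : Pre B C) (f : Pre A B) : Pre A C
  | zero (A B : Seq r t) : Pre A B
  | add {A B : Seq r t} (f g : Pre A B) : Pre A B
  | smul {A B : Seq r t} (c : ℂ) (f : Pre A B) : Pre A B

namespace Pre

/-- Formal differences. -/
def sub {A B : Seq r t} (f g : Pre A B) : Pre A B := add f (smul (-1) g)

/-- The generator `y_i`. -/
def y (A : Seq r t) (i : Fin (r + t)) : Pre A A := gen (Gen.y A i)

/-- The power `y_i ^ k`. -/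
def yPow (A : Seq r t) (i : Fin (r + t)) : ℕ → Pre A A
  | 0 => id A
  | k + 1 => mul (y A i) (yPow A i k)

/-- `IsS i f`: the morphism `f` is one of the generators `s_i`, `ŝ_i`. -/
inductive IsS (i : Fin (r + t - 1)) : ∀ {A B : Seq r t}, Pre A B → Prop
  | s (A : Seq r t) (h : A (lo i) = A (hi i)) : IsS i (gen (Gen.s A i h))
  | sHat (A : Seq r t) (h : A (lo i) ≠ A (hi i)) : IsS i (gen (Gen.sHat A i h))

/-- `IsE i f`: the morphism `f` is one of the generators `e_i`, `ê_i`. -/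
inductive IsE (i : Fin (r + t - 1)) : ∀ {A B : Seq r t}, Pre A B → Prop
  | e (A : Seq r t) (h : A (lo i) ≠ A (hi i)) : IsE i (gen (Gen.e A i h))
  | eHat (A : Seq r t) (h : A (lo i) ≠ A (hi i)) : IsE i (gen (Gen.eHat A i h))

/-- `IsSHat i f`: the morphism `f` is a generator `ŝ_i`. -/
inductive IsSHat (i : Fin (r + t - 1)) : ∀ {A B : Seq r t}, Pre A B → Prop
  | sHat (A : Seq r t) (h : A (lo i) ≠ A (hi i)) : IsSHat i (gen (Gen.sHat A i h))

/-- `IsEHat i f`: the morphism `f` is a generator `ê_i`. -/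
inductive IsEHat (i : Fin (r + t - 1)) : ∀ {A B : Seq r t}, Pre A B → Prop
  | eHat (A : Seq r t) (h : A (lo i) ≠ A (hi i)) : IsEHat i (gen (Gen.eHat A i h))

end Pre

/-- Two indices of simple reflections at distance more than `1`. -/
def Far (i j : Fin (r + t - 1)) : Prop := i.val + 1 < j.val ∨ j.val + 1 < i.val

open Pre

infixl:70 " ⬝ " => WalledBrauer.Pre.mul

/-- The defining relations of the degenerate affine walled Brauer category. A word in dotted
letters may be filled in independently at each letter, as long as both sides are composable and
have the same source and the same target. -/
inductive DefRel (ω : ℕ → ℂ) : ∀ {A B : Seq r t}, Pre A B → Pre A B → Prop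
  -- `ṡ_i ṡ_i = 1`
  | s_sq {i : Fin (r + t - 1)} {A B : Seq r t} {f : Pre A B} {g : Pre B A} :
      IsS i f → IsS i g → DefRel ω (g ⬝ f) (Pre.id A)
  -- `ṡ_i ṡ_j = ṡ_j ṡ_i` for `|i - j| > 1`
  | s_s_far {i j : Fin (r + t - 1)} {A B B' C : Seq r t}
      {f₁ : Pre B C} {f₂ : Pre A B} {g₁ : Pre B' C} {g₂ : Pre A B'} :
      Far i j → IsS i f₁ → IsS j f₂ → IsS j g₁ → IsS i g₂ → DefRel ω (f₁ ⬝ f₂) (g₁ ⬝ g₂)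
  -- `ṡ_i ṡ_{i+1} ṡ_i = ṡ_{i+1} ṡ_i ṡ_{i+1}`
  | braid {i j : Fin (r + t - 1)} {A B C B' C' D : Seq r t}
      {f₁ : Pre C D} {f₂ : Pre B C} {f₃ : Pre A B}
      {g₁ : Pre C' D} {g₂ : Pre B' C'} {g₃ : Pre A B'} :
      j.val = i.val + 1 → IsS i f₁ → IsS j f₂ → IsS i f₃ → IsS j g₁ → IsS i g₂ → IsS j g₃ →
      DefRel ω (f₁ ⬝ f₂ ⬝ f₃) (g₁ ⬝ g₂ ⬝ g₃)
  -- `ṡ_i y_j = y_j ṡ_i` for `j ≠ i, i + 1`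
  | s_y_far {i : Fin (r + t - 1)} {j : Fin (r + t)} {A B : Seq r t} {f : Pre A B} :
      j ≠ lo i → j ≠ hi i → IsS i f → DefRel ω (f ⬝ Pre.y A j) (Pre.y B j ⬝ f)
  -- `e_i e_i = ω_0 e_i`
  | e_sq (A : Seq r t) (i : Fin (r + t - 1)) (h : A (lo i) ≠ A (hi i)) :
      DefRel ω (gen (Gen.e A i h) ⬝ gen (Gen.e A i h)) (smul (ω 0) (gen (Gen.e A i h)))
  -- `e_1 y_1^k e_1 = ω_k e_1` if `a_1 = 1` and `a_2 = -1`
  | e_y_e (A : Seq r t) (i : Fin (r + t - 1)) (h : A (lo i) ≠ A (hi i)) (k : ℕ) :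
      i.val = 0 → A (lo i) = 1 → A (hi i) = -1 →
      DefRel ω (gen (Gen.e A i h) ⬝ yPow A (lo i) k ⬝ gen (Gen.e A i h))
        (smul (ω k) (gen (Gen.e A i h)))
  -- `ṡ_i ė_j = ė_j ṡ_i` for `|i - j| > 1`
  | s_e_far {i j : Fin (r + t - 1)} {A B B' C : Seq r t}
      {f₁ : Pre B C} {f₂ : Pre A B} {g₁ : Pre B' C} {g₂ : Pre A B'} :
      Far i j → IsS i f₁ → IsE j f₂ → IsE j g₁ → IsS i g₂ → DefRel ω (f₁ ⬝ f₂) (g₁ ⬝ g₂)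
  -- `ė_i ė_j = ė_j ė_i` for `|i - j| > 1`
  | e_e_far {i j : Fin (r + t - 1)} {A B B' C : Seq r t}
      {f₁ : Pre B C} {f₂ : Pre A B} {g₁ : Pre B' C} {g₂ : Pre A B'} :
      Far i j → IsE i f₁ → IsE j f₂ → IsE j g₁ → IsE i g₂ → DefRel ω (f₁ ⬝ f₂) (g₁ ⬝ g₂)
  -- `ė_i y_j = y_j ė_i` for `j ≠ i, i + 1`
  | e_y_far {i : Fin (r + t - 1)} {j : Fin (r + t)} {A B : Seq r t} {f : Pre A B} :
      j ≠ lo i → j ≠ hi i → IsE i f → DefRel ω (f ⬝ Pre.y A j) (Pre.y B j ⬝ f)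
  -- `y_i y_j = y_j y_i`
  | y_y (A : Seq r t) (i j : Fin (r + t)) :
      DefRel ω (Pre.y A i ⬝ Pre.y A j) (Pre.y A j ⬝ Pre.y A i)
  -- `ŝ_i ė_i = ė_i`
  | sHat_e {i : Fin (r + t - 1)} {A B C : Seq r t}
      {f : Pre B C} {g : Pre A B} {g' : Pre A C} :
      IsSHat i f → IsE i g → IsE i g' → DefRel ω (f ⬝ g) g'
  -- `ė_i ŝ_i = ė_i`
  | e_sHat {i : Fin (r + t - 1)} {A B C : Seq r t}
      {f : Pre B C} {g : Pre A B} {f' : Pre A C} :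
      IsE i f → IsSHat i g → IsE i f' → DefRel ω (f ⬝ g) f'
  -- `ṡ_i ė_{i+1} ė_i = ṡ_{i+1} ė_i`
  | s_e_e {i j : Fin (r + t - 1)} {A B C B' D : Seq r t}
      {f₁ : Pre C D} {f₂ : Pre B C} {f₃ : Pre A B} {g₁ : Pre B' D} {g₂ : Pre A B'} :
      j.val = i.val + 1 → IsS i f₁ → IsE j f₂ → IsE i f₃ → IsS j g₁ → IsE i g₂ →
      DefRel ω (f₁ ⬝ f₂ ⬝ f₃) (g₁ ⬝ g₂)
  -- `ė_i ė_{i+1} ṡ_i = ė_i ṡ_{i+1}`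
  | e_e_s {i j : Fin (r + t - 1)} {A B C B' D : Seq r t}
      {f₁ : Pre C D} {f₂ : Pre B C} {f₃ : Pre A B} {g₁ : Pre B' D} {g₂ : Pre A B'} :
      j.val = i.val + 1 → IsE i f₁ → IsE j f₂ → IsS i f₃ → IsE i g₁ → IsS j g₂ →
      DefRel ω (f₁ ⬝ f₂ ⬝ f₃) (g₁ ⬝ g₂)
  -- `ė_{i+1} ė_i ṡ_{i+1} = ė_{i+1} ṡ_i`
  | e_e_s' {i j : Fin (r + t - 1)} {A B C B' D : Seq r t}
      {f₁ : Pre C D} {f₂ : Pre B C} {f₃ : Pre A B} {g₁ : Pre B' D} {g₂ : Pre A B'} :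
      j.val = i.val + 1 → IsE j f₁ → IsE i f₂ → IsS j f₃ → IsE j g₁ → IsS i g₂ →
      DefRel ω (f₁ ⬝ f₂ ⬝ f₃) (g₁ ⬝ g₂)
  -- `ṡ_{i+1} ė_i ė_{i+1} = ṡ_i ė_{i+1}`
  | s_e_e' {i j : Fin (r + t - 1)} {A B C B' D : Seq r t}
      {f₁ : Pre C D} {f₂ : Pre B C} {f₃ : Pre A B} {g₁ : Pre B' D} {g₂ : Pre A B'} :
      j.val = i.val + 1 → IsS j f₁ → IsE i f₂ → IsE j f₃ → IsS i g₁ → IsE j g₂ →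
      DefRel ω (f₁ ⬝ f₂ ⬝ f₃) (g₁ ⬝ g₂)
  -- `ė_{i+1} ė_i ė_{i+1} = ė_{i+1}`
  | e_e_e {i j : Fin (r + t - 1)} {A B C D : Seq r t}
      {f₁ : Pre C D} {f₂ : Pre B C} {f₃ : Pre A B} {g : Pre A D} :
      j.val = i.val + 1 → IsE j f₁ → IsE i f₂ → IsE j f₃ → IsE j g →
      DefRel ω (f₁ ⬝ f₂ ⬝ f₃) g
  -- `ė_i ė_{i+1} ė_i = ė_i`
  | e_e_e' {i j : Fin (r + t - 1)} {A B C D : Seq r t}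
      {f₁ : Pre C D} {f₂ : Pre B C} {f₃ : Pre A B} {g : Pre A D} :
      j.val = i.val + 1 → IsE i f₁ → IsE j f₂ → IsE i f₃ → IsE i g →
      DefRel ω (f₁ ⬝ f₂ ⬝ f₃) g
  -- `s_i y_i - y_{i+1} s_i = -1`
  | s_y (A : Seq r t) (i : Fin (r + t - 1)) (h : A (lo i) = A (hi i)) :
      DefRel ω (Pre.sub (gen (Gen.s A i h) ⬝ Pre.y A (lo i)) (Pre.y A (hi i) ⬝ gen (Gen.s A i h)))
        (smul (-1) (Pre.id A))
  -- `s_i y_{i+1} - y_i s_i = 1`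
  | s_y' (A : Seq r t) (i : Fin (r + t - 1)) (h : A (lo i) = A (hi i)) :
      DefRel ω (Pre.sub (gen (Gen.s A i h) ⬝ Pre.y A (hi i)) (Pre.y A (lo i) ⬝ gen (Gen.s A i h)))
        (Pre.id A)
  -- `ŝ_i y_i - y_{i+1} ŝ_i = ê_i`
  | sHat_y {i : Fin (r + t - 1)} {A B : Seq r t} {f g : Pre A B} :
      IsSHat i f → IsEHat i g →
      DefRel ω (Pre.sub (f ⬝ Pre.y A (lo i)) (Pre.y B (hi i) ⬝ f)) g
  -- `ŝ_i y_{i+1} - y_i ŝ_i = -ê_i`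
  | sHat_y' {i : Fin (r + t - 1)} {A B : Seq r t} {f g : Pre A B} :
      IsSHat i f → IsEHat i g →
      DefRel ω (Pre.sub (f ⬝ Pre.y A (hi i)) (Pre.y B (lo i) ⬝ f)) (smul (-1) g)
  -- `ė_i (y_i + y_{i+1}) = 0`
  | e_y_add {i : Fin (r + t - 1)} {A B : Seq r t} {f : Pre A B} :
      IsE i f → DefRel ω (f ⬝ Pre.add (Pre.y A (lo i)) (Pre.y A (hi i))) (Pre.zero A B)
  -- `(y_i + y_{i+1}) ė_i = 0`
  | y_add_e {i : Fin (r + t - 1)} {A B : Seq r t} {f : Pre A B} :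
      IsE i f → DefRel ω (Pre.add (Pre.y B (lo i)) (Pre.y B (hi i)) ⬝ f) (Pre.zero A B)

/-- The smallest congruence on formal morphisms that contains the defining relations and makes
the quotient a `ℂ`-linear category. -/
inductive Rel (ω : ℕ → ℂ) : ∀ {A B : Seq r t}, Pre A B → Pre A B → Prop
  | of {A B : Seq r t} {f g : Pre A B} : DefRel ω f g → Rel ω f g
  -- equivalence relation
  | refl {A B : Seq r t} (f : Pre A B) : Rel ω f f
  | symm {A B : Seq r t} {f g : Pre A B} : Rel ω f g → Rel ω g f
  | trans {A B : Seq r t} {f g h : Pre A B} : Rel ω f g → Rel ω g h → Rel ω f h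
  -- compatibility with the operations
  | mul_congr {A B C : Seq r t} {g g' : Pre B C} {f f' : Pre A B} :
      Rel ω g g' → Rel ω f f' → Rel ω (g ⬝ f) (g' ⬝ f')
  | add_congr {A B : Seq r t} {f f' g g' : Pre A B} :
      Rel ω f f' → Rel ω g g' → Rel ω (add f g) (add f' g')
  | smul_congr {A B : Seq r t} (c : ℂ) {f f' : Pre A B} :
      Rel ω f f' → Rel ω (smul c f) (smul c f')
  -- category axioms
  | id_mul {A B : Seq r t} (f : Pre A B) : Rel ω (Pre.id B ⬝ f) f
  | mul_id {A B : Seq r t} (f : Pre A B) : Rel ω (f ⬝ Pre.id A) f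
  | mul_assoc {A B C D : Seq r t} (h : Pre C D) (g : Pre B C) (f : Pre A B) :
      Rel ω (h ⬝ g ⬝ f) (h ⬝ (g ⬝ f))
  -- vector space axioms
  | add_assoc {A B : Seq r t} (f g h : Pre A B) : Rel ω (add (add f g) h) (add f (add g h))
  | add_comm {A B : Seq r t} (f g : Pre A B) : Rel ω (add f g) (add g f)
  | zero_add {A B : Seq r t} (f : Pre A B) : Rel ω (add (Pre.zero A B) f) f
  | one_smul {A B : Seq r t} (f : Pre A B) : Rel ω (smul 1 f) f
  | zero_smul {A B : Seq r t} (f : Pre A B) : Rel ω (smul 0 f) (Pre.zero A B)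
  | mul_smul {A B : Seq r t} (c d : ℂ) (f : Pre A B) : Rel ω (smul (c * d) f) (smul c (smul d f))
  | add_smul {A B : Seq r t} (c d : ℂ) (f : Pre A B) :
      Rel ω (smul (c + d) f) (add (smul c f) (smul d f))
  | smul_add {A B : Seq r t} (c : ℂ) (f g : Pre A B) :
      Rel ω (smul c (add f g)) (add (smul c f) (smul c g))
  -- bilinearity of the composition
  | mul_add {A B C : Seq r t} (g : Pre B C) (f f' : Pre A B) :
      Rel ω (g ⬝ add f f') (add (g ⬝ f) (g ⬝ f'))
  | add_mul {A B C : Seq r t} (g g' : Pre B C) (f : Pre A B) :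
      Rel ω (add g g' ⬝ f) (add (g ⬝ f) (g' ⬝ f))
  | mul_smul_comm {A B C : Seq r t} (c : ℂ) (g : Pre B C) (f : Pre A B) :
      Rel ω (g ⬝ smul c f) (smul c (g ⬝ f))
  | smul_mul_assoc {A B C : Seq r t} (c : ℂ) (g : Pre B C) (f : Pre A B) :
      Rel ω (smul c g ⬝ f) (smul c (g ⬝ f))

/-- The setoid of equality modulo the relations. -/
def relSetoid (ω : ℕ → ℂ) (A B : Seq r t) : Setoid (Pre A B) where
  r := Rel ω
  iseqv := ⟨Rel.refl, Rel.symm, Rel.trans⟩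

/-- Morphisms of the degenerate affine walled Brauer category. -/
def Mor (ω : ℕ → ℂ) (A B : Seq r t) : Type := Quotient (relSetoid ω A B)

namespace Mor

variable {ω : ℕ → ℂ} {A B C D : Seq r t}

/-- The class of a formal morphism. -/
def mk (ω : ℕ → ℂ) (f : Pre A B) : Mor ω A B := Quotient.mk (relSetoid ω A B) f

/-- Composition of morphisms: first `f`, then `g`. -/
def comp (g : Mor ω B C) (f : Mor ω A B) : Mor ω A C :=
  Quotient.map₂ Pre.mul (fun _ _ h₁ _ _ h₂ => Rel.mul_congr h₁ h₂) g f

instance : Zero (Mor ω A B) := ⟨mk ω (Pre.zero A B)⟩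

instance : Add (Mor ω A B) :=
  ⟨Quotient.map₂ Pre.add (fun _ _ h₁ _ _ h₂ => Rel.add_congr h₁ h₂)⟩

instance : SMul ℂ (Mor ω A B) :=
  ⟨fun c => Quotient.map (Pre.smul c) (fun _ _ h => Rel.smul_congr c h)⟩

instance : Neg (Mor ω A B) := ⟨fun f => (-1 : ℂ) • f⟩

theorem add_assoc' (f g h : Mor ω A B) : f + g + h = f + (g + h) := by
  induction f using Quotient.inductionOn
  induction g using Quotient.inductionOn
  induction h using Quotient.inductionOn
  exact Quotient.sound (Rel.add_assoc _ _ _)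

theorem add_comm' (f g : Mor ω A B) : f + g = g + f := by
  induction f using Quotient.inductionOn
  induction g using Quotient.inductionOn
  exact Quotient.sound (Rel.add_comm _ _)

theorem zero_add' (f : Mor ω A B) : 0 + f = f := by
  induction f using Quotient.inductionOn
  exact Quotient.sound (Rel.zero_add _)

theorem one_smul' (f : Mor ω A B) : (1 : ℂ) • f = f := by
  induction f using Quotient.inductionOn
  exact Quotient.sound (Rel.one_smul _)

theorem zero_smul' (f : Mor ω A B) : (0 : ℂ) • f = 0 := by
  induction f using Quotient.inductionOn
  exact Quotient.sound (Rel.zero_smul _)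

theorem mul_smul' (c d : ℂ) (f : Mor ω A B) : (c * d) • f = c • d • f := by
  induction f using Quotient.inductionOn
  exact Quotient.sound (Rel.mul_smul _ _ _)

theorem add_smul' (c d : ℂ) (f : Mor ω A B) : (c + d) • f = c • f + d • f := by
  induction f using Quotient.inductionOn
  exact Quotient.sound (Rel.add_smul _ _ _)

theorem smul_add' (c : ℂ) (f g : Mor ω A B) : c • (f + g) = c • f + c • g := by
  induction f using Quotient.inductionOn
  induction g using Quotient.inductionOn
  exact Quotient.sound (Rel.smul_add _ _ _)

theorem neg_add_cancel' (f : Mor ω A B) : -f + f = 0 := by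
  have h : (-1 : ℂ) • f + f = ((-1 : ℂ) + 1) • f := by rw [add_smul', one_smul']
  change (-1 : ℂ) • f + f = 0
  rw [h, neg_add_cancel, zero_smul']

instance : AddCommGroup (Mor ω A B) where
  add_assoc := add_assoc'
  zero_add := zero_add'
  add_zero f := by rw [add_comm', zero_add']
  add_comm := add_comm'
  neg_add_cancel := neg_add_cancel'
  nsmul := nsmulRec
  zsmul := zsmulRec

instance : Module ℂ (Mor ω A B) where
  one_smul := one_smul'
  mul_smul := mul_smul'
  smul_zero c := by
    rw [← zero_smul' (0 : Mor ω A B), ← mul_smul', mul_zero]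
  smul_add := smul_add'
  add_smul := add_smul'
  zero_smul := zero_smul'

end Mor

/-- The degenerate affine walled Brauer category with parameters `ω`: its objects are the
`(r,t)`-sequences. -/
structure Cat (r t : ℕ) (ω : ℕ → ℂ) : Type where
  /-- The `(r,t)`-sequence that is the object. -/
  seq : Seq r t

namespace Cat

variable {ω : ℕ → ℂ}

instance : Category (Cat r t ω) where
  Hom A B := Mor ω A.seq B.seq
  id A := Mor.mk ω (Pre.id A.seq)
  comp f g := Mor.comp g f
  id_comp f := by
    induction f using Quotient.inductionOn
    exact Quotient.sound (Rel.mul_id _)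
  comp_id f := by
    induction f using Quotient.inductionOn
    exact Quotient.sound (Rel.id_mul _)
  assoc f g h := by
    induction f using Quotient.inductionOn
    induction g using Quotient.inductionOn
    induction h using Quotient.inductionOn
    exact Quotient.sound (Rel.symm (Rel.mul_assoc _ _ _))

instance : Preadditive (Cat r t ω) where
  homGroup A B := inferInstanceAs (AddCommGroup (Mor ω A.seq B.seq))
  add_comp _ _ _ f f' g := by
    induction f using Quotient.inductionOn
    induction f' using Quotient.inductionOn
    induction g using Quotient.inductionOn
    exact Quotient.sound (Rel.mul_add _ _ _)
  comp_add _ _ _ f g g' := by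
    induction f using Quotient.inductionOn
    induction g using Quotient.inductionOn
    induction g' using Quotient.inductionOn
    exact Quotient.sound (Rel.add_mul _ _ _)

instance : Linear ℂ (Cat r t ω) where
  homModule A B := inferInstanceAs (Module ℂ (Mor ω A.seq B.seq))
  smul_comp _ _ _ c f g := by
    induction f using Quotient.inductionOn
    induction g using Quotient.inductionOn
    exact Quotient.sound (Rel.mul_smul_comm _ _ _)
  comp_smul _ _ _ f c g := by
    induction f using Quotient.inductionOn
    induction g using Quotient.inductionOn
    exact Quotient.sound (Rel.smul_mul_assoc _ _ _)

end Cat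

/-- The degenerate affine walled Brauer algebra of `A`: the endomorphism algebra of `A` in the
degenerate affine walled Brauer category. -/
abbrev VVB (ω : ℕ → ℂ) (A : Seq r t) : Type := End (Cat.mk A : Cat r t ω)

/-- The element `y_i` of the degenerate affine walled Brauer algebra. -/
def yElt (ω : ℕ → ℂ) (A : Seq r t) (i : Fin (r + t)) : VVB ω A := Mor.mk ω (Pre.y A i)

theorem yElt_comm (ω : ℕ → ℂ) (A : Seq r t) (i j : Fin (r + t)) :
    yElt ω A i * yElt ω A j = yElt ω A j * yElt ω A i :=
  Quotient.sound (Rel.of (DefRel.y_y A i j))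

/-- The polynomial ring `R = ℂ[y_1, …, y_{r+t}]`. -/
abbrev R (r t : ℕ) : Type := MvPolynomial (Fin (r + t)) ℂ

open scoped IsMulCommutative in
/-- Evaluation of polynomials at the (commuting) elements `y_i`, the algebra homomorphism from
`R` to the degenerate affine walled Brauer algebra with `y_i ↦ y_i`. -/
noncomputable def polyMap (ω : ℕ → ℂ) (A : Seq r t) : R r t →ₐ[ℂ] VVB ω A :=
  haveI : IsMulCommutative (Algebra.adjoin ℂ (Set.range (yElt ω A))) :=
    Algebra.isMulCommutative_adjoin ℂ (by
      rintro _ ⟨i, rfl⟩ _ ⟨j, rfl⟩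
      exact yElt_comm ω A i j)
  (Algebra.adjoin ℂ (Set.range (yElt ω A))).val.comp
    (MvPolynomial.aeval fun i =>
      (⟨yElt ω A i, Algebra.subset_adjoin ⟨i, rfl⟩⟩ : Algebra.adjoin ℂ (Set.range (yElt ω A))))

open scoped IsMulCommutative in
theorem polyMap_X (ω : ℕ → ℂ) (A : Seq r t) (i : Fin (r + t)) :
    polyMap ω A (MvPolynomial.X i) = yElt ω A i := by
  simp [polyMap]

/-- `p` is invariant under the permutations of the variables by elements of `W`. -/
def IsInvariant (W : Subgroup (Equiv.Perm (Fin (r + t)))) (p : R r t) : Prop :=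
  ∀ w ∈ W, MvPolynomial.rename w p = p

/-- `p` satisfies `Q`-cancellation with respect to `y_i, y_j`: substituting `-y_i` for `y_j`
gives the same polynomial as substituting `0` for both `y_i` and `y_j`. -/
def QCancellation (i j : Fin (r + t)) (p : R r t) : Prop :=
  MvPolynomial.aeval (fun k => if k = j then -MvPolynomial.X i else MvPolynomial.X k : _ → R r t) p
    = MvPolynomial.aeval (fun k => if k = i ∨ k = j then 0 else MvPolynomial.X k : _ → R r t) p

end WalledBrauer

namespace WalledBrauer

noncomputable section

section
open Equiv Finset Module LinearMap Algebra MvPolynomial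

section CommEval

variable {σ A : Type*} [Ring A] [Algebra ℂ A]

open scoped IsMulCommutative in
/-- Evaluation of a polynomial at a family of pairwise commuting elements of an algebra. -/
def commEval (a : σ → A) (ha : ∀ i j, a i * a j = a j * a i) : MvPolynomial σ ℂ →ₐ[ℂ] A :=
  haveI : IsMulCommutative (adjoin ℂ (Set.range a)) :=
    isMulCommutative_adjoin ℂ (by
      rintro _ ⟨i, rfl⟩ _ ⟨j, rfl⟩
      exact ha i j)
  (adjoin ℂ (Set.range a)).val.comp
    (MvPolynomial.aeval fun i =>
      (⟨a i, subset_adjoin ⟨i, rfl⟩⟩ : adjoin ℂ (Set.range a)))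

open scoped IsMulCommutative in
@[simp] theorem commEval_X (a : σ → A) (ha : ∀ i j, a i * a j = a j * a i) (i : σ) :
    commEval a ha (X i) = a i := by
  simp [commEval]

end CommEval

namespace Hecke

variable {ι : Type} [Fintype ι] [LinearOrder ι]

variable (ι) in
/-- The free module with basis the symmetric group over the polynomial ring: the underlying space of
the regular representation of the degenerate affine Hecke algebra. -/
abbrev Reg : Type := Perm ι → MvPolynomial ι ℂ

/-- The basis vector of a permutation. -/
def bv (w : Perm ι) : Reg ι := Pi.single w 1

theorem end_ext {f g : End (MvPolynomial ι ℂ) (Reg ι)} (h : ∀ w, f (bv w) = g (bv w)) : f = g := by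
  apply (Pi.basisFun (MvPolynomial ι ℂ) (Perm ι)).ext
  intro w
  simpa [bv] using h w

/-- The endomorphism with prescribed values on the basis. -/
def endOf (v : Perm ι → Reg ι) : End (MvPolynomial ι ℂ) (Reg ι) :=
  (Pi.basisFun (MvPolynomial ι ℂ) (Perm ι)).constr (MvPolynomial ι ℂ) v

@[simp] theorem endOf_bv (v : Perm ι → Reg ι) (w : Perm ι) : endOf v (bv w) = v w := by
  simp [bv, endOf]

/-- Permutations act by left multiplication. -/
def gOp : Perm ι →* End (MvPolynomial ι ℂ) (Reg ι) where
  toFun g := endOf fun w => bv (g * w)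
  map_one' := end_ext fun w => by simp
  map_mul' g h := end_ext fun w => by simp [mul_assoc]

@[simp] theorem gOp_bv (g w : Perm ι) : gOp g (bv w) = bv (g * w) := by
  simp [gOp]

/-- The polynomial generators in their equivariant normalisation. -/
def xOp (k : ι) : End (MvPolynomial ι ℂ) (Reg ι) :=
  endOf fun w => (X (w⁻¹ k) : MvPolynomial ι ℂ) • bv w -
    ∑ j ∈ univ.filter (· < w⁻¹ k), bv (w * swap j (w⁻¹ k))

theorem xOp_bv (k : ι) (w : Perm ι) : xOp k (bv w) = (X (w⁻¹ k) : MvPolynomial ι ℂ) • bv w -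
      ∑ j ∈ univ.filter (· < w⁻¹ k), bv (w * swap j (w⁻¹ k)) := by
  simp [xOp]

theorem gOp_mul_xOp (g : Perm ι) (k : ι) : gOp g * xOp k = xOp (g k) * gOp g := by
  apply end_ext
  intro w
  simp [xOp_bv, map_sub, map_sum, mul_assoc]

end Hecke

theorem commutator_of_equivariant {ι A : Type*} [Fintype ι] [LinearOrder ι] [Ring A]
    (g : Perm ι →* A) (x : ι → A) (hgx : ∀ w k, g w * x k = x (w k) * g w)
    {i j : ι} (hij : i < j) :
    (x i + ∑ a ∈ univ.filter (· < i), g (swap a i)) *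
        (x j + ∑ b ∈ univ.filter (· < j), g (swap b j)) -
      (x j + ∑ b ∈ univ.filter (· < j), g (swap b j)) *
        (x i + ∑ a ∈ univ.filter (· < i), g (swap a i)) =
      x i * x j - x j * x i + (x i - x j) * g (swap i j) := by
  set J := ∑ b ∈ univ.filter (· < j), g (swap b j) with hJ
  set I := ∑ a ∈ univ.filter (· < i), g (swap a i) with hI
  have h1 : I * x j = x j * I := by
    rw [hI, sum_mul, mul_sum]
    refine sum_congr rfl fun a ha => ?_
    have ha' : a < i := by simpa using ha
    rw [hgx, swap_apply_of_ne_of_ne (ne_of_gt (ha'.trans hij)) (ne_of_gt hij)]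
  have h2 : I * J = J * I := by
    rw [hI, sum_mul, mul_sum]
    refine sum_congr rfl fun a ha => ?_
    have ha' : a < i := by simpa using ha
    rw [hJ, sum_mul, mul_sum]
    refine sum_bij' (fun b _ => swap a i b) (fun b _ => swap a i b) ?_ ?_ ?_ ?_ ?_
    · intro b hb
      have hb' : b < j := by simpa using hb
      simp only [mem_filter_univ]
      rw [swap_apply_def]; split_ifs <;> order
    · intro b hb
      have hb' : b < j := by simpa using hb
      simp only [mem_filter_univ]
      rw [swap_apply_def]; split_ifs <;> order
    · simp
    · simp
    · intro b hb
      have hb' : b < j := by simpa using hb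
      rw [← map_mul, ← map_mul]
      congr 1
      have := swap_apply_of_ne_of_ne (ne_of_gt (ha'.trans hij)) (ne_of_gt hij)
      rw [mul_swap_eq_swap_mul, this]
  have h3 : x i * J = J * x i + (x i - x j) * g (swap i j) := by
    have hi : i ∈ univ.filter (· < j) := by simpa using hij
    rw [hJ, ← sum_erase_add _ _ hi, mul_add, add_mul, hgx, swap_apply_left]
    have : x i * ∑ b ∈ (univ.filter (· < j)).erase i, g (swap b j) =
        (∑ b ∈ (univ.filter (· < j)).erase i, g (swap b j)) * x i := by
      rw [sum_mul, mul_sum]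
      refine sum_congr rfl fun b hb => ?_
      have hb' : b ≠ i ∧ b < j := by simpa using hb
      rw [hgx, swap_apply_of_ne_of_ne hb'.1.symm hij.ne]
    rw [this, sub_mul]; abel
  have h4 : (x i + I) * (x j + J) - (x j + J) * (x i + I) =
      x i * x j - x j * x i + (x i * J - J * x i) + (I * x j - x j * I) + (I * J - J * I) := by
    noncomm_ring
  rw [h4, h1, h2, h3]; abel

theorem commutator_mul_perm {ι A : Type*} [DecidableEq ι] [Ring A]
    (g : Perm ι →* A) (x : ι → A) (hgx : ∀ w k, g w * x k = x (w k) * g w)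
    (i j : ι) (w : Perm ι) :
    (x i * x j - x j * x i + (x i - x j) * g (swap i j)) * g w =
      g w * (x (w⁻¹ i) * x (w⁻¹ j) - x (w⁻¹ j) * x (w⁻¹ i) +
        (x (w⁻¹ i) - x (w⁻¹ j)) * g (swap (w⁻¹ i) (w⁻¹ j))) := by
  have hs : g (swap i j) * g w = g w * g (swap (w⁻¹ i) (w⁻¹ j)) := by
    rw [← map_mul, ← map_mul, swap_mul_eq_mul_swap]
  have hx : ∀ k, x k * g w = g w * x (w⁻¹ k) := fun k => by
    rw [hgx]; simp
  have hx' : ∀ k (b : A), x k * (g w * b) = g w * (x (w⁻¹ k) * b) := fun k b => by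
    rw [← mul_assoc, hx, mul_assoc]
  simp only [add_mul, sub_mul, mul_add, mul_sub, mul_assoc, hx, hs, hx']

theorem commutator_antisymm {ι A : Type*} [DecidableEq ι] [Ring A]
    (g : Perm ι →* A) (x : ι → A) (i j : ι) :
    x i * x j - x j * x i + (x i - x j) * g (swap i j) =
      -(x j * x i - x i * x j + (x j - x i) * g (swap j i)) := by
  rw [swap_comm j i]
  noncomm_ring

namespace Hecke

variable {ι : Type} [Fintype ι] [LinearOrder ι]

/-- The commuting polynomial generators. -/
def yOp (k : ι) : End (MvPolynomial ι ℂ) (Reg ι) :=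
  xOp k + ∑ j ∈ univ.filter (· < k), gOp (swap j k)

theorem yOp_bv_one (k : ι) : yOp k (bv 1) = (X k : MvPolynomial ι ℂ) • bv 1 := by
  simp [yOp, xOp_bv, LinearMap.sum_apply]

theorem xOp_comm (i j : ι) (hij : i ≠ j) :
    xOp i * xOp j - xOp j * xOp i + (xOp i - xOp j) * gOp (swap i j) = 0 := by
  have aux : ∀ i j : ι, i < j →
      (xOp i * xOp j - xOp j * xOp i + (xOp i - xOp j) * gOp (swap i j)) (bv 1) = 0 := by
    intro i j h
    rw [← commutator_of_equivariant gOp xOp gOp_mul_xOp h]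
    change yOp i (yOp j (bv 1)) - yOp j (yOp i (bv 1)) = 0
    rw [yOp_bv_one, yOp_bv_one, map_smul, map_smul, yOp_bv_one, yOp_bv_one, smul_smul, smul_smul,
      mul_comm, sub_self]
  have key : ∀ i j : ι, i ≠ j →
      (xOp i * xOp j - xOp j * xOp i + (xOp i - xOp j) * gOp (swap i j)) (bv 1) = 0 := by
    intro i j h
    rcases lt_or_gt_of_ne h with h | h
    · exact aux i j h
    · rw [commutator_antisymm, LinearMap.neg_apply, aux j i h, neg_zero]
  apply end_ext
  intro w
  have hw : bv w = gOp w (bv 1) := by simp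
  rw [hw, ← End.mul_apply, commutator_mul_perm gOp xOp gOp_mul_xOp, End.mul_apply,
    key _ _ (by simpa using hij), map_zero, LinearMap.zero_apply]

end Hecke

/-- A `ℂ`-algebra generated by a symmetric group and elements `x_k` subject to the relations of the
degenerate affine Hecke algebra in their equivariant form. -/
class HeckeRel (ι A : Type) [Fintype ι] [LinearOrder ι] [Ring A] [Algebra ℂ A] where
  /-- The permutations. -/
  perm : Perm ι →* A
  /-- The equivariant polynomial generators. -/
  gen : ι → A
  perm_mul_gen : ∀ w k, perm w * gen k = gen (w k) * perm w
  gen_mul_gen : ∀ {i j}, i ≠ j → gen i * gen j = gen j * gen i - (gen i - gen j) * perm (swap i j)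
  generate : adjoin ℂ (Set.range perm ∪ Set.range gen) = ⊤

namespace Hecke

section

variable {ι A : Type} [Fintype ι] [LinearOrder ι] [Ring A] [Algebra ℂ A] [HeckeRel ι A]

variable (A) in
/-- The permutations in the degenerate affine Hecke algebra. -/
def g : Perm ι →* A := HeckeRel.perm

variable (A) in
/-- The equivariant polynomial generators of the degenerate affine Hecke algebra. -/
def x : ι → A := HeckeRel.gen

theorem g_mul_x (w : Perm ι) (k : ι) : g A w * x A k = x A (w k) * g A w :=
  HeckeRel.perm_mul_gen w k

theorem x_mul_x {i j : ι} (hij : i ≠ j) :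
    x A i * x A j = x A j * x A i - (x A i - x A j) * g A (swap i j) :=
  HeckeRel.gen_mul_gen hij

theorem x_mul_g (w : Perm ι) (k : ι) : x A k * g A w = g A w * x A (w⁻¹ k) := by
  rw [g_mul_x]; simp

variable (A) in
/-- The commuting polynomial generators of the degenerate affine Hecke algebra. -/
def y (k : ι) : A := x A k + ∑ j ∈ univ.filter (· < k), g A (swap j k)

theorem x_eq_y_sub (k : ι) : x A k = y A k - ∑ j ∈ univ.filter (· < k), g A (swap j k) := by
  simp [y]

theorem y_comm (i j : ι) : y A i * y A j = y A j * y A i := by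
  have aux : ∀ i j : ι, i < j → y A i * y A j = y A j * y A i := by
    intro i j h
    rw [← sub_eq_zero]
    have h1 := commutator_of_equivariant (A := A) (g A) (x A) g_mul_x h
    rw [x_mul_x h.ne] at h1
    refine h1.trans ?_
    abel
  rcases lt_trichotomy i j with h | h | h
  · exact aux i j h
  · rw [h]
  · exact (aux j i h).symm

theorem left_induction {S : Submodule ℂ A} (h1 : 1 ∈ S)
    (hg : ∀ (w : Perm ι), ∀ h ∈ S, g A w * h ∈ S)
    (hx : ∀ k : ι, ∀ h ∈ S, x A k * h ∈ S) (h : A) : h ∈ S := by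
  suffices H : ∀ a : A, ∀ h ∈ S, a * h ∈ S by simpa using H h 1 h1
  intro a
  have ha : a ∈ adjoin ℂ (Set.range (g A : Perm ι → A) ∪ Set.range (x A : ι → A)) := by
    exact (HeckeRel.generate (ι := ι) (A := A)).symm ▸ mem_top
  refine adjoin_induction ?_ ?_ ?_ ?_ ha
  · rintro _ (⟨w, rfl⟩ | ⟨k, rfl⟩) h hh
    · exact hg w h hh
    · exact hx k h hh
  · intro c h hh
    rw [← Algebra.smul_def]
    exact S.smul_mem c hh
  · intro a b _ _ iha ihb h hh
    rw [add_mul]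
    exact S.add_mem (iha h hh) (ihb h hh)
  · intro a b _ _ iha ihb h hh
    rw [mul_assoc]
    exact iha _ (ihb h hh)

variable (A) in
/-- Polynomials in the commuting generators. -/
def pol : MvPolynomial ι ℂ →ₐ[ℂ] A := commEval (y A) y_comm

@[simp] theorem pol_X (k : ι) : pol A (X k : MvPolynomial ι ℂ) = y A k := commEval_X _ _ _

theorem y_mul_pol (k : ι) (f : MvPolynomial ι ℂ) : y A k * pol A f = pol A f * y A k := by
  rw [← pol_X, ← map_mul, ← map_mul, mul_comm]

end

end Hecke

/-- The Hecke algebra of `HeckeRel` with its normal form: the elements `w f(y)` are linearly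
independent over `ℂ`. -/
class AffineHecke (ι A : Type) [Fintype ι] [LinearOrder ι] [Ring A] [Algebra ℂ A] extends
    HeckeRel ι A where
  coeff : A →ₗ[ℂ] (Perm ι → MvPolynomial ι ℂ)
  coeff_apply : ∀ (w : Perm ι) (f : MvPolynomial ι ℂ),
    coeff (Hecke.g A w * Hecke.pol A f) = Pi.single w f

namespace Hecke

open AffineHecke (coeff coeff_apply)

section Construct

variable {ι : Type} [Fintype ι] [LinearOrder ι]

variable (ι) in
/-- The degenerate affine Hecke algebra as an algebra of operators. -/
def opAlgebra : Subalgebra ℂ (End (MvPolynomial ι ℂ) (Reg ι)) :=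
  adjoin ℂ (Set.range gOp ∪ Set.range xOp)

instance : HeckeRel ι (opAlgebra ι) where
  perm :=
  { toFun w := ⟨gOp w, subset_adjoin (Or.inl ⟨w, rfl⟩)⟩
    map_one' := Subtype.ext (map_one _)
    map_mul' _ _ := Subtype.ext (map_mul _ _ _) }
  gen k := ⟨xOp k, subset_adjoin (Or.inr ⟨k, rfl⟩)⟩
  perm_mul_gen w k := Subtype.ext (gOp_mul_xOp w k)
  gen_mul_gen {i j} hij := by
    have h := xOp_comm i j hij
    apply Subtype.ext
    change xOp i * xOp j = xOp j * xOp i - (xOp i - xOp j) * gOp (swap i j)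
    rw [← sub_eq_zero, ← h]; abel
  generate := by
    have h := adjoin_adjoin_coe_preimage (R := ℂ) (s := Set.range (gOp (ι := ι)) ∪ Set.range xOp)
    refine Eq.trans ?_ h
    congr 1
    ext a
    simp only [Set.mem_union, Set.mem_range]
    constructor
    · rintro (⟨w, rfl⟩ | ⟨k, rfl⟩)
      · exact Or.inl ⟨w, rfl⟩
      · exact Or.inr ⟨k, rfl⟩
    · rintro (⟨w, hw⟩ | ⟨k, hk⟩)
      · exact Or.inl ⟨w, Subtype.ext hw⟩
      · exact Or.inr ⟨k, Subtype.ext hk⟩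

theorem coe_y (k : ι) : (y (opAlgebra ι) k).1 = yOp k := by
  have : ∀ s : Finset ι, (∑ j ∈ s, g (opAlgebra ι) (swap j k)).1 = ∑ j ∈ s, gOp (swap j k) := by
    intro s
    rw [← Subalgebra.coe_val, map_sum]
    rfl
  change (x (opAlgebra ι) k).1 + _ = _
  rw [this]
  rfl

theorem pol_bv_one (f : MvPolynomial ι ℂ) :
    (pol (opAlgebra ι) f).1 (bv 1) = f • bv (1 : Perm ι) := by
  induction f using MvPolynomial.induction_on with
  | C c =>
    rw [← MvPolynomial.algebraMap_eq, AlgHom.commutes]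
    change (algebraMap ℂ (End (MvPolynomial ι ℂ) (Reg ι)) c) (bv 1) = _
    rw [algebraMap_end_apply, algebraMap_smul]
  | add p q hp hq =>
    rw [map_add, add_smul, ← hp, ← hq]; rfl
  | mul_X p i hp =>
    rw [map_mul, pol_X, mul_comm p, mul_smul, ← y_mul_pol]
    change (y (opAlgebra ι) i).1 ((pol (opAlgebra ι) p).1 (bv 1)) = _
    rw [hp, coe_y, map_smul, yOp_bv_one, smul_smul, smul_smul, mul_comm]

instance : AffineHecke ι (opAlgebra ι) where
  coeff :=
  { toFun h := h.1 (bv 1)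
    map_add' _ _ := rfl
    map_smul' _ _ := rfl }
  coeff_apply w f := by
    change gOp w ((pol (opAlgebra ι) f).1 (bv 1)) = _
    rw [pol_bv_one, map_smul, gOp_bv, mul_one, bv, ← Pi.single_smul, smul_eq_mul, mul_one]

end Construct

section

variable {ι A : Type} [Fintype ι] [LinearOrder ι] [Ring A] [Algebra ℂ A] [AffineHecke ι A]

theorem nf_surjective (h : A) :
    ∃ m : Perm ι → MvPolynomial ι ℂ, ∑ w : Perm ι, g A w * pol A (m w) = h := by
  let S : Submodule ℂ A := range
    (∑ w : Perm ι, (mulLeft ℂ (g A w)) ∘ₗ (pol A : MvPolynomial ι ℂ →ₐ[ℂ] A).toLinearMap ∘ₗ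
      proj w)
  have hS : ∀ a : A, a ∈ S ↔ ∃ m : Perm ι → MvPolynomial ι ℂ, ∑ w : Perm ι, g A w * pol A (m w) = a := by
    intro a
    simp [S, LinearMap.mem_range, LinearMap.sum_apply]
  have hmem : ∀ (w : Perm ι) (f : MvPolynomial ι ℂ), g A w * pol A f ∈ S := by
    intro w f
    rw [hS]
    refine ⟨Pi.single w f, ?_⟩
    rw [sum_eq_single w]
    · simp
    · intro b _ hb; simp [hb]
    · simp
  rw [← hS]
  refine left_induction (ι := ι) ?_ ?_ ?_ h
  · simpa using hmem 1 1
  · intro w h hh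
    obtain ⟨m, rfl⟩ := (hS h).1 hh
    rw [mul_sum]
    refine S.sum_mem fun v _ => ?_
    rw [← mul_assoc, ← map_mul]
    exact hmem _ _
  · intro k h hh
    obtain ⟨m, rfl⟩ := (hS h).1 hh
    rw [mul_sum]
    refine S.sum_mem fun v _ => ?_
    rw [← mul_assoc, x_mul_g, mul_assoc, x_eq_y_sub, sub_mul, mul_sub, sum_mul,
      mul_sum, ← pol_X, ← map_mul]
    refine S.sub_mem (hmem _ _) (S.sum_mem fun j _ => ?_)
    rw [← mul_assoc, ← map_mul]
    exact hmem _ _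

theorem nf (h : A) : ∑ w : Equiv.Perm ι, g A w * pol A (coeff h w) = h := by
  obtain ⟨m, rfl⟩ := nf_surjective (ι := ι) h
  refine sum_congr rfl fun w _ => ?_
  congr 2
  rw [map_sum, Finset.sum_apply, Finset.sum_eq_single w]
  · rw [coeff_apply]; simp
  · intro b _ hb; rw [coeff_apply]; simp [hb.symm]
  · simp

variable (A) in
/-- The linear map with prescribed restrictions to the parts `w ℂ[y]` of the normal form. -/
def lift {V : Type*} [AddCommGroup V] [Module ℂ V]
    (φ : Perm ι → MvPolynomial ι ℂ →ₗ[ℂ] V) : A →ₗ[ℂ] V :=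
  (∑ w, φ w ∘ₗ proj w) ∘ₗ coeff

theorem lift_apply {V : Type*} [AddCommGroup V] [Module ℂ V]
    (φ : Perm ι → MvPolynomial ι ℂ →ₗ[ℂ] V) (w : Perm ι) (f : MvPolynomial ι ℂ) :
    lift A φ (g A w * pol A f) = φ w f := by
  rw [lift, LinearMap.comp_apply, coeff_apply, LinearMap.sum_apply, sum_eq_single w]
  · simp
  · intro b _ hb; simp [hb]
  · simp

theorem nf_ext {V : Type*} [AddCommGroup V] [Module ℂ V] {φ ψ : A →ₗ[ℂ] V}
    (h : ∀ (w : Perm ι) (a : ι →₀ ℕ),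
      φ (g A w * pol A (monomial a 1)) = ψ (g A w * pol A (monomial a 1))) : φ = ψ := by
  have key : ∀ (w : Perm ι) (f : MvPolynomial ι ℂ), φ (g A w * pol A f) = ψ (g A w * pol A f) := by
    intro w f
    induction f using MvPolynomial.induction_on' with
    | monomial a c =>
      have : monomial a c = c • (monomial a 1 : MvPolynomial ι ℂ) := by simp [smul_monomial]
      rw [this, map_smul, mul_smul_comm, map_smul, map_smul, h]
    | add p q hp hq => rw [map_add, mul_add, map_add, map_add, hp, hq]
  ext a
  rw [← nf (ι := ι) a, map_sum, map_sum]
  exact sum_congr rfl fun w _ => key w _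

end

end Hecke

end

section
open Equiv Finset MvPolynomial

theorem perm_induction_fixing {ι : Type*} [Finite ι] [DecidableEq ι] {Q : Set ι}
    {p : Perm ι → Prop} (h1 : p 1) (hmul : ∀ v w, p v → p w → p (v * w))
    (hswap : ∀ a b, a ∉ Q → b ∉ Q → a ≠ b → p (swap a b)) (w : Perm ι)
    (hw : ∀ q ∈ Q, w q = q) : p w := by
  classical
  have key : ∀ v : Perm {a // a ∉ Q}, p (Perm.ofSubtype v) := by
    intro v
    induction v using Perm.swap_induction_on with
    | one => simpa using h1
    | swap_mul f a b hab ih =>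
      rw [map_mul, Perm.ofSubtype_swap_eq]
      exact hmul _ _ (hswap _ _ a.2 b.2 fun h => hab (Subtype.ext h)) ih
  have h2 : ∀ a, (w a ∉ Q) ↔ a ∉ Q := by
    intro a
    refine not_congr ⟨fun h => ?_, fun h => by rw [hw a h]; exact h⟩
    have := w.injective (hw _ h)
    rwa [← this]
  have h3 : Perm.ofSubtype (w.subtypePerm (p := fun a => a ∉ Q) h2) = w := by
    apply Perm.ofSubtype_subtypePerm
    intro a ha haQ
    exact ha (hw a haQ)
  rw [← h3]
  exact key _

theorem twisted_commEval {σ A : Type} [DecidableEq σ] [Ring A] [Algebra ℂ A] {a : σ → A}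
    {ha : ∀ i j, a i * a j = a j * a i} {T u : A} {i j : σ} (hij : i ≠ j)
    (hi : T * a i = a j * T - u) (hj : T * a j = a i * T + u)
    (hk : ∀ k, k ≠ i → k ≠ j → T * a k = a k * T) (hu : ∀ k, u * a k = a k * u)
    (f : MvPolynomial σ ℂ) :
    ∃ q : MvPolynomial σ ℂ, T * commEval a ha f =
        commEval a ha (rename (swap i j) f) * T + commEval a ha q * u ∧
      (X i - X j) * q = rename (swap i j) f - f := by
  induction f using MvPolynomial.induction_on with
  | C c =>
    refine ⟨0, ?_, by simp⟩
    rw [rename_C, ← MvPolynomial.algebraMap_eq, AlgHom.commutes, map_zero, zero_mul, add_zero]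
    exact (Algebra.commutes c T).symm
  | add p q hp hq =>
    obtain ⟨p', h1, h2⟩ := hp
    obtain ⟨q', h3, h4⟩ := hq
    refine ⟨p' + q', ?_, ?_⟩
    · simp only [map_add, mul_add, add_mul, h1, h3]; abel
    · rw [mul_add, h2, h4, map_add]; ring
  | mul_X p k hp =>
    obtain ⟨q, h1, h2⟩ := hp
    have hu' := hu k
    have e1 : T * (commEval a ha p * a k) =
        commEval a ha (rename (swap i j) p) * (T * a k) + commEval a ha q * a k * u := by
      rw [← mul_assoc, h1, add_mul, mul_assoc, mul_assoc, mul_assoc, hu]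
    simp only [map_mul, rename_X, commEval_X]
    rw [e1]
    rcases eq_or_ne k i with rfl | hki
    · refine ⟨q * X k - rename (swap k j) p, ?_, ?_⟩
      · rw [swap_apply_left, map_sub, map_mul, commEval_X, hi, mul_sub, sub_mul, mul_assoc,
        mul_assoc]
        abel
      · rw [swap_apply_left]; linear_combination X k * h2
    rcases eq_or_ne k j with rfl | hkj
    · refine ⟨q * X k + rename (swap i k) p, ?_, ?_⟩
      · rw [swap_apply_right, map_add, map_mul, commEval_X, hj, mul_add, add_mul, mul_assoc,
        mul_assoc]
        abel
      · rw [swap_apply_right]; linear_combination X k * h2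
    · refine ⟨q * X k, ?_, ?_⟩
      · rw [swap_apply_of_ne_of_ne hki hkj, map_mul, commEval_X, hk k hki hkj]
        simp only [mul_assoc]
      · rw [swap_apply_of_ne_of_ne hki hkj]; linear_combination X k * h2

theorem X_sub_X_ne_zero {σ : Type} {i j : σ} (hij : i ≠ j) :
    (X i - X j : MvPolynomial σ ℂ) ≠ 0 := by
  rw [sub_ne_zero]
  exact fun h => hij (X_injective h)

theorem twisted_commEval_of_symm {σ A : Type} [DecidableEq σ] [Ring A] [Algebra ℂ A] {a : σ → A}
    {ha : ∀ i j, a i * a j = a j * a i} {T u : A} {i j : σ} (hij : i ≠ j)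
    (hi : T * a i = a j * T - u) (hj : T * a j = a i * T + u)
    (hk : ∀ k, k ≠ i → k ≠ j → T * a k = a k * T) (hu : ∀ k, u * a k = a k * u)
    (f : MvPolynomial σ ℂ) (hf : rename (swap i j) f = f) :
    T * commEval a ha f = commEval a ha f * T := by
  obtain ⟨q, h1, h2⟩ := twisted_commEval (ha := ha) hij hi hj hk hu f
  rw [hf, sub_self] at h2
  have hq : q = 0 := (mul_eq_zero.1 h2).resolve_left (X_sub_X_ne_zero hij)
  rw [h1, hf, hq, map_zero, zero_mul, add_zero]

section Series

variable {ι : Type} [DecidableEq ι]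

/-- The geometric series `∑ c^n v^n`. -/
def geo {P : Type*} [CommRing P] (c : P) : PowerSeries P := PowerSeries.mk fun n => c ^ n

theorem one_sub_mul_geo {P : Type*} [CommRing P] (c : P) :
    (1 - PowerSeries.C c * PowerSeries.X) * geo c = 1 := by
  ext n
  rw [sub_mul, one_mul, mul_assoc]
  cases n with
  | zero => simp [geo]
  | succ n => simp [geo, PowerSeries.coeff_succ_X_mul, PowerSeries.coeff_one, pow_succ']

/-- The factor by which a strand changes the generating series of the bubbles. -/
def strandSeries {P : Type*} [CommRing P] (c : P) : PowerSeries P :=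
  1 + PowerSeries.X ^ 2 * geo (c + 1) * geo (c - 1)

theorem strandSeries_mul {P : Type*} [CommRing P] (c : P) :
    strandSeries c * (1 - PowerSeries.X ^ 2 * geo c ^ 2) = 1 := by
  have h0 := one_sub_mul_geo c
  have h1 := one_sub_mul_geo (c + 1)
  have h2 := one_sub_mul_geo (c - 1)
  rw [map_add, map_one] at h1
  rw [map_sub, map_one] at h2
  rw [strandSeries]
  generalize PowerSeries.C c = c' at *
  generalize geo c = a at *
  generalize geo (c + 1) = b at *
  generalize geo (c - 1) = d at *
  generalize (PowerSeries.X : PowerSeries P) = v at *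
  have h3 : ((1 - c' * v) ^ 2 - v ^ 2) * (b * d) = 1 := by
    linear_combination (1 - (c' - 1) * v) * d * h1 + h2
  have h4 : (1 - c' * v) ^ 2 * a ^ 2 = 1 := by
    linear_combination ((1 - c' * v) * a + 1) * h0
  linear_combination v ^ 2 * a ^ 2 * h3 - v ^ 2 * b * d * h4

/-- The generating series `1 + ∑ ω_k v^{k+1}` of the parameters. -/
def paramSeries (ι : Type) (ω : ℕ → ℂ) : PowerSeries (MvPolynomial ι ℂ) :=
  PowerSeries.mk fun n => if n = 0 then 1 else C (ω (n - 1))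

/-- The generating series of the bubbles to the right of a set of strands. -/
def bubbleSeries (ω : ℕ → ℂ) (S : Finset ι) : PowerSeries (MvPolynomial ι ℂ) :=
  paramSeries ι ω * ∏ i ∈ S, strandSeries (X i)

/-- The bubbles to the right of a set of strands. -/
def bubble (ω : ℕ → ℂ) (S : Finset ι) (k : ℕ) : MvPolynomial ι ℂ :=
  PowerSeries.coeff (k + 1) (bubbleSeries ω S)

theorem bubble_empty (ω : ℕ → ℂ) (k : ℕ) : bubble ω (∅ : Finset ι) k = C (ω k) := by
  simp [bubble, bubbleSeries, paramSeries]

theorem coeff_zero_bubbleSeries (ω : ℕ → ℂ) (S : Finset ι) :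
    PowerSeries.coeff 0 (bubbleSeries ω S) = 1 := by
  simp [bubbleSeries, paramSeries, strandSeries, map_prod]

theorem bubbleSeries_erase (ω : ℕ → ℂ) {S : Finset ι} {a : ι} (ha : a ∈ S) :
    bubbleSeries ω (S.erase a) = bubbleSeries ω S * (1 - PowerSeries.X ^ 2 * geo (X a) ^ 2) := by
  rw [bubbleSeries, bubbleSeries, ← prod_erase_mul _ _ ha, mul_assoc, mul_assoc,
    strandSeries_mul, mul_one]

/-- The polynomials `X^n + ∑_{a+b=n-1} X^a z_b`, at a variable. -/
def dotPoly (ω : ℕ → ℂ) (S : Finset ι) (a : ι) (n : ℕ) : MvPolynomial ι ℂ :=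
  PowerSeries.coeff n (bubbleSeries ω S * geo (X a))

theorem dotPoly_zero (ω : ℕ → ℂ) (S : Finset ι) (a : ι) : dotPoly ω S a 0 = 1 := by
  have := coeff_zero_bubbleSeries ω S
  rw [PowerSeries.coeff_zero_eq_constantCoeff] at this
  rw [dotPoly, PowerSeries.coeff_zero_eq_constantCoeff, map_mul, this, geo]
  simp

theorem dotPoly_succ (ω : ℕ → ℂ) (S : Finset ι) (a : ι) (n : ℕ) :
    dotPoly ω S a (n + 1) = X a * dotPoly ω S a n + bubble ω S n := by
  have h := one_sub_mul_geo (X a : MvPolynomial ι ℂ)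
  have h2 : bubbleSeries ω S * geo (X a) =
      PowerSeries.X * (PowerSeries.C (X a) * (bubbleSeries ω S * geo (X a))) + bubbleSeries ω S := by
    linear_combination bubbleSeries ω S * h
  rw [dotPoly, h2, map_add, PowerSeries.coeff_succ_X_mul, PowerSeries.coeff_C_mul]
  rfl

theorem bubble_erase (ω : ℕ → ℂ) {S : Finset ι} {a : ι} (ha : a ∈ S) (k : ℕ) :
    bubble ω S k = bubble ω (S.erase a) k + ∑ i ∈ range k, X a ^ (k - 1 - i) * dotPoly ω S a i := by
  rw [bubble, bubble, bubbleSeries_erase ω ha, mul_sub, mul_one, map_sub]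
  have h : bubbleSeries ω S * (PowerSeries.X ^ 2 * geo (X a) ^ 2) =
      PowerSeries.X * (PowerSeries.X * (bubbleSeries ω S * geo (X a) * geo (X a))) := by ring
  rw [h, PowerSeries.coeff_succ_X_mul]
  cases k with
  | zero => simp
  | succ k =>
    rw [PowerSeries.coeff_succ_X_mul, PowerSeries.coeff_mul,
      Nat.sum_antidiagonal_eq_sum_range_succ_mk]
    simp only [geo, PowerSeries.coeff_mk]
    rw [sub_add_eq_add_sub, eq_sub_iff_add_eq]
    congr 1
    refine sum_congr rfl fun i hi => ?_
    rw [Nat.add_sub_cancel, mul_comm]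
    rfl

theorem map_geo {P : Type*} [CommRing P] (φ : P →+* P) (c : P) :
    PowerSeries.map φ (geo c) = geo (φ c) := by
  ext n; simp [geo]

theorem map_strandSeries {P : Type*} [CommRing P] (φ : P →+* P) (c : P) :
    PowerSeries.map φ (strandSeries c) = strandSeries (φ c) := by
  simp [strandSeries, map_geo]

theorem rename_bubble (ω : ℕ → ℂ) (S : Finset ι) (k : ℕ) (w : Perm ι)
    (hw : ∀ i, i ∈ S ↔ w i ∈ S) : rename w (bubble ω S k) = bubble ω S k := by
  have h : PowerSeries.map (rename w : MvPolynomial ι ℂ →ₐ[ℂ] MvPolynomial ι ℂ).toRingHom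
      (bubbleSeries ω S) = bubbleSeries ω S := by
    have hp : PowerSeries.map (rename w : MvPolynomial ι ℂ →ₐ[ℂ] MvPolynomial ι ℂ).toRingHom
        (paramSeries ι ω) = paramSeries ι ω := by
      ext1 n
      rw [PowerSeries.coeff_map, paramSeries, PowerSeries.coeff_mk]
      split_ifs <;> simp
    rw [bubbleSeries, map_mul, hp, map_prod]
    congr 1
    refine prod_bij (fun i _ => w i) (fun i hi => (hw i).1 hi) (fun a _ b _ h => w.injective h)
      (fun b hb => ⟨w⁻¹ b, (hw _).2 (by simpa using hb), by simp⟩) fun i _ => ?_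
    rw [map_strandSeries]
    simp
  have h2 := congrArg (PowerSeries.coeff (k + 1)) h
  rw [PowerSeries.coeff_map] at h2
  exact h2

theorem totalDegree_dotPoly_of_bubble (ω : ℕ → ℂ) (S : Finset ι) (a : ι) (n : ℕ)
    (h : ∀ k < n, (bubble ω S k).totalDegree ≤ k) : (dotPoly ω S a n).totalDegree ≤ n := by
  induction n with
  | zero => simp [dotPoly_zero]
  | succ n ih =>
    rw [dotPoly_succ]
    refine (totalDegree_add _ _).trans (max_le ?_ ((h n n.lt_succ_self).trans n.le_succ))
    refine (totalDegree_mul _ _).trans ?_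
    have := ih fun k hk => h k (hk.trans n.lt_succ_self)
    rw [totalDegree_X]; omega

theorem totalDegree_bubble (ω : ℕ → ℂ) (S : Finset ι) (k : ℕ) : (bubble ω S k).totalDegree ≤ k := by
  induction hn : S.card generalizing S k with
  | zero =>
    rw [card_eq_zero.1 hn, bubble_empty]; simp
  | succ n ihn =>
    obtain ⟨a, ha⟩ : S.Nonempty := by rw [← card_pos]; omega
    induction k using Nat.strong_induction_on with
    | _ k ihk =>
      rw [bubble_erase ω ha]
      refine (totalDegree_add _ _).trans (max_le (ihn _ _ ?_) ?_)
      · rw [card_erase_of_mem ha]; omega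
      · refine (totalDegree_finsetSum _ _).trans (Finset.sup_le fun i hi => ?_)
        have hi' := mem_range.1 hi
        refine (totalDegree_mul _ _).trans ?_
        have h1 := totalDegree_dotPoly_of_bubble ω S a i fun j hj => ihk j (by omega)
        have h2 : (X a ^ (k - 1 - i) : MvPolynomial ι ℂ).totalDegree ≤ k - 1 - i :=
          (totalDegree_X_pow _ _).le
        omega

end Series

end

section
open Equiv Finset Algebra MvPolynomial

theorem bubble_mem {ι : Type} [DecidableEq ι] (ω : ℕ → ℂ) (T : Subalgebra ℂ (MvPolynomial ι ℂ))
    {S : Finset ι} (hS : ∀ i ∈ S, X i ∈ T) (k : ℕ) : bubble ω S k ∈ T := by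
  induction hn : S.card generalizing S k with
  | zero =>
    rw [card_eq_zero.1 hn, bubble_empty]
    exact T.algebraMap_mem _
  | succ n ihn =>
    obtain ⟨a, ha⟩ : S.Nonempty := by rw [← card_pos]; omega
    induction k using Nat.strong_induction_on with
    | _ k ihk =>
      have hd : ∀ i ≤ k, dotPoly ω S a i ∈ T := by
        intro i
        induction i with
        | zero => intro _; rw [dotPoly_zero]; exact T.one_mem
        | succ i ih =>
          intro hi
          rw [dotPoly_succ]
          exact T.add_mem (T.mul_mem (hS a ha) (ih (by omega))) (ihk i (by omega))
      rw [bubble_erase ω ha]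
      refine T.add_mem (ihn (fun i hi => hS i (mem_of_mem_erase hi)) k ?_)
        (T.sum_mem fun i hi => T.mul_mem (T.pow_mem (hS a ha) _) (hd i ?_))
      · rw [card_erase_of_mem ha]; omega
      · exact (mem_range.1 hi).le

namespace Hecke

section

variable {ι A : Type} [Fintype ι] [LinearOrder ι] [Ring A] [Algebra ℂ A] [AffineHecke ι A]

variable (A) in
/-- The subalgebra generated by the permutations fixing `m` and the `x_a` with `a ≠ m`. -/
def parabolic (m : ι) : Subalgebra ℂ A :=
  adjoin ℂ ({h | ∃ w : Perm ι, w m = m ∧ h = g A w} ∪ {h | ∃ a : ι, a ≠ m ∧ h = x A a})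

theorem g_mem_parabolic {m : ι} {w : Perm ι} (hw : w m = m) : g A w ∈ parabolic A m :=
  subset_adjoin (Or.inl ⟨w, hw, rfl⟩)

theorem x_mem_parabolic {m a : ι} (ha : a ≠ m) : x A a ∈ parabolic A m :=
  subset_adjoin (Or.inr ⟨a, ha, rfl⟩)

theorem swap_mem_parabolic {m i j : ι} (hi : i ≠ m) (hj : j ≠ m) : g A (swap i j) ∈ parabolic A m :=
  g_mem_parabolic (swap_apply_of_ne_of_ne hi.symm hj.symm)

theorem parabolic_le {m : ι} {T : Subalgebra ℂ A} (hg : ∀ w : Perm ι, w m = m → g A w ∈ T)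
    (hx : ∀ a : ι, a ≠ m → x A a ∈ T) : parabolic A m ≤ T := by
  refine adjoin_le ?_
  rintro _ (⟨w, hw, rfl⟩ | ⟨a, ha, rfl⟩)
  · exact hg w hw
  · exact hx a ha

variable {m : ι}

theorem y_mem_parabolic (hm : IsTop m) {a : ι} (ha : a ≠ m) : y A a ∈ parabolic A m := by
  refine Subalgebra.add_mem _ (x_mem_parabolic ha) (Subalgebra.sum_mem _ fun j hj => ?_)
  rw [mem_filter] at hj
  exact swap_mem_parabolic (hj.2.trans_le (hm a)).ne ha

theorem pol_mem_parabolic (hm : IsTop m) {f : MvPolynomial ι ℂ}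
    (hf : f ∈ adjoin ℂ (X '' {i | i ≠ m} : Set (MvPolynomial ι ℂ))) :
    pol A f ∈ parabolic A m := by
  refine (adjoin_le (S := (parabolic A m).comap (pol A)) ?_) hf
  rintro _ ⟨i, hi, rfl⟩
  change pol A (X i) ∈ parabolic A m
  rw [pol_X]
  exact y_mem_parabolic hm hi

theorem g_mul_y_top (hm : IsTop m) {w : Perm ι} (hw : w m = m) : g A w * y A m = y A m * g A w := by
  have h1 : ∀ j, g A w * g A (swap j m) = g A (swap (w j) m) * g A w := by
    intro j
    rw [← map_mul, ← map_mul, mul_swap_eq_swap_mul, hw]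
  rw [y, mul_add, add_mul, g_mul_x, hw, mul_sum, sum_mul]
  congr 1
  refine sum_bij' (fun j _ => w j) (fun j _ => w⁻¹ j) ?_ ?_ ?_ ?_ ?_
  · intro j hj
    simp only [mem_filter_univ] at hj ⊢
    refine lt_of_le_of_ne (hm _) fun h => hj.ne ?_
    apply w.injective; rw [h, hw]
  · intro j hj
    simp only [mem_filter_univ] at hj ⊢
    refine lt_of_le_of_ne (hm _) fun h => hj.ne ?_
    rw [Perm.inv_eq_iff_eq, hw] at h
    exact h
  · intro j _; simp
  · intro j _; simp
  · intro j _; rw [h1]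

theorem commute_parabolic {c : A} (hg : ∀ w : Perm ι, w m = m → c * g A w = g A w * c)
    (hy : ∀ a : ι, a ≠ m → c * y A a = y A a * c) (hm : IsTop m) {b : A}
    (hb : b ∈ parabolic A m) : c * b = b * c := by
  have : parabolic A m ≤ Subalgebra.centralizer ℂ {c} := by
    refine parabolic_le ?_ ?_
    · intro w hw
      rw [Subalgebra.mem_centralizer_iff]
      rintro _ rfl
      exact hg w hw
    · intro a ha
      rw [x_eq_y_sub]
      refine Subalgebra.sub_mem _ ?_ (Subalgebra.sum_mem _ fun j hj => ?_)
      · rw [Subalgebra.mem_centralizer_iff]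
        rintro _ rfl
        exact hy a ha
      · rw [Subalgebra.mem_centralizer_iff]
        rintro _ rfl
        rw [mem_filter] at hj
        exact hg _ (swap_apply_of_ne_of_ne (hj.2.trans_le (hm a)).ne' ha.symm)
  exact (Subalgebra.mem_centralizer_iff ℂ).1 (this hb) c rfl

theorem y_top_comm (hm : IsTop m) {b : A} (hb : b ∈ parabolic A m) : y A m * b = b * y A m :=
  commute_parabolic (fun _ hw => (g_mul_y_top hm hw).symm) (fun _ _ => y_comm _ _) hm hb

theorem y_top_pow_comm (hm : IsTop m) {b : A} (hb : b ∈ parabolic A m) (k : ℕ) :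
    y A m ^ k * b = b * y A m ^ k :=
  (Commute.pow_left (y_top_comm hm hb) k)

theorem adjacent_mul_y {a b : ι} (hab : a ⋖ b) :
    g A (swap a b) * y A a = y A b * g A (swap a b) - 1 := by
  have h1 : ∀ j, j < a → g A (swap a b) * g A (swap j a) = g A (swap j b) * g A (swap a b) := by
    intro j hj
    rw [← map_mul, ← map_mul, mul_swap_eq_swap_mul, swap_apply_left,
      swap_apply_of_ne_of_ne hj.ne (hj.trans hab.1).ne]
  have h2 : univ.filter (· < b) = insert a (univ.filter (· < a)) := by
    ext j
    simp only [mem_filter_univ, mem_insert]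
    constructor
    · intro h
      rcases lt_trichotomy j a with h' | h' | h'
      · exact Or.inr h'
      · exact Or.inl h'
      · exact absurd h (hab.2 h')
    · rintro (rfl | h)
      · exact hab.1
      · exact h.trans hab.1
  have h3 : g A (swap a b) * g A (swap a b) = 1 := by
    rw [← map_mul, swap_mul_self, map_one]
  rw [y, y, h2, sum_insert (by simp), mul_add, add_mul, add_mul, g_mul_x,
    swap_apply_left, h3, mul_sum, sum_mul]
  rw [sum_congr rfl fun j hj => h1 j (mem_filter.1 hj).2]
  abel

theorem adjacent_mul_y' {a b : ι} (hab : a ⋖ b) :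
    g A (swap a b) * y A b = y A a * g A (swap a b) + 1 := by
  have h3 : g A (swap a b) * g A (swap a b) = 1 := by
    rw [← map_mul, swap_mul_self, map_one]
  have h := adjacent_mul_y (A := A) hab
  have h4 : g A (swap a b) * (g A (swap a b) * y A a) * g A (swap a b) =
    g A (swap a b) * (y A b * g A (swap a b) - 1) * g A (swap a b) := by rw [h]
  rw [← mul_assoc, h3, one_mul, mul_sub, sub_mul, mul_one, h3, ← mul_assoc, mul_assoc _ _ (g A _),
    h3, mul_one] at h4
  rw [h4]; abel

theorem adjacent_comm_y {a b k : ι} (hab : a ⋖ b) (ha : k ≠ a) (hb : k ≠ b) :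
    g A (swap a b) * y A k = y A k * g A (swap a b) := by
  rw [y, mul_add, add_mul, g_mul_x, swap_apply_of_ne_of_ne ha hb, mul_sum, sum_mul]
  congr 1
  have key : ∀ j, j < k → swap a b j < k := by
    intro j hj
    rcases eq_or_ne j a with rfl | h1
    · rw [swap_apply_left]
      exact lt_of_le_of_ne (not_lt.1 (fun h => hab.2 hj h)) hb.symm
    rcases eq_or_ne j b with rfl | h2
    · rw [swap_apply_right]
      exact hab.1.trans hj
    rwa [swap_apply_of_ne_of_ne h1 h2]
  refine sum_bij' (fun j _ => swap a b j) (fun j _ => swap a b j) ?_ ?_ ?_ ?_ ?_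
  · intro j hj
    simpa using key j (mem_filter.1 hj).2
  · intro j hj
    simpa using key j (mem_filter.1 hj).2
  · intro j _; simp
  · intro j _; simp
  · intro j _
    rw [← map_mul, ← map_mul, mul_swap_eq_swap_mul, swap_apply_of_ne_of_ne ha hb]

theorem comm_of_adjacent {c : A}
    (h : ∀ a b : ι, a ⋖ b → b ≠ m → c * g A (swap a b) = g A (swap a b) * c)
    (hm : IsTop m) (w : Perm ι) (hw : w m = m) : c * g A w = g A w * c := by
  have key : ∀ n, ∀ a b : ι, (univ.filter fun i => a < i ∧ i < b).card = n → a < b → b ≠ m →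
      c * g A (swap a b) = g A (swap a b) * c := by
    intro n
    induction n using Nat.strong_induction_on with
    | _ n ih =>
      intro a b hn hab hb
      by_cases hc : a ⋖ b
      · exact h a b hc hb
      obtain ⟨d, hd1, hd2⟩ := (not_covBy_iff hab).1 hc
      have e1 := ih _ (by
        rw [← hn]
        refine card_lt_card ⟨fun i => ?_, fun hs => ?_⟩
        · simp only [mem_filter_univ]
          exact fun hi => ⟨hi.1, hi.2.trans hd2⟩
        · have := @hs d (by simp [hd1, hd2])
          simp at this) a d rfl hd1 (hd2.trans_le (hm b)).ne
      have e2 := ih _ (by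
        rw [← hn]
        refine card_lt_card ⟨fun i => ?_, fun hs => ?_⟩
        · simp only [mem_filter_univ]
          exact fun hi => ⟨hd1.trans hi.1, hi.2⟩
        · have := @hs d (by simp [hd1, hd2])
          simp at this) d b rfl hd2 hb
      have : swap a b = swap a d * swap d b * swap a d := by
        rw [mul_swap_eq_swap_mul (swap a d) d b, swap_apply_right,
          swap_apply_of_ne_of_ne hab.ne' hd2.ne', mul_assoc, swap_mul_self, mul_one]
      rw [this, map_mul, map_mul, ← mul_assoc, ← mul_assoc, e1, mul_assoc (g A _) c, e2,
        mul_assoc (g A _), mul_assoc (g A _) c, e1]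
      simp only [mul_assoc]
  refine perm_induction_fixing (Q := {m}) (p := fun w => c * g A w = g A w * c) ?_ ?_ ?_ w
    (by simpa using hw)
  · simp
  · intro v w hv hw
    rw [map_mul, ← mul_assoc, hv, mul_assoc, hw, mul_assoc]
  · intro a b ha hb hab
    rcases lt_or_gt_of_ne hab with h' | h'
    · exact key _ a b rfl h' hb
    · rw [swap_comm]
      exact key _ b a rfl h' ha

theorem g_sub_comm_pol (f : MvPolynomial ι ℂ) {a b : ι} (hab : a ⋖ b)
    (hf : rename (swap a b) f = f) :
    g A (swap a b) * pol A f = pol A f * g A (swap a b) :=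
  twisted_commEval_of_symm (u := (1 : A)) hab.1.ne (adjacent_mul_y hab) (adjacent_mul_y' hab)
    (fun _ h1 h2 => adjacent_comm_y hab h1 h2) (fun _ => by rw [one_mul, mul_one]) f hf

variable (A) in
/-- The bubbles to the right of all strands but `m`. -/
def outerBubble (ω : ℕ → ℂ) (m : ι) (k : ℕ) : A :=
  pol A (bubble ω (univ.erase m) k)

variable (ω : ℕ → ℂ)

theorem outerBubble_mem (hm : IsTop m) (k : ℕ) : outerBubble A ω m k ∈ parabolic A m := by
  refine pol_mem_parabolic hm (bubble_mem ω _ (fun i hi => ?_) k)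
  exact subset_adjoin ⟨i, ne_of_mem_erase hi, rfl⟩

theorem outerBubble_comm (hm : IsTop m) (k : ℕ) {b : A} (hb : b ∈ parabolic A m) :
    outerBubble A ω m k * b = b * outerBubble A ω m k := by
  refine commute_parabolic ?_ (fun a _ => (y_mul_pol a _).symm) hm hb
  refine comm_of_adjacent ?_ hm
  intro a b hab hb
  have ha : a ≠ m := (hab.1.trans_le (hm b)).ne
  refine (g_sub_comm_pol _ hab (rename_bubble ω _ k _ fun i => ?_)).symm
  simp only [mem_erase, mem_univ, and_true, ne_eq]
  rw [swap_apply_eq_iff, swap_apply_of_ne_of_ne ha.symm hb.symm]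

variable (A) in
/-- The Jucys-Murphy type element attached to a strand `j` in the complement of the strand `m`. -/
def inner (m j : ι) : A :=
  x A j + ∑ i ∈ univ.filter (fun i => i ≠ j ∧ i ≠ m), g A (swap i j)

theorem inner_mem {j : ι} (hj : j ≠ m) : inner A m j ∈ parabolic A m := by
  refine Subalgebra.add_mem _ (x_mem_parabolic hj) (Subalgebra.sum_mem _ fun i hi => ?_)
  rw [mem_filter] at hi
  exact swap_mem_parabolic hi.2.2 hj

theorem g_mul_inner {w : Perm ι} (hw : w m = m) (j : ι) :
    g A w * inner A m j = inner A m (w j) * g A w := by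
  rw [inner, inner, mul_add, add_mul, g_mul_x, mul_sum, sum_mul]
  congr 1
  refine sum_bij' (fun i _ => w i) (fun i _ => w⁻¹ i) ?_ ?_ ?_ ?_ ?_
  · intro i hi
    simp only [mem_filter_univ] at hi ⊢
    refine ⟨w.injective.ne hi.1, fun h => hi.2 ?_⟩
    apply w.injective; rw [h, hw]
  · intro i hi
    simp only [mem_filter_univ] at hi ⊢
    refine ⟨fun h => hi.1 ?_, fun h => hi.2 ?_⟩
    · rw [← h]; simp
    · rw [Perm.inv_eq_iff_eq, hw] at h
      exact h
  · intro i _; simp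
  · intro i _; simp
  · intro i _
    rw [← map_mul, ← map_mul, mul_swap_eq_swap_mul]

theorem x_mul_inner {j b : ι} (hb : b ≠ m) (hbj : b ≠ j) :
    x A b * inner A m j = inner A m j * x A b := by
  have h1 : univ.filter (fun i => i ≠ j ∧ i ≠ m) =
      insert b (univ.filter (fun i => i ≠ j ∧ i ≠ m ∧ i ≠ b)) := by
    ext i
    simp only [mem_filter_univ, mem_insert]
    constructor
    · intro h
      by_cases hi : i = b
      · exact Or.inl hi
      · exact Or.inr ⟨h.1, h.2, hi⟩
    · rintro (rfl | h)
      · exact ⟨hbj, hb⟩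
      · exact ⟨h.1, h.2.1⟩
  have h2 : ∀ i ∈ univ.filter (fun i => i ≠ j ∧ i ≠ m ∧ i ≠ b),
      g A (swap i j) * x A b = x A b * g A (swap i j) := by
    intro i hi
    simp only [mem_filter_univ] at hi
    rw [g_mul_x, swap_apply_of_ne_of_ne hi.2.2.symm hbj]
  rw [inner, h1, sum_insert (by simp), mul_add, add_mul, mul_add, add_mul, mul_sum,
    sum_mul, sum_congr rfl h2, x_mul_x hbj, g_mul_x, swap_apply_left, sub_mul]
  abel

variable (A) in
/-- A strand closed up across the strand `m` with `k` dots. -/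
def dots (ω : ℕ → ℂ) (m j : ι) : ℕ → A
  | 0 => 1
  | k + 1 => inner A m j * dots ω m j k + outerBubble A ω m k

theorem dots_mem (hm : IsTop m) {j : ι} (hj : j ≠ m) (k : ℕ) : dots A ω m j k ∈ parabolic A m := by
  induction k with
  | zero => exact Subalgebra.one_mem _
  | succ k ih =>
    exact Subalgebra.add_mem _ (Subalgebra.mul_mem _ (inner_mem hj) ih) (outerBubble_mem ω hm k)

theorem g_mul_dots (hm : IsTop m) {w : Perm ι} (hw : w m = m) (j : ι) (k : ℕ) :
    g A w * dots A ω m j k = dots A ω m (w j) k * g A w := by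
  induction k with
  | zero => rw [dots, dots, one_mul, mul_one]
  | succ k ih =>
    rw [dots, dots, mul_add, add_mul, ← mul_assoc, g_mul_inner hw, mul_assoc, ih, mul_assoc,
      outerBubble_comm ω hm k (g_mem_parabolic hw)]

theorem x_mul_dots (hm : IsTop m) {j b : ι} (hb : b ≠ m) (hbj : b ≠ j) (k : ℕ) :
    x A b * dots A ω m j k = dots A ω m j k * x A b := by
  induction k with
  | zero => rw [dots, one_mul, mul_one]
  | succ k ih =>
    rw [dots, mul_add, add_mul, ← mul_assoc, x_mul_inner hb hbj, mul_assoc, ih, mul_assoc,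
      outerBubble_comm ω hm k (x_mem_parabolic hb)]

theorem inner_mul_dots (hm : IsTop m) {j : ι} (hj : j ≠ m) (k : ℕ) :
    inner A m j * dots A ω m j k = dots A ω m j k * inner A m j := by
  induction k with
  | zero => rw [dots, one_mul, mul_one]
  | succ k ih =>
    rw [dots, mul_add, add_mul, mul_assoc, ← ih, outerBubble_comm ω hm k (inner_mem hj)]

variable (A) in
/-- The value of the partial trace at `w y_m^k`. -/
def traceCoeff (ω : ℕ → ℂ) (m : ι) (w : Perm ι) (k : ℕ) : A :=
  if w⁻¹ m = m then g A w * outerBubble A ω m k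
  else g A (w * swap (w⁻¹ m) m) * dots A ω m (w⁻¹ m) k

theorem traceCoeff_of_fix {w : Perm ι} (hw : w m = m) (k : ℕ) :
    traceCoeff A ω m w k = g A w * outerBubble A ω m k := by
  rw [traceCoeff, if_pos]
  rw [Perm.inv_eq_iff_eq, hw]

theorem traceCoeff_of_ne {w : Perm ι} {j : ι} (hw : w j = m) (hj : j ≠ m) (k : ℕ) :
    traceCoeff A ω m w k = g A (w * swap j m) * dots A ω m j k := by
  have : w⁻¹ m = j := by rw [Perm.inv_eq_iff_eq, hw]
  rw [traceCoeff, this, if_neg hj]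

theorem traceCoeff_mem (hm : IsTop m) (w : Perm ι) (k : ℕ) :
    traceCoeff A ω m w k ∈ parabolic A m := by
  by_cases h : w m = m
  · rw [traceCoeff_of_fix ω h]
    exact Subalgebra.mul_mem _ (g_mem_parabolic h) (outerBubble_mem ω hm k)
  · have hj : w⁻¹ m ≠ m := fun h' => h (by rw [Perm.inv_eq_iff_eq] at h'; exact h'.symm)
    rw [traceCoeff_of_ne ω (j := w⁻¹ m) (by simp) hj]
    refine Subalgebra.mul_mem _ (g_mem_parabolic ?_) (dots_mem ω hm hj k)
    simp

theorem traceCoeff_mul (hm : IsTop m) (w : Perm ι) {v : Perm ι} (hv : v m = m)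
    (k : ℕ) : traceCoeff A ω m (w * v) k = traceCoeff A ω m w k * g A v := by
  by_cases h : w m = m
  · rw [traceCoeff_of_fix ω h, traceCoeff_of_fix ω (by simp [hv, h]), map_mul, mul_assoc, mul_assoc,
    outerBubble_comm ω hm k (g_mem_parabolic hv)]
  · obtain ⟨j, hj⟩ := w.surjective m
    obtain ⟨i, rfl⟩ := v.surjective j
    have hi : i ≠ m := by rintro rfl; rw [hv] at hj; exact h hj
    have hi' : v i ≠ m := by rintro h'; rw [h'] at hj; exact h hj
    rw [traceCoeff_of_ne ω hj hi', traceCoeff_of_ne ω (j := i) hj hi, mul_assoc w,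
      mul_swap_eq_swap_mul, hv, ← mul_assoc, map_mul, mul_assoc, g_mul_dots ω hm hv, mul_assoc]

end

end Hecke

end

section
open Equiv Finset MvPolynomial

namespace Hecke

theorem monomial_eq_pow_mul_erase {ι : Type} (a : ι →₀ ℕ) (m : ι) :
    (monomial a 1 : MvPolynomial ι ℂ) = X m ^ (a m) * monomial (a.erase m) 1 := by
  rw [X_pow_eq_monomial, monomial_mul, one_mul, Finsupp.single_add_erase]

theorem monomial_mem_adjoin {ι : Type} {a : ι →₀ ℕ} {m : ι} (ha : a m = 0) :
    (monomial a 1 : MvPolynomial ι ℂ) ∈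
      Algebra.adjoin ℂ (X '' {i | i ≠ m} : Set (MvPolynomial ι ℂ)) := by
  rw [monomial_eq, map_one, one_mul]
  refine Subalgebra.prod_mem _ fun i hi => Subalgebra.pow_mem _ (Algebra.subset_adjoin (Set.mem_image_of_mem X ?_)) _
  rintro rfl
  exact Finsupp.mem_support_iff.1 hi ha

section

variable {ι A : Type} [Fintype ι] [LinearOrder ι] [Ring A] [Algebra ℂ A] [AffineHecke ι A]

variable {m : ι}

theorem parabolic_ext (hm : IsTop m) {V : Type*} [AddCommGroup V] [Module ℂ V] {φ ψ : A →ₗ[ℂ] V}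
    (h : ∀ (w : Perm ι) (k : ℕ), ∀ c ∈ parabolic A m,
      φ (g A w * (y A m ^ k * c)) = ψ (g A w * (y A m ^ k * c))) : φ = ψ := by
  refine nf_ext (ι := ι) fun w a => ?_
  rw [monomial_eq_pow_mul_erase a m, map_mul (pol A), map_pow (pol A), pol_X]
  exact h w _ _ (pol_mem_parabolic hm (monomial_mem_adjoin (by simp)))

theorem parabolic_le_span (hm : IsTop m) {c : A} (hc : c ∈ parabolic A m) :
    c ∈ Submodule.span ℂ {h : A | ∃ (u : Perm ι) (a : ι →₀ ℕ), u m = m ∧ a m = 0 ∧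
      h = g A u * pol A (monomial a 1)} := by
  set T := Submodule.span ℂ {h : A | ∃ (u : Perm ι) (a : ι →₀ ℕ), u m = m ∧ a m = 0 ∧
      h = g A u * pol A (monomial a 1)} with hT
  have hg : ∀ v : Perm ι, v m = m → ∀ h ∈ T, g A v * h ∈ T := by
    intro v hv h hh
    rw [hT] at hh
    induction hh using Submodule.span_induction with
    | mem h hh =>
      obtain ⟨u, a, hu, ha, rfl⟩ := hh
      exact Submodule.subset_span ⟨v * u, a, by simp [hu, hv], ha, by rw [map_mul, mul_assoc]⟩
    | zero => simp
    | add p q _ _ hp hq => rw [mul_add]; exact T.add_mem hp hq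
    | smul c p _ hp => rw [mul_smul_comm]; exact T.smul_mem c hp
  have hx : ∀ b : ι, b ≠ m → ∀ h ∈ T, x A b * h ∈ T := by
    intro b hb h hh
    rw [hT] at hh
    induction hh using Submodule.span_induction with
    | mem h hh =>
      obtain ⟨u, a, hu, ha, rfl⟩ := hh
      have hb' : u⁻¹ b ≠ m := fun h' => hb (by
        rw [Perm.inv_eq_iff_eq, hu] at h'; exact h')
      rw [← mul_assoc, x_mul_g, mul_assoc]
      refine hg u hu _ ?_
      rw [x_eq_y_sub, sub_mul, sum_mul]
      refine T.sub_mem (Submodule.subset_span ⟨1, Finsupp.single (u⁻¹ b) 1 + a, rfl, ?_, ?_⟩)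
        (T.sum_mem fun j hj => hg _ ?_ _ (Submodule.subset_span ⟨1, a, rfl, ha, by simp⟩))
      · rw [Finsupp.add_apply, ha, Finsupp.single_eq_of_ne hb'.symm]
      · have : (X (u⁻¹ b) * monomial a 1 : MvPolynomial ι ℂ) =
            monomial (Finsupp.single (u⁻¹ b) 1 + a) 1 := by rw [X, monomial_mul, one_mul]
        rw [map_one (g A), one_mul, ← this, map_mul (pol A), pol_X]
      · exact swap_apply_of_ne_of_ne ((mem_filter.1 hj).2.trans_le (hm _)).ne' hb'.symm
    | zero => simp
    | add p q _ _ hp hq => rw [mul_add]; exact T.add_mem hp hq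
    | smul c p _ hp => rw [mul_smul_comm]; exact T.smul_mem c hp
  suffices H : ∀ h ∈ T, c * h ∈ T by
    simpa using H 1 (Submodule.subset_span ⟨1, 0, rfl, rfl, by simp⟩)
  refine Algebra.adjoin_induction ?_ ?_ ?_ ?_ hc
  · rintro _ (⟨w, hw, rfl⟩ | ⟨k, hk, rfl⟩)
    · exact hg w hw
    · exact hx k hk
  · intro c h hh
    rw [← Algebra.smul_def]
    exact T.smul_mem c hh
  · intro a b _ _ iha ihb h hh
    rw [add_mul]
    exact T.add_mem (iha h hh) (ihb h hh)
  · intro a b _ _ iha ihb h hh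
    rw [mul_assoc]
    exact iha _ (ihb h hh)

variable (ω : ℕ → ℂ)

variable (A) in
/-- The partial trace over the last strand. -/
def ptrace (m : ι) : A →ₗ[ℂ] A :=
  lift A fun w => (basisMonomials ι ℂ).constr ℂ fun a =>
    traceCoeff A ω m w (a m) * pol A (monomial (a.erase m) 1)

theorem ptrace_apply (hm : IsTop m) (w : Perm ι) (k : ℕ) {c : A} (hc : c ∈ parabolic A m) :
    ptrace A ω m (g A w * (y A m ^ k * c)) = traceCoeff A ω m w k * c := by
  have hc' := parabolic_le_span hm hc
  clear hc
  induction hc' using Submodule.span_induction with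
  | mem h hh =>
    obtain ⟨u, a, hu, ha, rfl⟩ := hh
    have h2 : (Finsupp.single m k + a).erase m = a := by
      ext i
      by_cases hi : i = m
      · rw [hi, Finsupp.erase_same, ha]
      · rw [Finsupp.erase_ne hi, Finsupp.add_apply, Finsupp.single_eq_of_ne hi, zero_add]
    have h1 : y A m ^ k * pol A (monomial a 1) = pol A (monomial (Finsupp.single m k + a) 1) := by
      rw [← pol_X, ← map_pow, ← map_mul, X_pow_eq_monomial, monomial_mul, one_mul]
    rw [← mul_assoc (y A m ^ k), y_top_pow_comm hm (g_mem_parabolic hu), mul_assoc, ← mul_assoc,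
      ← map_mul, h1, ptrace, lift_apply]
    have h3 := (basisMonomials ι ℂ).constr_basis ℂ (fun a : ι →₀ ℕ =>
      traceCoeff A ω m (w * u) (a m) * pol A (monomial (a.erase m) 1)) (Finsupp.single m k + a)
    rw [coe_basisMonomials] at h3
    rw [h3, h2, ← mul_assoc, ← traceCoeff_mul ω hm w hu]
    simp [ha]
  | zero => simp
  | add p q _ _ hp hq => simp only [mul_add, map_add, hp, hq]
  | smul c p _ hp => simp only [mul_smul_comm, map_smul, hp]

theorem ptrace_g (hm : IsTop m) (w : Perm ι) : ptrace A ω m (g A w) = traceCoeff A ω m w 0 := by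
  simpa using ptrace_apply (A := A) ω hm w 0 (Subalgebra.one_mem _)

theorem ptrace_mul (hm : IsTop m) (h : A) {c : A} (hc : c ∈ parabolic A m) :
    ptrace A ω m (h * c) = ptrace A ω m h * c := by
  refine LinearMap.congr_fun (f := ptrace A ω m ∘ₗ LinearMap.mulRight ℂ c)
    (g := LinearMap.mulRight ℂ c ∘ₗ ptrace A ω m) (parabolic_ext hm fun w k b hb => ?_) h
  simp only [LinearMap.comp_apply, LinearMap.mulRight_apply]
  rw [ptrace_apply ω hm w k hb, mul_assoc, mul_assoc, ptrace_apply ω hm w k (Subalgebra.mul_mem _ hb hc),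
    mul_assoc]

theorem ptrace_mem (hm : IsTop m) (h : A) : ptrace A ω m h ∈ parabolic A m := by
  have : (Submodule.mkQ (parabolic A m).toSubmodule) ∘ₗ ptrace A ω m = 0 := by
    refine parabolic_ext hm fun w k b hb => ?_
    rw [LinearMap.comp_apply, ptrace_apply ω hm w k hb, LinearMap.zero_apply,
      Submodule.mkQ_apply, Submodule.Quotient.mk_eq_zero]
    exact Subalgebra.mul_mem _ (traceCoeff_mem ω hm w k) hb
  have h2 := LinearMap.congr_fun this h
  rwa [LinearMap.comp_apply, LinearMap.zero_apply, Submodule.mkQ_apply,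
    Submodule.Quotient.mk_eq_zero] at h2

theorem ptrace_g_mul (hm : IsTop m) {v : Perm ι} (hv : v m = m) (h : A) :
    ptrace A ω m (g A v * h) = g A v * ptrace A ω m h := by
  refine LinearMap.congr_fun (f := ptrace A ω m ∘ₗ LinearMap.mulLeft ℂ (g A v))
    (g := LinearMap.mulLeft ℂ (g A v) ∘ₗ ptrace A ω m) (parabolic_ext hm fun w k b hb => ?_) h
  simp only [LinearMap.comp_apply, LinearMap.mulLeft_apply]
  rw [← mul_assoc, ← map_mul, ptrace_apply ω hm _ k hb, ptrace_apply ω hm _ k hb, ← mul_assoc]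
  congr 1
  by_cases hw : w m = m
  · rw [traceCoeff_of_fix ω hw, traceCoeff_of_fix ω (by simp [hw, hv]), map_mul, mul_assoc]
  · obtain ⟨j, hj⟩ := w.surjective m
    have hj' : j ≠ m := by rintro rfl; exact hw hj
    rw [traceCoeff_of_ne ω hj hj', traceCoeff_of_ne ω (w := v * w) (j := j) (by simp [hj, hv]) hj',
      mul_assoc v, map_mul, mul_assoc]

theorem dots_succ_sub (hm : IsTop m) {j : ι} (hj : j ≠ m) (w : Perm ι) (hw : w j = m)
    (k : ℕ) : traceCoeff A ω m w (k + 1) -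
      ∑ i ∈ univ.filter (· < m), traceCoeff A ω m (w * swap i m) k =
      x A (w m) * traceCoeff A ω m w k := by
  have h1 : univ.filter (· < m) = insert j (univ.filter fun i => i ≠ j ∧ i ≠ m) := by
    ext i
    simp only [mem_filter_univ, mem_insert]
    constructor
    · intro h
      by_cases hi : i = j
      · exact Or.inl hi
      · exact Or.inr ⟨hi, h.ne⟩
    · rintro (rfl | h)
      · exact lt_of_le_of_ne (hm _) hj
      · exact lt_of_le_of_ne (hm _) h.2
  have h2 : ∀ i ∈ univ.filter (fun i => i ≠ j ∧ i ≠ m),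
      traceCoeff A ω m (w * swap i m) k =
        g A (w * swap j m) * (g A (swap i j) * dots A ω m j k) := by
    intro i hi
    simp only [mem_filter_univ] at hi
    rw [traceCoeff_of_ne ω (j := j) _ hj, ← mul_assoc, ← map_mul]
    · congr 2
      rw [mul_assoc, mul_assoc, mul_swap_eq_swap_mul (swap j m),
        swap_apply_of_ne_of_ne hi.1 hi.2, swap_apply_left]
    · rw [Perm.mul_apply, swap_apply_of_ne_of_ne hi.1.symm hj, hw]
  rw [h1, sum_insert (by simp), sum_congr rfl h2, traceCoeff_of_ne ω hw hj,
    traceCoeff_of_fix ω (by simp [hw]), traceCoeff_of_ne ω hw hj, dots, inner, mul_add, add_mul,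
    mul_add, ← mul_sum, sum_mul, ← mul_assoc (x A (w m)), x_mul_g, mul_inv_rev,
    Perm.mul_apply]
  simp [mul_assoc]
  abel

theorem ptrace_x_mul (hm : IsTop m) {a : ι} (ha : a ≠ m) (h : A) :
    ptrace A ω m (x A a * h) = x A a * ptrace A ω m h := by
  refine LinearMap.congr_fun (f := ptrace A ω m ∘ₗ LinearMap.mulLeft ℂ (x A a))
    (g := LinearMap.mulLeft ℂ (x A a) ∘ₗ ptrace A ω m) (parabolic_ext hm fun w k c hc => ?_) h
  simp only [LinearMap.comp_apply, LinearMap.mulLeft_apply]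
  obtain ⟨b, rfl⟩ := w.surjective a
  rw [ptrace_apply ω hm _ k hc, ← mul_assoc, ← g_mul_x, mul_assoc]
  by_cases hb : b = m
  · subst hb
    obtain ⟨j, hj⟩ := w.surjective b
    have hj' : j ≠ b := by rintro rfl; exact ha hj
    rw [x_eq_y_sub, sub_mul, mul_sub, ← mul_assoc (y A b), ← pow_succ', sum_mul,
      mul_sum, map_sub, map_sum, ptrace_apply ω hm _ _ hc, ← mul_assoc (x A (w b)),
      ← dots_succ_sub ω hm hj' w hj, sub_mul, sum_mul]
    congr 1
    refine sum_congr rfl fun i _ => ?_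
    rw [← mul_assoc, ← map_mul, ptrace_apply ω hm _ _ hc]
  · rw [← mul_assoc (x A b), ← y_top_pow_comm hm (x_mem_parabolic hb), mul_assoc,
    ptrace_apply ω hm _ _ (Subalgebra.mul_mem _ (x_mem_parabolic hb) hc), ← mul_assoc, ← mul_assoc]
    congr 1
    by_cases hw : w m = m
    · rw [traceCoeff_of_fix ω hw, mul_assoc, outerBubble_comm ω hm k (x_mem_parabolic hb),
      ← mul_assoc, g_mul_x, mul_assoc]
    · obtain ⟨j, hj⟩ := w.surjective m
      have hj' : j ≠ m := by rintro rfl; exact hw hj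
      have hbj : b ≠ j := by rintro rfl; exact ha hj
      rw [traceCoeff_of_ne ω hj hj', mul_assoc, ← x_mul_dots ω hm hb hbj, ← mul_assoc, g_mul_x,
        Perm.mul_apply, swap_apply_of_ne_of_ne hbj hb, mul_assoc]

theorem mul_ptrace (hm : IsTop m) {c : A} (hc : c ∈ parabolic A m) (h : A) :
    ptrace A ω m (c * h) = c * ptrace A ω m h := by
  refine Algebra.adjoin_induction (p := fun c _ => ∀ h, ptrace A ω m (c * h) = c * ptrace A ω m h)
    ?_ ?_ ?_ ?_ hc h
  · rintro _ (⟨w, hw, rfl⟩ | ⟨k, hk, rfl⟩)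
    · exact ptrace_g_mul ω hm hw
    · exact ptrace_x_mul ω hm hk
  · intro c h
    rw [← Algebra.smul_def, ← Algebra.smul_def, map_smul]
  · intro a b _ _ iha ihb h
    rw [add_mul, map_add, iha, ihb, add_mul]
  · intro a b _ _ iha ihb h
    rw [mul_assoc, iha, ihb, mul_assoc]

theorem ptrace_cyclic (hm : IsTop m) (h : A) :
    ptrace A ω m (y A m * h) = ptrace A ω m (h * y A m) := by
  refine LinearMap.congr_fun (f := ptrace A ω m ∘ₗ LinearMap.mulLeft ℂ (y A m))
    (g := ptrace A ω m ∘ₗ LinearMap.mulRight ℂ (y A m)) (parabolic_ext hm fun w k c hc => ?_) h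
  simp only [LinearMap.comp_apply, LinearMap.mulLeft_apply, LinearMap.mulRight_apply]
  rw [mul_assoc (g A w), mul_assoc (y A m ^ k), ← y_top_comm hm hc, ← mul_assoc (y A m ^ k), ← pow_succ,
    ptrace_apply ω hm _ _ hc]
  by_cases hw : w m = m
  · rw [← mul_assoc, ← g_mul_y_top hm hw, mul_assoc, ← mul_assoc (y A m), ← pow_succ',
    ptrace_apply ω hm _ _ hc]
  · obtain ⟨j, hj⟩ := w.surjective m
    have hj' : j ≠ m := by rintro rfl; exact hw hj
    have h1 : y A m * g A w = g A w * (inner A m j + g A (swap j m)) := by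
      have h2 : univ.filter (· < m) = insert (w m) (univ.filter fun i => i ≠ w m ∧ i ≠ m) := by
        ext i
        simp only [mem_filter_univ, mem_insert]
        constructor
        · intro h
          by_cases hi : i = w m
          · exact Or.inl hi
          · exact Or.inr ⟨hi, h.ne⟩
        · rintro (rfl | h)
          · exact lt_of_le_of_ne (hm _) hw
          · exact lt_of_le_of_ne (hm _) h.2
      rw [y, h2, sum_insert (by simp), inner, mul_add, mul_add, add_mul, add_mul, g_mul_x, hj,
        mul_sum, sum_mul, add_assoc, add_comm (g A (swap (w m) m) * g A w)]
      congr 2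
      · refine sum_bij' (fun i _ => w⁻¹ i) (fun i _ => w i) ?_ ?_ ?_ ?_ ?_
        · intro i hi
          simp only [mem_filter_univ, ne_eq, Perm.inv_eq_iff_eq, hj] at hi ⊢
          exact ⟨hi.2, hi.1⟩
        · intro i hi
          simp only [mem_filter_univ, ne_eq] at hi ⊢
          exact ⟨fun h => hi.2 (w.injective h), fun h => hi.1 (w.injective (h.trans hj.symm))⟩
        · intro i _; simp
        · intro i _; simp
        · intro i _
          rw [← map_mul, ← map_mul, mul_swap_eq_swap_mul, hj, show w (w⁻¹ i) = i by simp]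
      · rw [← map_mul, ← map_mul, mul_swap_eq_swap_mul, hj, swap_comm]
    rw [← mul_assoc, h1, mul_add, add_mul, mul_assoc (g A w) (inner A m j), ← mul_assoc (inner A m j),
      ← y_top_pow_comm hm (inner_mem hj'), mul_assoc, map_add,
      ptrace_apply ω hm _ _ (Subalgebra.mul_mem _ (inner_mem hj') hc), ← map_mul,
      ptrace_apply ω hm _ _ hc, traceCoeff_of_fix ω (w := w * swap j m) (by simp [hj]), traceCoeff_of_ne ω hj hj',
      traceCoeff_of_ne ω hj hj', dots, inner_mul_dots ω hm hj', mul_add, add_mul]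
    simp only [mul_assoc]

theorem ptrace_swap (hm : IsTop m) {a : ι} (ha : a ≠ m) : ptrace A ω m (g A (swap a m)) = 1 := by
  rw [ptrace_g ω hm, traceCoeff_of_ne ω (j := a) (by simp) ha]
  simp [dots]

theorem ptrace_y_top_pow (hm : IsTop m) (k : ℕ) :
    ptrace A ω m (y A m ^ k) = outerBubble A ω m k := by
  have := ptrace_apply (A := A) ω hm 1 k (Subalgebra.one_mem _)
  rwa [traceCoeff_of_fix ω rfl, map_one, one_mul, one_mul, mul_one, mul_one] at this

end

end Hecke

end

section
open Equiv Finset MvPolynomial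

namespace Hecke

theorem swap_conj {ι : Type} [DecidableEq ι] {i j k : ι} (hi : i ≠ k) (hj : j ≠ k) :
    swap i j * swap j k * swap i j = swap i k := by
  rw [mul_swap_eq_swap_mul (swap i j) j k, swap_apply_right,
    swap_apply_of_ne_of_ne hi.symm hj.symm, mul_assoc, swap_mul_self, mul_one]

theorem filter_lt_of_covBy {ι : Type} [Fintype ι] [LinearOrder ι] {a b : ι} (hab : a ⋖ b) :
    univ.filter (· < b) = insert a (univ.filter (· < a)) := by
  ext j
  simp only [mem_filter_univ, mem_insert]
  constructor
  · intro h
    rcases lt_trichotomy j a with h' | h' | h'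
    · exact Or.inr h'
    · exact Or.inl h'
    · exact absurd h (hab.2 h')
  · rintro (rfl | h)
    · exact hab.1
    · exact h.trans hab.1

section

variable {ι A : Type} [Fintype ι] [LinearOrder ι] [Ring A] [Algebra ℂ A] [AffineHecke ι A]
variable {m : ι}

theorem g_swap_sq (a b : ι) : g A (swap a b) * g A (swap a b) = 1 := by
  rw [← map_mul, swap_mul_self, map_one]

theorem g_comm_y {w : Perm ι} {a : ι} (ha : w a = a) (hw : ∀ i, w i < a ↔ i < a) :
    g A w * y A a = y A a * g A w := by
  rw [y, mul_add, add_mul, g_mul_x, ha, mul_sum, sum_mul]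
  congr 1
  refine sum_equiv w (fun i => by simp [hw]) fun j _ => ?_
  rw [← map_mul, ← map_mul, mul_swap_eq_swap_mul, ha]

theorem g_comm_y_of_fix {w : Perm ι} {a : ι} (hw : ∀ i ≤ a, w i = i) :
    g A w * y A a = y A a * g A w := by
  refine g_comm_y (hw a le_rfl) fun i => ⟨fun h => ?_, fun h => ?_⟩
  · rwa [w.injective (hw _ h.le)] at h
  · rwa [hw i h.le]

theorem pol_monomial_mem {K : Subalgebra ℂ A} {e : ι →₀ ℕ} (h : ∀ i, e i ≠ 0 → y A i ∈ K) :
    pol A (monomial e 1) ∈ K := by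
  have h1 : (monomial e 1 : MvPolynomial ι ℂ) ∈ K.comap (pol A) := by
    rw [monomial_eq, map_one, one_mul]
    refine Subalgebra.prod_mem _ fun i hi => Subalgebra.pow_mem _ ?_ _
    rw [Subalgebra.mem_comap, pol_X]
    exact h i (Finsupp.mem_support_iff.1 hi)
  exact h1

variable (A) in
/-- The part of `y_m` that only involves the strands before `a`. -/
def yBelow (a m : ι) : A :=
  x A m + ∑ j ∈ univ.filter (· < a), g A (swap j m)

theorem yBelow_comm_y (hm : IsTop m) {a b : ι} (hab : a < b) :
    yBelow A b m * y A a = y A a * yBelow A b m := by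
  have h1 : yBelow A b m = y A m - ∑ j ∈ univ.filter (fun j => b ≤ j ∧ j < m),
      g A (swap j m) := by
    have h2 : univ.filter (· < m) = univ.filter (· < b) ∪
        univ.filter (fun j => b ≤ j ∧ j < m) := by
      ext j
      simp only [mem_filter_univ, mem_union]
      constructor
      · intro h
        by_cases hj : j < b
        · exact Or.inl hj
        · exact Or.inr ⟨not_lt.1 hj, h⟩
      · rintro (h | h)
        · exact h.trans_le (hm b)
        · exact h.2
    rw [yBelow, y, h2, sum_union]
    · abel
    · rw [disjoint_left]
      intro j h1 h2
      simp only [mem_filter_univ] at h1 h2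
      exact absurd h1 (not_lt.2 h2.1)
  rw [h1, sub_mul, mul_sub, y_comm, sum_mul, mul_sum]
  congr 1
  refine sum_congr rfl fun j hj => g_comm_y_of_fix fun i hi => ?_
  have hj' := (mem_filter.1 hj).2
  have h3 : i < j := (hi.trans_lt hab).trans_le hj'.1
  exact swap_apply_of_ne_of_ne h3.ne (h3.trans hj'.2).ne

theorem swap_mul_yBelow {a : ι} (ha : a < m) :
    g A (swap a m) * yBelow A a m = y A a * g A (swap a m) := by
  rw [yBelow, y, mul_add, add_mul, g_mul_x, swap_apply_right, mul_sum, sum_mul]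
  congr 1
  refine sum_congr rfl fun j hj => ?_
  have hj' := (mem_filter.1 hj).2
  rw [← map_mul, ← map_mul, mul_swap_eq_swap_mul, swap_apply_right,
    swap_apply_of_ne_of_ne hj'.ne (hj'.trans ha).ne]

theorem yBelow_covBy {a b : ι} (hab : a ⋖ b) : yBelow A b m = yBelow A a m + g A (swap a m) := by
  rw [yBelow, yBelow, filter_lt_of_covBy hab, sum_insert (by simp)]
  abel

theorem yBelow_pow (hm : IsTop m) {a b : ι} (hab : a ⋖ b) (k : ℕ) :
    yBelow A b m ^ k = yBelow A a m ^ k + ∑ i ∈ range k,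
      y A a ^ (k - 1 - i) * (yBelow A b m ^ i * g A (swap a m)) := by
  have ha : a < m := hab.1.trans_le (hm b)
  have hc : Commute (yBelow A b m) (y A a) := yBelow_comm_y hm hab.1
  induction k with
  | zero => simp
  | succ k ih =>
    have h1 : ∀ i ∈ range k, y A a ^ (k - 1 - i) * (yBelow A b m ^ i * g A (swap a m)) *
        yBelow A a m = y A a ^ (k + 1 - 1 - i) * (yBelow A b m ^ i * g A (swap a m)) := by
      intro i hi
      have e : k + 1 - 1 - i = (k - 1 - i) + 1 := by
        have := mem_range.1 hi
        omega
      rw [e, pow_succ, mul_assoc, mul_assoc, swap_mul_yBelow ha, ← mul_assoc (yBelow A b m ^ i),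
        (hc.pow_left i).eq, mul_assoc, mul_assoc]
    rw [pow_succ, yBelow_covBy hab, mul_add, ← yBelow_covBy hab, sum_range_succ,
      ← sum_congr rfl h1, ← sum_mul]
    nth_rw 1 [ih]
    rw [add_mul, ← pow_succ]
    simp [add_assoc]

variable (ω : ℕ → ℂ)

theorem ptrace_yBelow_step (hm : IsTop m) {a b : ι} (hab : a ⋖ b)
    (h : ∀ k, ptrace A ω m (yBelow A b m ^ k) = pol A (bubble ω (univ.filter (· < b)) k)) :
    (∀ k, ptrace A ω m (yBelow A b m ^ k * g A (swap a m)) =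
      pol A (dotPoly ω (univ.filter (· < b)) a k)) ∧
    ∀ k, ptrace A ω m (yBelow A a m ^ k) = pol A (bubble ω (univ.filter (· < a)) k) := by
  have ha : a < m := hab.1.trans_le (hm b)
  have h1 : ∀ k, ptrace A ω m (yBelow A b m ^ k * g A (swap a m)) =
      pol A (dotPoly ω (univ.filter (· < b)) a k) := by
    intro k
    induction k with
    | zero => simp [dotPoly_zero, ptrace_swap ω hm ha.ne]
    | succ k ih =>
      have e : yBelow A b m * g A (swap a m) = g A (swap a m) * y A a + 1 := by
        have h2 : g A (swap a m) * (g A (swap a m) * yBelow A a m) *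
            g A (swap a m) = g A (swap a m) * (y A a * g A (swap a m)) *
            g A (swap a m) := by
          rw [swap_mul_yBelow ha]
        rw [← mul_assoc, g_swap_sq, one_mul, mul_assoc, mul_assoc, g_swap_sq, mul_one] at h2
        rw [yBelow_covBy hab, add_mul, g_swap_sq, h2]
      rw [pow_succ, mul_assoc, e, mul_add, mul_one, map_add, ← mul_assoc,
        ptrace_mul ω hm _ (y_mem_parabolic hm ha.ne), ih, h, dotPoly_succ, map_add, map_mul, pol_X,
        y_mul_pol]
  refine ⟨h1, fun k => ?_⟩
  have h2 := congrArg (ptrace A ω m) (yBelow_pow (A := A) hm hab k)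
  have haS : a ∈ univ.filter (· < b) := by simp [hab.1]
  have hS : (univ.filter (· < b)).erase a = univ.filter (· < a) := by
    rw [filter_lt_of_covBy hab, erase_insert (by simp)]
  rw [h, map_add, bubble_erase ω haS, map_add, hS, map_sum, map_sum] at h2
  have h3 : ∀ i ∈ range k, ptrace A ω m (y A a ^ (k - 1 - i) *
      (yBelow A b m ^ i * g A (swap a m))) =
      pol A (X a ^ (k - 1 - i) * dotPoly ω (univ.filter (· < b)) a i) := by
    intro i _
    rw [mul_ptrace ω hm (Subalgebra.pow_mem _ (y_mem_parabolic hm ha.ne) _), h1, map_mul, map_pow,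
      pol_X]
  rw [sum_congr rfl h3] at h2
  exact (add_right_cancel h2).symm

theorem ptrace_yBelow (hm : IsTop m) (a : ι) (k : ℕ) :
    ptrace A ω m (yBelow A a m ^ k) = pol A (bubble ω (univ.filter (· < a)) k) := by
  induction a using (wellFounded_gt (α := ι)).induction generalizing k with
  | _ a ih =>
    rcases eq_or_ne a m with rfl | ha
    · have : yBelow A a a = y A a := rfl
      rw [this, ptrace_y_top_pow ω hm, outerBubble]
      congr 2
      ext i
      simp only [mem_erase, mem_univ, and_true, mem_filter, true_and]
      exact ⟨fun h => lt_of_le_of_ne (hm i) h, fun h => h.ne⟩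
    · obtain ⟨b, hab, _⟩ := exists_covBy_le_of_lt (lt_of_le_of_ne (hm a) ha)
      exact (ptrace_yBelow_step ω hm hab fun k => ih b hab.1 k).2 k

theorem ptrace_x_pow (hm : IsTop m) (k : ℕ) : ptrace A ω m (x A m ^ k) = algebraMap ℂ A (ω k) := by
  obtain ⟨a, -, ha⟩ := exists_min_image univ (id : ι → ι) ⟨m, mem_univ m⟩
  have h : univ.filter (· < a) = ∅ := by
    ext i
    simpa using ha i (mem_univ i)
  have := ptrace_yBelow (A := A) ω hm a k
  rw [yBelow, h, sum_empty, add_zero, bubble_empty] at this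
  rw [this, ← MvPolynomial.algebraMap_eq, AlgHom.commutes]

/-! Closing up the last two strands. -/

variable {a : ι}

theorem psi_mem (hm : IsTop m) (ham : a ⋖ m) {b : A} (hb : b ∈ parabolic A m) :
    ptrace A ω m (g A (swap a m) * b * g A (swap a m)) ∈
      parabolic A m ⊓ Subalgebra.centralizer ℂ {g A (swap a m)} := by
  set s := g A (swap a m) with hs
  set K := parabolic A m ⊓ Subalgebra.centralizer ℂ {s} with hK
  have hss : s * s = 1 := g_swap_sq a m
  have memK : ∀ c : A, c ∈ K ↔ c ∈ parabolic A m ∧ s * c = c * s := by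
    intro c
    rw [hK, Algebra.mem_inf, Subalgebra.mem_centralizer_iff]
    simp
  have hleft : ∀ c ∈ K, ∀ b : A, ptrace A ω m (s * (c * b) * s) = c * ptrace A ω m (s * b * s) := by
    intro c hc b
    obtain ⟨h1, h2⟩ := (memK c).1 hc
    rw [← mul_assoc, h2, mul_assoc, mul_assoc, mul_ptrace ω hm h1, mul_assoc]
  have hright : ∀ c ∈ K, ∀ b : A, ptrace A ω m (s * (b * c) * s) = ptrace A ω m (s * b * s) * c := by
    intro c hc b
    obtain ⟨h1, h2⟩ := (memK c).1 hc
    rw [mul_assoc, mul_assoc b, ← h2, ← mul_assoc, ← mul_assoc, ptrace_mul ω hm _ h1]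
  have gK : ∀ u : Perm ι, u m = m → u a = a → g A u ∈ K := by
    intro u hu hua
    refine (memK _).2 ⟨g_mem_parabolic hu, ?_⟩
    rw [hs, ← map_mul, ← map_mul, mul_swap_eq_swap_mul, hu, hua]
  have yK : ∀ c, c ≠ m → c ≠ a → y A c ∈ K := fun c hcm hca =>
    (memK _).2 ⟨y_mem_parabolic hm hcm, adjacent_comm_y ham hca hcm⟩
  have polK : ∀ e : ι →₀ ℕ, e m = 0 → e a = 0 → pol A (monomial e 1) ∈ K := by
    intro e hem hea
    exact pol_monomial_mem fun i hi => yK i (fun h => hi (h ▸ hem)) (fun h => hi (h ▸ hea))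
  have hy : ∀ k, ptrace A ω m (s * y A a ^ k * s) ∈ K := by
    intro k
    have h1 : s * y A a ^ k * s = yBelow A a m ^ k := by
      have h2 : SemiconjBy s (yBelow A a m) (y A a) := swap_mul_yBelow ham.1
      have h3 := (h2.pow_right k).eq
      have h4 := congrArg (s * ·) h3
      simp only [← mul_assoc] at h4
      rw [hss, one_mul] at h4
      exact h4.symm
    rw [h1, ptrace_yBelow ω hm]
    refine (memK _).2 ⟨pol_mem_parabolic hm (bubble_mem ω _ (fun i hi => ?_) k),
      g_sub_comm_pol _ ham (rename_bubble ω _ k _ fun i => ?_)⟩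
    · refine Algebra.subset_adjoin ⟨i, ?_, rfl⟩
      exact ((mem_filter.1 hi).2.trans ham.1).ne
    · simp only [mem_filter_univ]
      rcases eq_or_ne i a with rfl | h1
      · simp [ham.1.le]
      rcases eq_or_ne i m with rfl | h2
      · simp [ham.1.le]
      rw [swap_apply_of_ne_of_ne h1 h2]
  have hswap : ∀ i, i < a → ∀ k, ptrace A ω m (s * (g A (swap i a) * y A a ^ k) * s) ∈ K := by
    intro i hi k
    have him : i ≠ m := (hi.trans ham.1).ne
    induction k with
    | zero =>
      have : s * (g A (swap i a) * y A a ^ 0) * s = g A (swap i m) := by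
        rw [pow_zero, mul_one, hs, ← map_mul, ← map_mul, mul_swap_eq_swap_mul _ i a,
          swap_apply_left, swap_apply_of_ne_of_ne hi.ne him, mul_assoc,
          swap_mul_self, mul_one]
      rw [this, ptrace_swap ω hm him]
      exact K.one_mem
    | succ k ih =>
      let X' : A := x A i + ∑ c ∈ univ.filter (fun c => c < a ∧ c ≠ i), g A (swap c i)
      have hX : X' ∈ K := by
        refine K.add_mem ((memK _).2 ⟨x_mem_parabolic him, ?_⟩) (K.sum_mem fun c hc => gK _ ?_ ?_)
        · rw [hs, g_mul_x, swap_apply_of_ne_of_ne hi.ne him]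
        · exact swap_apply_of_ne_of_ne
            ((mem_filter.1 hc).2.1.trans ham.1).ne' him.symm
        · exact swap_apply_of_ne_of_ne (mem_filter.1 hc).2.1.ne' hi.ne'
      have e : g A (swap i a) * y A a = X' * g A (swap i a) + 1 := by
        have h2 : univ.filter (· < a) = insert i (univ.filter fun c => c < a ∧ c ≠ i) := by
          ext c
          simp only [mem_filter_univ, mem_insert]
          constructor
          · intro h
            by_cases hc : c = i
            · exact Or.inl hc
            · exact Or.inr ⟨h, hc⟩
          · rintro (rfl | h)
            · exact hi
            · exact h.1
        rw [y, h2, sum_insert (by simp), mul_add, mul_add, g_swap_sq, g_mul_x,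
          swap_apply_right, add_mul, mul_sum, sum_mul, add_comm (1 : A), ← add_assoc]
        congr 2
        refine sum_congr rfl fun c hc => ?_
        have hc' := (mem_filter.1 hc).2
        rw [← map_mul, ← map_mul, mul_swap_eq_swap_mul, swap_apply_right,
          swap_apply_of_ne_of_ne hc'.2 hc'.1.ne]
      rw [pow_succ', ← mul_assoc (g A (swap i a)), e, add_mul, one_mul, mul_add, add_mul, map_add, mul_assoc X',
        hleft X' hX]
      exact K.add_mem (K.mul_mem hX ih) (hy k)
  have hb' := parabolic_le_span hm hb
  clear hb
  induction hb' using Submodule.span_induction with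
  | mem h hh =>
    obtain ⟨u, e, hu, he, rfl⟩ := hh
    rw [monomial_eq_pow_mul_erase e a, map_mul (pol A), map_pow (pol A), pol_X, ← mul_assoc (g A u),
      hright _ (polK _ (by rw [Finsupp.erase_ne ham.1.ne']; exact he) (by simp))]
    refine K.mul_mem ?_ (polK _ (by rw [Finsupp.erase_ne ham.1.ne']; exact he) (by simp))
    by_cases hua : u a = a
    · rw [hleft _ (gK u hu hua)]
      exact K.mul_mem (gK u hu hua) (hy _)
    · have h1 : u a < a := by
        refine lt_of_le_of_ne (not_lt.1 fun h => ham.2 h (lt_of_le_of_ne (hm _) fun h' => ?_)) hua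
        exact ham.1.ne (u.injective (h'.trans hu.symm))
      have h2 : (swap (u a) a * u) a = a := by simp
      have h3 : (swap (u a) a * u) m = m := by
        rw [Perm.mul_apply, hu, swap_apply_of_ne_of_ne (h1.trans ham.1).ne' ham.1.ne']
      have h4 : g A u * y A a ^ e a = g A (swap (u a) a) * y A a ^ e a *
          g A (swap (u a) a * u) := by
        have h5 : Commute (g A (swap (u a) a * u)) (y A a) := by
          refine g_comm_y h2 fun i => ?_
          have key : ∀ j, j < a ↔ j ≠ a ∧ j ≠ m := fun j => ⟨fun h => ⟨h.ne, (h.trans ham.1).ne⟩,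
            fun h => lt_of_le_of_ne (not_lt.1 fun h' => ham.2 h' (lt_of_le_of_ne (hm _) h.2)) h.1⟩
          have i1 : (swap (u a) a * u) i = a ↔ i = a :=
            ⟨fun h => (swap (u a) a * u).injective (h.trans h2.symm), by rintro rfl; exact h2⟩
          have i2 : (swap (u a) a * u) i = m ↔ i = m :=
            ⟨fun h => (swap (u a) a * u).injective (h.trans h3.symm), by rintro rfl; exact h3⟩
          rw [key, key, ne_eq, ne_eq, i1, i2]
        rw [mul_assoc, ← (h5.pow_right _).eq, ← mul_assoc, ← map_mul, ← mul_assoc,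
          swap_mul_self, one_mul]
      rw [h4, hright _ (gK _ h3 h2)]
      exact K.mul_mem (hswap _ h1 _) (gK _ h3 h2)
  | zero => simp
  | add p q _ _ hp hq =>
    rw [mul_add, add_mul, map_add]
    exact K.add_mem hp hq
  | smul c p _ hp =>
    rw [mul_smul_comm, smul_mul_assoc, map_smul]
    exact K.smul_mem hp c

theorem double_trace (hm : IsTop m) (ham : a ⋖ m) (h : A) :
    ptrace A ω m (g A (swap a m) * ptrace A ω m (g A (swap a m) * h) * g A (swap a m)) =
      ptrace A ω m (g A (swap a m) * ptrace A ω m (h * g A (swap a m)) * g A (swap a m)) := by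
  set s := g A (swap a m) with hs
  have hss : s * s = 1 := g_swap_sq a m
  have hya := y_mem_parabolic (A := A) hm ham.1.ne
  have hK : ∀ b ∈ parabolic A m, ptrace A ω m (s * b * s) ∈ parabolic A m ∧
      s * ptrace A ω m (s * b * s) = ptrace A ω m (s * b * s) * s := by
    intro b hb
    have := psi_mem ω hm ham hb
    rw [Algebra.mem_inf, Subalgebra.mem_centralizer_iff] at this
    exact ⟨this.1, this.2 _ rfl⟩
  have hsb : ∀ b ∈ parabolic A m, ptrace A ω m (s * b) = b := fun b hb => by
    rw [ptrace_mul ω hm _ hb, ptrace_swap ω hm ham.1.ne, one_mul]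
  have hbs : ∀ b ∈ parabolic A m, ptrace A ω m (b * s) = b := fun b hb => by
    rw [mul_ptrace ω hm hb, ptrace_swap ω hm ham.1.ne, mul_one]
  have sya : s * y A a = y A m * s - 1 := adjacent_mul_y ham
  have sym : s * y A m = y A a * s + 1 := adjacent_mul_y' ham
  have yas : y A a * s = s * y A m - 1 := by rw [sym]; abel
  have yms : y A m * s = s * y A a + 1 := by rw [sya]; abel
  let φ : A →ₗ[ℂ] A := ptrace A ω m ∘ₗ LinearMap.mulRight ℂ s ∘ₗ LinearMap.mulLeft ℂ s ∘ₗ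
    ptrace A ω m
  have hφ : ∀ h, φ h = ptrace A ω m (s * ptrace A ω m h * s) := fun _ => rfl
  have φm : ∀ h, φ (y A m * h) = φ (h * y A m) := fun h => by
    rw [hφ, hφ, ptrace_cyclic ω hm]
  have ψa : ∀ b ∈ parabolic A m, ptrace A ω m (s * (y A a * b) * s) =
      ptrace A ω m (s * (b * y A a) * s) := by
    intro b hb
    have e1 : s * (y A a * b) * s = y A m * (s * b * s) - b * s := by
      rw [← mul_assoc, sya]; noncomm_ring
    have e2 : s * (b * y A a) * s = (s * b * s) * y A m - s * b := by
      rw [mul_assoc, mul_assoc, yas]; noncomm_ring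
    rw [e1, e2, map_sub, map_sub, ptrace_cyclic ω hm, hsb b hb, hbs b hb]
  have φa : ∀ h, φ (y A a * h) = φ (h * y A a) := fun h => by
    rw [hφ, hφ, mul_ptrace ω hm hya, ptrace_mul ω hm _ hya, ψa _ (ptrace_mem ω hm h)]
  let Δ : A →ₗ[ℂ] A := φ ∘ₗ LinearMap.mulLeft ℂ s - φ ∘ₗ LinearMap.mulRight ℂ s
  have hΔ : ∀ h, Δ h = φ (s * h) - φ (h * s) := fun _ => rfl
  have Δa : ∀ h, Δ (y A a * h) = Δ (h * y A m) := by
    intro h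
    have e1 : s * (y A a * h) = y A m * (s * h) - h := by rw [← mul_assoc, sya]; noncomm_ring
    have e2 : h * y A m * s = h * s * y A a + h := by rw [mul_assoc, yms]; noncomm_ring
    rw [hΔ, hΔ, e1, e2, map_sub, map_add, φm, mul_assoc (y A a), φa, mul_assoc s]
    abel
  have Δm : ∀ h, Δ (y A m * h) = Δ (h * y A a) := by
    intro h
    have e1 : s * (y A m * h) = y A a * (s * h) + h := by rw [← mul_assoc, sym]; noncomm_ring
    have e2 : h * y A a * s = h * s * y A m - h := by rw [mul_assoc, yas]; noncomm_ring
    rw [hΔ, hΔ, e1, e2, map_sub, map_add, φa, mul_assoc (y A m), φm, mul_assoc s]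
    abel
  have Δa' : ∀ k h, Δ (y A a ^ k * h) = Δ (h * y A m ^ k) := by
    intro k
    induction k with
    | zero => simp
    | succ k ih => intro h; rw [pow_succ', mul_assoc, Δa, mul_assoc, ih, mul_assoc, ← pow_succ']
  have Δm' : ∀ k h, Δ (y A m ^ k * h) = Δ (h * y A a ^ k) := by
    intro k
    induction k with
    | zero => simp
    | succ k ih => intro h; rw [pow_succ', mul_assoc, Δm, mul_assoc, ih, mul_assoc, ← pow_succ']
  have Δb : ∀ b ∈ parabolic A m, Δ b = 0 := by
    intro b hb
    rw [hΔ, hφ, hφ, hsb b hb, hbs b hb, sub_self]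
  have Δbsc : ∀ b ∈ parabolic A m, ∀ c ∈ parabolic A m, Δ (b * s * c) = 0 := by
    intro b hb c hc
    have e1 : φ (s * (b * s * c)) = ptrace A ω m (s * b * s) * ptrace A ω m (s * c * s) := by
      obtain ⟨h1, h2⟩ := hK b hb
      rw [hφ, ← mul_assoc, ← mul_assoc, ptrace_mul ω hm _ hc, ← mul_assoc, h2, mul_assoc, mul_assoc,
        mul_ptrace ω hm h1, ← mul_assoc s c]
    have e2 : φ (b * s * c * s) = ptrace A ω m (s * b * s) * ptrace A ω m (s * c * s) := by
      obtain ⟨h1, h2⟩ := hK c hc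
      rw [hφ, mul_assoc (b * s), mul_assoc b, ← mul_assoc s c, mul_ptrace ω hm hb, ← mul_assoc s b,
        mul_assoc _ _ s, ← h2, ← mul_assoc, ptrace_mul ω hm _ h1]
    rw [hΔ, e1, e2, sub_self]
  have Δ0 : Δ = 0 := by
    refine parabolic_ext hm fun w k c hc => ?_
    rw [LinearMap.zero_apply]
    by_cases hw : w m = m
    · rw [← mul_assoc, ← y_top_pow_comm hm (g_mem_parabolic hw), mul_assoc, Δm']
      exact Δb _ (Subalgebra.mul_mem _ (Subalgebra.mul_mem _ (g_mem_parabolic hw) hc)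
        (Subalgebra.pow_mem _ hya _))
    · obtain ⟨j, hj⟩ := w.surjective m
      have hj' : j ≠ m := by rintro rfl; exact hw hj
      have h1 : w = (w * swap j m * swap j a) * swap a m * swap j a := by
        have : swap j a * swap a m * swap j a = swap j m :=
          swap_conj hj' ham.1.ne
        rw [mul_assoc, mul_assoc (w * _), ← mul_assoc (swap j a), this, mul_assoc,
          swap_mul_self, mul_one]
      have h2 : (w * swap j m * swap j a) m = m := by
        rw [Perm.mul_apply, swap_apply_of_ne_of_ne hj'.symm ham.1.ne']
        simp [hj]
      have h3 : g A w = g A (w * swap j m * swap j a) * s * g A (swap j a) := by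
        rw [hs, ← map_mul, ← map_mul, ← h1]
      have h4 : y A a ^ k * (g A w * c) =
          y A a ^ k * g A (w * swap j m * swap j a) * s * (g A (swap j a) * c) := by
        rw [h3]
        simp only [mul_assoc]
      rw [y_top_pow_comm hm hc, ← mul_assoc, ← Δa', h4]
      exact Δbsc _ (Subalgebra.mul_mem _ (Subalgebra.pow_mem _ hya _) (g_mem_parabolic h2)) _
        (Subalgebra.mul_mem _ (swap_mem_parabolic hj' ham.1.ne) hc)
  have := LinearMap.congr_fun Δ0 h
  rw [hΔ, LinearMap.zero_apply, sub_eq_zero] at this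
  exact this

end

end Hecke

end

section
open Equiv Finset Module LinearMap MvPolynomial

theorem exists_perm_of_injective {J ι : Type*} [Finite J] [Finite ι] {f g : J → ι}
    (hf : Function.Injective f) (hg : Function.Injective g) :
    ∃ v : Perm ι, ∀ j, v (f j) = g j := by
  classical
  have := Fintype.ofFinite ι
  let e : {x // x ∈ Set.range f} ≃ {x // x ∈ Set.range g} :=
    (ofInjective f hf).symm.trans (ofInjective g hg)
  refine ⟨e.extendSubtype, fun j => ?_⟩
  rw [extendSubtype_apply_of_mem e (f j) ⟨j, rfl⟩]
  have : (⟨f j, j, rfl⟩ : {x // x ∈ Set.range f}) = ofInjective f hf j := rfl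
  rw [this]
  simp [e]

theorem exists_perm_pair {ι : Type*} [Finite ι] {a b c d : ι} (hab : a ≠ b) (hcd : c ≠ d) :
    ∃ v : Perm ι, v a = c ∧ v b = d := by
  obtain ⟨v, hv⟩ := exists_perm_of_injective (f := ![a, b]) (g := ![c, d])
    (by simpa [Function.Injective, Fin.forall_fin_two] using ⟨hab, hab.symm⟩)
    (by simpa [Function.Injective, Fin.forall_fin_two] using ⟨hcd, hcd.symm⟩)
  exact ⟨v, hv 0, hv 1⟩

/-- Two commuting copies of the degenerate affine Hecke algebra together with operators that
connect strands of the first copy with strands of the second. -/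
structure CapSystem (ι E : Type) [Fintype ι] [LinearOrder ι] [Ring E] where
  lg : Perm ι →* E
  rg : Perm ι →* E
  lx : ι → E
  rx : ι → E
  ly : ι → E
  ry : ι → E
  cap : ι → ι → E
  ly_def : ∀ k, ly k = lx k + ∑ j ∈ univ.filter (· < k), lg (swap j k)
  ry_def : ∀ k, ry k = rx k + ∑ j ∈ univ.filter (· < k), rg (swap j k)
  lg_rg : ∀ v w, lg v * rg w = rg w * lg v
  lg_ry : ∀ v k, lg v * ry k = ry k * lg v
  ly_rg : ∀ k v, ly k * rg v = rg v * ly k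
  ly_ry : ∀ k l, ly k * ry l = ry l * ly k
  ly_ly : ∀ k l, ly k * ly l = ly l * ly k
  ry_ry : ∀ k l, ry k * ry l = ry l * ry k
  lg_ly : ∀ a b, a ⋖ b → lg (swap a b) * ly a = ly b * lg (swap a b) - 1
  rg_ry : ∀ a b, a ⋖ b → rg (swap a b) * ry a = ry b * rg (swap a b) - 1
  lg_ly_far : ∀ a b k, a ⋖ b → k ≠ a → k ≠ b → lg (swap a b) * ly k = ly k * lg (swap a b)
  rg_ry_far : ∀ a b k, a ⋖ b → k ≠ a → k ≠ b → rg (swap a b) * ry k = ry k * rg (swap a b)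
  lg_cap : ∀ v k l, lg v * cap k l = cap (v k) l * lg v
  rg_cap : ∀ v k l, rg v * cap k l = cap k (v l) * rg v
  cap_lx : ∀ k l k', k' ≠ k → cap k l * lx k' = lx k' * cap k l
  cap_rx : ∀ k l l', l' ≠ l → cap k l * rx l' = rx l' * cap k l
  cap_cap_left : ∀ k k' l, k ≠ k' → cap k l * cap k' l = cap k l * lg (swap k k')
  cap_cap_right : ∀ k l l', l ≠ l' → cap k l * cap k l' = cap k l * rg (swap l l')
  cap_cap_comm : ∀ k l k' l', k ≠ k' → l ≠ l' → cap k l * cap k' l' = cap k' l' * cap k l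
  cap_slide : ∀ k l,
    cap k l * (lx k + ∑ j ∈ univ.filter (· ≠ k), lg (swap k j)) =
      cap k l * (rx l + ∑ j ∈ univ.filter (· ≠ l), rg (swap l j))
  slide_cap : ∀ k l,
    (lx k + ∑ j ∈ univ.filter (· ≠ k), lg (swap k j)) * cap k l =
      (rx l + ∑ j ∈ univ.filter (· ≠ l), rg (swap l j)) * cap k l

namespace Hecke

section

variable {ι A : Type} [Fintype ι] [LinearOrder ι] [Ring A] [Algebra ℂ A] [AffineHecke ι A]

variable (A) in
/-- Left multiplication by permutations. -/
def lgOp : Perm ι →* End ℂ A where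
  toFun w := mulLeft ℂ (g A w)
  map_one' := by ext; simp
  map_mul' v w := by ext; simp

variable (A) in
/-- Right multiplication by inverses of permutations. -/
def rgOp : Perm ι →* End ℂ A where
  toFun w := mulRight ℂ (g A w⁻¹)
  map_one' := by ext; simp
  map_mul' v w := by ext; simp [mul_assoc]

@[simp] theorem lgOp_apply (w : Perm ι) (h : A) : lgOp A w h = g A w * h := rfl

@[simp] theorem rgOp_apply (w : Perm ι) (h : A) : rgOp A w h = h * g A w⁻¹ := rfl

variable (A) in
/-- The operator connecting the strand `k` on the left with the strand `l` on the right. -/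
def capOp (ω : ℕ → ℂ) (m k l : ι) : End ℂ A :=
  mulLeft ℂ (g A (swap k m)) * mulRight ℂ (g A (swap l m)) *
    ptrace A ω m * mulLeft ℂ (g A (swap k m)) *
    mulRight ℂ (g A (swap l m))

variable (ω : ℕ → ℂ) {m : ι}

theorem capOp_apply (k l : ι) (h : A) : capOp A ω m k l h = g A (swap k m) *
    ptrace A ω m (g A (swap k m) * h * g A (swap l m)) * g A (swap l m) := by
  simp [capOp, mul_assoc]

theorem lgOp_capOp (hm : IsTop m) (v : Perm ι) (k l : ι) :
    lgOp A v * capOp A ω m k l = capOp A ω m (v k) l * lgOp A v := by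
  ext h
  set u := swap (v k) m * v * swap k m with hu
  have h1 : g A (swap (v k) m) * (g A v * h) * g A (swap l m) =
      g A u * (g A (swap k m) * h * g A (swap l m)) := by
    rw [hu, map_mul, map_mul]
    simp only [mul_assoc]
    rw [← mul_assoc (g A (swap k m)), g_swap_sq, one_mul]
  have h2 : g A (swap (v k) m) * g A u = g A v * g A (swap k m) := by
    rw [hu, map_mul, map_mul, ← mul_assoc, ← mul_assoc, g_swap_sq, one_mul]
  rw [End.mul_apply, End.mul_apply, capOp_apply, capOp_apply, lgOp_apply, lgOp_apply,
    h1, ptrace_g_mul ω hm (by simp [hu]), ← mul_assoc (g A (swap (v k) m)), h2]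
  simp only [mul_assoc]

theorem rgOp_capOp (hm : IsTop m) (v : Perm ι) (k l : ι) :
    rgOp A v * capOp A ω m k l = capOp A ω m k (v l) * rgOp A v := by
  ext h
  set u := swap l m * v⁻¹ * swap (v l) m with hu
  have hum : u m = m := by
    rw [hu, Perm.mul_apply, Perm.mul_apply, swap_apply_right,
      show v⁻¹ (v l) = l by simp, swap_apply_left]
  have h1 : g A (swap k m) * (h * g A v⁻¹) * g A (swap (v l) m) =
      g A (swap k m) * h * g A (swap l m) * g A u := by
    rw [hu, map_mul, map_mul]
    simp only [mul_assoc]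
    rw [← mul_assoc (g A (swap l m)) (g A (swap l m)), g_swap_sq, one_mul]
  have h2 : g A u * g A (swap (v l) m) = g A (swap l m) * g A v⁻¹ := by
    rw [hu, map_mul, map_mul, mul_assoc, g_swap_sq, mul_one]
  rw [End.mul_apply, End.mul_apply, capOp_apply, capOp_apply, rgOp_apply, rgOp_apply,
    h1, ptrace_mul ω hm _ (g_mem_parabolic hum)]
  rw [mul_assoc _ _ (g A v⁻¹), ← h2]
  simp only [mul_assoc]

theorem capOp_eq_conj (hm : IsTop m) (v w : Perm ι) (k l : ι) :
    capOp A ω m (v k) (w l) = lgOp A v * rgOp A w * capOp A ω m k l * lgOp A v⁻¹ * rgOp A w⁻¹ := by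
  have h1 : ∀ v w : Perm ι, lgOp A v * rgOp A w = rgOp A w * lgOp A v := by
    intro v w; ext h; simp [mul_assoc]
  rw [mul_assoc (lgOp A v), rgOp_capOp ω hm, ← mul_assoc, lgOp_capOp ω hm, mul_assoc, mul_assoc, mul_assoc,
    ← mul_assoc (rgOp A w), ← h1, mul_assoc (lgOp A v⁻¹), ← map_mul, mul_inv_cancel, map_one, mul_one,
    ← map_mul, mul_inv_cancel, map_one, mul_one]

theorem capOp_comp_same (hm : IsTop m) (k l : ι) (n : ℕ) :
    capOp A ω m k l * LinearMap.mulLeft ℂ (x A k) ^ n * capOp A ω m k l = ω n • capOp A ω m k l := by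
  ext h
  have h0 : SemiconjBy (g A (swap k m)) (x A k) (x A m) := by
    rw [SemiconjBy, g_mul_x, swap_apply_left]
  have h1 := (h0.pow_right n).eq
  rw [End.mul_apply, End.mul_apply, pow_mulLeft, mulLeft_apply,
    capOp_apply, capOp_apply, LinearMap.smul_apply, capOp_apply]
  have h2 : g A (swap k m) * (x A k ^ n * (g A (swap k m) *
      ptrace A ω m (g A (swap k m) * h * g A (swap l m)) * g A (swap l m))) *
      g A (swap l m) =
      x A m ^ n * ptrace A ω m (g A (swap k m) * h * g A (swap l m)) := by
    rw [← mul_assoc, h1]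
    simp only [mul_assoc]
    rw [g_swap_sq, mul_one, ← mul_assoc (g A (swap k m)) (g A (swap k m)), g_swap_sq, one_mul]
  rw [h2, ptrace_mul ω hm _ (ptrace_mem ω hm _), ptrace_x_pow ω hm, ← Algebra.smul_def]
  simp

theorem lg_rg (v w : Perm ι) : lgOp A v * rgOp A w = rgOp A w * lgOp A v := by
  ext h; simp [mul_assoc]

theorem capOp_cap_left (hm : IsTop m) {k k' : ι} (l : ι) (hk : k ≠ k') :
    capOp A ω m k l * capOp A ω m k' l = capOp A ω m k l * lgOp A (swap k k') := by
  have base : ∀ a, a ≠ m → capOp A ω m m m * capOp A ω m a m =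
      capOp A ω m m m * lgOp A (swap m a) := by
    intro a ha
    ext h
    simp only [End.mul_apply, capOp_apply, lgOp_apply, swap_self]
    rw [show (Equiv.refl ι : Equiv.Perm ι) = 1 from rfl, map_one]
    simp only [one_mul, mul_one]
    rw [ptrace_mul ω hm _ (ptrace_mem ω hm _), ptrace_swap ω hm ha, one_mul, swap_comm]
  obtain ⟨a, v, ha, rfl, rfl⟩ : ∃ (a : ι) (v : Perm ι), a ≠ m ∧ v m = k ∧ v a = k' := by
    refine ⟨swap k m k', swap k m, fun h => hk ?_, by simp, by simp⟩
    rw [swap_apply_eq_iff, swap_apply_right] at h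
    exact h.symm
  have hl : l = swap l m m := by simp
  rw [hl, capOp_eq_conj ω hm v _ m m, capOp_eq_conj ω hm v _ a m]
  set w := swap l m
  have e : swap (v m) (v a) = v * swap m a * v⁻¹ := by
    rw [mul_swap_eq_swap_mul, mul_assoc, mul_inv_cancel, mul_one]
  have cl : lgOp A v⁻¹ * lgOp A v = 1 := by rw [← map_mul, inv_mul_cancel, map_one]
  have cr : rgOp A w⁻¹ * rgOp A w = 1 := by rw [← map_mul, inv_mul_cancel, map_one]
  have h3 := base a ha
  rw [e, map_mul, map_mul]
  calc _ = lgOp A v * rgOp A w * capOp A ω m m m * lgOp A v⁻¹ * (rgOp A w⁻¹ * lgOp A v) * rgOp A w *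
        capOp A ω m a m * lgOp A v⁻¹ * rgOp A w⁻¹ := by simp only [mul_assoc]
    _ = lgOp A v * rgOp A w * capOp A ω m m m * (lgOp A v⁻¹ * lgOp A v) * (rgOp A w⁻¹ * rgOp A w) *
        capOp A ω m a m * lgOp A v⁻¹ * rgOp A w⁻¹ := by rw [← lg_rg]; simp only [mul_assoc]
    _ = lgOp A v * rgOp A w * (capOp A ω m m m * capOp A ω m a m) * lgOp A v⁻¹ * rgOp A w⁻¹ := by
        rw [cl, cr]; simp only [mul_one, mul_assoc]
    _ = lgOp A v * rgOp A w * capOp A ω m m m * ((lgOp A v⁻¹ * lgOp A v) * lgOp A (swap m a) *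
        lgOp A v⁻¹) * rgOp A w⁻¹ := by rw [h3, cl, one_mul]; simp only [mul_assoc]
    _ = lgOp A v * rgOp A w * capOp A ω m m m * lgOp A v⁻¹ * (lgOp A (v * swap m a * v⁻¹) *
        rgOp A w⁻¹) := by rw [map_mul, map_mul]; simp only [mul_assoc]
    _ = _ := by rw [lg_rg (v * swap m a * v⁻¹) w⁻¹]; simp only [map_mul, mul_assoc]

theorem capOp_cap_right (hm : IsTop m) (k : ι) {l l' : ι} (hl : l ≠ l') :
    capOp A ω m k l * capOp A ω m k l' = capOp A ω m k l * rgOp A (swap l l') := by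
  have base : ∀ a, a ≠ m → capOp A ω m m m * capOp A ω m m a =
      capOp A ω m m m * rgOp A (swap m a) := by
    intro a ha
    ext h
    simp only [End.mul_apply, capOp_apply, rgOp_apply, swap_self, swap_inv]
    rw [show (Equiv.refl ι : Equiv.Perm ι) = 1 from rfl, map_one]
    simp only [one_mul, mul_one]
    rw [mul_ptrace ω hm (ptrace_mem ω hm _), ptrace_swap ω hm ha, mul_one, swap_comm]
  obtain ⟨a, v, ha, rfl, rfl⟩ : ∃ (a : ι) (v : Perm ι), a ≠ m ∧ v m = l ∧ v a = l' := by
    refine ⟨swap l m l', swap l m, fun h => hl ?_, by simp, by simp⟩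
    rw [swap_apply_eq_iff, swap_apply_right] at h
    exact h.symm
  have hl : k = swap k m m := by simp
  rw [hl, capOp_eq_conj ω hm _ v m m, capOp_eq_conj ω hm _ v m a]
  set w := swap k m
  have e : swap (v m) (v a) = v * swap m a * v⁻¹ := by
    rw [mul_swap_eq_swap_mul, mul_assoc, mul_inv_cancel, mul_one]
  have cl : lgOp A w⁻¹ * lgOp A w = 1 := by rw [← map_mul, inv_mul_cancel, map_one]
  have cr : rgOp A v⁻¹ * rgOp A v = 1 := by rw [← map_mul, inv_mul_cancel, map_one]
  have h3 := base a ha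
  rw [e, map_mul, map_mul]
  calc _ = lgOp A w * rgOp A v * capOp A ω m m m * lgOp A w⁻¹ * (rgOp A v⁻¹ * lgOp A w) * rgOp A v *
        capOp A ω m m a * lgOp A w⁻¹ * rgOp A v⁻¹ := by simp only [mul_assoc]
    _ = lgOp A w * rgOp A v * capOp A ω m m m * (lgOp A w⁻¹ * lgOp A w) * (rgOp A v⁻¹ * rgOp A v) *
        capOp A ω m m a * lgOp A w⁻¹ * rgOp A v⁻¹ := by rw [← lg_rg]; simp only [mul_assoc]
    _ = lgOp A w * rgOp A v * (capOp A ω m m m * capOp A ω m m a) * lgOp A w⁻¹ * rgOp A v⁻¹ := by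
        rw [cl, cr]; simp only [mul_one, mul_assoc]
    _ = lgOp A w * rgOp A v * capOp A ω m m m * (rgOp A (swap m a) * lgOp A w⁻¹) *
        rgOp A v⁻¹ := by rw [h3]; simp only [mul_assoc]
    _ = lgOp A w * rgOp A v * capOp A ω m m m * lgOp A w⁻¹ * ((rgOp A v⁻¹ * rgOp A v) *
        rgOp A (swap m a) * rgOp A v⁻¹) := by rw [← lg_rg, cr, one_mul]; simp only [mul_assoc]
    _ = _ := by simp only [mul_assoc]

theorem capOp_cap_comm (hm : IsTop m) {k l k' l' : ι} (hk : k ≠ k') (hl : l ≠ l') :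
    capOp A ω m k l * capOp A ω m k' l' = capOp A ω m k' l' * capOp A ω m k l := by
  obtain ⟨c, hc⟩ : ∃ c : ι, c ≠ m := by
    by_cases h : k = m
    · exact ⟨k', fun h' => hk (h.trans h'.symm)⟩
    · exact ⟨k, h⟩
  obtain ⟨a, ham⟩ : ∃ a : ι, a ⋖ m := by
    obtain ⟨a, -, ha⟩ := exists_le_covBy_of_lt (lt_of_le_of_ne (hm c) hc)
    exact ⟨a, ha⟩
  have base : capOp A ω m m a * capOp A ω m a m = capOp A ω m a m * capOp A ω m m a := by
    ext h
    simp only [End.mul_apply, capOp_apply, swap_self]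
    rw [show (Equiv.refl ι : Equiv.Perm ι) = 1 from rfl, map_one]
    simp only [one_mul, mul_one]
    have h1 := double_trace ω hm ham h
    have h2 : ∀ b : A, g A (swap a m) * (b * g A (swap a m)) =
      g A (swap a m) * b * g A (swap a m) := fun b => (mul_assoc _ _ _).symm
    have h3 := psi_mem ω hm ham (ptrace_mem ω hm (h * g A (swap a m)))
    rw [Algebra.mem_inf, Subalgebra.mem_centralizer_iff] at h3
    rw [h1, h2, h3.2 _ rfl]
  obtain ⟨v, rfl, rfl⟩ : ∃ v : Perm ι, v m = k ∧ v a = k' :=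
    exists_perm_pair ham.1.ne' hk
  obtain ⟨w, rfl, rfl⟩ : ∃ w : Perm ι, w a = l ∧ w m = l' := exists_perm_pair ham.1.ne hl
  have cl : lgOp A v⁻¹ * lgOp A v = 1 := by rw [← map_mul, inv_mul_cancel, map_one]
  have cr : rgOp A w⁻¹ * rgOp A w = 1 := by rw [← map_mul, inv_mul_cancel, map_one]
  have key : ∀ c d : End ℂ A, (lgOp A v * rgOp A w * c * lgOp A v⁻¹ * rgOp A w⁻¹) *
      (lgOp A v * rgOp A w * d * lgOp A v⁻¹ * rgOp A w⁻¹) =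
      lgOp A v * rgOp A w * (c * d) * lgOp A v⁻¹ * rgOp A w⁻¹ := by
    intro c d
    calc _ = lgOp A v * rgOp A w * c * lgOp A v⁻¹ * (rgOp A w⁻¹ * lgOp A v) * rgOp A w * d *
          lgOp A v⁻¹ * rgOp A w⁻¹ := by simp only [mul_assoc]
      _ = lgOp A v * rgOp A w * c * (lgOp A v⁻¹ * lgOp A v) * (rgOp A w⁻¹ * rgOp A w) * d *
          lgOp A v⁻¹ * rgOp A w⁻¹ := by rw [← lg_rg]; simp only [mul_assoc]
      _ = _ := by rw [cl, cr]; simp only [mul_one, mul_assoc]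
  rw [capOp_eq_conj ω hm v w m a, capOp_eq_conj ω hm v w a m, key, key, base]

theorem capOp_lx (hm : IsTop m) {k k' : ι} (l : ι) (hk : k' ≠ k) :
    capOp A ω m k l * mulLeft ℂ (x A k') = mulLeft ℂ (x A k') * capOp A ω m k l := by
  ext h
  have hk' : swap k m k' ≠ m := by
    rw [ne_eq, swap_apply_eq_iff, swap_apply_right]; exact hk
  rw [End.mul_apply, End.mul_apply, mulLeft_apply, mulLeft_apply,
    capOp_apply, capOp_apply, ← mul_assoc (g A _), g_mul_x, mul_assoc (x A _), mul_assoc (x A _),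
    mul_ptrace ω hm (x_mem_parabolic hk'), ← mul_assoc (g A _) (x A _), g_mul_x]
  simp [mul_assoc]

theorem capOp_rx (hm : IsTop m) (k : ι) {l l' : ι} (hl : l' ≠ l) :
    capOp A ω m k l * mulRight ℂ (x A l') = mulRight ℂ (x A l') * capOp A ω m k l := by
  ext h
  have hl' : swap l m l' ≠ m := by
    rw [ne_eq, swap_apply_eq_iff, swap_apply_right]; exact hl
  have e := x_mul_g (A := A) (swap l m) l'
  rw [swap_inv] at e
  have e2 := g_mul_x (A := A) (swap l m) l'
  rw [End.mul_apply, End.mul_apply, mulRight_apply, mulRight_apply,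
    capOp_apply, capOp_apply, ← mul_assoc (g A _) h, mul_assoc _ (x A l'), e, ← mul_assoc _ _ (x A _),
    ptrace_mul ω hm _ (x_mem_parabolic hl'), mul_assoc _ _ (x A l'), mul_assoc (g A (swap k m)), mul_assoc (ptrace A ω m _), e2]
  simp only [mul_assoc]

variable (A) in
/-- The Jucys-Murphy operators that involve all strands, on the left. -/
def lJM (k : ι) : End ℂ A :=
  mulLeft ℂ (x A k) + ∑ j ∈ univ.filter (· ≠ k), lgOp A (swap k j)

variable (A) in
/-- The Jucys-Murphy operators that involve all strands, on the right. -/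
def rJM (k : ι) : End ℂ A :=
  mulRight ℂ (x A k) + ∑ j ∈ univ.filter (· ≠ k), rgOp A (swap k j)

theorem lgOp_lx (v : Perm ι) (k : ι) : lgOp A v * mulLeft ℂ (x A k) =
    mulLeft ℂ (x A (v k)) * lgOp A v := by
  ext h
  simp only [End.mul_apply, lgOp_apply, mulLeft_apply]
  rw [← mul_assoc, g_mul_x, mul_assoc]

theorem rgOp_rx (v : Perm ι) (k : ι) : rgOp A v * mulRight ℂ (x A k) =
    mulRight ℂ (x A (v k)) * rgOp A v := by
  ext h
  simp only [End.mul_apply, rgOp_apply, mulRight_apply]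
  rw [mul_assoc, x_mul_g, inv_inv, mul_assoc]

theorem lgOp_lJM (v : Perm ι) (k : ι) : lgOp A v * lJM A k = lJM A (v k) * lgOp A v := by
  rw [lJM, lJM, mul_add, add_mul, lgOp_lx, mul_sum, sum_mul]
  congr 1
  refine sum_equiv v (fun i => by simp) fun i _ => ?_
  rw [← map_mul, ← map_mul, mul_swap_eq_swap_mul]

theorem rgOp_rJM (v : Perm ι) (k : ι) : rgOp A v * rJM A k = rJM A (v k) * rgOp A v := by
  rw [rJM, rJM, mul_add, add_mul, rgOp_rx, mul_sum, sum_mul]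
  congr 1
  refine sum_equiv v (fun i => by simp) fun i _ => ?_
  rw [← map_mul, ← map_mul, mul_swap_eq_swap_mul]

theorem filter_ne_top (hm : IsTop m) : univ.filter (· < m) = univ.filter (· ≠ m) := by
  ext i
  simp only [mem_filter_univ]
  exact ⟨fun h => h.ne, fun h => lt_of_le_of_ne (hm i) h⟩

theorem lJM_top (hm : IsTop m) : lJM A m = mulLeft ℂ (y A m) := by
  ext h
  rw [y, filter_ne_top hm, lJM]
  simp [add_mul, sum_mul, LinearMap.sum_apply, swap_comm m]

theorem rJM_top (hm : IsTop m) : rJM A m = mulRight ℂ (y A m) := by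
  ext h
  rw [y, filter_ne_top hm, rJM]
  simp [mul_add, mul_sum, LinearMap.sum_apply, swap_comm m]

theorem lJM_rg (k : ι) (w : Perm ι) : lJM A k * rgOp A w = rgOp A w * lJM A k := by
  have : mulLeft ℂ (x A k) * rgOp A w = rgOp A w * mulLeft ℂ (x A k) := by
    ext h; simp [mul_assoc]
  rw [lJM, mul_add, add_mul, this, mul_sum, sum_mul]
  simp only [lg_rg]

theorem rJM_lg (k : ι) (w : Perm ι) : rJM A k * lgOp A w = lgOp A w * rJM A k := by
  have : mulRight ℂ (x A k) * lgOp A w = lgOp A w * mulRight ℂ (x A k) := by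
    ext h; simp [mul_assoc]
  rw [rJM, mul_add, add_mul, this, mul_sum, sum_mul]
  simp only [lg_rg]

theorem capOp_slide (hm : IsTop m) (k l : ι) :
    capOp A ω m k l * lJM A k = capOp A ω m k l * rJM A l := by
  have base : capOp A ω m m m * lJM A m = capOp A ω m m m * rJM A m := by
    rw [lJM_top hm, rJM_top hm]
    ext h
    simp only [End.mul_apply, capOp_apply, swap_self, mulLeft_apply, mulRight_apply]
    rw [show (Equiv.refl ι : Equiv.Perm ι) = 1 from rfl, map_one]
    simp only [one_mul, mul_one]
    exact ptrace_cyclic ω hm h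
  obtain ⟨v, rfl⟩ : ∃ v : Perm ι, v m = k := ⟨swap k m, by simp⟩
  obtain ⟨w, rfl⟩ : ∃ w : Perm ι, w m = l := ⟨swap l m, by simp⟩
  have e1 : lgOp A v⁻¹ * lJM A (v m) = lJM A m * lgOp A v⁻¹ := by
    rw [lgOp_lJM, show v⁻¹ (v m) = m by simp]
  have e2 : rgOp A w⁻¹ * rJM A (w m) = rJM A m * rgOp A w⁻¹ := by
    rw [rgOp_rJM, show w⁻¹ (w m) = m by simp]
  rw [capOp_eq_conj ω hm]
  calc _ = lgOp A v * rgOp A w * capOp A ω m m m * (lgOp A v⁻¹ * lJM A (v m)) * rgOp A w⁻¹ := by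
        rw [mul_assoc _ (rgOp A w⁻¹), ← lJM_rg]; simp only [mul_assoc]
    _ = lgOp A v * rgOp A w * (capOp A ω m m m * lJM A m) * lgOp A v⁻¹ * rgOp A w⁻¹ := by
        rw [e1]; simp only [mul_assoc]
    _ = lgOp A v * rgOp A w * capOp A ω m m m * (rJM A m * lgOp A v⁻¹) * rgOp A w⁻¹ := by
        rw [base]; simp only [mul_assoc]
    _ = lgOp A v * rgOp A w * capOp A ω m m m * lgOp A v⁻¹ * (rgOp A w⁻¹ * rJM A (w m)) := by
        rw [rJM_lg, e2]; simp only [mul_assoc]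
    _ = _ := by simp only [mul_assoc]

theorem slide_capOp (hm : IsTop m) (k l : ι) :
    lJM A k * capOp A ω m k l = rJM A l * capOp A ω m k l := by
  have base : lJM A m * capOp A ω m m m = rJM A m * capOp A ω m m m := by
    rw [lJM_top hm, rJM_top hm]
    ext h
    simp only [End.mul_apply, capOp_apply, swap_self, mulLeft_apply, mulRight_apply]
    rw [show (Equiv.refl ι : Equiv.Perm ι) = 1 from rfl, map_one]
    simp only [one_mul, mul_one]
    exact y_top_comm hm (ptrace_mem ω hm h)
  obtain ⟨v, rfl⟩ : ∃ v : Perm ι, v m = k := ⟨swap k m, by simp⟩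
  obtain ⟨w, rfl⟩ : ∃ w : Perm ι, w m = l := ⟨swap l m, by simp⟩
  rw [capOp_eq_conj ω hm]
  simp only [← mul_assoc]
  rw [← lgOp_lJM, mul_assoc _ (lJM A m) (rgOp A w), lJM_rg, rJM_lg, mul_assoc (lgOp A v) (rJM A _),
    ← rgOp_rJM]
  simp only [mul_assoc]
  rw [← mul_assoc (lJM A m), base]
  simp only [mul_assoc]

/-- The operators on the Hecke algebra with a top strand form a system of caps. -/
def capSystem (ω : ℕ → ℂ) (hm : IsTop m) : CapSystem ι (End ℂ A) where
  lg := lgOp A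
  rg := rgOp A
  lx k := LinearMap.mulLeft ℂ (x A k)
  rx k := LinearMap.mulRight ℂ (x A k)
  ly k := LinearMap.mulLeft ℂ (y A k)
  ry k := LinearMap.mulRight ℂ (y A k)
  cap := capOp A ω m
  ly_def k := by ext h; simp [y, add_mul, sum_mul, LinearMap.sum_apply]
  ry_def k := by ext h; simp [y, mul_add, mul_sum, LinearMap.sum_apply]
  lg_rg := lg_rg
  lg_ry v k := by ext h; simp [mul_assoc]
  ly_rg k v := by ext h; simp [mul_assoc]
  ly_ry k l := by ext h; simp [mul_assoc]
  ly_ly k l := by ext h; simp only [End.mul_apply, LinearMap.mulLeft_apply, ← mul_assoc, y_comm k l]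
  ry_ry k l := by ext h; simp only [End.mul_apply, LinearMap.mulRight_apply, mul_assoc, y_comm k l]
  lg_ly a b hab := by
    ext h
    simp only [End.mul_apply, LinearMap.sub_apply, LinearMap.mulLeft_apply, lgOp_apply,
      ← mul_assoc, adjacent_mul_y hab, sub_mul, End.one_apply, one_mul]
  rg_ry a b hab := by
    ext h
    simp only [End.mul_apply, LinearMap.sub_apply, LinearMap.mulRight_apply, rgOp_apply,
      mul_assoc, swap_inv, adjacent_mul_y' hab, mul_add, End.one_apply, mul_one]
    abel
  lg_ly_far a b k hab ha hb := by
    ext h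
    simp only [End.mul_apply, LinearMap.mulLeft_apply, lgOp_apply, ← mul_assoc,
      adjacent_comm_y hab ha hb]
  rg_ry_far a b k hab ha hb := by
    ext h
    simp only [End.mul_apply, LinearMap.mulRight_apply, rgOp_apply, mul_assoc, swap_inv,
      adjacent_comm_y hab ha hb]
  lg_cap v k l := lgOp_capOp ω hm v k l
  rg_cap v k l := rgOp_capOp ω hm v k l
  cap_lx k l k' h := capOp_lx ω hm l h
  cap_rx k l l' h := capOp_rx ω hm k h
  cap_cap_left k k' l h := capOp_cap_left ω hm l h
  cap_cap_right k l l' h := capOp_cap_right ω hm k h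
  cap_cap_comm k l k' l' h h' := capOp_cap_comm ω hm h h'
  cap_slide k l := capOp_slide ω hm k l
  slide_cap k l := slide_capOp ω hm k l

end

end Hecke

end

section
open Equiv Finset

/-- The commutator in a ring. -/
def comm {E : Type*} [Ring E] (a b : E) : E := a * b - b * a

section

variable {E : Type*} [Ring E] (a b c : E)

theorem comm_eq_zero {a b : E} : comm a b = 0 ↔ Commute a b := sub_eq_zero

theorem neg_comm : -comm a b = comm b a := by rw [comm, comm, neg_sub]

theorem comm_self : comm a a = 0 := sub_self _

theorem comm_add_left : comm (a + b) c = comm a c + comm b c := by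
  rw [comm, comm, comm, add_mul, mul_add]; abel

theorem comm_sub_left : comm (a - b) c = comm a c - comm b c := by
  rw [comm, comm, comm, sub_mul, mul_sub]; abel

theorem comm_sub_right : comm a (b - c) = comm a b - comm a c := by
  rw [comm, comm, comm, sub_mul, mul_sub]; abel

theorem comm_sum_left {σ : Type*} (s : Finset σ) (f : σ → E) :
    comm (∑ i ∈ s, f i) c = ∑ i ∈ s, comm (f i) c := by
  simp [comm, sum_mul, mul_sum]

theorem comm_sum_right {σ : Type*} (s : Finset σ) (f : σ → E) :
    comm c (∑ i ∈ s, f i) = ∑ i ∈ s, comm c (f i) := by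
  simp [comm, sum_mul, mul_sum]

end

namespace CapSystem

variable {ι E : Type} [Fintype ι] [LinearOrder ι] [Ring E] (S : CapSystem ι E)

/-- The system with the two sides exchanged. -/
def symm : CapSystem ι E where
  lg := S.rg
  rg := S.lg
  lx := S.rx
  rx := S.lx
  ly := S.ry
  ry := S.ly
  cap k l := S.cap l k
  ly_def := S.ry_def
  ry_def := S.ly_def
  lg_rg v w := (S.lg_rg w v).symm
  lg_ry v k := (S.ly_rg k v).symm
  ly_rg k v := (S.lg_ry v k).symm
  ly_ry k l := (S.ly_ry l k).symm
  ly_ly := S.ry_ry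
  ry_ry := S.ly_ly
  lg_ly := S.rg_ry
  rg_ry := S.lg_ly
  lg_ly_far := S.rg_ry_far
  rg_ry_far := S.lg_ly_far
  lg_cap v k l := S.rg_cap v l k
  rg_cap v k l := S.lg_cap v l k
  cap_lx k l k' h := S.cap_rx l k k' h
  cap_rx k l l' h := S.cap_lx l k l' h
  cap_cap_left k k' l h := S.cap_cap_right l k k' h
  cap_cap_right k l l' h := S.cap_cap_left l l' k h
  cap_cap_comm k l k' l' h h' := S.cap_cap_comm l k l' k' h' h
  cap_slide k l := (S.cap_slide l k).symm
  slide_cap k l := (S.slide_cap l k).symm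

/-- The dot on the strand `k` on the left, corrected by caps with the strands in `T`. -/
def dotL (k : ι) (T : Finset ι) : E := S.ly k - ∑ l ∈ T, S.cap k l

/-- The dot on the strand `l` on the right, corrected by caps with the strands in `K`. -/
def dotR (l : ι) (K : Finset ι) : E := S.ry l - ∑ k ∈ K, S.cap k l

theorem cap_comm_lg {v : Perm ι} {k : ι} (hv : v k = k) (l : ι) : Commute (S.cap k l) (S.lg v) := by
  have := S.lg_cap v k l
  rw [hv] at this
  exact this.symm

theorem cap_comm_ly {k k' : ι} (h : k' < k) (l : ι) : Commute (S.cap k l) (S.ly k') := by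
  rw [S.ly_def]
  refine Commute.add_right (S.cap_lx k l k' h.ne) (Commute.sum_right _ _ _ fun j hj => ?_)
  exact S.cap_comm_lg
    (swap_apply_of_ne_of_ne ((mem_filter.1 hj).2.trans h).ne' h.ne') l

theorem comm_ly_cap {k k' : ι} (h : k < k') (l : ι) :
    comm (S.ly k') (S.cap k l) = comm (S.cap k' l) (S.cap k l) := by
  rw [S.ly_def, comm_add_left, comm_sum_left, sum_eq_single k]
  · have h1 : comm (S.lx k') (S.cap k l) = 0 := by
      rw [comm_eq_zero]
      exact (S.cap_lx k l k' h.ne').symm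
    rw [h1, zero_add, comm, comm, S.lg_cap, swap_apply_left,
      ← S.cap_cap_left _ _ _ h.ne, swap_comm, ← S.cap_cap_left _ _ _ h.ne']
  · intro j hj hjk
    rw [comm_eq_zero]
    exact (S.cap_comm_lg (swap_apply_of_ne_of_ne hjk.symm h.ne) l).symm
  · intro hk
    simp [h] at hk

theorem cap_comm_dotL_of_gt {k k' l : ι} {T : Finset ι} (h : k' < k) (hl : l ∉ T) :
    Commute (S.cap k l) (S.dotL k' T) := by
  refine (S.cap_comm_ly h l).sub_right (Commute.sum_right _ _ _ fun l' hl' => ?_)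
  exact S.cap_cap_comm _ _ _ _ h.ne' fun e => hl (e ▸ hl')

theorem cap_comm_dotL_of_lt {k k' l : ι} {T : Finset ι} (h : k < k') (hl : l ∈ T) :
    Commute (S.cap k l) (S.dotL k' T) := by
  refine Commute.symm ?_
  rw [← comm_eq_zero, dotL, comm_sub_left, S.comm_ly_cap h, comm_sum_left, sum_eq_single l]
  · rw [sub_self]
  · intro l' _ hl'
    rw [comm_eq_zero]
    exact S.cap_cap_comm _ _ _ _ h.ne' hl'
  · exact fun h' => absurd hl h'

theorem cap_comm_dotR_of_gt {k l l' : ι} {K : Finset ι} (h : l' < l) (hk : k ∉ K) :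
    Commute (S.cap k l) (S.dotR l' K) := S.symm.cap_comm_dotL_of_gt h hk

theorem cap_comm_dotR_of_lt {k l l' : ι} {K : Finset ι} (h : l < l') (hk : k ∈ K) :
    Commute (S.cap k l) (S.dotR l' K) := S.symm.cap_comm_dotL_of_lt h hk

theorem dotL_comm_dotL {k k' : ι} {T T' : Finset ι} (h : k < k') (hT : T ⊆ T') :
    Commute (S.dotL k T) (S.dotL k' T') := by
  have h1 : Commute (S.ly k) (S.dotL k' T') :=
    Commute.sub_right (S.ly_ly k k') (Commute.sum_right _ _ _ fun l _ => (S.cap_comm_ly h l).symm)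
  exact h1.sub_left (Commute.sum_left _ _ _ fun l hl => S.cap_comm_dotL_of_lt h (hT hl))

theorem dotR_comm_dotR {l l' : ι} {K K' : Finset ι} (h : l < l') (hK : K ⊆ K') :
    Commute (S.dotR l K) (S.dotR l' K') := S.symm.dotL_comm_dotL h hK

theorem dotL_comm_dotR_of_lt {k l : ι} {T K : Finset ι} (hT : ∀ l' ∈ T, l < l')
    (hK : ∀ k' ∈ K, k < k') : Commute (S.dotL k T) (S.dotR l K) := by
  refine Commute.sub_left (Commute.sub_right (S.ly_ry k l) ?_) ?_
  · exact Commute.sum_right _ _ _ fun k' hk' => (S.cap_comm_ly (hK k' hk') l).symm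
  · refine Commute.sum_left _ _ _ fun l' hl' => Commute.sub_right ?_ ?_
    · exact S.symm.cap_comm_ly (hT l' hl') k
    · exact Commute.sum_right _ _ _ fun k' hk' =>
        S.cap_cap_comm _ _ _ _ (hK k' hk').ne (hT l' hl').ne'

theorem cap_mul_ly (k l : ι) : S.cap k l * S.ly k =
    S.cap k l * (S.lx k + ∑ j ∈ univ.filter (· ≠ k), S.lg (swap k j)) -
      ∑ j ∈ univ.filter (k < ·), S.cap k l * S.cap j l := by
  have h1 : univ.filter (· ≠ k) = univ.filter (· < k) ∪ univ.filter (k < ·) := by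
    ext j; simp
  have h2 : Disjoint (univ.filter (· < k)) (univ.filter (k < ·)) := by
    rw [disjoint_left]
    intro j h1 h2
    exact absurd (mem_filter.1 h1).2 (mem_filter.1 h2).2.asymm
  rw [h1, sum_union h2, S.ly_def]
  have h3 : ∀ j ∈ univ.filter (k < ·), S.cap k l * S.cap j l = S.cap k l * S.lg (swap k j) :=
    fun j hj => S.cap_cap_left _ _ _ (mem_filter.1 hj).2.ne
  rw [sum_congr rfl h3, ← mul_sum, ← mul_sub]
  simp only [swap_comm k, ← add_assoc, add_sub_cancel_right]

theorem ly_mul_cap (k l : ι) : S.ly k * S.cap k l =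
    (S.lx k + ∑ j ∈ univ.filter (· ≠ k), S.lg (swap k j)) * S.cap k l -
      ∑ j ∈ univ.filter (k < ·), S.cap j l * S.cap k l := by
  have h1 : univ.filter (· ≠ k) = univ.filter (· < k) ∪ univ.filter (k < ·) := by
    ext j; simp
  have h2 : Disjoint (univ.filter (· < k)) (univ.filter (k < ·)) := by
    rw [disjoint_left]
    intro j h1 h2
    exact absurd (mem_filter.1 h1).2 (mem_filter.1 h2).2.asymm
  rw [h1, sum_union h2, S.ly_def]
  have h3 : ∀ j ∈ univ.filter (k < ·), S.cap j l * S.cap k l = S.lg (swap k j) * S.cap k l := by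
    intro j hj
    rw [S.lg_cap, swap_apply_left, swap_comm]
    exact S.cap_cap_left _ _ _ (mem_filter.1 hj).2.ne'
  rw [sum_congr rfl h3, ← sum_mul, ← sub_mul]
  simp only [swap_comm k, ← add_assoc, add_sub_cancel_right]

theorem cap_mul_dot (k l : ι) : S.cap k l * S.dotL k (univ.filter (l < ·)) =
    S.cap k l * S.dotR l (univ.filter (k < ·)) := by
  have h1 := S.cap_mul_ly k l
  have h2 := S.symm.cap_mul_ly l k
  have h3 := S.cap_slide k l
  change S.cap k l * S.ry l = S.cap k l * (S.rx l + ∑ j ∈ univ.filter (· ≠ l),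
    S.rg (swap l j)) - ∑ j ∈ univ.filter (l < ·), S.cap k l * S.cap k j at h2
  rw [dotL, dotR, mul_sub, mul_sub, h1, h2, h3, mul_sum, mul_sum]
  abel

theorem dot_mul_cap (k l : ι) : S.dotL k (univ.filter (l < ·)) * S.cap k l =
    S.dotR l (univ.filter (k < ·)) * S.cap k l := by
  have h1 := S.ly_mul_cap k l
  have h2 := S.symm.ly_mul_cap l k
  have h3 := S.slide_cap k l
  change S.ry l * S.cap k l = (S.rx l + ∑ j ∈ univ.filter (· ≠ l),
    S.rg (swap l j)) * S.cap k l - ∑ j ∈ univ.filter (l < ·), S.cap k j * S.cap k l at h2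
  rw [dotL, dotR, sub_mul, sub_mul, h1, h2, h3, sum_mul, sum_mul]
  abel

theorem filter_le_eq (l : ι) : univ.filter (l ≤ ·) = insert l (univ.filter (l < ·)) := by
  ext i
  simp [le_iff_eq_or_lt, eq_comm]

theorem dotL_le (k l : ι) : S.dotL k (univ.filter (l ≤ ·)) =
    S.dotL k (univ.filter (l < ·)) - S.cap k l := by
  rw [dotL, dotL, filter_le_eq, sum_insert (by simp)]
  abel

theorem dotR_le (l k : ι) : S.dotR l (univ.filter (k ≤ ·)) =
    S.dotR l (univ.filter (k < ·)) - S.cap k l := S.symm.dotL_le l k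

theorem cap_mul_dot' (k l : ι) : S.cap k l * S.dotL k (univ.filter (l ≤ ·)) =
    S.cap k l * S.dotR l (univ.filter (k ≤ ·)) := by
  rw [dotL_le, dotR_le, mul_sub, mul_sub, cap_mul_dot]

theorem dot_mul_cap' (k l : ι) : S.dotL k (univ.filter (l ≤ ·)) * S.cap k l =
    S.dotR l (univ.filter (k ≤ ·)) * S.cap k l := by
  rw [dotL_le, dotR_le, sub_mul, sub_mul, dot_mul_cap]

theorem dotL_comm_dotR_of_mem {k l : ι} {T K : Finset ι} (hl : l ∈ T) (hk : k ∈ K)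
    (hT : ∀ l', l < l' → l' ∈ T) (hK : ∀ k', k < k' → k' ∈ K) :
    Commute (S.dotL k T) (S.dotR l K) := by
  have c1 : comm (S.dotL k T) (S.ry l) = - ∑ l' ∈ T, comm (S.cap k l') (S.ry l) := by
    rw [dotL, comm_sub_left, comm_sum_left, comm_eq_zero.2 (S.ly_ry k l), zero_sub]
  have c2 : ∑ l' ∈ T, comm (S.cap k l') (S.ry l) =
      comm (S.cap k l) (S.ry l) + ∑ l' ∈ T.filter (· < l), comm (S.cap k l') (S.cap k l) := by
    rw [← add_sum_erase _ _ hl, ← sum_filter_add_sum_filter_not (T.erase l) (· < l)]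
    have e1 : (T.erase l).filter (· < l) = T.filter (· < l) := by
      ext i
      simp only [mem_filter, mem_erase]
      exact ⟨fun h => ⟨h.1.2, h.2⟩, fun h => ⟨⟨h.2.ne, h.1⟩, h.2⟩⟩
    have e2 : ∑ l' ∈ (T.erase l).filter (fun i => ¬ i < l), comm (S.cap k l') (S.ry l) = 0 := by
      refine sum_eq_zero fun l' hl' => ?_
      simp only [mem_filter, mem_erase] at hl'
      rw [comm_eq_zero]
      exact S.symm.cap_comm_ly (lt_of_le_of_ne (not_lt.1 hl'.2) hl'.1.1.symm) k
    rw [e1, e2, add_zero]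
    congr 1
    refine sum_congr rfl fun l' hl' => ?_
    have h3 := S.symm.comm_ly_cap (mem_filter.1 hl').2 k
    change comm (S.ry l) (S.cap k l') = comm (S.cap k l) (S.cap k l') at h3
    rw [← neg_comm, h3, neg_comm]
  have c3 : comm (S.dotL k T) (∑ k' ∈ K, S.cap k' l) =
      comm (S.dotL k T) (S.cap k l) - ∑ k' ∈ univ.filter (k < ·), comm (S.cap k l) (S.cap k' l) := by
    rw [comm_sum_right, ← add_sum_erase _ _ hk, ← sum_filter_add_sum_filter_not (K.erase k) (k < ·)]
    have e1 : (K.erase k).filter (k < ·) = univ.filter (k < ·) := by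
      ext i
      simp only [mem_filter, mem_erase, mem_univ, true_and]
      exact ⟨fun h => h.2, fun h => ⟨⟨h.ne', hK i h⟩, h⟩⟩
    have e2 : ∑ k' ∈ (K.erase k).filter (fun i => ¬ k < i), comm (S.dotL k T) (S.cap k' l) = 0 := by
      refine sum_eq_zero fun k' hk' => ?_
      simp only [mem_filter, mem_erase] at hk'
      rw [comm_eq_zero]
      exact (S.cap_comm_dotL_of_lt (lt_of_le_of_ne (not_lt.1 hk'.2) hk'.1.1) hl).symm
    rw [e1, e2, add_zero, sub_eq_add_neg, ← sum_neg_distrib]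
    congr 1
    refine sum_congr rfl fun k' hk' => ?_
    have hkk := (mem_filter.1 hk').2
    rw [dotL, comm_sub_left, comm_eq_zero.2 (S.cap_comm_ly hkk l).symm, zero_sub, comm_sum_left,
      sum_eq_single l]
    · intro l' _ hl'
      rw [comm_eq_zero]
      exact S.cap_cap_comm _ _ _ _ hkk.ne hl'
    · exact fun h' => absurd hl h'
  have c4 : comm (S.dotL k T) (S.cap k l) = comm (S.ly k) (S.cap k l) -
      (∑ l' ∈ T.filter (· < l), comm (S.cap k l') (S.cap k l) +
        ∑ l' ∈ univ.filter (l < ·), comm (S.cap k l') (S.cap k l)) := by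
    rw [dotL, comm_sub_left, comm_sum_left, ← add_sum_erase _ _ hl, comm_self, zero_add,
      ← sum_filter_add_sum_filter_not (T.erase l) (· < l)]
    congr 3
    · ext i
      simp only [mem_filter, mem_erase]
      exact ⟨fun h => ⟨h.1.2, h.2⟩, fun h => ⟨⟨h.2.ne, h.1⟩, h.2⟩⟩
    · ext i
      simp only [mem_filter, mem_erase, mem_univ, true_and]
      exact ⟨fun h => lt_of_le_of_ne (not_lt.1 h.2) h.1.1.symm, fun h => ⟨⟨h.ne', hT i h⟩, h.asymm⟩⟩
  have c5 : comm (S.dotL k (univ.filter (l < ·))) (S.cap k l) =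
      comm (S.dotR l (univ.filter (k < ·))) (S.cap k l) := by
    rw [comm, comm, S.cap_mul_dot, S.dot_mul_cap]
  have c6 : ∑ k' ∈ univ.filter (k < ·), comm (S.cap k l) (S.cap k' l) =
      - ∑ k' ∈ univ.filter (k < ·), comm (S.cap k' l) (S.cap k l) := by
    rw [← sum_neg_distrib]
    exact sum_congr rfl fun k' _ => neg_comm _ _ |>.symm
  rw [dotL, dotR, comm_sub_left, comm_sub_left, comm_sum_left, comm_sum_left] at c5
  rw [← comm_eq_zero]
  change comm (S.dotL k T) (S.ry l - ∑ k' ∈ K, S.cap k' l) = 0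
  rw [comm_sub_right, c1, c2, c3, c4, c6, ← neg_comm (S.ry l) (S.cap k l)]
  rw [sub_eq_sub_iff_add_eq_add] at c5
  have c7 : comm (S.ly k) (S.cap k l) = comm (S.ry l) (S.cap k l) +
    ∑ l' ∈ univ.filter (l < ·), comm (S.cap k l') (S.cap k l) -
    ∑ k' ∈ univ.filter (k < ·), comm (S.cap k' l) (S.cap k l) := by rw [← c5]; abel
  rw [c7]
  abel

theorem lg_mul_dotL {a b : ι} (hab : a ⋖ b) (T : Finset ι) :
    S.lg (swap a b) * S.dotL a T = S.dotL b T * S.lg (swap a b) - 1 := by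
  have h1 : ∀ l, S.lg (swap a b) * S.cap a l = S.cap b l * S.lg (swap a b) := by
    intro l; rw [S.lg_cap, swap_apply_left]
  rw [dotL, dotL, mul_sub, sub_mul, S.lg_ly a b hab, mul_sum, sum_mul]
  simp only [h1]
  abel

theorem lg_comm_dotL {a b k : ι} (hab : a ⋖ b) (ha : k ≠ a) (hb : k ≠ b) (T : Finset ι) :
    Commute (S.lg (swap a b)) (S.dotL k T) := by
  refine Commute.sub_right (S.lg_ly_far a b k hab ha hb) (Commute.sum_right _ _ _ fun l _ => ?_)
  exact (S.cap_comm_lg (swap_apply_of_ne_of_ne ha hb) l).symm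

theorem lg_comm_dotR {v : Perm ι} {K : Finset ι} (hK : ∀ k, v k ∈ K ↔ k ∈ K) (l : ι) :
    Commute (S.lg v) (S.dotR l K) := by
  refine Commute.sub_right (S.lg_ry v l) ?_
  change _ * _ = _ * _
  rw [mul_sum, sum_mul]
  refine sum_equiv v (fun k => (hK k).symm) fun k _ => ?_
  rw [S.lg_cap]

theorem rg_mul_dotR {a b : ι} (hab : a ⋖ b) (K : Finset ι) :
    S.rg (swap a b) * S.dotR a K = S.dotR b K * S.rg (swap a b) - 1 :=
  S.symm.lg_mul_dotL hab K

theorem rg_comm_dotR {a b l : ι} (hab : a ⋖ b) (ha : l ≠ a) (hb : l ≠ b) (K : Finset ι) :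
    Commute (S.rg (swap a b)) (S.dotR l K) := S.symm.lg_comm_dotL hab ha hb K

theorem rg_comm_dotL {v : Perm ι} {T : Finset ι} (hT : ∀ l, v l ∈ T ↔ l ∈ T) (k : ι) :
    Commute (S.rg v) (S.dotL k T) := S.symm.lg_comm_dotR hT k

end CapSystem

end

section
open Equiv Finset MvPolynomial

namespace Hecke

open AffineHecke (coeff coeff_apply)

theorem X_mul_monomial' {ι : Type*} (k : ι) (a : ι →₀ ℕ) :
    (X k * monomial a 1 : MvPolynomial ι ℂ) = monomial (Finsupp.single k 1 + a) 1 := by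
  rw [X, monomial_mul, one_mul]

section

variable {ι A : Type} [Fintype ι] [LinearOrder ι] [Ring A] [Algebra ℂ A] [AffineHecke ι A]

variable (A) in
/-- The elements of the Hecke algebra of degree less than `n`. -/
def degLT (ι : Type) {A : Type} [Fintype ι] [LinearOrder ι] [Ring A] [Algebra ℂ A]
    [AffineHecke ι A] (n : ℕ) : Submodule ℂ A :=
  Submodule.span ℂ {h | ∃ (w : Perm ι) (a : ι →₀ ℕ), a.degree < n ∧
    h = g A w * pol A (monomial a 1)}

theorem mem_degLT_of {n : ℕ} (w : Perm ι) {a : ι →₀ ℕ} (ha : a.degree < n) :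
    g A w * pol A (monomial a 1) ∈ degLT ι (A := A) n := Submodule.subset_span ⟨w, a, ha, rfl⟩

theorem degLT_mono {n n' : ℕ} (h : n ≤ n') : degLT ι (A := A) n ≤ degLT ι n' :=
  Submodule.span_mono fun _ ⟨w, a, ha, e⟩ => ⟨w, a, ha.trans_le h, e⟩

theorem map_degLT {V : Type*} [AddCommGroup V] [Module ℂ V] (φ : A →ₗ[ℂ] V) {n : ℕ}
    {S : Submodule ℂ V} (h : ∀ (w : Perm ι) (a : ι →₀ ℕ), a.degree < n →
      φ (g A w * pol A (monomial a 1)) ∈ S) {b : A} (hb : b ∈ degLT ι n) : φ b ∈ S := by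
  have : degLT ι n ≤ S.comap φ := Submodule.span_le.2 (by rintro _ ⟨w, a, ha, rfl⟩; exact h w a ha)
  exact this hb

theorem mem_degLT_iff {n : ℕ} {h : A} : h ∈ degLT ι n ↔
    ∀ (w : Perm ι) (a : ι →₀ ℕ), n ≤ a.degree → MvPolynomial.coeff a (coeff h w) = 0 := by
  constructor
  · intro hh w a ha
    let φ : A →ₗ[ℂ] ℂ := MvPolynomial.lcoeff ℂ a ∘ₗ LinearMap.proj w ∘ₗ coeff
    have h1 : φ h ∈ (⊥ : Submodule ℂ ℂ) := by
      refine map_degLT (ι := ι) φ (n := n) (fun v b hb => ?_) hh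
      rw [Submodule.mem_bot]
      change MvPolynomial.coeff a (coeff (g A v * pol A (monomial b 1)) w) = 0
      rw [coeff_apply]
      by_cases hvw : v = w
      · subst hvw
        rw [Pi.single_eq_same, coeff_monomial, if_neg]
        rintro rfl
        omega
      · rw [Pi.single_eq_of_ne (Ne.symm hvw), MvPolynomial.coeff_zero]
    exact (Submodule.mem_bot ℂ).1 h1
  · intro hh
    rw [← nf (ι := ι) h]
    refine sum_mem fun w _ => ?_
    rw [(coeff h w).as_sum, map_sum, mul_sum]
    refine sum_mem fun a ha => ?_
    have e : monomial a (MvPolynomial.coeff a (coeff h w)) =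
        MvPolynomial.coeff a (coeff h w) • (monomial a 1 : MvPolynomial ι ℂ) := by
      simp [smul_monomial]
    rw [e, map_smul, mul_smul_comm]
    refine Submodule.smul_mem _ _ (mem_degLT_of w ?_)
    by_contra hc
    exact (MvPolynomial.mem_support_iff.1 ha) (hh w a (not_lt.1 hc))

theorem g_mem_degLT (w : Perm ι) {n : ℕ} (hn : 0 < n) : g A w ∈ degLT ι (A := A) n := by
  simpa using mem_degLT_of (A := A) (n := n) w (a := 0) (by simpa using hn)

theorem g_mul_degLT (v : Perm ι) {n : ℕ} {h : A} (hh : h ∈ degLT ι n) : g A v * h ∈ degLT ι n :=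
  map_degLT (LinearMap.mulLeft ℂ (g A v)) (fun w a ha => by
    rw [LinearMap.mulLeft_apply, ← mul_assoc, ← map_mul]
    exact mem_degLT_of _ ha) hh

theorem degLT_mul_y (k : ι) {n : ℕ} {h : A} (hh : h ∈ degLT ι n) : h * y A k ∈ degLT ι (n + 1) :=
  map_degLT (LinearMap.mulRight ℂ (y A k)) (fun w a ha => by
    rw [LinearMap.mulRight_apply, mul_assoc, ← y_mul_pol, ← pol_X, ← map_mul, X, monomial_mul, one_mul]
    refine mem_degLT_of _ ?_
    rw [map_add, Finsupp.degree_single]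
    omega) hh

variable (A) in
/-- The leading part of left multiplication by `y_k`. -/
def leadL (k : ι) : Module.End ℂ A :=
  lift A fun w => (LinearMap.mulLeft ℂ (g A w)) ∘ₗ (pol A : MvPolynomial ι ℂ →ₐ[ℂ] A).toLinearMap ∘ₗ
    LinearMap.mulLeft ℂ (X (w⁻¹ k))

variable (A) in
/-- The leading part of right multiplication by `y_k`. -/
def leadR (k : ι) : Module.End ℂ A := LinearMap.mulRight ℂ (y A k)

theorem leadL_apply (k : ι) (w : Perm ι) (f : MvPolynomial ι ℂ) :
    leadL A k (g A w * pol A f) = g A w * pol A (X (w⁻¹ k) * f) := by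
  rw [leadL, lift_apply]; rfl

theorem leadR_apply (k : ι) (w : Perm ι) (f : MvPolynomial ι ℂ) :
    leadR A k (g A w * pol A f) = g A w * pol A (X k * f) := by
  rw [leadR, LinearMap.mulRight_apply, mul_assoc, ← y_mul_pol, ← pol_X, ← map_mul]

theorem coeff_leadL (k : ι) (h : A) (w : Perm ι) :
    coeff (leadL A k h) w = X (w⁻¹ k) * coeff h w := by
  conv_lhs => rw [← nf (ι := ι) h]
  simp only [map_sum, leadL_apply, coeff_apply]
  simp [Finset.sum_apply, Pi.single_apply]

theorem coeff_leadR (k : ι) (h : A) (w : Perm ι) : coeff (leadR A k h) w = X k * coeff h w := by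
  conv_lhs => rw [← nf (ι := ι) h]
  simp only [map_sum, leadR_apply, coeff_apply]
  simp [Finset.sum_apply, Pi.single_apply]

theorem leadL_mem (k : ι) {n : ℕ} {h : A} (hh : h ∈ degLT ι n) : leadL A k h ∈ degLT ι (n + 1) :=
  map_degLT (leadL A k) (fun w a ha => by
    rw [leadL_apply, X_mul_monomial']
    refine mem_degLT_of _ ?_
    rw [map_add, Finsupp.degree_single]
    omega) hh

theorem leadR_mem (k : ι) {n : ℕ} {h : A} (hh : h ∈ degLT ι n) : leadR A k h ∈ degLT ι (n + 1) :=
  degLT_mul_y k hh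

theorem y_mul_sub_leadL (k : ι) {n : ℕ} {h : A} (hh : h ∈ degLT ι n) :
    y A k * h - leadL A k h ∈ degLT ι n :=
  map_degLT (LinearMap.mulLeft ℂ (y A k) - leadL A k) (fun w a ha => by
    have e : y A k * g A w = g A w * y A (w⁻¹ k) + (∑ j ∈ univ.filter (· < k), g A (swap j k * w) -
          ∑ j ∈ univ.filter (· < w⁻¹ k), g A (w * swap j (w⁻¹ k))) := by
      rw [y, y, add_mul, x_mul_g, mul_add, sum_mul, mul_sum]
      simp only [map_mul]
      abel
    rw [LinearMap.sub_apply, LinearMap.mulLeft_apply, leadL_apply, ← mul_assoc, e, add_mul,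
      mul_assoc (g A w), ← pol_X, ← map_mul, add_sub_cancel_left, sub_mul, sum_mul, sum_mul]
    exact sub_mem (sum_mem fun j _ => mem_degLT_of _ ha)
      (sum_mem fun j _ => mem_degLT_of _ ha)) hh

theorem y_mul_degLT (k : ι) {n : ℕ} {h : A} (hh : h ∈ degLT ι n) : y A k * h ∈ degLT ι (n + 1) := by
  have := add_mem (degLT_mono n.le_succ (y_mul_sub_leadL k hh)) (leadL_mem k hh)
  rwa [sub_add_cancel] at this

theorem x_mul_degLT (k : ι) {n : ℕ} {h : A} (hh : h ∈ degLT ι n) : x A k * h ∈ degLT ι (n + 1) := by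
  rw [x_eq_y_sub, sub_mul, sum_mul]
  exact sub_mem (y_mul_degLT k hh)
    (sum_mem fun j _ => degLT_mono n.le_succ (g_mul_degLT _ hh))

theorem pol_monomial_mul_degLT (a : ι →₀ ℕ) {n : ℕ} {h : A} (hh : h ∈ degLT ι n) :
    pol A (monomial a 1) * h ∈ degLT ι (a.degree + n) := by
  obtain ⟨N, hN⟩ : ∃ N, a.degree = N := ⟨_, rfl⟩
  induction N generalizing a with
  | zero =>
    rw [(Finsupp.degree_eq_zero_iff a).1 hN]
    simpa using hh
  | succ N ih =>
    obtain ⟨i, hi⟩ : ∃ i, a i ≠ 0 := by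
      by_contra! hc
      rw [show a = 0 from Finsupp.ext hc, map_zero] at hN
      omega
    obtain ⟨b, rfl⟩ : ∃ b, a = Finsupp.single i 1 + b :=
      exists_add_of_le (Finsupp.single_le_iff.2 (Nat.one_le_iff_ne_zero.2 hi))
    rw [map_add Finsupp.degree, Finsupp.degree_single] at hN
    have h1 := y_mul_degLT i (ih b (by omega))
    rw [← mul_assoc, ← pol_X, ← map_mul (pol A), X_mul_monomial'] at h1
    rw [map_add Finsupp.degree, Finsupp.degree_single]
    exact degLT_mono (by omega) h1

theorem degLT_mul_g (v : Perm ι) {n : ℕ} {h : A} (hh : h ∈ degLT ι n) : h * g A v ∈ degLT ι n := by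
  refine map_degLT (LinearMap.mulRight ℂ (g A v)) (fun w a ha => ?_) hh
  have h1 := pol_monomial_mul_degLT a (g_mem_degLT (A := A) (n := 1) v one_pos)
  have h2 := degLT_mono (Nat.succ_le_of_lt ha) h1
  have h3 := g_mul_degLT w h2
  rwa [← mul_assoc] at h3

theorem degLT_mul_pol_monomial (a : ι →₀ ℕ) {n : ℕ} {h : A} (hh : h ∈ degLT ι n) :
    h * pol A (monomial a 1) ∈ degLT ι (n + a.degree) :=
  map_degLT (LinearMap.mulRight ℂ (pol A (monomial a 1))) (fun w b hb => by
    rw [LinearMap.mulRight_apply, mul_assoc, ← map_mul, monomial_mul, one_mul]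
    refine mem_degLT_of _ ?_
    rw [map_add]
    omega) hh

theorem g_mul_pol_mem (w : Perm ι) {f : MvPolynomial ι ℂ} {n : ℕ} (hf : f.totalDegree < n) :
    g A w * pol A f ∈ degLT ι (A := A) n := by
  rw [mem_degLT_iff]
  intro v a ha
  rw [coeff_apply]
  by_cases hv : v = w
  · subst hv
    rw [Pi.single_eq_same]
    exact coeff_eq_zero_of_totalDegree_lt (by rw [← Finsupp.degree_apply]; omega)
  · rw [Pi.single_eq_of_ne hv, MvPolynomial.coeff_zero]

variable (ω : ℕ → ℂ) {m : ι}

theorem outerBubble_mem_degLT (k : ℕ) : outerBubble A ω m k ∈ degLT ι (A := A) (k + 1) := by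
  have := g_mul_pol_mem (A := A) 1 (Nat.lt_succ_of_le (totalDegree_bubble ω (univ.erase m) k))
  rwa [map_one, one_mul] at this

theorem dots_mem_degLT (j : ι) (k : ℕ) : dots A ω m j k ∈ degLT ι (A := A) (k + 1) := by
  induction k with
  | zero =>
    have := g_mem_degLT (A := A) (1 : Perm ι) one_pos
    rwa [map_one] at this
  | succ k ih =>
    rw [dots, inner, add_mul, sum_mul]
    refine add_mem (add_mem (x_mul_degLT j ih)
      (sum_mem fun i _ => degLT_mono (Nat.le_succ _) (g_mul_degLT _ ih)))
      (degLT_mono (Nat.le_succ _) (outerBubble_mem_degLT ω k))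

theorem ptrace_degLT (hm : IsTop m) {n : ℕ} {h : A} (hh : h ∈ degLT ι n) :
    ptrace A ω m h ∈ degLT ι n :=
  map_degLT (ptrace A ω m) (fun w a ha => by
    rw [monomial_eq_pow_mul_erase a m, map_mul (pol A), map_pow (pol A), pol_X,
      ptrace_apply ω hm _ _ (pol_mem_parabolic hm (monomial_mem_adjoin (by simp)))]
    have h1 : traceCoeff A ω m w (a m) ∈ degLT ι (a m + 1) := by
      rw [traceCoeff]
      split_ifs
      · exact g_mul_degLT _ (outerBubble_mem_degLT ω _)
      · exact g_mul_degLT _ (dots_mem_degLT ω _ _)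
    refine degLT_mono ?_ (degLT_mul_pol_monomial (a.erase m) h1)
    have h2 := congrArg Finsupp.degree (Finsupp.single_add_erase m a)
    rw [map_add, Finsupp.degree_single] at h2
    omega) hh

theorem capOp_degLT (hm : IsTop m) (k l : ι) {n : ℕ} {h : A} (hh : h ∈ degLT ι n) :
    capOp A ω m k l h ∈ degLT ι n := by
  rw [capOp_apply]
  exact degLT_mul_g _ (g_mul_degLT _ (ptrace_degLT ω hm (degLT_mul_g _ (g_mul_degLT _ hh))))

theorem dotL_sub_leadL (hm : IsTop m) (k : ι) (T : Finset ι) {n : ℕ} {h : A}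
    (hh : h ∈ degLT ι n) : (capSystem (A := A) ω hm).dotL k T h - leadL A k h ∈ degLT ι n := by
  have e : (capSystem (A := A) ω hm).dotL k T h = y A k * h - ∑ l ∈ T, capOp A ω m k l h := by
    rw [CapSystem.dotL, LinearMap.sub_apply, LinearMap.sum_apply]; rfl
  rw [e, sub_right_comm]
  exact sub_mem (y_mul_sub_leadL k hh)
    (sum_mem fun l _ => capOp_degLT ω hm k l hh)

theorem dotR_sub_leadR (hm : IsTop m) (l : ι) (K : Finset ι) {n : ℕ} {h : A}
    (hh : h ∈ degLT ι n) : (capSystem (A := A) ω hm).dotR l K h - leadR A l h ∈ degLT ι n := by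
  have e : (capSystem (A := A) ω hm).dotR l K h = leadR A l h - ∑ k ∈ K, capOp A ω m k l h := by
    rw [CapSystem.dotR, LinearMap.sub_apply, LinearMap.sum_apply]; rfl
  rw [e, sub_right_comm, sub_self, zero_sub]
  exact neg_mem (sum_mem fun k _ => capOp_degLT ω hm k l hh)

theorem capOp_g (hm : IsTop m) {k l : ι} {w : Perm ι} (hw : w l ≠ k) :
    capOp A ω m k l (g A w) = g A (swap k (w l) * w) := by
  rw [capOp_apply, ← map_mul, ← map_mul]
  set u := swap k m * w * swap l m with hu
  have hum : u m = swap k m (w l) := by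
    rw [hu, Perm.mul_apply, swap_apply_right, Perm.mul_apply]
  have hne : u m ≠ m := by
    rw [hum, ne_eq, swap_apply_eq_iff, swap_apply_right]; exact hw
  obtain ⟨j, hj⟩ := u.surjective m
  have hjm : j ≠ m := by rintro rfl; exact hne hj
  rw [ptrace_g ω hm, traceCoeff_of_ne ω hj hjm, dots, mul_one, ← map_mul, ← map_mul]
  congr 1
  have e1 : u * swap j m = swap m (u m) * u := by rw [mul_swap_eq_swap_mul, hj]
  have e2 : swap k m * swap m (u m) = swap k (w l) * swap k m := by
    rw [mul_swap_eq_swap_mul, swap_apply_right, hum,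
      ← Perm.mul_apply, swap_mul_self, Perm.one_apply]
  rw [e1, ← mul_assoc, e2, hu]
  simp only [mul_assoc, swap_mul_self, mul_one]
  rw [← mul_assoc (swap k m), swap_mul_self, one_mul]

end

end Hecke

end

variable {r t : ℕ}

local notation "Pos" => Fin (r + t)
local notation "Adj" => Fin (r + t - 1)

variable {A B C D : Seq r t} {i j : Fin (r + t - 1)}

section
open Equiv Finset MvPolynomial

namespace Seq

theorem ext (h : ∀ i, A i = B i) : A = B := Subtype.ext (funext h)

theorem smul_apply (σ : Perm Pos) (A : Seq r t) (i : Pos) : (σ • A) i = A (σ⁻¹ i) := rfl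

theorem smul_apply_apply (σ : Perm Pos) (A : Seq r t) (i : Pos) :
    (σ • A) (σ i) = A i := by rw [smul_apply]; simp

theorem swap_smul_apply (p q : Pos) (A : Seq r t) (i : Pos) :
    (swap p q • A) i = A (swap p q i) := by rw [smul_apply, swap_inv]

theorem eq_one_or (A : Seq r t) (i : Pos) : A i = 1 ∨ A i = -1 := by
  obtain ⟨w, hw⟩ := A.2
  rw [hw, Function.comp_apply, stdSeq]
  split_ifs <;> simp

theorem ne_one_iff (A : Seq r t) (i : Pos) : A i ≠ 1 ↔ A i = -1 := by
  rcases A.eq_one_or i with h | h <;> rw [h] <;> decide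

theorem eq_of_ne_of_ne (A : Seq r t) {p q s : Pos} (h : A p ≠ A q) (h' : A q ≠ A s) :
    A p = A s := by
  rcases A.eq_one_or p with h1 | h1 <;> rcases A.eq_one_or q with h2 | h2 <;>
    rcases A.eq_one_or s with h3 | h3 <;> simp_all

/-- The number of entries `1` before the position `n`. -/
def plus (A : Seq r t) (n : ℕ) : ℕ := (univ.filter fun j => j.val < n ∧ A j = 1).card

/-- The number of entries `-1` before the position `n`. -/
def minus (A : Seq r t) (n : ℕ) : ℕ := (univ.filter fun j => j.val < n ∧ A j ≠ 1).card

theorem plus_mono (A : Seq r t) {n n' : ℕ} (h : n ≤ n') : A.plus n ≤ A.plus n' :=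
  card_le_card fun j hj => by simp at hj ⊢; exact ⟨hj.1.trans_le h, hj.2⟩

theorem minus_mono (A : Seq r t) {n n' : ℕ} (h : n ≤ n') : A.minus n ≤ A.minus n' :=
  card_le_card fun j hj => by simp at hj ⊢; exact ⟨hj.1.trans_le h, hj.2⟩

theorem plus_succ_of (A : Seq r t) {i : Pos} (h : A i = 1) :
    A.plus (i.val + 1) = A.plus i.val + 1 := by
  have : (univ.filter fun j => j.val < i.val + 1 ∧ A j = 1) =
      insert i (univ.filter fun j => j.val < i.val ∧ A j = 1) := by
    ext j
    simp only [mem_filter_univ, mem_insert, Fin.ext_iff]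
    constructor
    · rintro ⟨h1, h2⟩; by_cases h3 : j.val = i.val
      · exact Or.inl h3
      · exact Or.inr ⟨by omega, h2⟩
    · rintro (h1 | ⟨h1, h2⟩)
      · rw [Fin.ext h1]; exact ⟨by omega, h⟩
      · exact ⟨by omega, h2⟩
  rw [plus, this, card_insert_of_notMem (by simp)]
  rfl

theorem minus_succ_of (A : Seq r t) {i : Pos} (h : A i ≠ 1) :
    A.minus (i.val + 1) = A.minus i.val + 1 := by
  have : (univ.filter fun j => j.val < i.val + 1 ∧ A j ≠ 1) =
      insert i (univ.filter fun j => j.val < i.val ∧ A j ≠ 1) := by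
    ext j
    simp only [mem_filter_univ, mem_insert, Fin.ext_iff]
    constructor
    · rintro ⟨h1, h2⟩; by_cases h3 : j.val = i.val
      · exact Or.inl h3
      · exact Or.inr ⟨by omega, h2⟩
    · rintro (h1 | ⟨h1, h2⟩)
      · rw [Fin.ext h1]; exact ⟨by omega, h⟩
      · exact ⟨by omega, h2⟩
  rw [minus, this, card_insert_of_notMem (by simp)]
  rfl

theorem plus_add_minus (A : Seq r t) {n : ℕ} (hn : n ≤ r + t) : A.plus n + A.minus n = n := by
  have e1 : univ.filter (fun j : Pos => j.val < n ∧ A j = 1) =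
    (univ.filter fun j : Pos => j.val < n).filter fun j => A j = 1 := by
    rw [filter_filter]
  have e2 : univ.filter (fun j : Pos => j.val < n ∧ A j ≠ 1) =
    (univ.filter fun j : Pos => j.val < n).filter fun j => ¬ A j = 1 := by
    rw [filter_filter]
  rw [plus, minus, e1, e2, card_filter_add_card_filter_not, Fin.card_filter_val_lt]
  omega

theorem plus_total (A : Seq r t) : A.plus (r + t) = r := by
  obtain ⟨w, hw⟩ := A.2
  have : A.plus (r + t) = (univ.filter fun j : Pos => j.val < r).card := by
    refine card_equiv w fun j => ?_
    simp only [mem_filter_univ, j.isLt]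
    rw [hw, Function.comp_apply, stdSeq]
    split_ifs with h <;> simp [h]
  rw [this, Fin.card_filter_val_lt]
  omega

theorem plus_smul (A : Seq r t) {σ : Perm Pos} {n : ℕ}
    (hσ : ∀ j, (σ j).val < n ↔ j.val < n) : (σ • A).plus n = A.plus n := by
  refine (card_equiv σ fun j => ?_).symm
  simp only [mem_filter_univ, hσ, smul_apply_apply]

theorem minus_smul (A : Seq r t) {σ : Perm Pos} {n : ℕ}
    (hσ : ∀ j, (σ j).val < n ↔ j.val < n) : (σ • A).minus n = A.minus n := by
  refine (card_equiv σ fun j => ?_).symm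
  simp only [mem_filter_univ, hσ, smul_apply_apply]

theorem plus_lt (A : Seq r t) {i j : Pos} (h : i < j) (hi : A i = 1) : A.plus i < A.plus j := by
  have h1 := A.plus_succ_of hi
  have h2 := A.plus_mono (Nat.succ_le_of_lt h)
  simp only [Nat.succ_eq_add_one] at h2
  omega

theorem minus_lt (A : Seq r t) {i j : Pos} (h : i < j) (hi : A i ≠ 1) : A.minus i < A.minus j := by
  have h1 := A.minus_succ_of hi
  have h2 := A.minus_mono (Nat.succ_le_of_lt h)
  simp only [Nat.succ_eq_add_one] at h2
  omega

theorem plus_lt_total (A : Seq r t) {i : Pos} (hi : A i = 1) : A.plus i < r := by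
  have h1 := A.plus_succ_of hi
  have h2 := A.plus_mono (Nat.succ_le_of_lt i.isLt)
  rw [A.plus_total, Nat.succ_eq_add_one] at h2
  omega

theorem minus_total (A : Seq r t) : A.minus (r + t) = t := by
  have := A.plus_add_minus le_rfl
  rw [A.plus_total] at this
  omega

theorem minus_lt_total (A : Seq r t) {i : Pos} (hi : A i ≠ 1) : A.minus i < t := by
  have h1 := A.minus_succ_of hi
  have h2 := A.minus_mono (Nat.succ_le_of_lt i.isLt)
  rw [A.minus_total, Nat.succ_eq_add_one] at h2
  omega

theorem plus_le (A : Seq r t) (i : Pos) : A.plus i ≤ r := by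
  have := A.plus_mono i.isLt.le
  rwa [A.plus_total] at this

theorem minus_le (A : Seq r t) (i : Pos) : A.minus i ≤ t := by
  have := A.minus_mono i.isLt.le
  rwa [A.minus_total] at this

/-- The label of a position: the entries `1` are numbered `0, 1, …, r - 1` from left to right, the
entries `-1` are numbered `r, …, r + t - 1` from right to left. -/
def labelFun (A : Seq r t) (i : Pos) : Pos :=
  if h : A i = 1 then ⟨A.plus i, by have := A.plus_lt_total h; omega⟩
  else ⟨r + t - 1 - A.minus i, by have := i.isLt; omega⟩

theorem labelFun_of_eq (A : Seq r t) {i : Pos} (h : A i = 1) :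
    (A.labelFun i).val = A.plus i := by rw [labelFun, dif_pos h]

theorem labelFun_of_ne (A : Seq r t) {i : Pos} (h : A i ≠ 1) :
    (A.labelFun i).val + A.minus i + 1 = r + t := by
  rw [labelFun, dif_neg h]
  have := A.minus_lt_total h
  simp only
  omega

theorem labelFun_lt_iff (A : Seq r t) (i : Pos) : (A.labelFun i).val < r ↔ A i = 1 := by
  by_cases h : A i = 1
  · simp [A.labelFun_of_eq h, A.plus_lt_total h, h]
  · have := A.minus_lt_total h
    have := A.labelFun_of_ne h
    simp only [h, iff_false]
    omega

theorem labelFun_injective (A : Seq r t) : Function.Injective A.labelFun := by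
  intro i j hij
  have h1 : A i = 1 ↔ A j = 1 := by rw [← labelFun_lt_iff, hij, labelFun_lt_iff]
  by_contra hne
  by_cases h : A i = 1
  · have e := congrArg Fin.val hij
    rw [A.labelFun_of_eq h, A.labelFun_of_eq (h1.1 h)] at e
    rcases lt_or_gt_of_ne hne with h2 | h2
    · have := A.plus_lt h2 h; omega
    · have := A.plus_lt h2 (h1.1 h); omega
  · have e1 := A.labelFun_of_ne h
    have e2 := A.labelFun_of_ne (fun h' => h (h1.2 h'))
    rw [hij] at e1
    rcases lt_or_gt_of_ne hne with h2 | h2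
    · have := A.minus_lt h2 h; omega
    · have := A.minus_lt h2 (fun h' => h (h1.2 h')); omega

/-- The labelling of the positions as a permutation. -/
def label (A : Seq r t) : Perm Pos :=
  ofBijective A.labelFun (Finite.injective_iff_bijective.1 A.labelFun_injective)

theorem label_of_eq (A : Seq r t) {i : Pos} (h : A i = 1) :
    (A.label i).val = A.plus i := A.labelFun_of_eq h

theorem label_of_ne (A : Seq r t) {i : Pos} (h : A i ≠ 1) :
    (A.label i).val + A.minus i + 1 = r + t := A.labelFun_of_ne h

theorem label_lt_iff (A : Seq r t) (i : Pos) : (A.label i).val < r ↔ A i = 1 :=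
  A.labelFun_lt_iff i

theorem refl_lt_iff (i : Fin (r + t - 1)) {n : ℕ} (hn : n ≠ i.val + 1) (j : Pos) :
    (refl i j).val < n ↔ j.val < n := by
  rw [refl, swap_apply_def]
  split_ifs with h1 h2
  · subst h1; simp only [lo, hi]; omega
  · subst h2; simp only [lo, hi]; omega
  · rfl

theorem label_refl_smul (A : Seq r t) {i : Fin (r + t - 1)} (h : A (lo i) ≠ A (hi i))
    (j : Pos) : (refl i • A).label (refl i j) = A.label j := by
  have hlo : (refl i • A) (lo i) = A (hi i) := by
    rw [refl, swap_smul_apply, swap_apply_left]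
  have hhi : (refl i • A) (hi i) = A (lo i) := by
    rw [refl, swap_smul_apply, swap_apply_right]
  have p1 : (refl i • A).plus i.val = A.plus i.val := A.plus_smul (refl_lt_iff i (by omega))
  have m1 : (refl i • A).minus i.val = A.minus i.val := A.minus_smul (refl_lt_iff i (by omega))
  have p2 := A.plus_add_minus (n := i.val + 1) (by omega)
  have p3 := (refl i • A).plus_add_minus (n := i.val + 1) (by omega)
  have p4 := A.plus_add_minus (n := i.val) (by omega)
  by_cases hj1 : j = lo i
  · subst hj1
    have e : refl i (lo i) = hi i := swap_apply_left _ _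
    rw [e]
    apply Fin.ext
    by_cases hA : A (lo i) = 1
    · have h2 : (refl i • A) (lo i) ≠ 1 := by rw [hlo, ← hA]; exact h.symm
      rw [label_of_eq _ (hhi.trans hA), label_of_eq _ hA]
      have := (refl i • A).minus_succ_of h2
      simp only [lo, hi] at this ⊢
      omega
    · have h2 : (refl i • A) (lo i) = 1 := by
        rw [hlo]; by_contra hc; exact h (((ne_one_iff A _).1 hA).trans ((ne_one_iff A _).1 hc).symm)
      have h3 := label_of_ne (refl i • A) (i := hi i) (by rw [hhi]; exact hA)
      have h4 := label_of_ne A hA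
      have := (refl i • A).plus_succ_of h2
      simp only [lo, hi] at this h3 h4 ⊢
      omega
  by_cases hj2 : j = hi i
  · subst hj2
    have e : refl i (hi i) = lo i := swap_apply_right _ _
    rw [e]
    apply Fin.ext
    by_cases hA : A (hi i) = 1
    · have h2 : A (lo i) ≠ 1 := by rw [← hA]; exact h
      rw [label_of_eq _ (hlo.trans hA), label_of_eq _ hA]
      have := A.minus_succ_of h2
      simp only [lo, hi] at this ⊢
      omega
    · have h2 : A (lo i) = 1 := by
        by_contra hc; exact h (((ne_one_iff A _).1 hc).trans ((ne_one_iff A _).1 hA).symm)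
      have h3 := label_of_ne (refl i • A) (i := lo i) (by rw [hlo]; exact hA)
      have h4 := label_of_ne A hA
      have := A.plus_succ_of h2
      simp only [lo, hi] at this h3 h4 ⊢
      omega
  · have e : refl i j = j := swap_apply_of_ne_of_ne hj1 hj2
    have hj : (refl i • A) j = A j := by
      rw [refl, swap_smul_apply, swap_apply_of_ne_of_ne hj1 hj2]
    have hn : j.val ≠ i.val + 1 := fun h => hj2 (Fin.ext h)
    rw [e]
    apply Fin.ext
    by_cases hA : A j = 1
    · rw [label_of_eq _ (hj.trans hA), label_of_eq _ hA, plus_smul _ (refl_lt_iff i hn)]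
    · have h3 := label_of_ne (refl i • A) (i := j) (by rw [hj]; exact hA)
      have h4 := label_of_ne A hA
      rw [minus_smul _ (refl_lt_iff i hn)] at h3
      omega

end Seq

end

section
open Equiv MvPolynomial Seq

section

variable (r t) in
/-- The permutations of the labels that preserve the set of labels of the entries `1`. -/
def wall : Subgroup (Perm Pos) where
  carrier := {κ | ∀ x, (κ x).val < r ↔ x.val < r}
  one_mem' _ := Iff.rfl
  mul_mem' h h' x := (h _).trans (h' x)
  inv_mem' {κ} h x := by
    have := h (κ⁻¹ x)
    rw [show κ (κ⁻¹ x) = x by simp] at this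
    exact this.symm

theorem mem_wall {κ : Perm Pos} : κ ∈ wall r t ↔ ∀ x, (κ x).val < r ↔ x.val < r := Iff.rfl

/-- The part of a permutation on the labels of the entries `1`. -/
def leftPart : wall r t →* Perm Pos where
  toFun κ := Perm.ofSubtype
    (Perm.subtypePerm (p := fun x : Pos => x.val < r) κ.1 (mem_wall.1 κ.2))
  map_one' := by
    rw [show Perm.subtypePerm (p := fun x : Pos => x.val < r)
      (1 : wall r t).1 (mem_wall.1 (1 : wall r t).2) = 1 from rfl, map_one]
  map_mul' κ κ' := by rw [← map_mul]; rfl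

/-- The part of a permutation on the labels of the entries `-1`. -/
def rightPart : wall r t →* Perm Pos where
  toFun κ := Perm.ofSubtype
    (Perm.subtypePerm (p := fun x : Pos => ¬ x.val < r) κ.1
      fun x => not_congr (mem_wall.1 κ.2 x))
  map_one' := by
    rw [show Perm.subtypePerm (p := fun x : Pos => ¬ x.val < r)
      (1 : wall r t).1 (fun x => not_congr (mem_wall.1 (1 : wall r t).2 x)) = 1 from rfl, map_one]
  map_mul' κ κ' := by rw [← map_mul]; rfl

theorem leftPart_of_lt (κ : wall r t) {x : Pos} (hx : x.val < r) : leftPart κ x = κ.1 x := by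
  change Perm.ofSubtype _ x = _
  rw [Perm.ofSubtype_apply_of_mem (p := fun x : Pos => x.val < r) _ hx]; rfl

theorem leftPart_of_le (κ : wall r t) {x : Pos} (hx : ¬ x.val < r) : leftPart κ x = x := by
  change Perm.ofSubtype _ x = _
  rw [Perm.ofSubtype_apply_of_not_mem (p := fun x : Pos => x.val < r) _ hx]

theorem rightPart_of_le (κ : wall r t) {x : Pos} (hx : ¬ x.val < r) : rightPart κ x = κ.1 x := by
  change Perm.ofSubtype _ x = _
  rw [Perm.ofSubtype_apply_of_mem (p := fun x : Pos => ¬ x.val < r) _ hx]; rfl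

theorem rightPart_of_lt (κ : wall r t) {x : Pos} (hx : x.val < r) : rightPart κ x = x := by
  change Perm.ofSubtype _ x = _
  rw [Perm.ofSubtype_apply_of_not_mem (p := fun x : Pos => ¬ x.val < r) _ (not_not.2 hx)]

theorem label_conj_mem (A : Seq r t) (σ : Perm Pos) : (σ • A).label * σ * A.label⁻¹ ∈ wall r t := by
  intro x
  obtain ⟨i, rfl⟩ := A.label.surjective x
  have : ((σ • A).label * σ * A.label⁻¹) (A.label i) = (σ • A).label (σ i) := by
    simp [Perm.mul_apply]
  rw [this, label_lt_iff, label_lt_iff, smul_apply_apply]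

/-- A permutation of positions, read on labels. -/
def relabel (A : Seq r t) (σ : Perm Pos) : wall r t :=
  ⟨(σ • A).label * σ * A.label⁻¹, label_conj_mem A σ⟩

theorem relabel_label (A : Seq r t) (σ : Perm Pos) (i : Pos) :
    (relabel A σ).1 (A.label i) = (σ • A).label (σ i) := by
  simp [relabel, Perm.mul_apply]

theorem relabel_mul (A : Seq r t) (σ τ : Perm Pos) :
    relabel A (σ * τ) = relabel (τ • A) σ * relabel A τ := by
  apply Subtype.ext
  change ((σ * τ) • A).label * (σ * τ) * A.label⁻¹ =
    (σ • τ • A).label * σ * (τ • A).label⁻¹ * ((τ • A).label * τ * A.label⁻¹)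
  rw [mul_smul]
  group

theorem relabel_one (A : Seq r t) : relabel A 1 = 1 := by
  apply Subtype.ext
  change ((1 : Perm Pos) • A).label * 1 * A.label⁻¹ = 1
  rw [one_smul]
  group

end

theorem refl_smul_of_eq (h : A (lo i) = A (hi i)) : refl i • A = A := by
  apply Seq.ext
  intro j
  rw [refl, swap_smul_apply, swap_apply_def]
  split_ifs with h1 h2
  · rw [h1, h]
  · rw [h2, h]
  · rfl

theorem refl_smul_lo (A : Seq r t) (i : Adj) : (refl i • A) (lo i) = A (hi i) := by
  rw [refl, swap_smul_apply, swap_apply_left]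

theorem refl_smul_hi (A : Seq r t) (i : Adj) : (refl i • A) (hi i) = A (lo i) := by
  rw [refl, swap_smul_apply, swap_apply_right]

theorem refl_smul_of_ne (A : Seq r t) {j : Pos} (h : j ≠ lo i)
    (h' : j ≠ hi i) : (refl i • A) j = A j := by
  rw [refl, swap_smul_apply, swap_apply_of_ne_of_ne h h']

theorem refl_mul_refl (i : Adj) : refl i * refl i = 1 := swap_mul_self _ _

theorem refl_smul_refl_smul (i : Adj) (A : Seq r t) : refl i • refl i • A = A := by
  rw [← mul_smul, refl_mul_refl, one_smul]

theorem swap_smul_of_eq {p q : Pos} (h : A p = A q) : swap p q • A = A := by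
  apply Seq.ext
  intro j
  rw [swap_smul_apply, swap_apply_def]
  split_ifs with h1 h2
  · rw [h1, h]
  · rw [h2, h]
  · rfl

namespace CapSystem

variable {E : Type} [Ring E] (S : CapSystem (Fin (r + t)) E)

/-- The operator of a permutation that preserves the wall. -/
def sideHom : wall r t →* E where
  toFun κ := S.lg (leftPart κ) * S.rg (rightPart κ)
  map_one' := by simp only [map_one, mul_one]
  map_mul' κ κ' := by
    simp only [map_mul]
    rw [mul_assoc, ← mul_assoc (S.lg (leftPart κ')), S.lg_rg]
    simp only [mul_assoc]

theorem sideHom_apply (κ : wall r t) : S.sideHom κ = S.lg (leftPart κ) * S.rg (rightPart κ) := rfl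

theorem sideHom_cap (κ : wall r t) {k l : Pos} (hk : k.val < r) (hl : ¬ l.val < r) :
    S.sideHom κ * S.cap k l = S.cap (κ.1 k) (κ.1 l) * S.sideHom κ := by
  rw [sideHom_apply, mul_assoc, S.rg_cap, ← mul_assoc, S.lg_cap, mul_assoc, leftPart_of_lt κ hk,
    rightPart_of_le κ hl]

theorem sideHom_of_left (κ : wall r t) (h : ∀ x : Pos, ¬ x.val < r → κ.1 x = x) :
    S.sideHom κ = S.lg κ.1 := by
  have h1 : leftPart κ = κ.1 := by
    ext x
    by_cases hx : x.val < r
    · rw [leftPart_of_lt κ hx]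
    · rw [leftPart_of_le κ hx, h x hx]
  have h2 : rightPart κ = 1 := by
    ext x
    by_cases hx : x.val < r
    · rw [rightPart_of_lt κ hx]; rfl
    · rw [rightPart_of_le κ hx, h x hx]; rfl
  rw [sideHom_apply, h1, h2, map_one, mul_one]

theorem sideHom_of_right (κ : wall r t) (h : ∀ x : Pos, x.val < r → κ.1 x = x) :
    S.sideHom κ = S.rg κ.1 := by
  have h1 : rightPart κ = κ.1 := by
    ext x
    by_cases hx : x.val < r
    · rw [rightPart_of_lt κ hx, h x hx]
    · rw [rightPart_of_le κ hx]
  have h2 : leftPart κ = 1 := by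
    ext x
    by_cases hx : x.val < r
    · rw [leftPart_of_lt κ hx, h x hx]; rfl
    · rw [leftPart_of_le κ hx]; rfl
  rw [sideHom_apply, h1, h2, map_one, one_mul]

/-- The operator of a permutation of the positions of `A`. -/
def permOp (A : Seq r t) (σ : Perm Pos) : E := S.sideHom (relabel A σ)

theorem permOp_mul (A : Seq r t) (σ τ : Perm Pos) :
    S.permOp (τ • A) σ * S.permOp A τ = S.permOp A (σ * τ) := by
  rw [permOp, permOp, permOp, relabel_mul, map_mul]

theorem permOp_one (A : Seq r t) : S.permOp A 1 = 1 := by rw [permOp, relabel_one, map_one]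

theorem permOp_refl_of_ne (h : A (lo i) ≠ A (hi i)) : S.permOp A (refl i) = 1 := by
  have : relabel A (refl i) = 1 := by
    apply Subtype.ext
    ext x : 1
    obtain ⟨j, rfl⟩ := A.label.surjective x
    rw [relabel_label, A.label_refl_smul h]
    rfl
  rw [permOp, this, map_one]

theorem relabel_swap {p q : Pos} (h : A p = A q) :
    (relabel A (swap p q)).1 = swap (A.label p) (A.label q) := by
  ext x : 1
  obtain ⟨j, rfl⟩ := A.label.surjective x
  rw [relabel_label, swap_smul_of_eq h, A.label.injective.map_swap]

theorem permOp_swap_of_eq {p q : Pos} (h : A p = A q) (hp : A p = 1) :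
    S.permOp A (swap p q) = S.lg (swap (A.label p) (A.label q)) := by
  rw [permOp, sideHom_of_left, relabel_swap h]
  intro x hx
  rw [relabel_swap h, swap_apply_of_ne_of_ne]
  · rintro rfl; exact hx ((A.label_lt_iff p).2 hp)
  · rintro rfl; exact hx ((A.label_lt_iff q).2 (h ▸ hp))

theorem permOp_swap_of_ne {p q : Pos} (h : A p = A q) (hp : A p ≠ 1) :
    S.permOp A (swap p q) = S.rg (swap (A.label p) (A.label q)) := by
  rw [permOp, sideHom_of_right, relabel_swap h]
  intro x hx
  rw [relabel_swap h, swap_apply_of_ne_of_ne]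
  · rintro rfl; exact hp ((A.label_lt_iff p).1 hx)
  · rintro rfl; exact hp (h.trans ((A.label_lt_iff q).1 hx))

/-- The cap that connects two positions. -/
def capOf (A : Seq r t) (p q : Pos) : E :=
  if A p = 1 then S.cap (A.label p) (A.label q) else S.cap (A.label q) (A.label p)

theorem eq_one_of_ne {p q : Pos} (h : A p ≠ A q) (hp : A p ≠ 1) : A q = 1 := by
  rcases A.eq_one_or q with h1 | h1
  · exact h1
  · exact absurd (((ne_one_iff A p).1 hp).trans h1.symm) h

theorem capOf_symm {p q : Pos} (h : A p ≠ A q) : S.capOf A p q = S.capOf A q p := by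
  unfold capOf
  by_cases hp : A p = 1
  · rw [if_pos hp, if_neg (fun hq => h (hp.trans hq.symm))]
  · rw [if_neg hp, if_pos (eq_one_of_ne h hp)]

theorem permOp_capOf {p q : Pos} (h : A p ≠ A q) (σ : Perm Pos) :
    S.permOp A σ * S.capOf A p q = S.capOf (σ • A) (σ p) (σ q) * S.permOp A σ := by
  unfold capOf permOp
  rw [smul_apply_apply]
  by_cases hp : A p = 1
  · rw [if_pos hp, if_pos hp, sideHom_cap _ _ ((A.label_lt_iff p).2 hp), relabel_label,
    relabel_label]
    rw [A.label_lt_iff q]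
    exact fun hq => h (hp.trans hq.symm)
  · rw [if_neg hp, if_neg hp, sideHom_cap _ _ ((A.label_lt_iff q).2 (eq_one_of_ne h hp)),
    relabel_label, relabel_label]
    rwa [A.label_lt_iff p]

theorem capOf_refl_smul (h : A (lo i) ≠ A (hi i)) :
    S.capOf (refl i • A) (lo i) (hi i) = S.capOf A (lo i) (hi i) := by
  have := S.permOp_capOf h (refl i)
  rw [S.permOp_refl_of_ne h, one_mul, mul_one] at this
  rw [this, refl, swap_apply_left, swap_apply_right, capOf_symm]
  rw [← refl, refl_smul_lo, refl_smul_hi]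
  exact h.symm

theorem capOf_mul_capOf {p q s : Pos} (h : A p ≠ A q) (h' : A q ≠ A s)
    (hps : p ≠ s) : S.capOf A q s * S.capOf A p q = S.capOf A q s * S.permOp A (swap p s) := by
  have e := A.eq_of_ne_of_ne h h'
  have hne : A.label s ≠ A.label p := fun h => hps (A.label.injective h).symm
  by_cases hp : A p = 1
  · have hq : A q ≠ 1 := fun hq => h (hp.trans hq.symm)
    rw [S.permOp_swap_of_eq e hp, capOf, capOf, if_neg hq, if_pos hp, S.cap_cap_left _ _ _ hne,
      swap_comm]
  · have hq : A q = 1 := eq_one_of_ne h hp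
    rw [S.permOp_swap_of_ne e hp, capOf, capOf, if_pos hq, if_neg hp, S.cap_cap_right _ _ _ hne,
      swap_comm]

theorem capOf_mul_permOp {p q s : Pos} (h : A p ≠ A q) (h' : A q ≠ A s) :
    S.permOp A (swap p s) * S.capOf A p q = S.capOf A q s * S.permOp A (swap p s) := by
  have e := A.eq_of_ne_of_ne h h'
  have hq : q ≠ p := by rintro rfl; exact h rfl
  have hq' : q ≠ s := by rintro rfl; exact h' rfl
  rw [S.permOp_capOf h, swap_smul_of_eq e, swap_apply_left,
    swap_apply_of_ne_of_ne hq hq', S.capOf_symm h'.symm]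

theorem capOf_comm {p q p' q' : Pos} (h1 : p ≠ p') (h2 : p ≠ q') (h3 : q ≠ p') (h4 : q ≠ q') :
    S.capOf A p q * S.capOf A p' q' = S.capOf A p' q' * S.capOf A p q := by
  have inj := A.label.injective
  unfold capOf
  split_ifs with hp hp' hp'
  · exact S.cap_cap_comm _ _ _ _ (inj.ne h1) (inj.ne h4)
  · exact S.cap_cap_comm _ _ _ _ (inj.ne h2) (inj.ne h3)
  · exact S.cap_cap_comm _ _ _ _ (inj.ne h3) (inj.ne h2)
  · exact S.cap_cap_comm _ _ _ _ (inj.ne h4) (inj.ne h1)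

end CapSystem

end

section
open Equiv Finset MvPolynomial

theorem lo_lt_hi (i : Adj) : lo i < hi i := by
  rw [Fin.lt_def]; simp [lo, hi]

theorem lt_lo_or_hi_lt {j : Pos} (h : j ≠ lo i) (h' : j ≠ hi i) : j < lo i ∨ hi i < j := by
  have h1 : j.val ≠ i.val := fun e => h (Fin.ext e)
  have h2 : j.val ≠ i.val + 1 := fun e => h' (Fin.ext e)
  simp only [Fin.lt_def, lo, hi]
  omega

namespace Seq

theorem plus_hi_of_eq (h : A (lo i) = 1) :
    A.plus (hi i).val = A.plus (lo i).val + 1 := A.plus_succ_of h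

theorem minus_hi_of_ne (h : A (lo i) ≠ 1) :
    A.minus (hi i).val = A.minus (lo i).val + 1 := A.minus_succ_of h

theorem minus_hi_of_eq (h : A (lo i) = 1) : A.minus (hi i).val = A.minus (lo i).val := by
  have h1 := plus_hi_of_eq h
  have h2 := A.plus_add_minus (hi i).isLt.le
  have h3 := A.plus_add_minus (lo i).isLt.le
  have h4 : (hi i).val = (lo i).val + 1 := rfl
  omega

theorem plus_hi_of_ne (h : A (lo i) ≠ 1) : A.plus (hi i).val = A.plus (lo i).val := by
  have h1 := minus_hi_of_ne h
  have h2 := A.plus_add_minus (hi i).isLt.le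
  have h3 := A.plus_add_minus (lo i).isLt.le
  have h4 : (hi i).val = (lo i).val + 1 := rfl
  omega

theorem label_refl_smul_far (A : Seq r t) {j : Pos} (h : j ≠ lo i)
    (h' : j ≠ hi i) : (refl i • A).label j = A.label j := by
  by_cases hA : A (lo i) = A (hi i)
  · rw [refl_smul_of_eq hA]
  · have := A.label_refl_smul hA j
    rwa [refl, swap_apply_of_ne_of_ne h h'] at this

theorem label_covBy (h : A (lo i) = A (hi i))
    (hp : A (lo i) = 1) : A.label (lo i) ⋖ A.label (hi i) := by
  have h1 := label_of_eq A hp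
  have h2 := label_of_eq A (h ▸ hp)
  have h3 := plus_hi_of_eq hp
  rw [Fin.covBy_iff, Nat.covBy_iff_add_one_eq]
  omega

theorem label_covBy' (h : A (lo i) = A (hi i))
    (hp : A (lo i) ≠ 1) : A.label (hi i) ⋖ A.label (lo i) := by
  have h1 := label_of_ne A hp
  have h2 := label_of_ne A (i := hi i) (h ▸ hp)
  have h3 := minus_hi_of_ne hp
  rw [Fin.covBy_iff, Nat.covBy_iff_add_one_eq]
  omega

end Seq

namespace CapSystem

variable {E : Type} [Ring E] (S : CapSystem (Fin (r + t)) E)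

/-- The labels of the entries `-1` before `i`. -/
def minusLabels (A : Seq r t) (i : Pos) : Finset Pos :=
  univ.filter fun l => r + t ≤ l.val + A.minus i

/-- The labels that do not belong to entries `1` before `i`. -/
def plusLabels (A : Seq r t) (i : Pos) : Finset Pos :=
  univ.filter fun k => A.plus i ≤ k.val

theorem mem_minusLabels {i l : Pos} :
    l ∈ minusLabels A i ↔ r + t ≤ l.val + A.minus i := by simp [minusLabels]

theorem mem_plusLabels {i k : Pos} : k ∈ plusLabels A i ↔ A.plus i ≤ k.val := by simp [plusLabels]

/-- The dot on the strand at the position `i`, up to sign. -/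
def dotOp (A : Seq r t) (i : Pos) : E :=
  if A i = 1 then S.dotL (A.label i) (minusLabels A i) else S.dotR (A.label i) (plusLabels A i)

theorem dotOp_of_eq {i : Pos} (h : A i = 1) :
    S.dotOp A i = S.dotL (A.label i) (minusLabels A i) := if_pos h

theorem dotOp_of_ne {i : Pos} (h : A i ≠ 1) :
    S.dotOp A i = S.dotR (A.label i) (plusLabels A i) := if_neg h

theorem dotOp_commute_of_lt (A : Seq r t) {i j : Pos} (hij : i < j) :
    Commute (S.dotOp A i) (S.dotOp A j) := by
  by_cases hi : A i = 1 <;> by_cases hj : A j = 1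
  · rw [dotOp_of_eq S hi, dotOp_of_eq S hj]
    refine S.dotL_comm_dotL ?_ fun l hl => ?_
    · rw [Fin.lt_def, A.label_of_eq hi, A.label_of_eq hj]; exact A.plus_lt hij hi
    · rw [mem_minusLabels] at hl ⊢
      have := A.minus_mono hij.le
      omega
  · rw [dotOp_of_eq S hi, dotOp_of_ne S hj]
    refine S.dotL_comm_dotR_of_lt (fun l hl => ?_) fun k hk => ?_
    · rw [mem_minusLabels] at hl
      have := A.minus_mono hij.le
      have := A.label_of_ne hj
      rw [Fin.lt_def]; omega
    · rw [mem_plusLabels] at hk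
      have := A.plus_lt hij hi
      rw [Fin.lt_def, A.label_of_eq hi]; omega
  · rw [dotOp_of_ne S hi, dotOp_of_eq S hj]
    refine (S.dotL_comm_dotR_of_mem ?_ ?_ (fun l hl => ?_) fun k hk => ?_).symm
    · rw [mem_minusLabels]
      have := A.minus_lt hij hi
      have := A.label_of_ne hi
      omega
    · rw [mem_plusLabels, A.label_of_eq hj]
      exact A.plus_mono hij.le
    · rw [Fin.lt_def] at hl
      rw [mem_minusLabels]
      have := A.minus_lt hij hi
      have := A.label_of_ne hi
      omega
    · rw [Fin.lt_def, A.label_of_eq hj] at hk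
      rw [mem_plusLabels]
      have := A.plus_mono hij.le
      omega
  · rw [dotOp_of_ne S hi, dotOp_of_ne S hj]
    refine (S.dotR_comm_dotR ?_ fun k hk => ?_).symm
    · rw [Fin.lt_def]
      have := A.label_of_ne hi
      have := A.label_of_ne hj
      have := A.minus_lt hij hi
      omega
    · rw [mem_plusLabels] at hk ⊢
      have := A.plus_mono hij.le
      omega

theorem dotOp_commute (A : Seq r t) (i j : Pos) : Commute (S.dotOp A i) (S.dotOp A j) := by
  rcases lt_trichotomy i j with h | rfl | h
  · exact S.dotOp_commute_of_lt A h
  · exact Commute.refl _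
  · exact (S.dotOp_commute_of_lt A h).symm

theorem dotOp_refl_smul {j : Pos} (h : j ≠ lo i)
    (h' : j ≠ hi i) : S.dotOp (refl i • A) j = S.dotOp A j := by
  have hn : j.val ≠ i.val + 1 := fun e => h' (Fin.ext e)
  have e1 : (refl i • A).plus j = A.plus j := A.plus_smul (Seq.refl_lt_iff i hn)
  have e2 : (refl i • A).minus j = A.minus j := A.minus_smul (Seq.refl_lt_iff i hn)
  rw [dotOp, dotOp, refl_smul_of_ne A h h', A.label_refl_smul_far h h', minusLabels, minusLabels,
    plusLabels, plusLabels, e1, e2]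

theorem permOp_dotOp_far {j : Pos} (h : j ≠ lo i)
    (h' : j ≠ hi i) : S.permOp A (refl i) * S.dotOp A j =
      S.dotOp (refl i • A) j * S.permOp A (refl i) := by
  rw [dotOp_refl_smul S h h']
  by_cases hA : A (lo i) = A (hi i)
  · have inj := A.label.injective
    have key : ∀ (x : Pos) (P : Pos → Prop), (P (A.label (lo i)) ↔ P (A.label (hi i))) →
        (P (swap (A.label (lo i)) (A.label (hi i)) x) ↔ P x) := by
      intro x P hP
      rw [swap_apply_def]
      split_ifs with h1 h2
      · rw [h1, hP]
      · rw [h2, hP]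
      · rfl
    by_cases hp : A (lo i) = 1
    · rw [refl, S.permOp_swap_of_eq hA hp]
      by_cases hj : A j = 1
      · rw [S.dotOp_of_eq hj]
        exact S.lg_comm_dotL (Seq.label_covBy hA hp) (inj.ne h) (inj.ne h') _
      · rw [S.dotOp_of_ne hj]
        refine S.lg_comm_dotR (fun k => key k (· ∈ plusLabels A j) ?_) _
        rw [mem_plusLabels, mem_plusLabels, A.label_of_eq hp, A.label_of_eq (hA ▸ hp)]
        have h1 := Seq.plus_hi_of_eq hp
        rcases lt_lo_or_hi_lt h h' with h2 | h2
        · have := A.plus_mono h2.le; omega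
        · have := A.plus_lt h2 (hA ▸ hp); omega
    · rw [refl, S.permOp_swap_of_ne hA hp]
      by_cases hj : A j = 1
      · rw [S.dotOp_of_eq hj]
        refine S.rg_comm_dotL (fun k => key k (· ∈ minusLabels A j) ?_) _
        rw [mem_minusLabels, mem_minusLabels]
        have h3 := A.label_of_ne hp
        have h4 := A.label_of_ne (i := hi i) (hA ▸ hp)
        have h1 := Seq.minus_hi_of_ne hp
        rcases lt_lo_or_hi_lt h h' with h2 | h2
        · have := A.minus_mono h2.le; omega
        · have := A.minus_lt h2 (hA ▸ hp); omega
      · rw [S.dotOp_of_ne hj, swap_comm]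
        exact S.rg_comm_dotR (Seq.label_covBy' hA hp) (inj.ne h') (inj.ne h) _
  · rw [permOp_refl_of_ne S hA, one_mul, mul_one]

theorem permOp_dotOp_of_eq (hA : A (lo i) = A (hi i)) : S.permOp A (refl i) * S.dotOp A (lo i) =
      S.dotOp A (hi i) * S.permOp A (refl i) - A (lo i) • 1 := by
  by_cases hp : A (lo i) = 1
  · rw [refl, S.permOp_swap_of_eq hA hp, S.dotOp_of_eq hp, S.dotOp_of_eq (hA ▸ hp), hp, one_smul,
    S.lg_mul_dotL (Seq.label_covBy hA hp), minusLabels, minusLabels, Seq.minus_hi_of_eq hp]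
  · have h1 := S.rg_mul_dotR (Seq.label_covBy' hA hp) (plusLabels A (hi i))
    have h2 : plusLabels A (lo i) = plusLabels A (hi i) := by
      rw [plusLabels, plusLabels, Seq.plus_hi_of_ne hp]
    rw [refl, S.permOp_swap_of_ne hA hp, S.dotOp_of_ne hp, S.dotOp_of_ne (i := hi i) (hA ▸ hp),
      (Seq.ne_one_iff A _).1 hp, neg_smul, one_smul, h2, swap_comm]
    set g := S.rg (swap (A.label (hi i)) (A.label (lo i)))
    have hg : g * g = 1 := by rw [← map_mul, swap_mul_self, map_one]
    have h3 := congrArg (fun z => g * z * g) h1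
    beta_reduce at h3
    rw [← mul_assoc, hg, one_mul, mul_sub, sub_mul, mul_one, hg] at h3
    rw [h3, mul_assoc, mul_assoc, hg, mul_one]
    abel

theorem dotOp_lo_of_eq (h : A (lo i) ≠ A (hi i)) (hp : A (lo i) = 1) : S.dotOp A (lo i) =
      S.dotL (A.label (lo i)) (univ.filter (A.label (hi i) < ·)) := by
  have h1 := A.label_of_ne (i := hi i) (hp ▸ h.symm)
  have h2 := Seq.minus_hi_of_eq hp
  rw [S.dotOp_of_eq hp, minusLabels]
  congr 1
  ext x
  simp only [mem_filter_univ, Fin.lt_def]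
  omega

theorem dotOp_hi_of_eq (h : A (lo i) ≠ A (hi i)) (hp : A (lo i) = 1) : S.dotOp A (hi i) =
      S.dotR (A.label (hi i)) (univ.filter (A.label (lo i) < ·)) := by
  have h1 := A.label_of_eq hp
  have h2 := Seq.plus_hi_of_eq hp
  rw [S.dotOp_of_ne (i := hi i) (hp ▸ h.symm), plusLabels]
  congr 1
  ext x
  simp only [mem_filter_univ, Fin.lt_def]
  omega

theorem dotOp_lo_of_ne (h : A (lo i) ≠ A (hi i)) (hp : A (lo i) ≠ 1) : S.dotOp A (lo i) =
      S.dotR (A.label (lo i)) (univ.filter (A.label (hi i) ≤ ·)) := by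
  have h1 := A.label_of_eq (eq_one_of_ne h hp)
  have h2 := Seq.plus_hi_of_ne hp
  rw [S.dotOp_of_ne hp, plusLabels]
  congr 1
  ext x
  simp only [mem_filter_univ, Fin.le_def]
  omega

theorem dotOp_hi_of_ne (h : A (lo i) ≠ A (hi i)) (hp : A (lo i) ≠ 1) : S.dotOp A (hi i) =
      S.dotL (A.label (hi i)) (univ.filter (A.label (lo i) ≤ ·)) := by
  have h1 := A.label_of_ne hp
  have h2 := Seq.minus_hi_of_ne hp
  rw [S.dotOp_of_eq (eq_one_of_ne h hp), minusLabels]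
  congr 1
  ext x
  simp only [mem_filter_univ, Fin.le_def]
  omega

theorem dotOp_refl_hi (h : A (lo i) ≠ A (hi i)) :
    S.dotOp A (lo i) - S.dotOp (refl i • A) (hi i) = A (lo i) • S.capOf A (lo i) (hi i) := by
  have e1 := A.label_refl_smul h (lo i)
  have e2 := A.label_refl_smul h (hi i)
  rw [refl, swap_apply_left, ← refl] at e1
  rw [refl, swap_apply_right, ← refl] at e2
  have hB : (refl i • A) (lo i) ≠ (refl i • A) (hi i) := by
    rw [refl_smul_lo, refl_smul_hi]; exact h.symm
  by_cases hp : A (lo i) = 1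
  · rw [S.dotOp_lo_of_eq h hp, S.dotOp_hi_of_ne hB (by rw [refl_smul_lo, ← hp]; exact h.symm),
    capOf, if_pos hp, hp, e1, e2, dotL_le, one_smul]
    abel
  · rw [S.dotOp_lo_of_ne h hp, S.dotOp_hi_of_eq hB (by rw [refl_smul_lo]; exact eq_one_of_ne h hp),
    capOf, if_neg hp, (Seq.ne_one_iff A _).1 hp, e1, e2, dotR_le, neg_smul, one_smul]
    abel

theorem dotOp_refl_lo (h : A (lo i) ≠ A (hi i)) :
    S.dotOp A (hi i) - S.dotOp (refl i • A) (lo i) = A (lo i) • S.capOf A (lo i) (hi i) := by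
  have hB : (refl i • A) (lo i) ≠ (refl i • A) (hi i) := by
    rw [refl_smul_lo, refl_smul_hi]; exact h.symm
  have h1 := S.dotOp_refl_hi hB
  rw [refl_smul_refl_smul, S.capOf_refl_smul h, refl_smul_lo] at h1
  rw [← neg_sub, h1]
  rcases A.eq_one_or (lo i) with h2 | h2 <;> rcases A.eq_one_or (hi i) with h3 | h3
  · exact absurd (h2.trans h3.symm) h
  · rw [h2, h3, neg_smul, neg_neg]
  · rw [h2, h3, neg_smul]
  · exact absurd (h2.trans h3.symm) h

theorem capOf_mul_dotOp (h : A (lo i) ≠ A (hi i)) :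
    S.capOf A (lo i) (hi i) * S.dotOp A (lo i) = S.capOf A (lo i) (hi i) * S.dotOp A (hi i) := by
  by_cases hp : A (lo i) = 1
  · rw [S.dotOp_lo_of_eq h hp, S.dotOp_hi_of_eq h hp, capOf, if_pos hp, S.cap_mul_dot]
  · rw [S.dotOp_lo_of_ne h hp, S.dotOp_hi_of_ne h hp, capOf, if_neg hp, S.cap_mul_dot']

theorem dotOp_mul_capOf (h : A (lo i) ≠ A (hi i)) :
    S.dotOp A (lo i) * S.capOf A (lo i) (hi i) = S.dotOp A (hi i) * S.capOf A (lo i) (hi i) := by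
  by_cases hp : A (lo i) = 1
  · rw [S.dotOp_lo_of_eq h hp, S.dotOp_hi_of_eq h hp, capOf, if_pos hp, S.dot_mul_cap]
  · rw [S.dotOp_lo_of_ne h hp, S.dotOp_hi_of_ne h hp, capOf, if_neg hp, S.dot_mul_cap']

theorem cap_commute_dotOp (A : Seq r t) {p q j : Pos}
    (hp : A p = 1) (hq : A q ≠ 1) (h : j < p ∧ j < q ∨ p < j ∧ q < j) :
    Commute (S.cap (A.label p) (A.label q)) (S.dotOp A j) := by
  have h1 := A.label_of_eq hp
  have h2 := A.label_of_ne hq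
  by_cases hj : A j = 1
  · have h3 := A.label_of_eq hj
    rw [S.dotOp_of_eq hj]
    rcases h with ⟨h, h'⟩ | ⟨h, h'⟩
    · refine S.cap_comm_dotL_of_gt ?_ ?_
      · rw [Fin.lt_def, h1, h3]; exact A.plus_lt h hj
      · rw [mem_minusLabels]
        have := A.minus_mono h'.le
        omega
    · refine S.cap_comm_dotL_of_lt ?_ ?_
      · rw [Fin.lt_def, h1, h3]; exact A.plus_lt h hp
      · rw [mem_minusLabels]
        have := A.minus_lt h' hq
        omega
  · have h3 := A.label_of_ne hj
    rw [S.dotOp_of_ne hj]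
    rcases h with ⟨h, h'⟩ | ⟨h, h'⟩
    · refine S.cap_comm_dotR_of_lt ?_ ?_
      · rw [Fin.lt_def]
        have := A.minus_lt h' hj
        omega
      · rw [mem_plusLabels, h1]; exact A.plus_mono h.le
    · refine S.cap_comm_dotR_of_gt ?_ ?_
      · rw [Fin.lt_def]
        have := A.minus_lt h' hq
        omega
      · rw [mem_plusLabels, h1]
        have := A.plus_lt h hp
        omega

theorem capOf_commute_dotOp {j : Pos} (hA : A (lo i) ≠ A (hi i)) (h : j ≠ lo i) (h' : j ≠ hi i) :
    Commute (S.capOf A (lo i) (hi i)) (S.dotOp A j) := by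
  have h1 := lo_lt_hi i
  rw [capOf]
  split_ifs with hp
  · refine S.cap_commute_dotOp A hp (hp ▸ hA.symm) ?_
    rcases lt_lo_or_hi_lt h h' with h2 | h2
    · exact Or.inl ⟨h2, h2.trans h1⟩
    · exact Or.inr ⟨h1.trans h2, h2⟩
  · refine S.cap_commute_dotOp A (eq_one_of_ne hA hp) hp ?_
    rcases lt_lo_or_hi_lt h h' with h2 | h2
    · exact Or.inl ⟨h2.trans h1, h2⟩
    · exact Or.inr ⟨h2, h1.trans h2⟩

theorem dotOp_zero {i : Pos} (hi : i.val = 0) (h : A i = 1) : S.dotOp A i = S.lx (A.label i) := by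
  have e1 : A.plus i = 0 := by
    rw [hi]; simp [Seq.plus]
  have e2 : A.minus i = 0 := by
    rw [hi]; simp [Seq.minus]
  have e3 : minusLabels A i = ∅ := by
    ext l
    rw [mem_minusLabels, e2]
    have := l.isLt
    simp only [notMem_empty, iff_false]
    omega
  have e4 : univ.filter (· < A.label i) = ∅ := by
    ext l
    simp only [mem_filter_univ, notMem_empty, iff_false, Fin.lt_def, A.label_of_eq h, e1]
    omega
  rw [dotOp_of_eq S h, e3, dotL, sum_empty, sub_zero, S.ly_def, e4, sum_empty, add_zero]

end CapSystem

end

section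
open Equiv MvPolynomial Seq

theorem swap_braid {ι : Type*} [DecidableEq ι] {p q s : ι} (hqs : q ≠ s) (hps : p ≠ s) :
    swap p s = swap p q * swap q s * swap p q := by
  have := mul_swap_eq_swap_mul (swap p q) q s
  rw [swap_apply_right, swap_apply_of_ne_of_ne hps.symm hqs.symm] at this
  rw [this, mul_assoc, swap_mul_self, mul_one]

theorem swap_braid_eq {ι : Type*} [DecidableEq ι] {p q s : ι} (hpq : p ≠ q) (hqs : q ≠ s)
    (hps : p ≠ s) : swap p q * swap q s * swap p q = swap q s * swap p q * swap q s := by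
  rw [← swap_braid hqs hps, swap_comm p s, swap_braid hpq.symm hps.symm, swap_comm s q,
    swap_comm q p]

theorem lo_eq_hi (h : j.val = i.val + 1) : lo j = hi i := Fin.ext h

theorem lo_ne_hi (h : j.val = i.val + 1) : lo i ≠ hi j := by
  simp only [ne_eq, Fin.ext_iff, lo, hi]; omega

theorem refl_braid (h : j.val = i.val + 1) :
    refl i * refl j * refl i = refl j * refl i * refl j := by
  rw [refl, refl, lo_eq_hi h]
  exact swap_braid_eq (lo_lt_hi i).ne (lo_eq_hi h ▸ (lo_lt_hi j).ne) (lo_ne_hi h)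

namespace Pre

theorem IsS.target_eq {f : Pre A B} (h : IsS i f) : B = refl i • A := by
  cases h with
  | s h => rw [refl_smul_of_eq h]
  | sHat h => rfl

theorem IsE.source_ne {f : Pre A B} (h : IsE i f) : A (lo i) ≠ A (hi i) := by
  cases h <;> assumption

theorem IsE.target {f : Pre A B} (h : IsE i f) : B = A ∨ B = refl i • A := by
  cases h with
  | e => exact Or.inl rfl
  | eHat => exact Or.inr rfl

theorem IsSHat.isS {f : Pre A B} (h : IsSHat i f) : IsS i f := by
  cases h; exact IsS.sHat _ _

theorem IsSHat.source_ne {f : Pre A B} (h : IsSHat i f) : A (lo i) ≠ A (hi i) := by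
  cases h; assumption

theorem IsEHat.isE {f : Pre A B} (h : IsEHat i f) : IsE i f := by
  cases h; exact IsE.eHat _ _

end Pre

theorem ne_of_mem_pair {p q : Pos} (hA : A p ≠ A q)
    (hB : B = A ∨ B = swap p q • A) : B p ≠ B q := by
  rcases hB with rfl | rfl
  · exact hA
  · rw [swap_smul_apply, swap_smul_apply, swap_apply_left, swap_apply_right]
    exact hA.symm

namespace CapSystem

variable {E : Type} [Ring E] (S : CapSystem (Fin (r + t)) E)

theorem capOf_target {p q : Pos} (hA : A p ≠ A q)
    (hpq : ∀ X : Seq r t, X p ≠ X q → S.permOp X (swap p q) = 1)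
    (hB : B = A ∨ B = swap p q • A) : S.capOf B p q = S.capOf A p q := by
  rcases hB with rfl | rfl
  · rfl
  · have := S.permOp_capOf hA (swap p q)
    rw [hpq A hA, one_mul, mul_one, swap_apply_left, swap_apply_right] at this
    rw [this, capOf_symm]
    exact ne_of_mem_pair hA (Or.inr rfl)

section

variable {p q s : Fin (r + t)} (hps : p ≠ s)
  (hpq : ∀ X : Seq r t, X p ≠ X q → S.permOp X (swap p q) = 1)
  (hqs : ∀ X : Seq r t, X q ≠ X s → S.permOp X (swap q s) = 1)

include hps hpq in
theorem capOf_capOf_capOf (hA : A p ≠ A q) (hAB : B = A ∨ B = swap p q • A) (hB : B q ≠ B s)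
    (hBC : C = B ∨ C = swap q s • B) (hC : C p ≠ C q) :
    S.capOf C p q * S.capOf B q s * S.capOf A p q = S.capOf A p q := by
  have hB' := ne_of_mem_pair hA hAB
  rw [← S.capOf_target hA hpq hAB]
  rcases hBC with rfl | rfl
  · have h1 := S.capOf_mul_permOp hB.symm hB'.symm
    have h2 : S.permOp C (swap p s) * S.permOp C (swap p s) = 1 := by
      have := S.permOp_mul C (swap p s) (swap p s)
      rwa [swap_smul_of_eq (C.eq_of_ne_of_ne hB' hB), swap_mul_self, permOp_one] at this
    rw [S.capOf_symm hB.symm, S.capOf_symm hB'.symm, swap_comm] at h1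
    rw [mul_assoc, S.capOf_mul_capOf hB' hB hps, ← mul_assoc, mul_assoc, ← S.capOf_mul_permOp hB' hB,
      ← mul_assoc, ← h1, mul_assoc, S.capOf_mul_capOf hB' hB hps, ← S.capOf_mul_permOp hB' hB,
      ← mul_assoc, h2, one_mul]
  · exfalso
    have hqp : q ≠ p := by rintro rfl; exact hB' rfl
    rw [swap_smul_apply, swap_smul_apply, swap_apply_left,
      swap_apply_of_ne_of_ne hqp.symm hps] at hC
    exact hC (B.eq_of_ne_of_ne hB' hB)

include hps hpq hqs in
theorem capOf_capOf_permOp {A B B' C D : Seq r t} (hAB : B = swap p q • A) (hB : B q ≠ B s)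
    (hBC : C = B ∨ C = swap q s • B) (hC : C p ≠ C q)
    (hCD : D = C ∨ D = swap p q • C) (hAB' : B' = swap q s • A) (hB' : B' p ≠ B' q)
    (hBD : D = B' ∨ D = swap p q • B') :
    S.capOf C p q * S.capOf B q s * S.permOp A (swap p q) =
      S.capOf B' p q * S.permOp A (swap q s) := by
  have hqs' : q ≠ s := by rintro rfl; exact hB rfl
  have hpq' : p ≠ q := by rintro rfl; exact hC rfl
  have hC' := ne_of_mem_pair hB hBC
  rw [← S.capOf_target hB' hpq hBD, S.capOf_target hC hpq hCD, ← S.capOf_target hB hqs hBC]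
  have h1 := S.capOf_mul_capOf hC'.symm hC.symm hps.symm
  rw [S.capOf_symm hC.symm, S.capOf_symm hC'.symm, swap_comm] at h1
  rw [h1, mul_assoc]
  congr 1
  subst hAB hAB'
  rcases hBC with rfl | rfl
  · rw [permOp_mul]
    have h2 := S.permOp_mul A (swap p q) (swap q s)
    rw [hpq _ hB', one_mul] at h2
    rw [h2, swap_braid hqs' hps, mul_assoc, swap_mul_self, mul_one]
  · have h2 := S.permOp_mul A (swap q s) (swap p q)
    rw [hqs _ hB, one_mul] at h2
    rw [h2, ← mul_smul, permOp_mul]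
    congr 1
    rw [swap_comm p s, swap_braid hpq'.symm hps.symm, swap_comm s q, swap_comm q p]
    simp only [mul_assoc]
    rw [← mul_assoc (swap q s) (swap q s), swap_mul_self, one_mul, swap_mul_self, mul_one]

include hps hpq hqs in
theorem permOp_capOf_capOf {A B B' C : Seq r t} (hA : A p ≠ A q)
    (hAB : B = A ∨ B = swap p q • A) (hB : B q ≠ B s)
    (hBC : C = B ∨ C = swap q s • B)
    (hAB' : B' = A ∨ B' = swap p q • A)
    (hD : swap p q • C = swap q s • B') :
    S.permOp C (swap p q) * S.capOf B q s * S.capOf A p q =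
      S.permOp B' (swap q s) * S.capOf A p q := by
  have hqs' : q ≠ s := by rintro rfl; exact hB rfl
  have hpq' : p ≠ q := by rintro rfl; exact hA rfl
  have hBpq := ne_of_mem_pair hA hAB
  have hBps := B.eq_of_ne_of_ne hBpq hB
  have hBB : B' = B ∨ B' = swap p q • B := by
    rcases hAB with rfl | rfl
    · exact hAB'
    · rw [← mul_smul, swap_mul_self, one_smul]
      exact hAB'.symm
  have hps2 : S.permOp B (swap q s) * S.permOp B (swap p s) = S.permOp B (swap q s * swap p s) := by
    have := S.permOp_mul B (swap q s) (swap p s)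
    rwa [swap_smul_of_eq hBps] at this
  have hps1 : S.permOp B (swap p q) * S.permOp B (swap p s) = S.permOp B (swap p q * swap p s) := by
    have := S.permOp_mul B (swap p q) (swap p s)
    rwa [swap_smul_of_eq hBps] at this
  rw [← S.capOf_target hA hpq hAB, mul_assoc, S.capOf_mul_capOf hBpq hB hps,
    ← S.capOf_mul_permOp hBpq hB, ← mul_assoc]
  congr 1
  have hDp := congrArg (fun X : Seq r t => X p) hD
  beta_reduce at hDp
  rcases hBC with rfl | rfl
  · rcases hBB with rfl | rfl
    · exfalso
      rw [swap_smul_apply, swap_smul_apply, swap_apply_left, swap_apply_of_ne_of_ne hpq' hps] at hDp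
      exact hBpq hDp.symm
    · have h2 := S.permOp_mul C (swap q s) (swap p q)
      rw [hpq _ hBpq, mul_one] at h2
      rw [hps1, h2]
      congr 1
      rw [swap_braid hqs' hps, ← mul_assoc, ← mul_assoc, swap_mul_self, one_mul]
  · rcases hBB with rfl | rfl
    · have h2 := S.permOp_mul B' (swap p q) (swap q s)
      rw [hqs _ hB, mul_one] at h2
      rw [h2]
      have := S.permOp_mul B' (swap p q * swap q s) (swap p s)
      rw [swap_smul_of_eq hBps] at this
      rw [this]
      congr 1
      rw [swap_comm p s, swap_braid hpq'.symm hps.symm, swap_comm s q, swap_comm q p]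
      simp only [mul_assoc]
      rw [← mul_assoc (swap q s) (swap q s), swap_mul_self, one_mul,
        ← mul_assoc, swap_mul_self, one_mul]
    · exfalso
      simp only [swap_smul_apply] at hDp
      rw [swap_apply_left, swap_apply_left, swap_apply_of_ne_of_ne hpq' hps, swap_apply_left] at hDp
      exact hB hDp.symm

end

theorem far_ne (h : Far i j) : lo i ≠ lo j ∧ lo i ≠ hi j ∧ hi i ≠ lo j ∧ hi i ≠ hi j := by
  simp only [Far] at h
  simp only [ne_eq, Fin.ext_iff, lo, hi]
  omega

theorem refl_comm_of_far (h : Far i j) : refl i * refl j = refl j * refl i := by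
  obtain ⟨h1, h2, h3, h4⟩ := far_ne h
  rw [refl, refl, mul_swap_eq_swap_mul, swap_apply_of_ne_of_ne h1.symm h3.symm,
    swap_apply_of_ne_of_ne h2.symm h4.symm]

theorem permOp_refl_sq (A : Seq r t) (i : Adj) :
    S.permOp (refl i • A) (refl i) * S.permOp A (refl i) = 1 := by
  rw [permOp_mul, refl_mul_refl, permOp_one]

theorem capOf_target_refl (hA : A (lo i) ≠ A (hi i))
    (hB : B = A ∨ B = refl i • A) : S.capOf B (lo i) (hi i) = S.capOf A (lo i) (hi i) :=
  S.capOf_target hA (fun _ h => S.permOp_refl_of_ne h) hB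

theorem capOf_target_far (h : Far i j) (hA : A (lo i) ≠ A (hi i)) (hB : B = A ∨ B = refl i • A) :
    S.capOf B (lo j) (hi j) = S.capOf A (lo j) (hi j) := by
  obtain ⟨h1, h2, h3, h4⟩ := far_ne h
  rcases hB with rfl | rfl
  · rfl
  · rw [capOf, capOf, refl_smul_of_ne _ h1.symm h3.symm, A.label_refl_smul_far h1.symm h3.symm,
    A.label_refl_smul_far h2.symm h4.symm]

theorem permOp_target_far (h : Far i j) (hA : A (lo i) ≠ A (hi i)) (hB : B = A ∨ B = refl i • A) :
    S.permOp B (refl j) = S.permOp A (refl j) := by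
  obtain ⟨h1, h2, h3, h4⟩ := far_ne h
  rcases hB with rfl | rfl
  · rfl
  · have e1 := S.permOp_mul A (refl j) (refl i)
    have e2 := S.permOp_mul A (refl i) (refl j)
    rw [S.permOp_refl_of_ne hA, mul_one] at e1
    rw [S.permOp_refl_of_ne (A := refl j • A), one_mul] at e2
    · rw [e1, e2, refl_comm_of_far h]
    · rw [refl_smul_of_ne _ h1 h2, refl_smul_of_ne _ h3 h4]
      exact hA

theorem dotOp_target {j : Pos} (h : j ≠ lo i)
    (h' : j ≠ hi i) (hB : B = A ∨ B = refl i • A) : S.dotOp B j = S.dotOp A j := by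
  rcases hB with rfl | rfl
  · rfl
  · exact S.dotOp_refl_smul h h'

theorem seq_smul_of_ne (h : A (lo i) ≠ A (hi i)) : A (hi i) = - A (lo i) := by
  rcases A.eq_one_or (lo i) with h1 | h1 <;> rcases A.eq_one_or (hi i) with h2 | h2 <;>
    simp_all

theorem seq_sq (A : Seq r t) (i : Pos) : A i * A i = 1 := by
  rcases A.eq_one_or i with h | h <;> rw [h] <;> norm_num

/-- The operator of a generating morphism. -/
def evGen : ∀ {A B : Seq r t}, Gen A B → E
  | A, _, Gen.y _ i => A i • S.dotOp A i
  | A, _, Gen.s _ i _ => S.permOp A (refl i)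
  | A, _, Gen.e _ i _ => S.capOf A (lo i) (hi i)
  | A, _, Gen.sHat _ i _ => S.permOp A (refl i)
  | A, _, Gen.eHat _ i _ => S.capOf A (lo i) (hi i)

variable [Algebra ℂ E]

/-- The operator of a formal morphism. -/
def ev : ∀ {A B : Seq r t}, Pre A B → E
  | _, _, Pre.gen g => S.evGen g
  | _, _, Pre.id _ => 1
  | _, _, Pre.mul g f => ev g * ev f
  | _, _, Pre.zero _ _ => 0
  | _, _, Pre.add f g => ev f + ev g
  | _, _, Pre.smul c f => c • ev f

open Pre

theorem ev_isS {f : Pre A B} (h : IsS i f) : S.ev f = S.permOp A (refl i) := by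
  cases h <;> rfl

theorem ev_isE {f : Pre A B} (h : IsE i f) : S.ev f = S.capOf A (lo i) (hi i) := by
  cases h <;> rfl

theorem ev_mul (g : Pre B C) (f : Pre A B) : S.ev (g ⬝ f) = S.ev g * S.ev f := rfl

theorem ev_y (A : Seq r t) (i : Pos) : S.ev (Pre.y A i) = A i • S.dotOp A i := rfl

theorem ev_yPow (A : Seq r t) (i : Pos) (k : ℕ) :
    S.ev (Pre.yPow A i k) = (A i • S.dotOp A i) ^ k := by
  induction k with
  | zero => rw [pow_zero]; rfl
  | succ k ih => rw [pow_succ', ← ih]; rfl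

theorem ev_sub (f g : Pre A B) : S.ev (Pre.sub f g) = S.ev f - S.ev g := by
  change S.ev f + (-1 : ℂ) • S.ev g = _
  rw [neg_one_smul, sub_eq_add_neg]

theorem ev_defRel {ω : ℕ → ℂ} (hω : ∀ k l n, S.cap k l * S.lx k ^ n * S.cap k l = ω n • S.cap k l)
    {f g : Pre A B} (h : DefRel ω f g) : S.ev f = S.ev g := by
  have hperm : ∀ (i : Adj) (X : Seq r t), X (lo i) ≠ X (hi i) →
    S.permOp X (swap (lo i) (hi i)) = 1 := fun i X hX => S.permOp_refl_of_ne hX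
  have hperm' : ∀ (i : Adj) (X : Seq r t), X (hi i) ≠ X (lo i) →
      S.permOp X (swap (hi i) (lo i)) = 1 := fun i X hX => by
    rw [swap_comm]; exact S.permOp_refl_of_ne hX.symm
  cases h with
  | s_sq hf hg =>
    obtain rfl := hf.target_eq
    rw [ev_mul, ev_isS S hf, ev_isS S hg, permOp_refl_sq]; rfl
  | s_s_far hij hf₁ hf₂ hg₁ hg₂ =>
    obtain rfl := hf₂.target_eq
    obtain rfl := hg₂.target_eq
    rw [ev_mul, ev_mul, ev_isS S hf₁, ev_isS S hf₂, ev_isS S hg₁, ev_isS S hg₂, permOp_mul,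
      permOp_mul, refl_comm_of_far hij]
  | @braid i j _ _ _ _ _ _ _ _ _ _ _ _ hij hf₁ hf₂ hf₃ hg₁ hg₂ hg₃ =>
    obtain rfl := hf₃.target_eq
    obtain rfl := hf₂.target_eq
    obtain rfl := hg₃.target_eq
    obtain rfl := hg₂.target_eq
    rw [ev_mul, ev_mul, ev_mul, ev_mul, ev_isS S hf₁, ev_isS S hf₂, ev_isS S hf₃, ev_isS S hg₁,
      ev_isS S hg₂, ev_isS S hg₃, mul_assoc, mul_assoc, permOp_mul, permOp_mul, ← mul_smul,
      ← mul_smul, permOp_mul, permOp_mul]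
    exact congrArg _ (by simpa only [mul_assoc] using refl_braid hij)
  | s_y_far h1 h2 hf =>
    obtain rfl := hf.target_eq
    rw [ev_mul, ev_mul, ev_isS S hf, ev_y, ev_y, mul_smul_comm, smul_mul_assoc,
      S.permOp_dotOp_far h1 h2, refl_smul_of_ne _ h1 h2]
  | e_sq _ i h =>
    change S.capOf A (lo i) (hi i) * S.capOf A (lo i) (hi i) = ω 0 • S.capOf A (lo i) (hi i)
    unfold capOf
    split_ifs
    · simpa using hω (A.label (lo i)) (A.label (hi i)) 0
    · simpa using hω (A.label (hi i)) (A.label (lo i)) 0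
  | e_y_e _ i h k hi0 h1 h2 =>
    change S.capOf A (lo i) (hi i) * S.ev (yPow A (lo i) k) * S.capOf A (lo i) (hi i) =
      ω k • S.capOf A (lo i) (hi i)
    rw [ev_yPow, h1, one_smul, S.dotOp_zero hi0 h1, capOf, if_pos h1, hω]
  | @s_e_far i j _ _ _ _ _ _ _ _ hij hf₁ hf₂ hg₁ hg₂ =>
    obtain ⟨n1, n2, n3, n4⟩ := far_ne hij
    obtain rfl := hg₂.target_eq
    rw [ev_mul, ev_mul, ev_isS S hf₁, ev_isE S hf₂, ev_isE S hg₁, ev_isS S hg₂,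
      S.permOp_target_far (Or.symm hij) hf₂.source_ne hf₂.target, S.permOp_capOf hf₂.source_ne, refl,
      swap_apply_of_ne_of_ne n1.symm n3.symm, swap_apply_of_ne_of_ne n2.symm n4.symm]
  | @e_e_far i j _ _ _ _ _ _ _ _ hij hf₁ hf₂ hg₁ hg₂ =>
    obtain ⟨n1, n2, n3, n4⟩ := far_ne hij
    rw [ev_mul, ev_mul, ev_isE S hf₁, ev_isE S hf₂, ev_isE S hg₁, ev_isE S hg₂,
      S.capOf_target_far (Or.symm hij) hf₂.source_ne hf₂.target,
      S.capOf_target_far hij hg₂.source_ne hg₂.target]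
    exact S.capOf_comm n1 n2 n3 n4
  | @e_y_far i j A B f h1 h2 hf =>
    have h3 : B j = A j := by
      rcases hf.target with rfl | rfl
      · rfl
      · rw [refl_smul_of_ne _ h1 h2]
    rw [ev_mul, ev_mul, ev_isE S hf, ev_y, ev_y, mul_smul_comm, smul_mul_assoc,
      S.dotOp_target h1 h2 hf.target, h3, (S.capOf_commute_dotOp hf.source_ne h1 h2).eq]
  | y_y _ i j =>
    rw [ev_mul, ev_mul, ev_y, ev_y]
    exact (((S.dotOp_commute A i j).smul_left _).smul_right _).eq
  | sHat_e hf hg hg' =>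
    have h := hg.source_ne
    rw [ev_mul, ev_isS S hf.isS, ev_isE S hg, ev_isE S hg', S.permOp_refl_of_ne hf.source_ne,
      one_mul]
  | e_sHat hf hg hf' =>
    rw [ev_mul, ev_isS S hg.isS, ev_isE S hf, ev_isE S hf', S.permOp_refl_of_ne hg.source_ne,
      mul_one, S.capOf_target_refl hg.source_ne (Or.inr hg.isS.target_eq)]
  | @s_e_e i j _ _ _ _ _ _ _ _ _ _ hij hf₁ hf₂ hf₃ hg₁ hg₂ =>
    have hj := lo_eq_hi hij
    have h1 := lo_ne_hi hij
    have hs := hf₂.source_ne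
    have ht := hf₂.target
    have pj := hperm j
    have hD := hf₁.target_eq.symm.trans hg₁.target_eq
    rw [ev_mul, ev_mul, ev_mul, ev_isS S hf₁, ev_isE S hf₂, ev_isE S hf₃, ev_isS S hg₁,
      ev_isE S hg₂]
    rw [refl] at ht hD
    rw [refl] at hD
    rw [refl, refl]
    rw [hj] at hs ht pj hD ⊢
    exact S.permOp_capOf_capOf h1 (hperm i) pj hf₃.source_ne hf₃.target hs ht hg₂.target hD
  | @e_e_s i j _ _ _ _ _ _ _ _ _ _ hij hf₁ hf₂ hf₃ hg₁ hg₂ =>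
    have hj := lo_eq_hi hij
    have h1 := lo_ne_hi hij
    have hs := hf₂.source_ne
    have ht := hf₂.target
    have pj := hperm j
    have hg := hg₂.target_eq
    rw [ev_mul, ev_mul, ev_mul, ev_isE S hf₁, ev_isE S hf₂, ev_isS S hf₃, ev_isE S hg₁,
      ev_isS S hg₂]
    rw [refl] at ht hg
    rw [refl, refl]
    rw [hj] at hs ht pj hg ⊢
    exact S.capOf_capOf_permOp h1 (hperm i) pj hf₃.target_eq hs ht hf₁.source_ne hf₁.target hg
      hg₁.source_ne hg₁.target
  | @e_e_s' i j _ _ _ _ _ _ _ _ _ _ hij hf₁ hf₂ hf₃ hg₁ hg₂ =>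
    have hj := lo_eq_hi hij
    have h1 := lo_ne_hi hij
    have pj := hperm' j
    rw [ev_mul, ev_mul, ev_mul, ev_isE S hf₁, ev_isE S hf₂, ev_isS S hf₃, ev_isE S hg₁,
      ev_isS S hg₂, S.capOf_symm hf₁.source_ne, S.capOf_symm hf₂.source_ne,
      S.capOf_symm hg₁.source_ne, refl, refl, swap_comm (lo j), swap_comm (lo i)]
    have a1 := hf₃.target_eq
    have a2 := hf₂.source_ne.symm
    have a3 := hf₂.target
    have a4 := hf₁.source_ne.symm
    have a5 := hf₁.target
    have a6 := hg₂.target_eq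
    have a7 := hg₁.source_ne.symm
    have a8 := hg₁.target
    rw [refl, swap_comm] at a1 a3 a5 a6 a8
    rw [hj] at pj a1 a4 a5 a7 a8 ⊢
    exact S.capOf_capOf_permOp h1.symm pj (hperm' i) a1 a2 a3 a4 a5 a6 a7 a8
  | @s_e_e' i j _ _ _ _ _ _ _ _ _ _ hij hf₁ hf₂ hf₃ hg₁ hg₂ =>
    have hj := lo_eq_hi hij
    have h1 := lo_ne_hi hij
    have pj := hperm' j
    have hD := hf₁.target_eq.symm.trans hg₁.target_eq
    rw [ev_mul, ev_mul, ev_mul, ev_isS S hf₁, ev_isE S hf₂, ev_isE S hf₃, ev_isS S hg₁,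
      ev_isE S hg₂, S.capOf_symm hf₂.source_ne, S.capOf_symm hf₃.source_ne, refl, refl,
      swap_comm (lo j), swap_comm (lo i)]
    have a1 := hf₃.source_ne.symm
    have a2 := hf₃.target
    have a3 := hf₂.source_ne.symm
    have a4 := hf₂.target
    have a5 := hg₂.target
    rw [refl, swap_comm] at a2 a4 a5
    rw [refl, refl, swap_comm (lo j), swap_comm (lo i)] at hD
    rw [hj] at pj a1 a2 a5 hD ⊢
    exact S.permOp_capOf_capOf h1.symm pj (hperm' i) a1 a2 a3 a4 a5 hD
  | @e_e_e i j _ _ _ _ _ _ _ _ hij hf₁ hf₂ hf₃ hg =>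
    have hj := lo_eq_hi hij
    have h1 := lo_ne_hi hij
    have pj := hperm' j
    rw [ev_mul, ev_mul, ev_isE S hf₁, ev_isE S hf₂, ev_isE S hf₃, ev_isE S hg,
      S.capOf_symm hf₁.source_ne, S.capOf_symm hf₂.source_ne, S.capOf_symm hf₃.source_ne]
    have a1 := hf₃.source_ne.symm
    have a2 := hf₃.target
    have a3 := hf₂.source_ne.symm
    have a4 := hf₂.target
    have a5 := hf₁.source_ne.symm
    rw [refl, swap_comm] at a2 a4
    rw [hj] at pj a1 a2 a5 ⊢
    exact S.capOf_capOf_capOf h1.symm pj a1 a2 a3 a4 a5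
  | @e_e_e' i j _ _ _ _ _ _ _ _ hij hf₁ hf₂ hf₃ hg =>
    have hj := lo_eq_hi hij
    have h1 := lo_ne_hi hij
    rw [ev_mul, ev_mul, ev_isE S hf₁, ev_isE S hf₂, ev_isE S hf₃, ev_isE S hg]
    have a3 := hf₂.source_ne
    have a4 := hf₂.target
    rw [refl] at a4
    rw [hj] at a3 a4 ⊢
    exact S.capOf_capOf_capOf h1 (hperm i) hf₃.source_ne hf₃.target a3 a4 hf₁.source_ne
  | s_y _ i h =>
    rw [ev_sub, ev_mul, ev_mul, ev_y, ev_y, ev_isS S (IsS.s A h), mul_smul_comm, smul_mul_assoc,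
      S.permOp_dotOp_of_eq h, ← h, smul_sub, smul_smul, seq_sq, one_smul, sub_sub_cancel_left]
    change _ = (-1 : ℂ) • (1 : E)
    rw [neg_one_smul]
  | s_y' _ i h =>
    rw [ev_sub, ev_mul, ev_mul, ev_y, ev_y, ev_isS S (IsS.s A h), mul_smul_comm, smul_mul_assoc, ← h]
    have h1 := S.permOp_dotOp_of_eq h
    have h2 := S.permOp_refl_sq A i
    rw [refl_smul_of_eq h] at h2
    have h3 := congrArg (fun z => S.permOp A (refl i) * z * S.permOp A (refl i)) h1
    beta_reduce at h3
    rw [← mul_assoc, h2, one_mul, mul_sub, sub_mul, mul_smul_comm, mul_one, smul_mul_assoc, h2,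
      ← mul_assoc, mul_assoc _ _ (S.permOp A (refl i)), h2, mul_one] at h3
    rw [h3, smul_sub, smul_smul, seq_sq, one_smul, sub_sub_cancel]
    rfl
  | @sHat_y i _ _ f g hf hg =>
    obtain rfl := hf.isS.target_eq
    rw [ev_sub, ev_mul, ev_mul, ev_y, ev_y, ev_isS S hf.isS, ev_isE S hg.isE,
      S.permOp_refl_of_ne hf.source_ne, one_mul, mul_one, refl_smul_hi, ← smul_sub,
      S.dotOp_refl_hi hf.source_ne, smul_smul, seq_sq, one_smul]
  | @sHat_y' i _ _ f g hf hg =>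
    obtain rfl := hf.isS.target_eq
    change _ = (-1 : ℂ) • S.ev g
    rw [ev_sub, ev_mul, ev_mul, ev_y, ev_y, ev_isS S hf.isS, ev_isE S hg.isE,
      S.permOp_refl_of_ne hf.source_ne, one_mul, mul_one, refl_smul_lo, ← smul_sub,
      S.dotOp_refl_lo hf.source_ne, smul_smul, seq_smul_of_ne hf.source_ne, neg_mul, seq_sq, neg_smul,
      one_smul, neg_one_smul]
  | @e_y_add i _ _ f hf =>
    change S.ev f * (S.ev (Pre.y A (lo i)) + S.ev (Pre.y A (hi i))) = 0
    rw [ev_y, ev_y, ev_isE S hf, seq_smul_of_ne hf.source_ne, mul_add, neg_smul, mul_neg,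
      mul_smul_comm, mul_smul_comm, S.capOf_mul_dotOp hf.source_ne, add_neg_cancel]
  | @y_add_e i _ _ f hf =>
    change (S.ev (Pre.y B (lo i)) + S.ev (Pre.y B (hi i))) * S.ev f = 0
    have hB : B (lo i) ≠ B (hi i) := ne_of_mem_pair hf.source_ne hf.target
    rw [ev_y, ev_y, ev_isE S hf, seq_smul_of_ne hB, add_mul, neg_smul, neg_mul,
      smul_mul_assoc, smul_mul_assoc, ← S.capOf_target_refl hf.source_ne hf.target,
      S.dotOp_mul_capOf hB, add_neg_cancel]

theorem ev_rel {ω : ℕ → ℂ} (hω : ∀ k l n, S.cap k l * S.lx k ^ n * S.cap k l = ω n • S.cap k l)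
    {f g : Pre A B} (h : Rel ω f g) : S.ev f = S.ev g := by
  induction h with
  | of h => exact S.ev_defRel hω h
  | refl => rfl
  | symm _ ih => exact ih.symm
  | trans _ _ ih ih' => exact ih.trans ih'
  | mul_congr _ _ ih ih' => exact congrArg₂ (· * ·) ih ih'
  | add_congr _ _ ih ih' => exact congrArg₂ (· + ·) ih ih'
  | smul_congr c _ ih => exact congrArg (c • ·) ih
  | id_mul f => exact one_mul _
  | mul_id f => exact mul_one _
  | mul_assoc => exact mul_assoc _ _ _
  | add_assoc => exact add_assoc _ _ _
  | add_comm => exact add_comm _ _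
  | zero_add => exact zero_add _
  | one_smul => exact one_smul _ _
  | zero_smul => exact zero_smul _ _
  | mul_smul => exact mul_smul _ _ _
  | add_smul => exact add_smul _ _ _
  | smul_add => exact smul_add _ _ _
  | mul_add => exact mul_add _ _ _
  | add_mul => exact add_mul _ _ _
  | mul_smul_comm => exact mul_smul_comm _ _ _
  | smul_mul_assoc => exact smul_mul_assoc _ _ _

end CapSystem

end

section
open Equiv

section

variable {G : Type*} [Group G] (T : ℕ → G)

/-- The descending product `T (j + m - 1) ⋯ T (j + 1) T j`. -/
def descProd : ℕ → ℕ → G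
  | _, 0 => 1
  | j, m + 1 => descProd (j + 1) m * T j

variable {n : ℕ} (hfar : ∀ i j, i + 1 < j → j < n → T i * T j = T j * T i)
  (hbraid : ∀ i, i + 1 < n → T i * T (i + 1) * T i = T (i + 1) * T i * T (i + 1))

include hfar in
theorem commute_descProd {i j m : ℕ} (hij : i + 1 < j) (hm : j + m ≤ n) :
    T i * descProd T j m = descProd T j m * T i := by
  induction m generalizing j with
  | zero => simp [descProd]
  | succ m ih =>
    rw [descProd, ← mul_assoc, ih (by omega) (by omega), mul_assoc, mul_assoc,
      hfar i j hij (by omega)]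

include hfar hbraid in
theorem descProd_mul {i j m : ℕ} (hij : j ≤ i) (him : i + 1 < j + m) (hm : j + m ≤ n) :
    descProd T j m * T (i + 1) = T i * descProd T j m := by
  induction m generalizing j with
  | zero => omega
  | succ m ih =>
    rcases hij.eq_or_lt with rfl | hlt
    · obtain ⟨m, rfl⟩ : ∃ m', m = m' + 1 := ⟨m - 1, by omega⟩
      rw [descProd, descProd, mul_assoc, mul_assoc, ← mul_assoc (T (j + 1)), ← hbraid j (by omega),
        ← mul_assoc, ← mul_assoc, ← commute_descProd T hfar (by omega) (by omega)]
      simp only [mul_assoc]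
    · rw [descProd, mul_assoc, hfar j (i + 1) (by omega) (by omega), ← mul_assoc,
      ih (by omega) (by omega) (by omega), mul_assoc]

include hfar hbraid in
theorem exists_descProd (hsq : ∀ i, i < n → T i * T i = 1) {k : ℕ} (hk : k < n) {g : G}
    (hg : g ∈ Subgroup.closure {x | ∃ i, i < k + 1 ∧ x = T i}) :
    ∃ h ∈ Subgroup.closure {x | ∃ i, i < k ∧ x = T i}, ∃ j m, j + m = k + 1 ∧
      g = h * descProd T j m := by
  have step : ∀ x : G, (∃ h ∈ Subgroup.closure {x | ∃ i, i < k ∧ x = T i}, ∃ j m, j + m = k + 1 ∧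
      x = h * descProd T j m) → ∀ i, i < k + 1 →
      ∃ h ∈ Subgroup.closure {x | ∃ i, i < k ∧ x = T i}, ∃ j m, j + m = k + 1 ∧
        x * T i = h * descProd T j m := by
    rintro _ ⟨h, hh, j, m, hjm, rfl⟩ i hi
    have mem : ∀ i, i < k → h * T i ∈ Subgroup.closure {x | ∃ i, i < k ∧ x = T i} :=
      fun i hi => mul_mem hh (Subgroup.subset_closure ⟨i, hi, rfl⟩)
    rcases lt_or_ge (i + 1) j with h1 | h1
    · exact ⟨h * T i, mem i (by omega), j, m, hjm, by
        rw [mul_assoc, ← commute_descProd T hfar h1 (by omega), mul_assoc]⟩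
    rcases h1.eq_or_lt with rfl | h1
    · exact ⟨h, hh, i, m + 1, by omega, by rw [mul_assoc]; rfl⟩
    rcases (Nat.le_of_lt_succ h1).eq_or_lt with rfl | h2
    · obtain ⟨m, rfl⟩ : ∃ m', m = m' + 1 := ⟨m - 1, by omega⟩
      exact ⟨h, hh, j + 1, m, by omega, by
        rw [descProd, mul_assoc, mul_assoc, hsq j (by omega), mul_one]⟩
    · obtain ⟨i, rfl⟩ : ∃ i', i = i' + 1 := ⟨i - 1, by omega⟩
      exact ⟨h * T i, mem i (by omega), j, m, hjm, by
        rw [mul_assoc, descProd_mul T hfar hbraid (by omega) (by omega) (by omega), mul_assoc]⟩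
  induction hg using Subgroup.closure_induction_right with
  | one => exact ⟨1, one_mem _, k + 1, 0, rfl, by simp [descProd]⟩
  | mul_right x _ y hy ih =>
    obtain ⟨i, hi, rfl⟩ := hy
    exact step x ih i hi
  | mul_inv_cancel x _ y hy ih =>
    obtain ⟨i, hi, rfl⟩ := hy
    rw [inv_eq_of_mul_eq_one_right (hsq i (by omega))]
    exact step x ih i hi

end

/-- The adjacent transpositions of `Fin N`. -/
def adjSwap (N i : ℕ) : Perm (Fin N) :=
  if h : i + 1 < N then swap ⟨i, by omega⟩ ⟨i + 1, h⟩ else 1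

theorem adjSwap_val {N i : ℕ} (h : i + 1 < N) (x : Fin N) :
    (adjSwap N i x).val = if x.val = i then i + 1 else if x.val = i + 1 then i else x.val := by
  rw [adjSwap, dif_pos h, swap_apply_def]
  simp only [Fin.ext_iff]
  split_ifs <;> rfl

theorem adjSwap_sq {N i : ℕ} (h : i + 1 < N) : adjSwap N i * adjSwap N i = 1 := by
  rw [adjSwap, dif_pos h, swap_mul_self]

theorem adjSwap_far {N i j : ℕ} (hij : i + 1 < j) (hj : j + 1 < N) :
    adjSwap N i * adjSwap N j = adjSwap N j * adjSwap N i := by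
  rw [adjSwap, adjSwap, dif_pos hj, dif_pos (by omega), mul_swap_eq_swap_mul,
    swap_apply_of_ne_of_ne, swap_apply_of_ne_of_ne] <;>
  simp only [ne_eq, Fin.mk.injEq] <;> omega

theorem adjSwap_braid {N i : ℕ} (hi : i + 2 < N) : adjSwap N i * adjSwap N (i + 1) * adjSwap N i =
      adjSwap N (i + 1) * adjSwap N i * adjSwap N (i + 1) := by
  rw [adjSwap, adjSwap, dif_pos (show i + 1 < N by omega), dif_pos (show i + 1 + 1 < N by omega)]
  exact swap_braid_eq (by simp) (by simp) (by simp; omega)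

theorem exists_hom_of_coxeter {N : ℕ} {M : Type*} [Group M] (t : ℕ → M)
    (hsq : ∀ i, i + 1 < N → t i * t i = 1)
    (hfar : ∀ i j, i + 1 < j → j + 1 < N → t i * t j = t j * t i)
    (hbraid : ∀ i, i + 2 < N → t i * t (i + 1) * t i = t (i + 1) * t i * t (i + 1)) :
    ∃ π : Perm (Fin N) →* M, ∀ i, i + 1 < N → π (adjSwap N i) = t i := by
  obtain _ | n := N
  · exact ⟨1, fun i hi => by omega⟩
  let T : ℕ → Perm (Fin (n + 1)) × M := fun i => (adjSwap (n + 1) i, t i)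
  have Tsq : ∀ i, i < n → T i * T i = 1 := fun i hi =>
    Prod.ext (adjSwap_sq (by omega)) (hsq i (by omega))
  have Tfar : ∀ i j, i + 1 < j → j < n → T i * T j = T j * T i := fun i j hij hj =>
    Prod.ext (adjSwap_far hij (by omega)) (hfar i j hij (by omega))
  have Tbraid : ∀ i, i + 1 < n → T i * T (i + 1) * T i = T (i + 1) * T i * T (i + 1) := fun i hi =>
    Prod.ext (adjSwap_braid (by omega)) (hbraid i (by omega))
  have fix : ∀ k, k ≤ n → ∀ g ∈ Subgroup.closure {x | ∃ i, i < k ∧ x = T i},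
      ∀ x : Fin (n + 1), k < x.val → g.1 x = x := by
    intro k hk g hg
    induction hg using Subgroup.closure_induction with
    | mem g hg =>
      obtain ⟨i, hi, rfl⟩ := hg
      intro x hx
      apply Fin.ext
      rw [adjSwap_val (by omega), if_neg (by omega), if_neg (by omega)]
    | one => intro x _; rfl
    | mul g g' _ _ ih ih' =>
      intro x hx
      change g.1 (g'.1 x) = x
      rw [ih' x hx, ih x hx]
    | inv g _ ih =>
      intro x hx
      change g.1⁻¹ x = x
      rw [Perm.inv_eq_iff_eq, ih x hx]
  have desc : ∀ m j (h : j + m < n + 1), (descProd T j m).1 ⟨j, by omega⟩ = ⟨j + m, h⟩ := by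
    intro m
    induction m with
    | zero => intro j h; rfl
    | succ m ih =>
      intro j h
      change (descProd T (j + 1) m).1 (adjSwap (n + 1) j ⟨j, by omega⟩) = _
      have : adjSwap (n + 1) j ⟨j, by omega⟩ = ⟨j + 1, by omega⟩ := by
        apply Fin.ext
        rw [adjSwap_val (by omega), if_pos rfl]
      rw [this, ih (j + 1) (by omega)]
      apply Fin.ext
      change j + 1 + m = j + (m + 1)
      omega
  have triv : ∀ k, k ≤ n → ∀ g ∈ Subgroup.closure {x | ∃ i, i < k ∧ x = T i}, g.1 = 1 → g = 1 := by
    intro k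
    induction k with
    | zero =>
      intro _ g hg _
      have : {x | ∃ i, i < 0 ∧ x = T i} = ∅ := by ext; simp
      rw [this, Subgroup.closure_empty] at hg
      exact hg
    | succ k ih =>
      intro hk g hg h1
      obtain ⟨h, hh, j, m, hjm, rfl⟩ := exists_descProd T Tfar Tbraid Tsq (by omega) hg
      have e1 := congrArg (fun σ : Perm (Fin (n + 1)) => σ ⟨j, by omega⟩) h1
      have e2 : h.1 ((descProd T j m).1 ⟨j, by omega⟩) = ⟨j, by omega⟩ := e1
      rw [desc m j (by omega), fix k (by omega) h hh _ (by simp; omega), Fin.mk.injEq] at e2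
      obtain rfl : m = 0 := by omega
      have e3 : h * descProd T j 0 = h := mul_one _
      rw [e3] at h1 ⊢
      exact ih (by omega) h hh h1
  set K := Subgroup.closure {x | ∃ i, i < n ∧ x = T i} with hK
  have surj : ∀ σ, ∃ m, (σ, m) ∈ K := by
    intro σ
    have : σ ∈ Submonoid.closure (Set.range fun i : Fin n ↦ swap i.castSucc i.succ) := by
      rw [Perm.mclosure_swap_castSucc_succ]; exact Submonoid.mem_top σ
    induction this using Submonoid.closure_induction with
    | mem σ hσ =>
      obtain ⟨i, rfl⟩ := hσ
      refine ⟨t i, Subgroup.subset_closure ⟨i, i.isLt, ?_⟩⟩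
      refine Prod.ext ?_ rfl
      change swap i.castSucc i.succ = adjSwap (n + 1) i
      rw [adjSwap, dif_pos (by omega)]
      rfl
    | one => exact ⟨1, one_mem _⟩
    | mul σ τ _ _ ih ih' =>
      obtain ⟨m, hm⟩ := ih
      obtain ⟨m', hm'⟩ := ih'
      exact ⟨m * m', mul_mem hm hm'⟩
  have uniq : ∀ σ m m', (σ, m) ∈ K → (σ, m') ∈ K → m = m' := by
    intro σ m m' h h'
    have := triv n le_rfl _ (mul_mem (inv_mem h) h') (by simp)
    have e : m⁻¹ * m' = 1 := congrArg Prod.snd this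
    rw [inv_mul_eq_one] at e
    exact e
  choose f hf using surj
  refine ⟨MonoidHom.mk' f fun σ τ => uniq _ _ _ (hf _) (mul_mem (hf σ) (hf τ)), fun i hi => ?_⟩
  exact uniq _ _ _ (hf _) (Subgroup.subset_closure ⟨i, by omega, rfl⟩)

end

section
open Module LinearMap Pre

namespace Mor

variable (ω : ℕ → ℂ) {A B C D : Seq r t}

/-- Composition with a formal morphism. -/
def act (f : Pre B C) : Mor ω A B →ₗ[ℂ] Mor ω A C where
  toFun z := comp (mk ω f) z
  map_add' z z' := by
    induction z using Quotient.inductionOn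
    induction z' using Quotient.inductionOn
    exact Quotient.sound (Rel.mul_add _ _ _)
  map_smul' c z := by
    induction z using Quotient.inductionOn
    exact Quotient.sound (Rel.mul_smul_comm _ _ _)

/-- Composition of a formal morphism with a morphism. -/
def coact (f : Pre A B) : Mor ω B C →ₗ[ℂ] Mor ω A C where
  toFun z := comp z (mk ω f)
  map_add' z z' := by
    induction z using Quotient.inductionOn
    induction z' using Quotient.inductionOn
    exact Quotient.sound (Rel.add_mul _ _ _)
  map_smul' c z := by
    induction z using Quotient.inductionOn
    exact Quotient.sound (Rel.smul_mul_assoc _ _ _)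

variable {ω}

theorem act_mk (f : Pre B C) (g : Pre A B) : act ω f (mk ω g) = mk ω (f ⬝ g) := rfl

theorem act_mul (g : Pre C D) (f : Pre B C) (z : Mor ω A B) :
    act ω (g ⬝ f) z = act ω g (act ω f z) := by
  induction z using Quotient.inductionOn
  exact Quotient.sound (Rel.mul_assoc _ _ _)

theorem act_coact {A' : Seq r t} (g : Pre B C) (f : Pre A' A) (z : Mor ω A B) :
    act ω g (coact ω f z) = coact ω f (act ω g z) := by
  induction z using Quotient.inductionOn
  exact Quotient.sound (Rel.symm (Rel.mul_assoc _ _ _))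

theorem act_id (z : Mor ω A B) : act ω (Pre.id B) z = z := by
  induction z using Quotient.inductionOn
  exact Quotient.sound (Rel.id_mul _)

theorem act_add (f g : Pre B C) (z : Mor ω A B) : act ω (Pre.add f g) z = act ω f z + act ω g z := by
  induction z using Quotient.inductionOn
  exact Quotient.sound (Rel.add_mul _ _ _)

theorem act_smul (c : ℂ) (f : Pre B C) (z : Mor ω A B) : act ω (Pre.smul c f) z = c • act ω f z := by
  induction z using Quotient.inductionOn
  exact Quotient.sound (Rel.smul_mul_assoc _ _ _)

theorem act_rel {f g : Pre B C} (h : Rel ω f g) (z : Mor ω A B) : act ω f z = act ω g z := by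
  induction z using Quotient.inductionOn
  exact Quotient.sound (Rel.mul_congr h (Rel.refl _))

theorem act_of {f g : Pre B C} (h : DefRel ω f g) (z : Mor ω A B) : act ω f z = act ω g z :=
  act_rel (Rel.of h) z

theorem act_zero (z : Mor ω A B) : act ω (Pre.zero B C) z = 0 := by
  rw [← act_rel (Rel.zero_smul (Pre.zero B C)), act_smul, zero_smul]

theorem act_sub (f g : Pre B C) (z : Mor ω A B) : act ω (Pre.sub f g) z = act ω f z - act ω g z := by
  rw [Pre.sub, act_add, act_smul, neg_one_smul, sub_eq_add_neg]

theorem act_isS_unique {f g : Pre B C} (hf : IsS i f) (hg : IsS i g)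
    {h : Pre C B} (hh : IsS i h) (z : Mor ω A B) : act ω f z = act ω g z := by
  have h1 : act ω (h ⬝ g) z = z := by rw [act_of (DefRel.s_sq hg hh), act_id]
  have h2 : act ω (f ⬝ h) (act ω g z) = act ω g z := by rw [act_of (DefRel.s_sq hh hf), act_id]
  rw [act_mul] at h1 h2
  rw [h1] at h2
  exact h2

end Mor

theorem exists_isS (i : Adj) (h : C = refl i • B) : ∃ f : Pre B C, IsS i f := by
  by_cases hB : B (lo i) = B (hi i)
  · rw [refl_smul_of_eq hB] at h
    subst h
    exact ⟨_, IsS.s C hB⟩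
  · subst h
    exact ⟨_, IsS.sHat B hB⟩

theorem exists_isSHat (hB : B (lo i) ≠ B (hi i))
    (h : C = refl i • B) : ∃ f : Pre B C, IsSHat i f := by
  subst h
  exact ⟨_, IsSHat.sHat B hB⟩

theorem exists_isE (hB : B (lo i) ≠ B (hi i))
    (h : C = B ∨ C = refl i • B) : ∃ f : Pre B C, IsE i f := by
  rcases h with rfl | rfl
  · exact ⟨_, IsE.e _ hB⟩
  · exact ⟨_, IsE.eHat B hB⟩

instance : DecidableEq (Seq r t) := Classical.decEq _

/-- The sum of all spaces of morphisms with source `A`. -/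
abbrev Tot (ω : ℕ → ℂ) (A : Seq r t) : Type := ∀ B : Seq r t, Mor ω A B

namespace Tot

variable (ω : ℕ → ℂ) (A : Seq r t)

/-- The inclusion of the morphisms from `A` to `B`. -/
def sgl (B : Seq r t) : Mor ω A B →ₗ[ℂ] Tot ω A := single ℂ _ B

instance : Finite (Seq r t) := by
  refine Finite.of_surjective (fun w : Equiv.Perm Pos =>
    (⟨stdSeq r t ∘ w, w, rfl⟩ : Seq r t)) ?_
  rintro ⟨a, w, hw⟩
  exact ⟨w, Subtype.ext hw.symm⟩

/-- The operator of the dotted letter `ṡ_i`. -/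
def S (i : Adj) : End ℂ (Tot ω A) :=
  pi fun C => Mor.act ω
    (Classical.choose (exists_isS i (refl_smul_refl_smul i C).symm)) ∘ₗ proj (refl i • C)

open Classical in
/-- The operator of the letter `e_i`. -/
def E (i : Adj) : End ℂ (Tot ω A) :=
  pi fun C => if h : C (lo i) ≠ C (hi i) then
    Mor.act ω (Pre.gen (Gen.e C i h)) ∘ₗ proj C else 0

/-- The operator of the letter `y_j`, with a sign. -/
def Y (j : Pos) : End ℂ (Tot ω A) :=
  pi fun C => C j • Mor.act ω (Pre.y C j) ∘ₗ proj C

/-- The operator of composition with the letter `y_j` on the right, with a sign. -/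
def Yr (j : Pos) : End ℂ (Tot ω A) :=
  pi fun C => A j • Mor.coact ω (Pre.y A j) ∘ₗ proj C

variable {ω A}

theorem sgl_self (B : Seq r t) (z : Mor ω A B) : sgl ω A B z B = z := Pi.single_eq_same B z

theorem sgl_of_ne (h : C ≠ B) (z : Mor ω A B) : sgl ω A B z C = 0 :=
  Pi.single_eq_of_ne h z

theorem end_ext {F G : End ℂ (Tot ω A)} (h : ∀ B z, F (sgl ω A B z) = G (sgl ω A B z)) : F = G := by
  have := Fintype.ofFinite (Seq r t)
  exact pi_ext fun B z => h B z

theorem S_sgl {f : Pre B C} (hf : IsS i f) (z : Mor ω A B) :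
    S ω A i (sgl ω A B z) = sgl ω A C (Mor.act ω f z) := by
  have hC := hf.target_eq
  obtain rfl : B = refl i • C := by rw [hC, refl_smul_refl_smul]
  funext D
  change Mor.act ω _ (sgl ω A _ z (refl i • D)) = _
  by_cases hD : D = C
  · subst hD
    rw [sgl_self, sgl_self]
    obtain ⟨h, hh⟩ := exists_isS i (rfl : refl i • D = refl i • D)
    exact Mor.act_isS_unique (Classical.choose_spec
      (exists_isS i (refl_smul_refl_smul i D).symm)) hf hh z
  · rw [sgl_of_ne hD, sgl_of_ne, map_zero]
    intro h
    exact hD (MulAction.injective _ h)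

theorem E_sgl (h : B (lo i) ≠ B (hi i)) (z : Mor ω A B) :
    E ω A i (sgl ω A B z) = sgl ω A B (Mor.act ω (Pre.gen (Gen.e B i h)) z) := by
  funext D
  rw [E, pi_apply]
  by_cases hD : D = B
  · subst hD
    rw [dif_pos h, comp_apply, proj_apply, sgl_self, sgl_self]
  · rw [sgl_of_ne hD]
    split_ifs
    · rw [comp_apply, proj_apply, sgl_of_ne hD, map_zero]
    · rfl

theorem E_sgl_of_eq (h : B (lo i) = B (hi i)) (z : Mor ω A B) : E ω A i (sgl ω A B z) = 0 := by
  funext D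
  rw [E, pi_apply]
  by_cases hD : D = B
  · subst hD
    rw [dif_neg (not_not.2 h)]; rfl
  · split_ifs
    · rw [comp_apply, proj_apply, sgl_of_ne hD, map_zero]; rfl
    · rfl

theorem Y_sgl (j : Pos) (z : Mor ω A B) :
    Y ω A j (sgl ω A B z) = sgl ω A B (B j • Mor.act ω (Pre.y B j) z) := by
  funext D
  rw [Y, LinearMap.pi_apply, LinearMap.smul_apply, LinearMap.comp_apply, LinearMap.proj_apply]
  by_cases hD : D = B
  · subst hD
    rw [sgl_self, sgl_self]
  · rw [sgl_of_ne hD, sgl_of_ne hD, map_zero, smul_zero]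

theorem Yr_sgl (j : Pos) (z : Mor ω A B) :
    Yr ω A j (sgl ω A B z) = sgl ω A B (A j • Mor.coact ω (Pre.y A j) z) := by
  funext D
  rw [Yr, LinearMap.pi_apply, LinearMap.smul_apply, LinearMap.comp_apply, LinearMap.proj_apply]
  by_cases hD : D = B
  · subst hD
    rw [sgl_self, sgl_self]
  · rw [sgl_of_ne hD, sgl_of_ne hD, map_zero, smul_zero]

theorem S_sq (i : Adj) : S ω A i * S ω A i = 1 := by
  refine end_ext fun B z => ?_
  obtain ⟨f, hf⟩ := exists_isS i (rfl : refl i • B = refl i • B)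
  obtain ⟨g, hg⟩ := exists_isS i (refl_smul_refl_smul i B).symm
  rw [End.mul_apply, S_sgl hf, S_sgl hg, ← Mor.act_mul, Mor.act_of (DefRel.s_sq hf hg), Mor.act_id]
  rfl

theorem S_far (h : Far i j) : S ω A i * S ω A j = S ω A j * S ω A i := by
  refine end_ext fun B z => ?_
  obtain ⟨f₂, hf₂⟩ := exists_isS j (rfl : refl j • B = refl j • B)
  obtain ⟨f₁, hf₁⟩ := exists_isS i (rfl : refl i • refl j • B = refl i • refl j • B)
  obtain ⟨g₂, hg₂⟩ := exists_isS i (rfl : refl i • B = refl i • B)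
  obtain ⟨g₁, hg₁⟩ := exists_isS j (show refl i • refl j • B = refl j • refl i • B by
    rw [← mul_smul, ← mul_smul, CapSystem.refl_comm_of_far h])
  rw [End.mul_apply, End.mul_apply, S_sgl hf₂, S_sgl hf₁, S_sgl hg₂, S_sgl hg₁,
    ← Mor.act_mul, ← Mor.act_mul, Mor.act_of (DefRel.s_s_far h hf₁ hf₂ hg₁ hg₂)]

theorem S_braid (h : j.val = i.val + 1) :
    S ω A i * S ω A j * S ω A i = S ω A j * S ω A i * S ω A j := by
  refine end_ext fun B z => ?_
  obtain ⟨f₃, hf₃⟩ := exists_isS i (rfl : refl i • B = refl i • B)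
  obtain ⟨f₂, hf₂⟩ := exists_isS j (rfl : refl j • refl i • B = _)
  obtain ⟨f₁, hf₁⟩ := exists_isS i (rfl : refl i • refl j • refl i • B = _)
  obtain ⟨g₃, hg₃⟩ := exists_isS j (rfl : refl j • B = refl j • B)
  obtain ⟨g₂, hg₂⟩ := exists_isS i (rfl : refl i • refl j • B = _)
  obtain ⟨g₁, hg₁⟩ := exists_isS j (show refl i • refl j • refl i • B = refl j • refl i • refl j • B by
    rw [← mul_smul, ← mul_smul, ← mul_smul, ← mul_smul, refl_braid h])
  simp only [End.mul_apply]
  rw [S_sgl hf₃, S_sgl hf₂, S_sgl hf₁, S_sgl hg₃, S_sgl hg₂, S_sgl hg₁,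
    ← Mor.act_mul, ← Mor.act_mul, ← Mor.act_mul, ← Mor.act_mul,
    Mor.act_of (DefRel.braid h hf₁ hf₂ hf₃ hg₁ hg₂ hg₃)]

theorem S_E_far (h : Far i j) : S ω A i * E ω A j = E ω A j * S ω A i := by
  refine end_ext fun B z => ?_
  obtain ⟨h1, h2, h3, h4⟩ := CapSystem.far_ne h
  obtain ⟨f, hf⟩ := exists_isS i (rfl : refl i • B = refl i • B)
  have e1 : (refl i • B) (lo j) = B (lo j) := refl_smul_of_ne B h1.symm h3.symm
  have e2 : (refl i • B) (hi j) = B (hi j) := refl_smul_of_ne B h2.symm h4.symm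
  rw [End.mul_apply, End.mul_apply, S_sgl hf]
  by_cases hB : B (lo j) = B (hi j)
  · rw [E_sgl_of_eq hB, E_sgl_of_eq (by rw [e1, e2, hB]), map_zero]
  · rw [E_sgl hB, E_sgl (by rw [e1, e2]; exact hB), S_sgl hf, ← Mor.act_mul, ← Mor.act_mul,
    Mor.act_of (DefRel.s_e_far h hf (IsE.e B hB) (IsE.e _ _) hf)]

theorem E_E_far (h : Far i j) : E ω A i * E ω A j = E ω A j * E ω A i := by
  refine end_ext fun B z => ?_
  rw [End.mul_apply, End.mul_apply]
  by_cases h1 : B (lo i) = B (hi i) <;> by_cases hj : B (lo j) = B (hi j)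
  · rw [E_sgl_of_eq h1, E_sgl_of_eq hj, map_zero, map_zero]
  · rw [E_sgl_of_eq h1, E_sgl hj, E_sgl_of_eq h1, map_zero]
  · rw [E_sgl_of_eq hj, E_sgl h1, E_sgl_of_eq hj, map_zero]
  · rw [E_sgl h1, E_sgl hj, E_sgl h1, E_sgl hj, ← Mor.act_mul, ← Mor.act_mul,
    Mor.act_of (DefRel.e_e_far h (IsE.e B h1) (IsE.e B hj) (IsE.e B hj) (IsE.e B h1))]

theorem E_sq (i : Adj) : E ω A i * E ω A i = ω 0 • E ω A i := by
  refine end_ext fun B z => ?_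
  rw [End.mul_apply, LinearMap.smul_apply]
  by_cases hi : B (lo i) = B (hi i)
  · rw [E_sgl_of_eq hi, map_zero, smul_zero]
  · rw [E_sgl hi, E_sgl hi, ← Mor.act_mul, Mor.act_of (DefRel.e_sq B i hi), Mor.act_smul, map_smul]

theorem S_E_sgl {f : Pre B C} (hB : B (lo i) ≠ B (hi i))
    (hf : IsE i f) (hC : C = refl i • B) (z : Mor ω A B) :
    S ω A i (E ω A i (sgl ω A B z)) = sgl ω A C (Mor.act ω f z) := by
  obtain ⟨g, hg⟩ := exists_isSHat hB hC
  rw [E_sgl hB, S_sgl hg.isS, ← Mor.act_mul, Mor.act_of (DefRel.sHat_e hg (IsE.e B hB) hf)]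

theorem S_E_self (i : Adj) : S ω A i * E ω A i = E ω A i * S ω A i := by
  refine end_ext fun B z => ?_
  rw [End.mul_apply, End.mul_apply]
  obtain ⟨f, hf⟩ := exists_isS i (rfl : refl i • B = refl i • B)
  by_cases hB : B (lo i) = B (hi i)
  · rw [E_sgl_of_eq hB, S_sgl hf, E_sgl_of_eq, map_zero]
    rw [refl_smul_lo, refl_smul_hi, hB]
  · obtain ⟨g, hg⟩ := exists_isSHat hB (rfl : refl i • B = refl i • B)
    have h' : (refl i • B) (lo i) ≠ (refl i • B) (hi i) := by
      rw [refl_smul_lo, refl_smul_hi]; exact Ne.symm hB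
    rw [S_E_sgl hB (IsE.eHat B hB) rfl, S_sgl hg.isS, E_sgl h', ← Mor.act_mul,
      Mor.act_of (DefRel.e_sHat (IsE.e _ h') hg (IsE.eHat B hB))]

theorem S_E_S (h : j.val = i.val + 1) :
    S ω A j * E ω A i * S ω A j = S ω A i * E ω A j * S ω A i := by
  have hij := lo_eq_hi h
  have hne := lo_ne_hi h
  have hqs : hi i ≠ hi j := hij ▸ (lo_lt_hi j).ne
  have hpq := (lo_lt_hi i).ne
  refine end_ext fun B z => ?_
  simp only [End.mul_apply]
  obtain ⟨f, hf⟩ := exists_isS j (rfl : refl j • B = refl j • B)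
  obtain ⟨g, hg⟩ := exists_isS i (rfl : refl i • B = refl i • B)
  obtain ⟨f', hf'⟩ := exists_isS j (refl_smul_refl_smul j B).symm
  obtain ⟨g', hg'⟩ := exists_isS i (refl_smul_refl_smul i B).symm
  have a1 : (refl j • B) (lo i) = B (lo i) := refl_smul_of_ne B (hij ▸ hpq) hne
  have a2 : (refl j • B) (hi i) = B (hi j) := hij ▸ refl_smul_lo B j
  have a3 : (refl i • B) (lo j) = B (lo i) := hij ▸ refl_smul_hi B i
  have a4 : (refl i • B) (hi j) = B (hi j) := refl_smul_of_ne B hne.symm hqs.symm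
  rw [S_sgl hf, S_sgl hg]
  by_cases hB : B (lo i) = B (hi j)
  · rw [E_sgl_of_eq (by rw [a1, a2, hB]), E_sgl_of_eq (by rw [a3, a4, hB]), map_zero, map_zero]
  have hj : (refl j • B) (lo i) ≠ (refl j • B) (hi i) := by rw [a1, a2]; exact hB
  have hi' : (refl i • B) (lo j) ≠ (refl i • B) (hi j) := by rw [a3, a4]; exact hB
  rw [E_sgl hj, E_sgl hi', S_sgl hf', S_sgl hg']
  congr 1
  by_cases hyz : B (hi i) = B (hi j)
  · have hBj : refl j • B = B := refl_smul_of_eq (hij ▸ hyz)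
    have c1 : (refl i • B) (lo i) ≠ (refl i • B) (hi i) := by
      rw [refl_smul_lo, refl_smul_hi, hyz]; exact Ne.symm hB
    obtain ⟨e, he⟩ := exists_isE (C := refl j • B) c1 (Or.inr (by rw [refl_smul_refl_smul, hBj]))
    have r1 := Mor.act_of (DefRel.e_e_s h he (IsE.e _ hi') hg (IsE.e _ hj) hf) z
    have r2 := Mor.act_of (DefRel.s_e_e' h hf' he (IsE.e _ hi') hg' (IsE.e _ hi')) (Mor.act ω g z)
    simp only [Mor.act_mul] at r1 r2
    rw [← r1, r2]
  · have hxy : B (lo i) = B (hi i) := B.eq_of_ne_of_ne hB (Ne.symm hyz)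
    have hBi : refl i • B = B := refl_smul_of_eq hxy
    have c1 : (refl j • B) (lo j) ≠ (refl j • B) (hi j) := by
      rw [refl_smul_lo, refl_smul_hi, hij]; exact Ne.symm hyz
    obtain ⟨e, he⟩ := exists_isE (C := refl i • B) c1 (Or.inr (by rw [refl_smul_refl_smul, hBi]))
    have r1 := Mor.act_of (DefRel.e_e_s' h he (IsE.e _ hj) hf (IsE.e _ hi') hg) z
    have r2 := Mor.act_of (DefRel.s_e_e h hg' he (IsE.e _ hj) hf' (IsE.e _ hj)) (Mor.act ω f z)
    simp only [Mor.act_mul] at r1 r2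
    rw [← r1, r2]

theorem E_S_E (h : j.val = i.val + 1)
    (hB : B (lo i) ≠ B (hi i)) (hB' : B (hi i) = B (hi j)) (z : Mor ω A B) :
    E ω A i (S ω A j (E ω A i (sgl ω A B z))) = E ω A i (sgl ω A B z) := by
  have hij := lo_eq_hi h
  have hBj : refl j • B = B := refl_smul_of_eq (hij ▸ hB')
  obtain ⟨f, hf⟩ := exists_isS j hBj.symm
  have a3 : (refl i • B) (lo j) = B (lo i) := hij ▸ refl_smul_hi B i
  have hqs : hi i ≠ hi j := hij ▸ (lo_lt_hi j).ne
  have a4 : (refl i • B) (hi j) = B (hi j) := refl_smul_of_ne B (lo_ne_hi h).symm hqs.symm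
  have hi' : (refl i • B) (lo j) ≠ (refl i • B) (hi j) := by rw [a3, a4, ← hB']; exact hB
  have c1 : (refl i • B) (lo i) ≠ (refl i • B) (hi i) := by
    rw [refl_smul_lo, refl_smul_hi]; exact Ne.symm hB
  obtain ⟨g, hg⟩ := exists_isSHat c1 (refl_smul_refl_smul i B).symm
  have e1 := DefRel.s_e_e (ω := ω) h hg.isS (IsE.e _ hi') (IsE.eHat B hB) hf (IsE.e B hB)
  obtain ⟨d, hd⟩ := exists_isE (C := B) c1 (Or.inr (refl_smul_refl_smul i B).symm)
  rw [E_sgl hB, S_sgl hf, E_sgl hB, ← Mor.act_mul f, ← Mor.act_of e1, Mor.act_mul, Mor.act_mul,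
    ← Mor.act_mul _ g, Mor.act_of (DefRel.e_sHat (IsE.e B hB) hg hd), ← Mor.act_mul, ← Mor.act_mul,
    Mor.act_of (DefRel.e_e_e' h hd (IsE.e _ hi')
      (IsE.eHat B hB) (IsE.e B hB))]

end Tot

end

section
open Module Submodule CapSystem Mor Pre

namespace Tot

variable (ω : ℕ → ℂ) (A : Seq r t)

/-- Words of letters, with the number of letters `y`. -/
inductive IsWord : ℕ → Tot ω A → Prop
  | one : IsWord 0 (sgl ω A A (mk ω (Pre.id A)))
  | s {n : ℕ} {v : Tot ω A} (i : Adj) : IsWord n v → IsWord n (S ω A i v)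
  | e {n : ℕ} {v : Tot ω A} (i : Adj) : IsWord n v → IsWord n (E ω A i v)
  | y {n : ℕ} {v : Tot ω A} (j : Pos) : IsWord n v → IsWord (n + 1) (Y ω A j v)

/-- The span of the words with less than `n` letters `y`. -/
def fil (n : ℕ) : Submodule ℂ (Tot ω A) := span ℂ {v | ∃ m, m < n ∧ IsWord ω A m v}

/-- The operators of degree at most `k`. -/
def op (k : ℕ) : Submodule ℂ (End ℂ (Tot ω A)) where
  carrier := {T | ∀ n, ∀ v ∈ fil ω A n, T v ∈ fil ω A (n + k)}
  add_mem' h h' n _ hv := add_mem (h n _ hv) (h' n _ hv)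
  zero_mem' _ _ _ := zero_mem _
  smul_mem' c _ h n _ hv := smul_mem _ c (h n _ hv)

variable {ω A}

theorem fil_mono {m n : ℕ} (h : m ≤ n) : fil ω A m ≤ fil ω A n :=
  span_mono fun _ ⟨k, hk, hv⟩ => ⟨k, hk.trans_le h, hv⟩

theorem IsWord.mem {n m : ℕ} {v : Tot ω A} (h : IsWord ω A n v) (hm : n < m) : v ∈ fil ω A m :=
  subset_span ⟨n, hm, h⟩

theorem fil_zero : fil ω A 0 = ⊥ := by
  rw [eq_bot_iff]
  exact span_le.2 (by rintro _ ⟨m, hm, _⟩; omega)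

theorem mem_op_of {k : ℕ} {T : End ℂ (Tot ω A)}
    (h : ∀ n v, IsWord ω A n v → T v ∈ fil ω A (n + 1 + k)) : T ∈ op ω A k := by
  intro n v hv
  induction hv using span_induction with
  | mem v hv =>
    obtain ⟨m, hm, hv⟩ := hv
    exact fil_mono (by omega) (h m v hv)
  | zero => rw [map_zero]; exact zero_mem _
  | add v w _ _ hv hw => rw [map_add]; exact add_mem hv hw
  | smul c v _ hv => rw [map_smul]; exact smul_mem _ c hv

theorem mul_mem_op {k l : ℕ} {T U : End ℂ (Tot ω A)} (hT : T ∈ op ω A k)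
    (hU : U ∈ op ω A l) : T * U ∈ op ω A (k + l) := fun n v hv => by
  have := hT _ _ (hU n v hv)
  rwa [add_assoc, add_comm l k] at this

theorem one_mem_op : (1 : End ℂ (Tot ω A)) ∈ op ω A 0 := fun _ _ hv => hv

theorem S_mem_op (i : Adj) : S ω A i ∈ op ω A 0 :=
  mem_op_of fun _ _ h => (IsWord.s i h).mem (by omega)

theorem E_mem_op (i : Adj) : E ω A i ∈ op ω A 0 :=
  mem_op_of fun _ _ h => (IsWord.e i h).mem (by omega)

theorem Y_mem_op (j : Pos) : Y ω A j ∈ op ω A 1 :=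
  mem_op_of fun _ _ h => (IsWord.y j h).mem (by omega)

theorem IsWord.eq_sgl {n : ℕ} {v : Tot ω A} (h : IsWord ω A n v) : ∃ B z, v = sgl ω A B z := by
  induction h with
  | one => exact ⟨_, _, rfl⟩
  | s i _ ih =>
    obtain ⟨B, z, rfl⟩ := ih
    obtain ⟨f, hf⟩ := exists_isS i (rfl : refl i • B = refl i • B)
    exact ⟨_, _, S_sgl hf z⟩
  | e i _ ih =>
    obtain ⟨B, z, rfl⟩ := ih
    by_cases h : B (lo i) = B (hi i)
    · exact ⟨B, 0, by rw [E_sgl_of_eq h, map_zero]⟩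
    · exact ⟨_, _, E_sgl h z⟩
  | y j _ ih =>
    obtain ⟨B, z, rfl⟩ := ih
    exact ⟨_, _, Y_sgl j z⟩

theorem Y_comm (i j : Pos) : Y ω A i * Y ω A j = Y ω A j * Y ω A i := by
  refine end_ext fun B z => ?_
  simp only [End.mul_apply, Y_sgl, map_zsmul]
  rw [← act_mul, act_of (DefRel.y_y B i j), act_mul, smul_comm]

theorem S_Y_far {j : Pos} (h : j ≠ lo i) (h' : j ≠ hi i) :
    S ω A i * Y ω A j = Y ω A j * S ω A i := by
  refine end_ext fun B z => ?_
  obtain ⟨f, hf⟩ := exists_isS i (rfl : refl i • B = refl i • B)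
  rw [End.mul_apply, End.mul_apply, Y_sgl, S_sgl hf, S_sgl hf, Y_sgl, map_zsmul,
    ← act_mul, act_of (DefRel.s_y_far h h' hf), act_mul, refl_smul_of_ne B h h']

theorem E_Y_far {j : Pos} (h : j ≠ lo i) (h' : j ≠ hi i) :
    E ω A i * Y ω A j = Y ω A j * E ω A i := by
  refine end_ext fun B z => ?_
  rw [End.mul_apply, End.mul_apply, Y_sgl]
  by_cases hB : B (lo i) = B (hi i)
  · rw [E_sgl_of_eq hB, E_sgl_of_eq hB, map_zero]
  · rw [E_sgl hB, E_sgl hB, Y_sgl, map_zsmul, ← act_mul,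
    act_of (DefRel.e_y_far h h' (IsE.e B hB)), act_mul]

theorem S_Y_lo (i : Adj) : S ω A i * Y ω A (lo i) - Y ω A (hi i) * S ω A i ∈ op ω A 0 := by
  refine mem_op_of fun n v hv => ?_
  obtain ⟨B, z, rfl⟩ := hv.eq_sgl
  rw [LinearMap.sub_apply, End.mul_apply, End.mul_apply, Y_sgl, map_zsmul, map_zsmul]
  by_cases hB : B (lo i) = B (hi i)
  · rw [S_sgl (IsS.s B hB), S_sgl (IsS.s B hB), Y_sgl, map_zsmul, ← hB, ← smul_sub, ← map_sub,
    ← act_mul, ← act_mul, ← act_sub, act_of (DefRel.s_y B i hB), act_smul,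
    act_id, map_smul]
    exact zsmul_mem (smul_mem _ _ (hv.mem (by omega))) _
  · obtain ⟨f, hf⟩ := exists_isSHat hB (rfl : refl i • B = refl i • B)
    rw [S_sgl hf.isS, S_sgl hf.isS, Y_sgl, map_zsmul, refl_smul_hi, ← smul_sub, ← map_sub,
      ← act_mul, ← act_mul, ← act_sub, act_of (DefRel.sHat_y hf (IsEHat.eHat B hB)),
      ← S_E_sgl hB (IsE.eHat B hB) rfl]
    exact zsmul_mem (((hv.e i).s i).mem (by omega)) _

theorem S_Y_hi (i : Adj) : S ω A i * Y ω A (hi i) - Y ω A (lo i) * S ω A i ∈ op ω A 0 := by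
  have h := mul_mem_op (mul_mem_op (S_mem_op (ω := ω) (A := A) i) (S_Y_lo i)) (S_mem_op i)
  rw [mul_sub, sub_mul, ← mul_assoc, S_sq, one_mul, ← mul_assoc, mul_assoc _ (S ω A i) (S ω A i),
    S_sq, mul_one, ← neg_sub] at h
  exact neg_mem_iff.1 h

theorem E_Y_sub (i : Adj) : E ω A i * (Y ω A (lo i) - Y ω A (hi i)) = 0 := by
  refine end_ext fun B z => ?_
  rw [End.mul_apply, LinearMap.sub_apply, Y_sgl, Y_sgl, ← map_sub]
  by_cases hB : B (lo i) = B (hi i)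
  · rw [E_sgl_of_eq hB]; rfl
  · rw [E_sgl hB, seq_smul_of_ne hB, neg_smul, sub_neg_eq_add, ← smul_add, ← act_add,
    map_zsmul, ← act_mul, act_of (DefRel.e_y_add (IsE.e B hB)), act_zero, smul_zero,
    map_zero]
    rfl

theorem Y_sub_E (i : Adj) : (Y ω A (lo i) - Y ω A (hi i)) * E ω A i = 0 := by
  refine end_ext fun B z => ?_
  rw [End.mul_apply]
  by_cases hB : B (lo i) = B (hi i)
  · rw [E_sgl_of_eq hB, map_zero]; rfl
  · rw [E_sgl hB, LinearMap.sub_apply, Y_sgl, Y_sgl, ← map_sub, seq_smul_of_ne hB, neg_smul,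
    sub_neg_eq_add, ← smul_add, ← act_add, ← act_mul,
    act_of (DefRel.y_add_e (IsE.e B hB)), act_zero, smul_zero, map_zero]
    rfl

theorem Y_pow_sgl {j : Pos} (h : B j = 1) (k : ℕ) (z : Mor ω A B) :
    (Y ω A j ^ k) (sgl ω A B z) = sgl ω A B (act ω (Pre.yPow B j k) z) := by
  induction k with
  | zero =>
    change _ = sgl ω A B (act ω (Pre.id B) z)
    rw [act_id]; rfl
  | succ k ih =>
    rw [pow_succ', End.mul_apply, ih, Y_sgl, h, one_smul, ← act_mul]
    rfl

theorem E_Y_pow_E (hi0 : i.val = 0) (h : B (lo i) = 1)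
    (h' : B (hi i) = -1) (k : ℕ) (z : Mor ω A B) :
    E ω A i ((Y ω A (lo i) ^ k) (E ω A i (sgl ω A B z))) = ω k • E ω A i (sgl ω A B z) := by
  have hB : B (lo i) ≠ B (hi i) := by rw [h, h']; decide
  rw [E_sgl hB, Y_pow_sgl h, E_sgl hB, ← act_mul, ← act_mul,
    act_of (DefRel.e_y_e B i hB k hi0 h h'), act_smul, map_smul]

theorem exists_mem_fil_act (f : Pre B C) (z : Mor ω A B)
    (hz : ∃ n, sgl ω A B z ∈ fil ω A n) : ∃ n, sgl ω A C (act ω f z) ∈ fil ω A n := by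
  induction f with
  | @gen B C g =>
    obtain ⟨n, hn⟩ := hz
    cases g with
    | y j =>
      have h := Y_mem_op (ω := ω) (A := A) j n _ hn
      rw [Y_sgl, map_zsmul] at h
      have h2 := zsmul_mem h (B j)
      rw [smul_smul, seq_sq, one_smul] at h2
      exact ⟨_, h2⟩
    | s i h => exact ⟨_, by rw [← S_sgl (IsS.s B h)]; exact S_mem_op i n _ hn⟩
    | e i h => exact ⟨_, by rw [← E_sgl h]; exact E_mem_op i n _ hn⟩
    | sHat i h => exact ⟨_, by rw [← S_sgl (IsS.sHat B h)]; exact S_mem_op i n _ hn⟩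
    | eHat i h =>
      exact ⟨_, by
        rw [← S_E_sgl h (IsE.eHat B h) rfl]
        exact S_mem_op i _ _ (E_mem_op i n _ hn)⟩
  | id => rwa [act_id]
  | mul g f ihg ihf => rw [act_mul]; exact ihg _ (ihf z hz)
  | zero => exact ⟨0, by rw [act_zero, map_zero]; exact zero_mem _⟩
  | add f g ihf ihg =>
    obtain ⟨n, hn⟩ := ihf z hz
    obtain ⟨m, hm⟩ := ihg z hz
    refine ⟨max n m, ?_⟩
    rw [act_add, map_add]
    exact add_mem (fil_mono (le_max_left _ _) hn) (fil_mono (le_max_right _ _) hm)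
  | smul c f ih =>
    obtain ⟨n, hn⟩ := ih z hz
    exact ⟨n, by rw [act_smul, map_smul]; exact smul_mem _ _ hn⟩

theorem exists_mem_fil (z : Mor ω A B) : ∃ n, sgl ω A B z ∈ fil ω A n := by
  induction z using Quotient.inductionOn with
  | h f =>
    have := exists_mem_fil_act f (mk ω (Pre.id A)) ⟨1, IsWord.one.mem one_pos⟩
    rw [act_mk] at this
    have e : mk ω (f ⬝ Pre.id A) = mk ω f := Quotient.sound (Rel.mul_id f)
    rwa [e] at this

theorem S_Yr (i : Adj) (j : Pos) : S ω A i * Yr ω A j = Yr ω A j * S ω A i := by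
  refine end_ext fun B z => ?_
  obtain ⟨f, hf⟩ := exists_isS i (rfl : refl i • B = refl i • B)
  rw [End.mul_apply, End.mul_apply, Yr_sgl, S_sgl hf, S_sgl hf, Yr_sgl, map_zsmul, act_coact]

theorem E_Yr (i : Adj) (j : Pos) : E ω A i * Yr ω A j = Yr ω A j * E ω A i := by
  refine end_ext fun B z => ?_
  rw [End.mul_apply, End.mul_apply, Yr_sgl]
  by_cases hB : B (lo i) = B (hi i)
  · rw [E_sgl_of_eq hB, E_sgl_of_eq hB, map_zero]
  · rw [E_sgl hB, E_sgl hB, Yr_sgl, map_zsmul, act_coact]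

theorem Y_Yr (i j : Pos) : Y ω A i * Yr ω A j = Yr ω A j * Y ω A i := by
  refine end_ext fun B z => ?_
  rw [End.mul_apply, End.mul_apply, Yr_sgl, Y_sgl, Y_sgl, Yr_sgl]
  simp only [map_zsmul, act_coact]
  rw [smul_comm]

theorem Y_one (j : Pos) : Y ω A j (sgl ω A A (mk ω (Pre.id A))) =
    Yr ω A j (sgl ω A A (mk ω (Pre.id A))) := by
  rw [Y_sgl, Yr_sgl]
  congr 2
  exact Quotient.sound ((Rel.mul_id _).trans (Rel.id_mul _).symm)

theorem Yr_mem_op (j : Pos) : Yr ω A j ∈ op ω A 1 := by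
  refine mem_op_of fun n v hv => ?_
  induction hv with
  | one => rw [← Y_one]; exact (IsWord.one.y j).mem (by omega)
  | s i _ ih =>
    rw [← End.mul_apply, ← S_Yr]
    exact S_mem_op i _ _ ih
  | e i _ ih =>
    rw [← End.mul_apply, ← E_Yr]
    exact E_mem_op i _ _ ih
  | y i _ ih =>
    rw [← End.mul_apply, ← Y_Yr]
    exact fil_mono (by omega) (Y_mem_op i _ _ ih)

theorem Yr_comm (i j : Pos) : Yr ω A i * Yr ω A j = Yr ω A j * Yr ω A i := by
  refine end_ext fun B z => ?_
  have key : coact ω (Pre.y A i) (coact ω (Pre.y A j) z) =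
      coact ω (Pre.y A j) (coact ω (Pre.y A i) z) := by
    induction z using Quotient.inductionOn with
    | h z =>
      exact Quotient.sound (s := relSetoid ω A B) ((Rel.mul_assoc _ _ _).trans
        ((Rel.mul_congr (Rel.refl z) (Rel.of (DefRel.y_y A j i))).trans (Rel.mul_assoc _ _ _).symm))
  simp only [End.mul_apply, Yr_sgl, map_zsmul, key]
  rw [smul_comm]

end Tot

end

section
open Equiv Finset Module Submodule Seq Pre

theorem adjSwap_eq_refl (i : Adj) : adjSwap (r + t) i = refl i := by
  rw [adjSwap, dif_pos (by omega)]; rfl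

theorem refl_induction {p : Perm Pos → Prop} (h1 : p 1)
    (hmul : ∀ v w, p v → p w → p (v * w)) (hrefl : ∀ i, p (refl i)) (w : Perm Pos) :
    p w := by
  have key : ∀ (N : ℕ) (p : Perm (Fin N) → Prop), p 1 → (∀ v w, p v → p w → p (v * w)) →
      (∀ i, i + 1 < N → p (adjSwap N i)) → ∀ w, p w := by
    rintro (_ | n) p h1 hmul hrefl w
    · rwa [Subsingleton.elim w 1]
    have : w ∈ Submonoid.closure (Set.range fun i : Fin n ↦ swap i.castSucc i.succ) := by
      rw [Perm.mclosure_swap_castSucc_succ]; exact Submonoid.mem_top w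
    induction this using Submonoid.closure_induction with
    | mem σ hσ =>
      obtain ⟨i, rfl⟩ := hσ
      have := hrefl i (by omega)
      rwa [adjSwap, dif_pos (by omega)] at this
    | one => exact h1
    | mul σ τ _ _ ih ih' => exact hmul _ _ ih ih'
  refine key (r + t) p h1 hmul (fun i hi => ?_) w
  have := adjSwap_eq_refl (r := r) (t := t) ⟨i, by omega⟩
  rw [show adjSwap (r + t) i = _ from this]
  exact hrefl _

namespace Tot

variable (ω : ℕ → ℂ) (A : Seq r t)

theorem exists_perm : ∃ π : Perm Pos →* End ℂ (Tot ω A), ∀ i, π (refl i) = S ω A i := by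
  let t' : ℕ → (End ℂ (Tot ω A))ˣ := fun i =>
    if h : i < r + t - 1 then ⟨S ω A ⟨i, h⟩, S ω A ⟨i, h⟩, S_sq _, S_sq _⟩ else 1
  have ht : ∀ i (h : i < r + t - 1), (t' i : End ℂ (Tot ω A)) = S ω A ⟨i, h⟩ := fun i h => by
    simp only [t', dif_pos h]
  obtain ⟨π, hπ⟩ := exists_hom_of_coxeter (N := r + t) t'
    (fun i hi => Units.ext (by rw [Units.val_mul, ht i (by omega), S_sq]; rfl))
    (fun i j hij hj => Units.ext (by
      rw [Units.val_mul, Units.val_mul, ht i (by omega), ht j (by omega), S_far (Or.inl hij)]))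
    (fun i hi => Units.ext (by
      simp only [Units.val_mul]
      rw [ht i (by omega), ht (i + 1) (by omega), S_braid rfl]))
  refine ⟨(Units.coeHom _).comp π, fun i => ?_⟩
  rw [← adjSwap_eq_refl, MonoidHom.comp_apply, hπ i.val (by omega)]
  exact ht i.val i.isLt

/-- The operators of the permutations. -/
def perm : Perm Pos →* End ℂ (Tot ω A) :=
  Classical.choose (exists_perm ω A)

variable {ω A}

theorem perm_refl (i : Adj) : perm ω A (refl i) = S ω A i :=
  Classical.choose_spec (exists_perm ω A) i

theorem perm_mul_inv (σ : Perm Pos) : perm ω A σ * perm ω A σ⁻¹ = 1 := by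
  rw [← map_mul, mul_inv_cancel, map_one]

theorem perm_inv_mul (σ : Perm Pos) : perm ω A σ⁻¹ * perm ω A σ = 1 := by
  rw [← map_mul, inv_mul_cancel, map_one]

theorem mul_mem_op_left {k : ℕ} {T U : End ℂ (Tot ω A)} (hT : T ∈ op ω A 0)
    (hU : U ∈ op ω A k) : T * U ∈ op ω A k := fun _ _ hv => hT _ _ (hU _ _ hv)

theorem perm_mem_op (σ : Perm Pos) : perm ω A σ ∈ op ω A 0 := by
  induction σ using refl_induction with
  | h1 => rw [map_one]; exact one_mem_op
  | hmul v w hv hw => rw [map_mul]; exact mul_mem_op_left hv hw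
  | hrefl i => rw [perm_refl]; exact S_mem_op i

theorem perm_Yr (σ : Perm Pos) (j : Pos) : perm ω A σ * Yr ω A j = Yr ω A j * perm ω A σ := by
  induction σ using refl_induction with
  | h1 => rw [map_one, one_mul, mul_one]
  | hmul v w hv hw => rw [map_mul, mul_assoc, hw, ← mul_assoc, hv, mul_assoc]
  | hrefl i => rw [perm_refl, S_Yr]

theorem perm_Y (σ : Perm Pos) (j : Pos) :
    perm ω A σ * Y ω A j - Y ω A (σ j) * perm ω A σ ∈ op ω A 0 := by
  induction σ using refl_induction generalizing j with
  | h1 => simp only [map_one, one_mul, mul_one, Perm.one_apply, sub_self, zero_mem]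
  | hmul v w hv hw =>
    have h1 := mul_mem_op_left (perm_mem_op (ω := ω) (A := A) v) (hw j)
    have h2 := mul_mem_op_left (hv (w j)) (perm_mem_op (ω := ω) (A := A) w)
    have := add_mem h1 h2
    rw [map_mul, Perm.mul_apply]
    convert this using 1
    rw [mul_sub, sub_mul]
    simp only [mul_assoc]
    rw [sub_add_sub_cancel]
  | hrefl i =>
    rw [perm_refl, refl, swap_apply_def]
    split_ifs with h1 h2
    · subst h1; exact S_Y_lo i
    · subst h2; exact S_Y_hi i
    · rw [S_Y_far h1 h2, sub_self]; exact zero_mem _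

theorem perm_sgl (σ : Perm Pos) (hC : C = σ • B) (z : Mor ω A B) :
    ∃ z', perm ω A σ (sgl ω A B z) = sgl ω A C z' := by
  induction σ using refl_induction generalizing B C with
  | h1 =>
    obtain rfl : C = B := by rw [hC, one_smul]
    exact ⟨z, by rw [map_one]; rfl⟩
  | hmul v w hv hw =>
    obtain ⟨z', h⟩ := hw rfl z
    obtain ⟨z'', h'⟩ := hv (hC.trans (mul_smul v w B)) z'
    exact ⟨z'', by rw [map_mul, End.mul_apply, h, h']⟩
  | hrefl i =>
    obtain ⟨f, hf⟩ := exists_isS i hC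
    exact ⟨_, by rw [perm_refl, S_sgl hf]⟩

theorem exists_perm_E {i₀ : Adj} (h0 : i₀.val = 0) (i : Adj) :
    ∃ ρ : Perm Pos, ρ (lo i₀) = lo i ∧ ρ (hi i₀) = hi i ∧
      perm ω A ρ * E ω A i₀ = E ω A i * perm ω A ρ := by
  obtain ⟨n, hn⟩ := i
  induction n with
  | zero =>
    obtain rfl : i₀ = ⟨0, hn⟩ := Fin.ext h0
    exact ⟨1, rfl, rfl, by rw [map_one, one_mul, mul_one]⟩
  | succ n ih =>
    obtain ⟨ρ, h1, h2, h3⟩ := ih (by omega)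
    set i : Adj := ⟨n, by omega⟩ with hi_def
    set j : Adj := ⟨n + 1, hn⟩ with hj_def
    have hij : j.val = i.val + 1 := rfl
    have hl := lo_eq_hi hij
    refine ⟨refl i * refl j * ρ, ?_, ?_, ?_⟩
    · rw [Perm.mul_apply, Perm.mul_apply, h1, refl, refl,
      swap_apply_of_ne_of_ne (hl ▸ (lo_lt_hi i).ne) (lo_ne_hi hij), swap_apply_left, hl]
    · rw [Perm.mul_apply, Perm.mul_apply, h2, refl, refl, ← hl, swap_apply_left,
      swap_apply_of_ne_of_ne (lo_ne_hi hij).symm (lo_lt_hi j).ne']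
    · have key : S ω A i * S ω A j * E ω A i = E ω A j * (S ω A i * S ω A j) := by
        have := congrArg (fun x => S ω A i * x * S ω A j) (S_E_S (ω := ω) (A := A) hij)
        beta_reduce at this
        rw [← mul_assoc, ← mul_assoc, mul_assoc _ (S ω A j) (S ω A j), S_sq, mul_one, ← mul_assoc,
          ← mul_assoc, S_sq, one_mul, mul_assoc (E ω A j)] at this
        exact this
      rw [map_mul, map_mul, perm_refl, perm_refl, mul_assoc, h3, ← mul_assoc, key, mul_assoc]

theorem perm_E_of_fix {i₀ : Adj} (h0 : i₀.val = 0) {τ : Perm Pos}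
    (h1 : τ (lo i₀) = lo i₀) (h2 : τ (hi i₀) = hi i₀) :
    perm ω A τ * E ω A i₀ = E ω A i₀ * perm ω A τ := by
  let p : Perm Pos → Prop := fun τ => perm ω A τ * E ω A i₀ = E ω A i₀ * perm ω A τ
  have hp1 : p 1 := by change _ * _ = _ * _; rw [map_one, one_mul, mul_one]
  have hpm : ∀ v w, p v → p w → p (v * w) := fun v w hv hw => by
    change _ * _ = _ * _ at hv hw ⊢
    rw [map_mul, mul_assoc, hw, ← mul_assoc, hv, mul_assoc]
  have hs : ∀ (m : ℕ) (a b : Pos), 1 < a.val → b.val = a.val + m + 1 → p (swap a b) := by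
    intro m
    induction m with
    | zero =>
      intro a b ha hb
      have := S_E_far (ω := ω) (A := A) (i := ⟨a.val, by omega⟩) (j := i₀)
        (Or.inr (by rw [h0]; exact ha))
      rw [← perm_refl] at this
      have e : swap a b = refl ⟨a.val, by omega⟩ := by
        rw [refl]; congr 1; exact Fin.ext hb
      rw [e]; exact this
    | succ m ih =>
      intro a b ha hb
      have e := swap_braid (p := a) (q := ⟨a.val + m + 1, by omega⟩) (s := b)
        (by rw [ne_eq, Fin.ext_iff]; simp only; omega) (by rw [ne_eq, Fin.ext_iff]; omega)
      rw [e]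
      refine hpm _ _ (hpm _ _ (ih a _ ha rfl) ?_) (ih a _ ha rfl)
      have := S_E_far (ω := ω) (A := A) (i := ⟨a.val + m + 1, by omega⟩) (j := i₀)
        (Or.inr (by rw [h0]; simp only; omega))
      rw [← perm_refl] at this
      have e : swap (⟨a.val + m + 1, by omega⟩ : Pos) b = refl ⟨a.val + m + 1, by omega⟩ := by
        rw [refl]; congr 1; exact Fin.ext hb
      rw [e]; exact this
  refine perm_induction_fixing (Q := {lo i₀, hi i₀}) (p := p) hp1 hpm (fun a b ha hb hab => ?_) τ ?_
  · have hval : ∀ x : Pos, x ∉ ({lo i₀, hi i₀} : Set Pos) → 1 < x.val := by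
      intro x hx
      simp only [Set.mem_insert_iff, Set.mem_singleton_iff, not_or, Fin.ext_iff, lo, hi] at hx
      omega
    have ha' := hval a ha
    have hb' := hval b hb
    rcases lt_or_gt_of_ne hab with h | h
    · exact hs (b.val - a.val - 1) a b ha' (by rw [Fin.lt_def] at h; omega)
    · rw [swap_comm]
      exact hs (a.val - b.val - 1) b a hb' (by rw [Fin.lt_def] at h; omega)
  · rintro q (rfl | rfl)
    · exact h1
    · exact h2

theorem perm_E {τ : Perm Pos} (h1 : τ (lo i) = lo j)
    (h2 : τ (hi i) = hi j) : perm ω A τ * E ω A i = E ω A j * perm ω A τ := by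
  obtain ⟨ρ, a1, a2, a3⟩ := exists_perm_E (ω := ω) (A := A) (i₀ := ⟨0, by have := i.isLt; omega⟩) rfl i
  obtain ⟨η, b1, b2, b3⟩ := exists_perm_E (ω := ω) (A := A) (i₀ := ⟨0, by have := i.isLt; omega⟩) rfl j
  have c := perm_E_of_fix (ω := ω) (A := A) (i₀ := ⟨0, by have := i.isLt; omega⟩) rfl (τ := η⁻¹ * τ * ρ)
    (by rw [Perm.mul_apply, Perm.mul_apply, a1, h1, ← b1]; simp)
    (by rw [Perm.mul_apply, Perm.mul_apply, a2, h2, ← b2]; simp)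
  have d : τ = η * (η⁻¹ * τ * ρ) * ρ⁻¹ := by group
  have a4 : E ω A i = perm ω A ρ * E ω A ⟨0, by have := i.isLt; omega⟩ * perm ω A ρ⁻¹ := by
    rw [a3, mul_assoc, perm_mul_inv, mul_one]
  rw [a4, ← mul_assoc, ← mul_assoc, ← map_mul, show τ * ρ = η * (η⁻¹ * τ * ρ) by group, map_mul,
    mul_assoc (perm ω A η), c, ← mul_assoc, b3, mul_assoc, mul_assoc, ← map_mul, ← map_mul]
  congr 2
  group

open Classical in
variable (ω A) in
/-- The operator that connects the positions `p` and `q`. -/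
def arc (p q : Pos) : End ℂ (Tot ω A) :=
  if h : ∃ (σ : Perm Pos) (i : Adj), σ (lo i) = p ∧ σ (hi i) = q then
    perm ω A h.choose * E ω A h.choose_spec.choose * perm ω A h.choose⁻¹ else 0

theorem arc_eq {p q : Pos} {σ : Perm Pos}
    (hp : σ (lo i) = p) (hq : σ (hi i) = q) : arc ω A p q = perm ω A σ * E ω A i * perm ω A σ⁻¹ := by
  have h : ∃ (σ : Perm Pos) (i : Adj), σ (lo i) = p ∧ σ (hi i) = q :=
    ⟨σ, i, hp, hq⟩
  rw [arc, dif_pos h]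
  obtain ⟨h1, h2⟩ := h.choose_spec.choose_spec
  generalize h.choose_spec.choose = j at h1 h2 ⊢
  generalize h.choose = τ at h1 h2 ⊢
  have := perm_E (ω := ω) (A := A) (i := i) (j := j) (τ := τ⁻¹ * σ)
    (by rw [Perm.mul_apply, hp, ← h1]; simp) (by rw [Perm.mul_apply, hq, ← h2]; simp)
  have e : perm ω A σ = perm ω A τ * perm ω A (τ⁻¹ * σ) := by rw [← map_mul]; congr 1; group
  rw [e, mul_assoc (perm ω A τ) _ (E ω A i), this, ← mul_assoc, mul_assoc _ _ (perm ω A σ⁻¹),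
    ← map_mul]
  congr 2
  group

theorem arc_lo_hi (i : Adj) : arc ω A (lo i) (hi i) = E ω A i := by
  rw [arc_eq (p := lo i) (q := hi i) (σ := 1) (i := i) rfl rfl, inv_one, map_one, one_mul, mul_one]

theorem exists_perm_adj {p q : Pos} (h : p ≠ q) :
    ∃ (σ : Perm Pos) (i : Adj), i.val = 0 ∧ σ (lo i) = p ∧ σ (hi i) = q := by
  have hN : 0 < r + t - 1 := by
    have := p.isLt
    have := q.isLt
    have : p.val ≠ q.val := fun e => h (Fin.ext e)
    omega
  obtain ⟨σ, h1, h2⟩ := exists_perm_pair (lo_lt_hi ⟨0, hN⟩).ne h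
  exact ⟨σ, ⟨0, hN⟩, rfl, h1, h2⟩

theorem perm_arc (τ : Perm Pos) {p q : Pos} (h : p ≠ q) :
    perm ω A τ * arc ω A p q = arc ω A (τ p) (τ q) * perm ω A τ := by
  obtain ⟨σ, i, _, hp, hq⟩ := exists_perm_adj h
  rw [arc_eq hp hq, arc_eq (p := τ p) (q := τ q) (σ := τ * σ) (i := i)
    (by rw [Perm.mul_apply, hp]) (by rw [Perm.mul_apply, hq]), map_mul, mul_inv_rev,
    map_mul]
  simp only [mul_assoc]
  rw [perm_inv_mul, mul_one]

theorem arc_symm {p q : Pos} (h : p ≠ q) : arc ω A p q = arc ω A q p := by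
  obtain ⟨σ, i, _, hp, hq⟩ := exists_perm_adj h
  rw [arc_eq hp hq, arc_eq (p := q) (q := p) (σ := σ * refl i) (i := i)
    (by rw [Perm.mul_apply, refl, swap_apply_left, hq])
    (by rw [Perm.mul_apply, refl, swap_apply_right, hp]), map_mul, mul_inv_rev, map_mul,
    show (refl i)⁻¹ = refl i from swap_inv _ _, perm_refl]
  have : S ω A i * E ω A i * S ω A i = E ω A i := by rw [S_E_self, mul_assoc, S_sq, mul_one]
  conv_lhs => rw [← this]
  simp only [mul_assoc]

theorem arc_mem_op (p q : Pos) : arc ω A p q ∈ op ω A 0 := by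
  rw [arc]
  split_ifs with h
  · exact mul_mem_op_left (mul_mem_op_left (perm_mem_op _) (E_mem_op _)) (perm_mem_op _)
  · exact zero_mem _

theorem arc_Yr {p q : Pos} (h : p ≠ q) (j : Pos) :
    arc ω A p q * Yr ω A j = Yr ω A j * arc ω A p q := by
  obtain ⟨σ, i, _, hp, hq⟩ := exists_perm_adj h
  rw [arc_eq hp hq, mul_assoc, perm_Yr, mul_assoc, ← mul_assoc (E ω A i), E_Yr, ← mul_assoc,
    ← mul_assoc, perm_Yr]
  simp only [mul_assoc]

theorem arc_sq {p q : Pos} (h : p ≠ q) : arc ω A p q * arc ω A p q = ω 0 • arc ω A p q := by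
  obtain ⟨σ, i, _, hp, hq⟩ := exists_perm_adj h
  rw [arc_eq hp hq, mul_assoc, ← mul_assoc (perm ω A σ⁻¹), ← mul_assoc (perm ω A σ⁻¹), perm_inv_mul,
    one_mul, mul_assoc, ← mul_assoc (E ω A i), E_sq, smul_mul_assoc, mul_smul_comm, ← mul_assoc]

theorem arc_sgl {p q : Pos} (h : p ≠ q) (z : Mor ω A B) :
    ∃ z', arc ω A p q (sgl ω A B z) = sgl ω A B z' := by
  obtain ⟨σ, i, _, hp, hq⟩ := exists_perm_adj h
  obtain ⟨z', h'⟩ := perm_sgl (ω := ω) σ⁻¹ rfl z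
  rw [arc_eq hp hq, End.mul_apply, End.mul_apply, h']
  by_cases hB : (σ⁻¹ • B) (lo i) = (σ⁻¹ • B) (hi i)
  · exact ⟨0, by rw [E_sgl_of_eq hB, map_zero, map_zero]⟩
  · obtain ⟨z'', h''⟩ := perm_sgl (ω := ω) σ (smul_inv_smul σ B).symm
      (Mor.act ω (Pre.gen (Gen.e (σ⁻¹ • B) i hB)) z')
    exact ⟨z'', by rw [E_sgl hB, h'']⟩

theorem arc_sgl_of_eq {p q : Pos} (h : p ≠ q) (hB : B p = B q) (z : Mor ω A B) :
    arc ω A p q (sgl ω A B z) = 0 := by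
  obtain ⟨σ, i, _, hp, hq⟩ := exists_perm_adj h
  obtain ⟨z', h'⟩ := perm_sgl (ω := ω) σ⁻¹ rfl z
  rw [arc_eq hp hq, End.mul_apply, End.mul_apply, h', E_sgl_of_eq, map_zero]
  rw [smul_apply, smul_apply, inv_inv, hp, hq, hB]

theorem arc_comm {p q p' q' : Pos} (h : p ≠ q) (h' : p' ≠ q') (h1 : p ≠ p') (h2 : p ≠ q')
    (h3 : q ≠ p') (h4 : q ≠ q') : arc ω A p q * arc ω A p' q' = arc ω A p' q' * arc ω A p q := by
  have hN : 2 < r + t - 1 := by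
    have : ({p, q, p', q'} : Finset Pos).card ≤ r + t := by
      simpa using card_le_univ ({p, q, p', q'} : Finset Pos)
    rw [card_insert_of_notMem (by simp [*]), card_insert_of_notMem (by simp [*]),
      card_insert_of_notMem (by simp [*]), card_singleton] at this
    omega
  obtain ⟨σ, hσ⟩ := exists_perm_of_injective
    (f := (![lo ⟨0, by omega⟩, hi ⟨0, by omega⟩, lo ⟨2, hN⟩, hi ⟨2, hN⟩] : Fin 4 → Pos))
    (g := ![p, q, p', q'])
    (by intro a b hab; fin_cases a <;> fin_cases b <;> simp_all [lo, hi])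
    (by intro a b hab; fin_cases a <;> fin_cases b <;> simp_all)
  have e1 := arc_eq (ω := ω) (A := A) (hσ 0) (hσ 1)
  have e2 := arc_eq (ω := ω) (A := A) (hσ 2) (hσ 3)
  have c := E_E_far (ω := ω) (A := A) (i := ⟨0, by omega⟩) (j := ⟨2, hN⟩) (Or.inl (by simp))
  change arc ω A p q = _ at e1
  change arc ω A p' q' = _ at e2
  have m : ∀ x y : End ℂ (Tot ω A), perm ω A σ * x * perm ω A σ⁻¹ *
      (perm ω A σ * y * perm ω A σ⁻¹) = perm ω A σ * (x * y) * perm ω A σ⁻¹ := fun x y => by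
    simp only [mul_assoc]
    rw [← mul_assoc (perm ω A σ⁻¹) (perm ω A σ), perm_inv_mul, one_mul]
  rw [e1, e2, m, m, c]

theorem arc_arc {p q s : Pos} (hpq : p ≠ q) (hqs : q ≠ s) (hps : p ≠ s)
    (hB : B q = B s) (z : Mor ω A B) :
    arc ω A p q (arc ω A p s (sgl ω A B z)) = perm ω A (swap q s) (arc ω A p s (sgl ω A B z)) := by
  by_cases hB' : B p = B s
  · rw [arc_sgl_of_eq hps hB', map_zero, map_zero]
  have hN : 1 < r + t - 1 := by
    have : ({p, q, s} : Finset Pos).card ≤ r + t := by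
      simpa using card_le_univ ({p, q, s} : Finset Pos)
    rw [card_insert_of_notMem (by simp [*]), card_insert_of_notMem (by simp [*]),
      card_singleton] at this
    omega
  set i : Adj := ⟨0, by omega⟩
  set j : Adj := ⟨1, hN⟩
  have hij : j.val = i.val + 1 := rfl
  have hl := lo_eq_hi hij
  obtain ⟨σ, hσ⟩ := exists_perm_of_injective
    (f := (![lo i, hi i, hi j] : Fin 3 → Pos))
    (g := ![p, s, q])
    (by intro a b hab; fin_cases a <;> fin_cases b <;> simp_all [lo, hi, i, j])
    (by intro a b hab; fin_cases a <;> fin_cases b <;> simp_all)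
  have a1 : σ (lo i) = p := hσ 0
  have a2 : σ (hi i) = s := hσ 1
  have a3 : σ (hi j) = q := hσ 2
  obtain ⟨z', h'⟩ := perm_sgl (ω := ω) σ⁻¹ rfl z
  have c1 : (σ⁻¹ • B) (lo i) ≠ (σ⁻¹ • B) (hi i) := by
    rw [smul_apply, smul_apply, inv_inv, a1, a2]; exact hB'
  have c2 : (σ⁻¹ • B) (hi i) = (σ⁻¹ • B) (hi j) := by
    rw [smul_apply, smul_apply, inv_inv, a2, a3]; exact hB.symm
  have key := E_S_E hij c1 c2 z'
  rw [← h', ← arc_lo_hi, ← perm_refl] at key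
  have e1 : arc ω A p s * perm ω A σ = perm ω A σ * arc ω A (lo i) (hi i) := by
    rw [perm_arc σ (lo_lt_hi i).ne, a1, a2]
  have e2 : perm ω A (swap q s) * perm ω A σ = perm ω A σ * perm ω A (refl j) := by
    rw [← map_mul, ← map_mul, refl, mul_swap_eq_swap_mul, hl, a2, a3, swap_comm]
  have key2 := congrArg (perm ω A σ) key
  have e3 : ∀ v, perm ω A σ (perm ω A σ⁻¹ v) = v := fun v => by
    rw [← End.mul_apply, perm_mul_inv]; rfl
  simp only [← End.mul_apply] at key2 e3
  have f : arc ω A p s * perm ω A (swap q s) * arc ω A p s = perm ω A σ *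
      (arc ω A (lo i) (hi i) * perm ω A (refl j) * arc ω A (lo i) (hi i)) * perm ω A σ⁻¹ := by
    have g : ∀ x y : End ℂ (Tot ω A), x * perm ω A σ = y → x = y * perm ω A σ⁻¹ := by
      rintro x _ rfl
      rw [mul_assoc, perm_mul_inv, mul_one]
    refine g _ _ ?_
    rw [mul_assoc, e1, ← mul_assoc, mul_assoc (arc ω A p s), e2, ← mul_assoc, e1]
    simp only [mul_assoc]
  have f' : arc ω A p s = perm ω A σ * arc ω A (lo i) (hi i) * perm ω A σ⁻¹ := by
    rw [← e1, mul_assoc, perm_mul_inv, mul_one]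
  have key3 : (arc ω A p s * perm ω A (swap q s) * arc ω A p s) (sgl ω A B z) =
      arc ω A p s (sgl ω A B z) := by
    rw [f]
    conv_rhs => rw [f']
    simp only [mul_assoc] at key2 ⊢
    exact key2
  have h5 := perm_arc (ω := ω) (A := A) (swap q s) hpq
  rw [swap_apply_of_ne_of_ne hpq hps, swap_apply_left] at h5
  have h6 : perm ω A (swap q s) * perm ω A (swap q s) = 1 := by
    rw [← map_mul, swap_mul_self, map_one]
  have h7 : arc ω A p q = perm ω A (swap q s) * arc ω A p s * perm ω A (swap q s) := by
    rw [mul_assoc, ← h5, ← mul_assoc, h6, one_mul]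
  rw [← End.mul_apply, h7, mul_assoc, mul_assoc, ← mul_assoc (arc ω A p s), End.mul_apply, key3]

theorem arc_Y {p q j : Pos} (h : p ≠ q) (hp : j ≠ p) (hq : j ≠ q) :
    arc ω A p q * Y ω A j - Y ω A j * arc ω A p q ∈ op ω A 0 := by
  obtain ⟨σ, i, _, h1, h2⟩ := exists_perm_adj h
  have e : E ω A i * Y ω A (σ⁻¹ j) = Y ω A (σ⁻¹ j) * E ω A i := by
    refine E_Y_far ?_ ?_
    · rintro e; exact hp (by rw [← h1, ← e]; simp)
    · rintro e; exact hq (by rw [← h2, ← e]; simp)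
  have a := mul_mem_op_left (mul_mem_op_left (perm_mem_op (ω := ω) (A := A) σ) (E_mem_op i)) (perm_Y σ⁻¹ j)
  have b := perm_Y (ω := ω) (A := A) σ (σ⁻¹ j)
  rw [show σ (σ⁻¹ j) = j by simp] at b
  have b' := mul_mem_op b (mul_mem_op_left (E_mem_op (ω := ω) (A := A) i) (perm_mem_op σ⁻¹))
  have c := add_mem a b'
  rw [arc_eq h1 h2]
  convert c using 1
  rw [mul_sub, sub_mul]
  have e' : perm ω A σ * E ω A i * (Y ω A (σ⁻¹ j) * perm ω A σ⁻¹) =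
      perm ω A σ * Y ω A (σ⁻¹ j) * (E ω A i * perm ω A σ⁻¹) := by
    simp only [mul_assoc]
    rw [← mul_assoc (E ω A i), e, mul_assoc]
  rw [e', sub_add_sub_cancel]
  simp only [mul_assoc]

theorem arc_Y_sub {p q : Pos} (h : p ≠ q) : arc ω A p q * (Y ω A p - Y ω A q) ∈ op ω A 0 := by
  obtain ⟨σ, i, _, h1, h2⟩ := exists_perm_adj h
  have a := perm_Y (ω := ω) (A := A) σ⁻¹ p
  have b := perm_Y (ω := ω) (A := A) σ⁻¹ q
  rw [show σ⁻¹ p = lo i by rw [← h1]; simp] at a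
  rw [show σ⁻¹ q = hi i by rw [← h2]; simp] at b
  have c := mul_mem_op_left (mul_mem_op_left (perm_mem_op (ω := ω) (A := A) σ) (E_mem_op i)) (sub_mem a b)
  have d : E ω A i * (Y ω A (lo i) * perm ω A σ⁻¹ - Y ω A (hi i) * perm ω A σ⁻¹) = 0 := by
    rw [← sub_mul, ← mul_assoc, E_Y_sub, zero_mul]
  rw [arc_eq h1 h2]
  convert c using 1
  rw [sub_sub_sub_comm, mul_sub (perm ω A σ * E ω A i), mul_assoc _ (E ω A i) (Y ω A (lo i) * _ - _), d, mul_zero,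
    sub_zero, ← mul_sub, mul_assoc]

theorem Y_sub_arc {p q : Pos} (h : p ≠ q) : (Y ω A p - Y ω A q) * arc ω A p q ∈ op ω A 0 := by
  obtain ⟨σ, i, _, h1, h2⟩ := exists_perm_adj h
  have a := perm_Y (ω := ω) (A := A) σ (lo i)
  have b := perm_Y (ω := ω) (A := A) σ (hi i)
  rw [h1] at a
  rw [h2] at b
  have c := mul_mem_op_left (sub_mem b a) (mul_mem_op_left (E_mem_op (ω := ω) (A := A) i) (perm_mem_op σ⁻¹))
  have d : (perm ω A σ * Y ω A (hi i) - perm ω A σ * Y ω A (lo i)) * E ω A i = 0 := by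
    rw [sub_mul, mul_assoc, mul_assoc, sub_eq_zero.1 ((sub_mul _ _ _).symm.trans (Y_sub_E i)), sub_self]
  rw [arc_eq h1 h2]
  convert c using 1
  rw [sub_sub_sub_comm, ← sub_mul, sub_mul _ _ (E ω A i * _), ← mul_assoc _ (E ω A i), d, zero_mul,
    zero_sub, ← neg_mul, ← neg_mul, neg_sub]
  simp only [mul_assoc]

end Tot

end

section
open Equiv Module LinearMap List Submodule Seq Pre

namespace Tot

variable (ω : ℕ → ℂ) (A : Seq r t)

/-- The diagram without dots that is given by a permutation and a list of caps. -/
def diag (M : List (Pos × Pos)) (κ : Perm Pos) : Tot ω A :=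
  (M.map fun x => arc ω A x.1 x.2).prod (perm ω A κ (sgl ω A A (Mor.mk ω (Pre.id A))))

/-- Lists of disjoint pairs of a position of a `1` and a position of a `-1`. -/
structure IsCaps (B : Seq r t) (M : List (Pos × Pos)) : Prop where
  plus : ∀ x ∈ M, B x.1 = 1
  minus : ∀ x ∈ M, B x.2 = -1
  nodup_plus : (M.map Prod.fst).Nodup
  nodup_minus : (M.map Prod.snd).Nodup

/-- Diagrams without dots with target `B`. -/
def IsDiag (B : Seq r t) (x : Tot ω A) : Prop :=
  ∃ M κ, IsCaps B M ∧ κ • A = B ∧ diag ω A M κ = x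

/-- Diagrams with dots in normal position. -/
def IsForm (B : Seq r t) (n : ℕ) (v : Tot ω A) : Prop :=
  ∃ (L b : List Pos) (x : Tot ω A), (∀ q ∈ L, B q = -1) ∧ (∀ j ∈ b, A j = 1) ∧
    IsDiag ω A B x ∧ L.length + b.length = n ∧
    v = (L.map (Y ω A)).prod ((b.map (Yr ω A)).prod x)

/-- The span of the diagrams in normal position with `n` dots and of the words with fewer dots. -/
def forms (B : Seq r t) (n : ℕ) : Submodule ℂ (Tot ω A) :=
  span ℂ {v | IsForm ω A B n v} ⊔ fil ω A n

variable {ω A}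

theorem diag_cons (x : Pos × Pos) (M : List (Pos × Pos))
    (κ : Perm Pos) : diag ω A (x :: M) κ = arc ω A x.1 x.2 (diag ω A M κ) := by
  rw [diag, map_cons, prod_cons, End.mul_apply]; rfl

theorem diag_nil (κ : Perm Pos) :
    diag ω A [] κ = perm ω A κ (sgl ω A A (Mor.mk ω (Pre.id A))) := rfl

theorem IsCaps.ne {M : List (Pos × Pos)} (h : IsCaps B M) : ∀ x ∈ M, x.1 ≠ x.2 := fun x hx e => by
  have := h.plus x hx
  rw [e, h.minus x hx] at this
  exact absurd this (by decide)

theorem IsCaps.perm {M M' : List (Pos × Pos)} (h : IsCaps B M) (hM : M.Perm M') : IsCaps B M' where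
  plus x hx := h.plus x (hM.mem_iff.2 hx)
  minus x hx := h.minus x (hM.mem_iff.2 hx)
  nodup_plus := (hM.map _).nodup_iff.1 h.nodup_plus
  nodup_minus := (hM.map _).nodup_iff.1 h.nodup_minus

theorem IsCaps.tail {x : Pos × Pos}
    {M : List (Pos × Pos)} (h : IsCaps B (x :: M)) : IsCaps B M where
  plus y hy := h.plus y (mem_cons_of_mem _ hy)
  minus y hy := h.minus y (mem_cons_of_mem _ hy)
  nodup_plus := (nodup_cons.1 h.nodup_plus).2
  nodup_minus := (nodup_cons.1 h.nodup_minus).2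

theorem IsCaps.cons {p q : Pos} {M : List (Pos × Pos)}
    (h : IsCaps B M) (hp : B p = 1) (hq : B q = -1) (hpM : ∀ x ∈ M, x.1 ≠ p)
    (hqM : ∀ x ∈ M, x.2 ≠ q) : IsCaps B ((p, q) :: M) where
  plus y hy := by
    rcases mem_cons.1 hy with rfl | hy
    exacts [hp, h.plus y hy]
  minus y hy := by
    rcases mem_cons.1 hy with rfl | hy
    exacts [hq, h.minus y hy]
  nodup_plus := nodup_cons.2 ⟨fun hm => by
    obtain ⟨x, hx, e⟩ := mem_map.1 hm
    exact hpM x hx e, h.nodup_plus⟩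
  nodup_minus := nodup_cons.2 ⟨fun hm => by
    obtain ⟨x, hx, e⟩ := mem_map.1 hm
    exact hqM x hx e, h.nodup_minus⟩

theorem IsCaps.disjoint {M : List (Pos × Pos)} (h : IsCaps B M) {x : Pos × Pos} (hx : x ∈ M) :
    ∀ y ∈ M.erase x, y.1 ≠ x.1 ∧ y.2 ≠ x.2 := fun y hy => by
  have h' := h.perm (perm_cons_erase hx)
  exact ⟨fun e => (nodup_cons.1 h'.nodup_plus).1 (e ▸ mem_map_of_mem hy),
    fun e => (nodup_cons.1 h'.nodup_minus).1 (e ▸ mem_map_of_mem hy)⟩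

theorem diag_perm_list {M M' : List (Pos × Pos)} (h : IsCaps B M)
    (hM : M.Perm M') (κ : Perm Pos) : diag ω A M κ = diag ω A M' κ := by
  rw [diag, diag, (hM.map _).prod_eq']
  have h1 := pairwise_map.1 h.nodup_plus
  have h2 := pairwise_map.1 h.nodup_minus
  refine pairwise_map.2 ((h1.and h2).imp_of_mem fun {x y} hx hy e => ?_)
  have key : ∀ x ∈ M, ∀ y ∈ M, x.1 ≠ y.2 := fun x hx y hy e => by
    have := h.plus x hx
    rw [e, h.minus y hy] at this
    exact absurd this (by decide)
  exact arc_comm (h.ne x hx) (h.ne y hy) e.1 (key x hx y hy) (key y hy x hx).symm e.2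

theorem diag_front {M : List (Pos × Pos)} (h : IsCaps B M)
    {p q : Pos} (hx : (p, q) ∈ M) (κ : Perm Pos) :
    diag ω A M κ = arc ω A p q (diag ω A (M.erase (p, q)) κ) := by
  rw [diag_perm_list h (perm_cons_erase hx), diag_cons]

theorem IsCaps.erase {M : List (Pos × Pos)} (h : IsCaps B M)
    {x : Pos × Pos} (hx : x ∈ M) : IsCaps B (M.erase x) :=
  (h.perm (perm_cons_erase hx)).tail

theorem diag_eq_sgl {M : List (Pos × Pos)} (h : IsCaps B M)
    {κ : Perm Pos} (hκ : κ • A = B) : ∃ z, diag ω A M κ = sgl ω A B z := by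
  induction M with
  | nil => exact perm_sgl κ hκ.symm _
  | cons x M ih =>
    obtain ⟨z, hz⟩ := ih h.tail
    rw [diag_cons, hz]
    exact arc_sgl (h.ne x mem_cons_self) z

theorem perm_diag {M : List (Pos × Pos)} (h : IsCaps B M) (τ κ : Perm Pos) :
    perm ω A τ (diag ω A M κ) = diag ω A (M.map (Prod.map τ τ)) (τ * κ) := by
  induction M with
  | nil => rw [map_nil, diag_nil, diag_nil, map_mul, End.mul_apply]
  | cons x M ih =>
    rw [map_cons, diag_cons, diag_cons, ← ih h.tail, ← End.mul_apply,
      perm_arc τ (h.ne x mem_cons_self), End.mul_apply]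
    rfl

theorem IsDiag.perm {x : Tot ω A} (h : IsDiag ω A B x) (τ : Perm Pos) :
    IsDiag ω A (τ • B) (perm ω A τ x) := by
  obtain ⟨M, κ, hM, rfl, rfl⟩ := h
  refine ⟨_, τ * κ, ⟨?_, ?_, ?_, ?_⟩, mul_smul _ _ _, (perm_diag hM τ κ).symm⟩
  · simp only [mem_map]
    rintro _ ⟨x, hx, rfl⟩
    rw [Prod.map_fst, smul_apply_apply, hM.plus x hx]
  · simp only [mem_map]
    rintro _ ⟨x, hx, rfl⟩
    rw [Prod.map_snd, smul_apply_apply, hM.minus x hx]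
  · have := hM.nodup_plus.map τ.injective
    rw [map_map] at this ⊢
    exact this
  · have := hM.nodup_minus.map τ.injective
    rw [map_map] at this ⊢
    exact this

theorem diag_mem_fil (M : List (Pos × Pos)) (κ : Perm Pos) : diag ω A M κ ∈ fil ω A 1 := by
  induction M with
  | nil => exact perm_mem_op κ _ _ (IsWord.one.mem one_pos)
  | cons x M ih => rw [diag_cons]; exact arc_mem_op _ _ _ _ ih

theorem IsDiag.mem_fil {x : Tot ω A} (h : IsDiag ω A B x) : x ∈ fil ω A 1 := by
  obtain ⟨M, κ, _, _, rfl⟩ := h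
  exact diag_mem_fil M κ

theorem IsDiag.eq_sgl {x : Tot ω A} (h : IsDiag ω A B x) : ∃ z, x = sgl ω A B z := by
  obtain ⟨M, κ, hM, hκ, rfl⟩ := h
  exact diag_eq_sgl hM hκ

theorem IsDiag.mem_forms {x : Tot ω A} (h : IsDiag ω A B x) : x ∈ forms ω A B 0 :=
  mem_sup_left (subset_span ⟨[], [], x, by simp, by simp, h, rfl, rfl⟩)

theorem fil_le_forms (B : Seq r t) (n : ℕ) : fil ω A n ≤ forms ω A B n := le_sup_right

theorem map_forms {k n m : ℕ} {T : End ℂ (Tot ω A)} (hT : T ∈ op ω A k)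
    (hm : n + k ≤ m) (h : ∀ v, IsForm ω A B n v → T v ∈ forms ω A C m) {v : Tot ω A}
    (hv : v ∈ forms ω A B n) : T v ∈ forms ω A C m := by
  have : forms ω A B n ≤ (forms ω A C m).comap T :=
    sup_le (span_le.2 h) fun w hw => fil_le_forms C m (fil_mono hm (hT n w hw))
  exact this hv

theorem mem_forms_of_sub {n : ℕ} {v w : Tot ω A} (h : v - w ∈ fil ω A n)
    (hw : w ∈ forms ω A B n) : v ∈ forms ω A B n := by
  have := add_mem (fil_le_forms B n h) hw
  rwa [sub_add_cancel] at this

theorem prod_Y_Yr (L : List Pos) (j : Pos) : Commute (L.map (Y ω A)).prod (Yr ω A j) :=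
  (Commute.list_prod_right _ _ fun x hx => by
    obtain ⟨i, _, rfl⟩ := mem_map.1 hx
    exact (Y_Yr i j).symm).symm

theorem prod_Y_Y (L : List Pos) (j : Pos) : Commute (L.map (Y ω A)).prod (Y ω A j) :=
  (Commute.list_prod_right _ _ fun x hx => by
    obtain ⟨i, _, rfl⟩ := mem_map.1 hx
    exact Y_comm j i).symm

theorem Yr_forms {n : ℕ} {j : Pos} (hj : A j = 1) {v : Tot ω A}
    (hv : v ∈ forms ω A B n) : Yr ω A j v ∈ forms ω A B (n + 1) := by
  refine map_forms (Yr_mem_op j) le_rfl (fun v hv => ?_) hv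
  obtain ⟨L, b, x, hL, hb, hx, hn, rfl⟩ := hv
  refine mem_sup_left (subset_span ⟨L, j :: b, x, hL, ?_, hx, ?_, ?_⟩)
  · exact forall_mem_cons.2 ⟨hj, hb⟩
  · rw [length_cons]; omega
  · rw [map_cons, prod_cons, End.mul_apply, ← End.mul_apply, ← (prod_Y_Yr L j).eq, End.mul_apply]

theorem Y_forms_of_neg {n : ℕ} {q : Pos} (hq : B q = -1) {v : Tot ω A}
    (hv : v ∈ forms ω A B n) : Y ω A q v ∈ forms ω A B (n + 1) := by
  refine map_forms (Y_mem_op q) le_rfl (fun v hv => ?_) hv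
  obtain ⟨L, b, x, hL, hb, hx, hn, rfl⟩ := hv
  refine mem_sup_left (subset_span ⟨q :: L, b, x, ?_, hb, hx, ?_, ?_⟩)
  · exact forall_mem_cons.2 ⟨hq, hL⟩
  · rw [length_cons]; omega
  · rw [map_cons, prod_cons, End.mul_apply]

theorem prod_Y_forms {n : ℕ} {L : List Pos} (hL : ∀ q ∈ L, B q = -1)
    {v : Tot ω A} (hv : v ∈ forms ω A B n) :
    (L.map (Y ω A)).prod v ∈ forms ω A B (n + L.length) := by
  induction L with
  | nil => exact hv
  | cons q L ih =>
    rw [map_cons, prod_cons, End.mul_apply]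
    exact Y_forms_of_neg (hL q mem_cons_self) (ih fun q hq => hL q (mem_cons_of_mem _ hq))

theorem prod_Y_mem_fil (L : List Pos) {n : ℕ} {v : Tot ω A} (hv : v ∈ fil ω A n) :
    (L.map (Y ω A)).prod v ∈ fil ω A (n + L.length) := by
  induction L with
  | nil => exact hv
  | cons q L ih =>
    rw [map_cons, prod_cons, End.mul_apply]
    exact Y_mem_op q _ _ ih

theorem forms_of_commute {k n : ℕ} {T : End ℂ (Tot ω A)} (hT : T ∈ op ω A k)
    (hc : ∀ j, T * Yr ω A j = Yr ω A j * T)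
    (h : ∀ (L : List Pos) x, (∀ q ∈ L, B q = -1) → IsDiag ω A B x →
      T ((L.map (Y ω A)).prod x) ∈ forms ω A C (L.length + k)) {v : Tot ω A}
    (hv : v ∈ forms ω A B n) : T v ∈ forms ω A C (n + k) := by
  refine map_forms hT le_rfl (fun v hv => ?_) hv
  obtain ⟨L, b, x, hL, hb, hx, rfl, rfl⟩ := hv
  rw [add_right_comm]
  clear hv
  induction b with
  | nil => exact h L x hL hx
  | cons j b ih =>
    rw [map_cons, prod_cons, End.mul_apply,
      ← End.mul_apply (L.map (Y ω A)).prod, (prod_Y_Yr L j).eq, End.mul_apply,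
      ← End.mul_apply T, hc, End.mul_apply]
    exact Yr_forms (hb j mem_cons_self) (ih fun q hq => hb q (mem_cons_of_mem _ hq))

theorem perm_forms (τ : Perm Pos) {n : ℕ} {v : Tot ω A}
    (hv : v ∈ forms ω A B n) : perm ω A τ v ∈ forms ω A (τ • B) n := by
  refine forms_of_commute (k := 0) (perm_mem_op τ) (perm_Yr τ) (fun L x hL hx => ?_) hv
  induction L with
  | nil => exact (hx.perm τ).mem_forms
  | cons q L ih =>
    rw [map_cons, prod_cons, End.mul_apply]
    have h1 := perm_Y τ q _ _ (prod_Y_mem_fil L hx.mem_fil)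
    refine mem_forms_of_sub (fil_mono (by simp; omega) h1) ?_
    refine Y_forms_of_neg (n := L.length + 0) ?_ (ih fun q hq => hL q (mem_cons_of_mem _ hq))
    rw [smul_apply_apply]
    exact hL q mem_cons_self

theorem Y_diag {M : List (Pos × Pos)} (h : IsCaps B M) {κ : Perm Pos} {j : Pos} (hj : B j = 1)
    (hM : ∀ x ∈ M, x.1 ≠ j) :
    Y ω A j (diag ω A M κ) - Yr ω A (κ⁻¹ j) (diag ω A M κ) ∈ fil ω A 1 := by
  induction M with
  | nil =>
    have h1 := perm_Y (ω := ω) (A := A) κ (κ⁻¹ j) _ _ (IsWord.one.mem one_pos)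
    rw [show κ (κ⁻¹ j) = j by simp, LinearMap.sub_apply, End.mul_apply, Y_one,
      ← End.mul_apply, perm_Yr, ← neg_mem_iff, neg_sub] at h1
    exact h1
  | cons x M ih =>
    have hx := h.ne x List.mem_cons_self
    have h1 := arc_Y (ω := ω) (A := A) hx (hM x List.mem_cons_self).symm
      (fun e => absurd ((h.minus x List.mem_cons_self).symm.trans (e ▸ hj)) (by decide)) _ _
      (diag_mem_fil M κ)
    have h2 := arc_mem_op (ω := ω) (A := A) x.1 x.2 _ _ (ih h.tail fun y hy => hM y (List.mem_cons_of_mem _ hy))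
    have h3 := sub_mem h2 h1
    rw [diag_cons]
    convert h3 using 1
    simp only [map_sub, LinearMap.sub_apply, End.mul_apply]
    rw [← End.mul_apply _ (Yr ω A _), arc_Yr hx, End.mul_apply]
    abel

theorem pow_sub_pow_mem {Y Z : End ℂ (Tot ω A)} (hY : Y ∈ op ω A 1) (hZ : Z ∈ op ω A 1)
    (hc : Commute Y Z) {x : Tot ω A} (h : Y x - Z x ∈ fil ω A 1) (c : ℕ) :
    (Y ^ c) x - (Z ^ c) x ∈ fil ω A c := by
  have hp : ∀ c, Y ^ c ∈ op ω A c := fun c => by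
    induction c with
    | zero => exact one_mem_op
    | succ c ih => rw [pow_succ]; exact mul_mem_op ih hY
  induction c with
  | zero => rw [pow_zero, pow_zero, sub_self]; exact zero_mem _
  | succ c ih =>
    have h1 := hp c _ _ h
    have h2 := hZ _ _ ih
    rw [add_comm 1 c] at h1
    have h3 := add_mem h1 h2
    convert h3 using 1
    rw [pow_succ, pow_succ', map_sub, map_sub, ← End.mul_apply Z (Y ^ c), ← (hc.pow_left c).eq]
    simp only [End.mul_apply]
    abel

theorem arc_pow_sub_pow_mem {p q : Pos} (h : p ≠ q) (c n : ℕ) {v : Tot ω A}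
    (hv : v ∈ fil ω A (n + 1)) :
    arc ω A p q ((Y ω A p ^ c) v) - arc ω A p q ((Y ω A q ^ c) v) ∈ fil ω A (n + c) := by
  induction c generalizing n v with
  | zero => rw [pow_zero, pow_zero, sub_self]; exact zero_mem _
  | succ c ih =>
    have hp : ∀ c, Y ω A q ^ c ∈ op ω A c := fun c => by
      induction c with
      | zero => exact one_mem_op
      | succ c ih => rw [pow_succ]; exact mul_mem_op ih (Y_mem_op q)
    have h1 := arc_Y_sub h _ _ (hp c _ _ hv)
    have h2 := ih (n + 1) (Y_mem_op p _ _ hv)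
    have h3 := add_mem (fil_mono (by omega) h1 : _ ∈ fil ω A (n + (c + 1)))
      (fil_mono (by omega) h2)
    convert h3 using 1
    have e : Y ω A p * Y ω A q ^ c = Y ω A q ^ c * Y ω A p :=
      (Commute.pow_right (Y_comm p q : Commute (Y ω A p) (Y ω A q)) c).eq
    rw [pow_succ, pow_succ', mul_sub, LinearMap.sub_apply, End.mul_apply (arc ω A p q),
      ← End.mul_apply (Y ω A p), e]
    simp only [End.mul_apply]
    abel

theorem arc_pow_arc_mem {p q : Pos} (hp : B p = 1) (hq : B q = -1) (c : ℕ)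
    {x : Tot ω A} (hx : ∃ z, x = sgl ω A B z) (hx' : x ∈ fil ω A 1) :
    arc ω A p q ((Y ω A p ^ (c + 1)) (arc ω A p q x)) ∈ fil ω A (c + 1) := by
  have h : p ≠ q := fun e => by rw [e, hq] at hp; exact absurd hp (by decide)
  obtain ⟨σ, i, h0, h1, h2⟩ := exists_perm_adj h
  obtain ⟨z, rfl⟩ := hx
  obtain ⟨z', h'⟩ := perm_sgl (ω := ω) σ⁻¹ rfl z
  set u := E ω A i (perm ω A σ⁻¹ (sgl ω A B z)) with hu
  have hu1 : u ∈ fil ω A 1 := E_mem_op i _ _ (perm_mem_op σ⁻¹ _ _ hx')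
  have hx1 : arc ω A p q (sgl ω A B z) = perm ω A σ u := by rw [arc_eq h1 h2]; rfl
  have hpow : ∀ c, (Y ω A (lo i) ^ c) u ∈ fil ω A (1 + c) := fun c => by
    induction c with
    | zero => exact hu1
    | succ c ih => rw [pow_succ', End.mul_apply]; exact Y_mem_op _ _ _ ih
  have key : ∀ c, (Y ω A p ^ c) (perm ω A σ u) - perm ω A σ ((Y ω A (lo i) ^ c) u) ∈ fil ω A c := by
    intro c
    induction c with
    | zero => rw [pow_zero, pow_zero]; exact (sub_self (perm ω A σ u)).symm ▸ zero_mem _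
    | succ c ih =>
      have a := Y_mem_op p _ _ ih
      have b := perm_Y σ (lo i) _ _ (hpow c)
      rw [h1] at b
      have d := sub_mem a (fil_mono (by omega) b : _ ∈ fil ω A (c + 1))
      convert d using 1
      rw [pow_succ', pow_succ', map_sub]
      simp only [LinearMap.sub_apply, End.mul_apply]
      abel
  have a := arc_mem_op p q _ _ (key (c + 1))
  rw [hx1]
  have hE := E_Y_pow_E h0 (B := σ⁻¹ • B) (by rw [Seq.smul_apply, inv_inv, h1, hp])
    (by rw [Seq.smul_apply, inv_inv, h2, hq]) (c + 1) z'
  rw [← h', ← hu] at hE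
  have b : arc ω A p q (perm ω A σ ((Y ω A (lo i) ^ (c + 1)) u)) ∈ fil ω A (c + 1) := by
    rw [arc_eq h1 h2, ← End.mul_apply, mul_assoc, perm_inv_mul, mul_one, End.mul_apply,
      hE, map_smul]
    exact Submodule.smul_mem _ _ (fil_mono (by omega) (perm_mem_op σ _ _ hu1))
  have d := add_mem a b
  rwa [map_sub, sub_add_cancel] at d

theorem arc_diag {x : Tot ω A} (h : IsDiag ω A B x) {p q : Pos} (hp : B p = 1)
    (hq : B q = -1) : arc ω A p q x ∈ forms ω A B 0 := by
  have hpq : ∀ {a b}, B a = 1 → B b = -1 → a ≠ b := fun ha hb e => by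
    rw [e, hb] at ha; exact absurd ha (by decide)
  obtain ⟨M, κ, hM, hκ, rfl⟩ := h
  have hdiag : IsDiag ω A B (diag ω A M κ) := ⟨M, κ, hM, hκ, rfl⟩
  by_cases h1 : ∃ x ∈ M, x.1 = p
  · obtain ⟨⟨p, q'⟩, hx, rfl⟩ := h1
    have hq' := hM.minus _ hx
    by_cases e : q' = q
    · subst e
      rw [diag_front hM hx, ← End.mul_apply, arc_sq (hpq hp hq), LinearMap.smul_apply,
        ← diag_front hM hx]
      exact smul_mem _ _ hdiag.mem_forms
    · have h2 := hdiag.perm (swap q q')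
      obtain ⟨z, hz⟩ := diag_eq_sgl (ω := ω) (hM.erase hx) hκ
      rw [swap_smul_of_eq (hq.trans hq'.symm)] at h2
      rw [diag_front hM hx, hz] at h2 ⊢
      rw [arc_arc (hpq hp hq) (Ne.symm e) (hpq hp hq') (hq.trans hq'.symm)]
      exact h2.mem_forms
  by_cases h2 : ∃ x ∈ M, x.2 = q
  · obtain ⟨⟨p', q⟩, hx, rfl⟩ := h2
    have hp' := hM.plus _ hx
    have e : p' ≠ p := fun e => h1 ⟨_, hx, e⟩
    have h2 := hdiag.perm (swap p p')
    obtain ⟨z, hz⟩ := diag_eq_sgl (ω := ω) (hM.erase hx) hκ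
    rw [swap_smul_of_eq (hp.trans hp'.symm)] at h2
    rw [diag_front hM hx, hz, arc_symm (hpq hp' hq)] at h2 ⊢
    rw [arc_symm (hpq hp hq), arc_arc (hpq hp hq).symm e.symm (hpq hp' hq).symm (hp.trans hp'.symm)]
    exact h2.mem_forms
  · push Not at h1 h2
    exact IsDiag.mem_forms ⟨(p, q) :: M, κ, hM.cons hp hq h1 h2, hκ, diag_cons _ _ _⟩

theorem Yr_pow_forms {n : ℕ} {j : Pos} (hj : A j = 1) (c : ℕ) {v : Tot ω A}
    (hv : v ∈ forms ω A B n) : (Yr ω A j ^ c) v ∈ forms ω A B (n + c) := by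
  induction c with
  | zero => exact hv
  | succ c ih => rw [pow_succ', End.mul_apply]; exact Yr_forms hj ih

theorem arc_Y_forms {p q l : Pos} (hp : B p = 1) (hq : B q = -1)
    (hl : B l = -1) (hlq : l ≠ q) {n : ℕ} {v : Tot ω A} (hv : v ∈ fil ω A (n + 1))
    (h : arc ω A p q v ∈ forms ω A B n) : arc ω A p q (Y ω A l v) ∈ forms ω A B (n + 1) :=
  mem_forms_of_sub (arc_Y (fun e => by rw [e, hq] at hp; exact absurd hp (by decide))
    (fun e => by rw [e, hp] at hl; exact absurd hl (by decide)) hlq _ _ hv) (Y_forms_of_neg hl h)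

theorem arc_Y_pow_diag {x : Tot ω A} (h : IsDiag ω A B x) {p q : Pos}
    (hp : B p = 1) (hq : B q = -1) (c : ℕ) :
    arc ω A p q ((Y ω A q ^ c) x) ∈ forms ω A B c := by
  have hpq : p ≠ q := fun e => by rw [e, hq] at hp; exact absurd hp (by decide)
  have h0 := arc_diag h hp hq
  obtain ⟨M, κ, hM, hκ, rfl⟩ := h
  have h1 := arc_pow_sub_pow_mem hpq c 0 (diag_mem_fil (ω := ω) (A := A) M κ)
  rw [← neg_mem_iff, neg_sub, zero_add] at h1
  refine mem_forms_of_sub h1 ?_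
  by_cases hpM : ∃ x ∈ M, x.1 = p
  · obtain ⟨⟨p, q'⟩, hx, rfl⟩ := hpM
    have hq' : B q' = -1 := hM.minus _ hx
    by_cases e : q' = q
    · subst e
      rcases c with _ | c
      · exact h0
      · rw [diag_front hM hx]
        exact fil_le_forms _ _ (arc_pow_arc_mem hp hq c (diag_eq_sgl (hM.erase hx) hκ)
          (diag_mem_fil _ κ))
    · have h2 := Y_sub_arc (hM.ne _ hx) _ _ (diag_mem_fil (ω := ω) (A := A) (M.erase (p, q')) κ)
      rw [End.mul_apply, ← diag_front hM hx, LinearMap.sub_apply] at h2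
      have h3 := arc_mem_op (ω := ω) (A := A) p q _ _ (pow_sub_pow_mem (Y_mem_op p) (Y_mem_op q') (Y_comm _ _) h2 c)
      rw [map_sub] at h3
      refine mem_forms_of_sub h3 ?_
      have h4 : ∀ c, (Y ω A q' ^ c) (diag ω A M κ) ∈ fil ω A (c + 1) := fun c => by
        induction c with
        | zero => exact diag_mem_fil M κ
        | succ c ih => rw [pow_succ', End.mul_apply]; exact Y_mem_op _ _ _ ih
      clear h1 h3
      induction c with
      | zero => exact h0
      | succ c ih =>
        rw [pow_succ', End.mul_apply]
        exact arc_Y_forms hp hq hq' e (h4 c) ih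
  · push Not at hpM
    have h3 := arc_mem_op (ω := ω) (A := A) p q _ _ (pow_sub_pow_mem (Y_mem_op p) (Yr_mem_op _) (Y_Yr _ _)
      (Y_diag (κ := κ) hM hp hpM) c)
    rw [map_sub] at h3
    refine mem_forms_of_sub h3 ?_
    have hc : Commute (arc ω A p q) (Yr ω A (κ⁻¹ p)) := arc_Yr hpq _
    rw [← End.mul_apply, (hc.pow_right c).eq, End.mul_apply]
    have := Yr_pow_forms (j := κ⁻¹ p) (by rw [← smul_apply_apply κ, hκ]; simpa using hp) c h0
    rwa [zero_add] at this

theorem arc_forms {p q : Pos} (hp : B p = 1) (hq : B q = -1) {n : ℕ}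
    {v : Tot ω A} (hv : v ∈ forms ω A B n) : arc ω A p q v ∈ forms ω A B n := by
  have hpq : p ≠ q := fun e => by rw [e, hq] at hp; exact absurd hp (by decide)
  refine forms_of_commute (k := 0) (arc_mem_op p q) (arc_Yr hpq) (fun L x hL hx => ?_) hv
  have hpow : ∀ c, (Y ω A q ^ c) x ∈ fil ω A (1 + c) := fun c => by
    induction c with
    | zero => exact hx.mem_fil
    | succ c ih => rw [pow_succ', End.mul_apply]; exact Y_mem_op _ _ _ ih
  suffices ∀ c, arc ω A p q ((L.map (Y ω A)).prod ((Y ω A q ^ c) x)) ∈ forms ω A B (L.length + c) from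
    this 0
  induction L with
  | nil =>
    intro c
    rw [length_nil, zero_add]
    exact arc_Y_pow_diag hx hp hq c
  | cons l L ih =>
    intro c
    have hL' := fun q hq => hL q (mem_cons_of_mem _ hq)
    rw [map_cons, prod_cons, length_cons, add_right_comm]
    by_cases hl : l = q
    · rw [hl, ← (prod_Y_Y L q).eq, End.mul_apply, ← End.mul_apply (Y ω A q), ← pow_succ']
      exact ih hL' (c + 1)
    · rw [End.mul_apply]
      exact arc_Y_forms hp hq (hL l mem_cons_self) hl
        (fil_mono (by omega) (prod_Y_mem_fil L (hpow c))) (ih hL' c)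

theorem Y_forms (j : Pos) {n : ℕ} {v : Tot ω A} (hv : v ∈ forms ω A B n) :
    Y ω A j v ∈ forms ω A B (n + 1) := by
  rcases eq_one_or B j with hj | hj
  swap
  · exact Y_forms_of_neg hj hv
  refine forms_of_commute (k := 1) (Y_mem_op j) (Y_Yr j) (fun L x hL hx => ?_) hv
  rw [← End.mul_apply, ← (prod_Y_Y L j).eq, End.mul_apply, add_comm L.length]
  refine prod_Y_forms hL ?_
  have h0 := hx.mem_forms
  obtain ⟨M, κ, hM, hκ, rfl⟩ := hx
  by_cases hM' : ∃ x ∈ M, x.1 = j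
  · obtain ⟨⟨p, q⟩, hx, rfl⟩ := hM'
    have h2 := Y_sub_arc (hM.ne _ hx) _ _ (diag_mem_fil (ω := ω) (A := A) (M.erase (p, q)) κ)
    rw [End.mul_apply, ← diag_front hM hx, LinearMap.sub_apply] at h2
    exact mem_forms_of_sub h2 (Y_forms_of_neg (hM.minus _ hx) h0)
  · push Not at hM'
    refine mem_forms_of_sub (Y_diag hM hj hM') (Yr_forms ?_ h0)
    rw [← smul_apply_apply κ, hκ]; simpa using hj

theorem IsForm.eq_sgl {n : ℕ} {v : Tot ω A} (h : IsForm ω A B n v) : ∃ z, v = sgl ω A B z := by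
  obtain ⟨L, b, x, -, -, hx, -, rfl⟩ := h
  obtain ⟨z, rfl⟩ := hx.eq_sgl
  have hb : ∀ b : List Pos, ∃ z', (b.map (Yr ω A)).prod (sgl ω A B z) = sgl ω A B z' := by
    intro b
    induction b with
    | nil => exact ⟨z, rfl⟩
    | cons j b ih =>
      obtain ⟨z', h'⟩ := ih
      rw [map_cons, prod_cons, End.mul_apply, h', Yr_sgl]
      exact ⟨_, rfl⟩
  obtain ⟨z', h'⟩ := hb b
  rw [h']
  clear hb h'
  induction L with
  | nil => exact ⟨z', rfl⟩
  | cons j b ih =>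
    obtain ⟨z', h'⟩ := ih
    rw [map_cons, prod_cons, End.mul_apply, h', Y_sgl]
    exact ⟨_, rfl⟩

theorem IsWord.mem_forms {n : ℕ} {v : Tot ω A} (h : IsWord ω A n v) : ∃ B, v ∈ forms ω A B n := by
  induction h with
  | one =>
    exact ⟨A, IsDiag.mem_forms ⟨[], 1, ⟨by simp, by simp, by simp, by simp⟩, one_smul _ _,
      by rw [diag_nil, map_one]; rfl⟩⟩
  | s i _ ih =>
    obtain ⟨B, hB⟩ := ih
    exact ⟨_, perm_refl (ω := ω) (A := A) i ▸ perm_forms (refl i) hB⟩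
  | @e n v i h ih =>
    obtain ⟨B, hB⟩ := ih
    refine ⟨B, ?_⟩
    have hl := eq_one_or B (lo i)
    have hh := eq_one_or B (hi i)
    by_cases he : B (lo i) = B (hi i)
    · refine map_forms (E_mem_op i) le_rfl (fun v hv => ?_) hB
      obtain ⟨z, rfl⟩ := hv.eq_sgl
      rw [E_sgl_of_eq he]
      exact zero_mem _
    rw [← arc_lo_hi]
    rcases hl with h1 | h1 <;> rcases hh with h2 | h2
    · exact absurd (h1.trans h2.symm) he
    · exact arc_forms h1 h2 hB
    · rw [arc_symm (lo_lt_hi i).ne]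
      exact arc_forms h2 h1 hB
    · exact absurd (h1.trans h2.symm) he
  | y j _ ih =>
    obtain ⟨B, hB⟩ := ih
    exact ⟨_, Y_forms j hB⟩

end Tot

end

section
open Equiv Module LinearMap MvPolynomial Tot Pre

namespace CapSystem

section

variable {E : Type} [Ring E] (S : CapSystem (Fin (r + t)) E)

/-- The dot at the position `j` of the source. -/
def inert (A : Seq r t) (j : Pos) : E :=
  if A j = 1 then S.dotR (A.label j) (minusLabels A j) else S.dotL (A.label j) (plusLabels A j)

theorem lt_of_lt_of_not_lt {k l : Pos} (hk : k.val < r) (hl : ¬ l.val < r) : k < l :=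
  Fin.lt_def.2 (hk.trans_le (not_lt.1 hl))

theorem le_of_mem_minusLabels {i l : Pos} (h : l ∈ minusLabels A i) : r ≤ l.val := by
  rw [mem_minusLabels] at h
  have := A.minus_le i
  omega

theorem mem_plusLabels_of_le (A : Seq r t) (i : Pos) {k : Pos} (h : r ≤ k.val) :
    k ∈ plusLabels A i := mem_plusLabels.2 ((A.plus_le i).trans h)

theorem swap_apply_iff {p : Pos → Prop} {a b : Pos} (h : p a ↔ p b)
    (x : Pos) : p (swap a b x) ↔ p x := by
  rw [swap_apply_def]
  split_ifs with h1 h2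
  · rw [h1, h]
  · rw [h2, h]
  · rfl

theorem inert_commute_cap (A : Seq r t) (j : Pos) {k l : Pos} (hk : k.val < r)
    (hl : ¬ l.val < r) : Commute (S.inert A j) (S.cap k l) := by
  rw [inert]
  split_ifs with h
  · exact (S.cap_comm_dotR_of_gt (lt_of_lt_of_not_lt ((A.label_lt_iff j).2 h) hl)
      fun hm => (le_of_mem_minusLabels hm).not_gt hk).symm
  · refine (S.cap_comm_dotL_of_lt (lt_of_lt_of_not_lt hk ?_) (mem_plusLabels_of_le A j (not_lt.1 hl))).symm
    exact mt (A.label_lt_iff j).1 h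

theorem inert_commute_dotOp (A : Seq r t) (j : Pos) (B : Seq r t) (i : Pos) :
    Commute (S.inert A j) (S.dotOp B i) := by
  have hA := A.label_lt_iff j
  have hB := B.label_lt_iff i
  rw [inert, dotOp]
  split_ifs with h h' h'
  · exact (S.dotL_comm_dotR_of_lt
      (fun l hl => lt_of_lt_of_not_lt (hA.2 h) (le_of_mem_minusLabels hl).not_gt)
      (fun l hl => lt_of_lt_of_not_lt (hB.2 h') (le_of_mem_minusLabels hl).not_gt)).symm
  · exact S.dotR_comm_dotR (lt_of_lt_of_not_lt (hA.2 h) (mt hB.1 h'))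
      fun l hl => mem_plusLabels_of_le _ _ (le_of_mem_minusLabels hl)
  · exact (S.dotL_comm_dotL (lt_of_lt_of_not_lt (hB.2 h') (mt hA.1 h))
      fun l hl => mem_plusLabels_of_le _ _ (le_of_mem_minusLabels hl)).symm
  · have h1 := not_lt.1 (mt hA.1 h)
    have h2 := not_lt.1 (mt hB.1 h')
    exact S.dotL_comm_dotR_of_mem (mem_plusLabels_of_le _ _ h2) (mem_plusLabels_of_le _ _ h1)
      (fun l hl => mem_plusLabels_of_le _ _ (h2.trans (Fin.le_def.1 hl.le)))
      (fun l hl => mem_plusLabels_of_le _ _ (h1.trans (Fin.le_def.1 hl.le)))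

theorem inert_commute_permOp (A : Seq r t) (j : Pos) (B : Seq r t) (i : Fin (r + t - 1)) :
    Commute (S.inert A j) (S.permOp B (refl i)) := by
  by_cases h : B (lo i) = B (hi i)
  swap
  · rw [S.permOp_refl_of_ne h]; exact Commute.one_right _
  have hA := A.label_lt_iff j
  have hB := B.label_lt_iff (lo i)
  have hB' := B.label_lt_iff (hi i)
  rw [← h] at hB'
  rw [inert, refl]
  by_cases hp : B (lo i) = 1
  · rw [S.permOp_swap_of_eq h hp]
    have e := hB.2 hp
    have e' := hB'.2 hp
    split_ifs with h'
    · refine (S.lg_comm_dotR (swap_apply_iff (iff_of_false ?_ ?_)) _).symm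
      exacts [fun hm => (le_of_mem_minusLabels hm).not_gt e, fun hm => (le_of_mem_minusLabels hm).not_gt e']
    · have h1 := mt hA.1 h'
      exact (S.lg_comm_dotL (Seq.label_covBy h hp) (by rintro x; rw [x] at h1; exact h1 e)
        (by rintro x; rw [x] at h1; exact h1 e') _).symm
  · rw [S.permOp_swap_of_ne h hp]
    have e := mt hB.1 hp
    have e' := mt hB'.1 hp
    split_ifs with h'
    · rw [swap_comm]
      have h1 := hA.2 h'
      exact (S.rg_comm_dotR (Seq.label_covBy' h hp) (by rintro x; rw [x] at h1; exact e' h1)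
        (by rintro x; rw [x] at h1; exact e h1) _).symm
    · refine (S.rg_comm_dotL (swap_apply_iff (iff_of_true ?_ ?_)) _).symm
      exacts [mem_plusLabels_of_le _ _ (not_lt.1 e), mem_plusLabels_of_le _ _ (not_lt.1 e')]

theorem inert_commute_capOf (A : Seq r t) (j : Pos) {p q : Pos}
    (h : B p ≠ B q) : Commute (S.inert A j) (S.capOf B p q) := by
  have h1 := B.label_lt_iff p
  have h2 := B.label_lt_iff q
  rw [capOf]
  split_ifs with hp
  · exact S.inert_commute_cap A j (h1.2 hp) (mt h2.1 fun e => h (hp.trans e.symm))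
  · exact S.inert_commute_cap A j (h2.2 (eq_one_of_ne h hp)) (mt h1.1 hp)

variable [Algebra ℂ E]

theorem inert_commute_ev (A : Seq r t) (j : Pos) (f : Pre B C) :
    Commute (S.inert A j) (S.ev f) := by
  induction f with
  | gen g =>
    cases g with
    | y i => exact (S.inert_commute_dotOp A j _ i).smul_right _
    | s i _ => exact S.inert_commute_permOp A j _ i
    | e i h => exact S.inert_commute_capOf A j h
    | sHat i _ => exact S.inert_commute_permOp A j _ i
    | eHat i h => exact S.inert_commute_capOf A j h
  | id => exact Commute.one_right _
  | mul g f ih ih' => exact ih.mul_right ih'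
  | zero => exact Commute.zero_right _
  | add f g ih ih' => exact ih.add_right ih'
  | smul c f ih => exact ih.smul_right c

end

end CapSystem

variable (r t) in
/-- The degenerate affine Hecke algebra on `r + t` strands. -/
def Alg : Type := Hecke.opAlgebra Pos

instance : Ring (Alg r t) := inferInstanceAs (Ring (Hecke.opAlgebra Pos))

instance : Algebra ℂ (Alg r t) :=
  inferInstanceAs (Algebra ℂ (Hecke.opAlgebra Pos))

instance : AffineHecke Pos (Alg r t) :=
  inferInstanceAs (AffineHecke Pos (Hecke.opAlgebra Pos))

variable (ω : ℕ → ℂ)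

theorem le_last (h : 0 < r + t) (i : Pos) : i ≤ ⟨r + t - 1, by omega⟩ := by
  rw [Fin.le_def]; simp only; omega

/-- The cap system of the degenerate affine Hecke algebra. -/
def sys (h : 0 < r + t) : CapSystem Pos (End ℂ (Alg r t)) :=
  Hecke.capSystem (A := Alg r t) ω (le_last h)

variable {ω}

theorem sys_cap_one (h : 0 < r + t) {k l : Pos} (hkl : k ≠ l) :
    (sys ω h).cap k l 1 = Hecke.g (Alg r t) (swap k l) := by
  have := Hecke.capOp_g (A := Alg r t) (ω := ω) (le_last h) (k := k) (l := l) (w := 1) hkl.symm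
  rw [map_one, mul_one, Perm.one_apply] at this
  exact this

theorem sys_cap_one_comm (h : 0 < r + t) (k l : Pos) :
    (sys ω h).cap k l 1 = (sys ω h).cap l k 1 := by
  rcases eq_or_ne k l with rfl | hkl
  · rfl
  rw [sys_cap_one h hkl, sys_cap_one h hkl.symm, swap_comm]

theorem dotOp_one (h : 0 < r + t) (A : Seq r t) (j : Pos) :
    (sys ω h).dotOp A j 1 = (sys ω h).inert A j 1 := by
  have h1 : ∀ k T, (sys ω h).dotL k T 1 = (sys ω h).dotR k T 1 := fun k T => by
    rw [CapSystem.dotL, CapSystem.dotR, LinearMap.sub_apply, LinearMap.sub_apply, LinearMap.sum_apply,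
      LinearMap.sum_apply]
    refine congrArg₂ _ ?_ (Finset.sum_congr rfl fun l _ => sys_cap_one_comm h k l)
    change Hecke.y (Alg r t) k * 1 = 1 * Hecke.y (Alg r t) k
    rw [mul_one, one_mul]
  rw [CapSystem.dotOp, CapSystem.inert]
  split_ifs
  · exact h1 _ _
  · exact (h1 _ _).symm

variable (ω) in
/-- The operator of a morphism. -/
def evMor (h : 0 < r + t) {A B : Seq r t} : Mor ω A B →ₗ[ℂ] End ℂ (Alg r t) where
  toFun := Quotient.lift (sys ω h).ev fun _ _ hfg => (sys ω h).ev_rel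
    (fun k l n => Hecke.capOp_comp_same ω (le_last h) k l n) hfg
  map_add' z z' := by
    induction z using Quotient.inductionOn
    induction z' using Quotient.inductionOn
    rfl
  map_smul' c z := by
    induction z using Quotient.inductionOn
    rfl

theorem evMor_act (h : 0 < r + t) (f : Pre B C) (z : Mor ω A B) :
    evMor ω h (Mor.act ω f z) = (sys ω h).ev f * evMor ω h z := by
  induction z using Quotient.inductionOn
  rfl

theorem evMor_coact (h : 0 < r + t) (f : Pre A B) (z : Mor ω B C) :
    evMor ω h (Mor.coact ω f z) = evMor ω h z * (sys ω h).ev f := by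
  induction z using Quotient.inductionOn
  rfl

theorem inert_commute_evMor (h : 0 < r + t) (A : Seq r t) (j : Pos)
    (z : Mor ω B C) : Commute ((sys ω h).inert A j) (evMor ω h z) := by
  induction z using Quotient.inductionOn with
  | h f => exact (sys ω h).inert_commute_ev A j f

variable (ω) in
/-- The value of the component at `B`. -/
def val (h : 0 < r + t) (A B : Seq r t) : Tot ω A →ₗ[ℂ] Alg r t :=
  applyₗ 1 ∘ₗ evMor ω h ∘ₗ proj B

section

variable (h : 0 < r + t) {A : Seq r t}

theorem val_apply (B : Seq r t) (v : Tot ω A) : val ω h A B v = evMor ω h (v B) 1 := rfl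

theorem val_sgl (z : Mor ω A B) : val ω h A B (sgl ω A B z) = evMor ω h z 1 := by
  rw [val_apply, sgl_self]

theorem val_sgl_of_ne (hBC : C ≠ B) (z : Mor ω A B) : val ω h A C (sgl ω A B z) = 0 := by
  rw [val_apply, sgl_of_ne hBC, map_zero]; rfl

theorem val_Y (B : Seq r t) (j : Pos) (v : Tot ω A) :
    val ω h A B (Y ω A j v) = (sys ω h).dotOp B j (val ω h A B v) := by
  change evMor ω h (B j • Mor.act ω (Pre.y B j) (v B)) 1 = _
  rw [map_zsmul, evMor_act, CapSystem.ev_y, smul_mul_assoc, smul_smul, CapSystem.seq_sq, one_smul]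
  rfl

theorem val_Yr (B : Seq r t) (j : Pos) (v : Tot ω A) :
    val ω h A B (Yr ω A j v) = (sys ω h).inert A j (val ω h A B v) := by
  change evMor ω h (A j • Mor.coact ω (Pre.y A j) (v B)) 1 = _
  rw [map_zsmul, evMor_coact, CapSystem.ev_y, mul_smul_comm, smul_smul, CapSystem.seq_sq, one_smul,
    End.mul_apply, dotOp_one, ← End.mul_apply, ← (inert_commute_evMor h A j _).eq]
  rfl

theorem val_perm (σ : Perm Pos) (hC : C = σ • B) (z : Mor ω A B) :
    val ω h A C (perm ω A σ (sgl ω A B z)) = (sys ω h).permOp B σ (evMor ω h z 1) := by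
  induction σ using refl_induction generalizing B C with
  | h1 =>
    obtain rfl : C = B := by rw [hC, one_smul]
    rw [map_one, End.one_apply, val_sgl, CapSystem.permOp_one]; rfl
  | hmul v w hv hw =>
    obtain ⟨z', h'⟩ := perm_sgl (ω := ω) w rfl z
    have e := hw rfl z
    rw [h', val_sgl] at e
    rw [map_mul, End.mul_apply, h', hv (hC.trans (mul_smul v w B)), e, ← CapSystem.permOp_mul]
    rfl
  | hrefl i =>
    obtain ⟨f, hf⟩ := exists_isS i hC
    rw [perm_refl, S_sgl hf, val_sgl, evMor_act, CapSystem.ev_isS _ hf]; rfl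

theorem val_arc {p q : Pos} (hB : B p ≠ B q) (z : Mor ω A B) :
    val ω h A B (arc ω A p q (sgl ω A B z)) = (sys ω h).capOf B p q (evMor ω h z 1) := by
  obtain ⟨σ, i, _, hp, hq⟩ := exists_perm_adj (fun e => hB (congrArg B e) : p ≠ q)
  have hB' : (σ⁻¹ • B) (lo i) ≠ (σ⁻¹ • B) (hi i) := by
    rw [Seq.smul_apply, Seq.smul_apply, inv_inv, hp, hq]; exact hB
  obtain ⟨z', h'⟩ := perm_sgl (ω := ω) σ⁻¹ rfl z
  have e := val_perm h σ⁻¹ rfl z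
  rw [h', val_sgl] at e
  have hc := (sys ω h).permOp_capOf hB σ⁻¹
  rw [show σ⁻¹ p = lo i by rw [← hp]; simp, show σ⁻¹ q = hi i by rw [← hq]; simp] at hc
  have h1 := (sys ω h).permOp_mul B σ σ⁻¹
  rw [mul_inv_cancel, CapSystem.permOp_one] at h1
  rw [arc_eq hp hq, End.mul_apply, End.mul_apply, h', E_sgl hB',
    val_perm h σ (smul_inv_smul σ B).symm, evMor_act, End.mul_apply, e,
    CapSystem.ev_isE _ (IsE.e _ hB'), ← End.mul_apply, ← End.mul_apply, mul_assoc, ← hc,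
    ← mul_assoc, h1, one_mul]

end

end

section
open Equiv Module MvPolynomial Pre

theorem Seq.label_ne {p q : Pos} (hp : B p = 1) (hq : A q = -1) :
    B.label p ≠ A.label q := fun e => by
  have h1 := (B.label_lt_iff p).2 hp
  rw [e, A.label_lt_iff, hq] at h1
  exact absurd h1 (by decide)

/-- The permutation of the labels that is described by a diagram without dots. -/
structure IsValue (A B : Seq r t) (M : List (Pos × Pos))
    (κ w : Perm Pos) : Prop where
  plus : ∀ p, B p = 1 → (∀ x ∈ M, x.1 ≠ p) → w (A.label (κ⁻¹ p)) = B.label p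
  minus : ∀ q, B q = -1 → (∀ x ∈ M, x.2 ≠ q) → w (B.label q) = A.label (κ⁻¹ q)
  cup : ∀ x ∈ M, w (B.label x.2) = B.label x.1
  cap : ∀ x ∈ M, w (A.label (κ⁻¹ x.1)) = A.label (κ⁻¹ x.2)

theorem Seq.inv_apply_of_smul {κ : Perm Pos} (hκ : κ • A = B) (j : Pos) : A (κ⁻¹ j) = B j := by
  rw [← hκ, Seq.smul_apply]

theorem Tot.IsCaps.head_ne {p q : Pos} {M : List (Pos × Pos)} (hM : IsCaps B ((p, q) :: M)) :
    (∀ x ∈ M, x.1 ≠ p) ∧ ∀ x ∈ M, x.2 ≠ q :=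
  ⟨fun _ hx e => (List.nodup_cons.1 hM.nodup_plus).1 (List.mem_map.2 ⟨_, hx, e⟩),
    fun _ hx e => (List.nodup_cons.1 hM.nodup_minus).1 (List.mem_map.2 ⟨_, hx, e⟩)⟩

namespace IsValue

variable {A B : Seq r t} {M : List ((Fin (r + t)) × (Fin (r + t)))} {κ w : Perm (Fin (r + t))}

theorem swap_mul (hκ : κ • A = B) {p q : Pos} (hM : Tot.IsCaps B ((p, q) :: M))
    (h : IsValue A B M κ w) :
    IsValue A B ((p, q) :: M) κ (swap (B.label p) (A.label (κ⁻¹ q)) * w) := by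
  have hp : B p = 1 := hM.plus _ List.mem_cons_self
  have hq : B q = -1 := hM.minus _ List.mem_cons_self
  have ha := Seq.inv_apply_of_smul hκ
  obtain ⟨h1', h2'⟩ := hM.head_ne
  have hinj : ∀ {q' : Pos}, q' ≠ q → A.label (κ⁻¹ q') ≠ A.label (κ⁻¹ q) := fun hne e =>
    hne (κ⁻¹.injective (A.label.injective e))
  refine ⟨fun p' hp' hx => ?_, fun q' hq' hx => ?_, fun x hx => ?_, fun x hx => ?_⟩ <;>
    rw [Perm.mul_apply]
  · have hx := List.forall_mem_cons.1 hx
    rw [h.plus p' hp' hx.2, swap_apply_of_ne_of_ne (fun e => hx.1 (B.label.injective e).symm)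
      (Seq.label_ne hp' ((ha q).trans hq))]
  · have hx := List.forall_mem_cons.1 hx
    rw [h.minus q' hq' hx.2, swap_apply_of_ne_of_ne
      (Seq.label_ne hp ((ha q').trans hq')).symm (hinj hx.1.symm)]
  · rcases List.mem_cons.1 hx with rfl | hx
    · rw [h.minus q hq h2', swap_apply_right]
    · rw [h.cup x hx, swap_apply_of_ne_of_ne (fun e => h1' x hx (B.label.injective e))
        (Seq.label_ne (hM.plus x (List.mem_cons_of_mem _ hx)) ((ha q).trans hq))]
  · rcases List.mem_cons.1 hx with rfl | hx
    · rw [h.plus p hp h1', swap_apply_left]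
    · rw [h.cap x hx, swap_apply_of_ne_of_ne (Seq.label_ne hp
        ((ha _).trans (hM.minus x (List.mem_cons_of_mem _ hx)))).symm (hinj (h2' x hx))]

theorem tail (hκ : κ • A = B) {p q : Pos} (hM : Tot.IsCaps B ((p, q) :: M))
    (h : IsValue A B ((p, q) :: M) κ w) :
    IsValue A B M κ (swap (B.label p) (A.label (κ⁻¹ q)) * w) := by
  have hp : B p = 1 := hM.plus _ List.mem_cons_self
  have hq : B q = -1 := hM.minus _ List.mem_cons_self
  have ha := Seq.inv_apply_of_smul hκ
  obtain ⟨h1', h2'⟩ := hM.head_ne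
  have hinj : ∀ {q' : Pos}, q' ≠ q → A.label (κ⁻¹ q') ≠ A.label (κ⁻¹ q) := fun hne e =>
    hne (κ⁻¹.injective (A.label.injective e))
  refine ⟨fun p' hp' hx => ?_, fun q' hq' hx => ?_, fun x hx => ?_, fun x hx => ?_⟩ <;>
    rw [Perm.mul_apply]
  · by_cases e : p' = p
    · rw [e, h.cap _ List.mem_cons_self, swap_apply_right]
    · rw [h.plus p' hp' (List.forall_mem_cons.2 ⟨Ne.symm e, hx⟩), swap_apply_of_ne_of_ne
        (fun e' => e (B.label.injective e')) (Seq.label_ne hp' ((ha q).trans hq))]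
  · by_cases e : q' = q
    · rw [e, h.cup _ List.mem_cons_self, swap_apply_left]
    · rw [h.minus q' hq' (List.forall_mem_cons.2 ⟨Ne.symm e, hx⟩), swap_apply_of_ne_of_ne
        (Seq.label_ne hp ((ha q').trans hq')).symm (hinj e)]
  · have hx' := List.mem_cons_of_mem (p, q) hx
    rw [h.cup x hx', swap_apply_of_ne_of_ne (fun e => h1' x hx (B.label.injective e))
        (Seq.label_ne (hM.plus x hx') ((ha q).trans hq))]
  · have hx' := List.mem_cons_of_mem (p, q) hx
    rw [h.cap x hx', swap_apply_of_ne_of_ne (Seq.label_ne hp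
        ((ha _).trans (hM.minus x hx'))).symm (hinj (h2' x hx))]

theorem perm_list {M' : List (Pos × Pos)} (hM : M.Perm M') (h : IsValue A B M κ w) :
    IsValue A B M' κ w where
  plus p hp hx := h.plus p hp fun x hx' => hx x (hM.mem_iff.1 hx')
  minus p hp hx := h.minus p hp fun x hx' => hx x (hM.mem_iff.1 hx')
  cup x hx := h.cup x (hM.mem_iff.2 hx)
  cap x hx := h.cap x (hM.mem_iff.2 hx)

end IsValue

namespace Tot

variable {ω : ℕ → ℂ} {A B : Seq r t}

theorem IsCaps.ne_of_mem {M : List (Pos × Pos)} (hM : IsCaps B M) {x y} (hx : x ∈ M)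
    (hy : y ∈ M) (hxy : x ≠ y) : x.1 ≠ y.1 ∧ x.2 ≠ y.2 :=
  hM.disjoint hy x ((List.mem_erase_of_ne hxy).2 hx)

theorem IsCaps.fst_ne_snd {M : List (Pos × Pos)} (hM : IsCaps B M) {x y} (hx : x ∈ M)
    (hy : y ∈ M) : x.1 ≠ y.2 := fun e => by
  have := hM.plus x hx
  rw [e, hM.minus y hy] at this
  exact absurd this (by decide)

theorem diag_exchange {M : List (Pos × Pos)} (hM : IsCaps B M)
    {κ : Perm Pos} (hκ : κ • A = B) {x y : Pos × Pos} (hx : x ∈ M)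
    (hy : y ∈ M) :
    diag ω A M (swap x.1 y.1 * swap x.2 y.2 * κ) = diag ω A M κ := by
  by_cases hxy : x = y
  · subst hxy
    rw [swap_self, swap_self]; rfl
  obtain ⟨p, q⟩ := x
  obtain ⟨p', q'⟩ := y
  have hp := hM.plus _ hx
  have hp' := hM.plus _ hy
  have hq := hM.minus _ hx
  have hq' := hM.minus _ hy
  obtain ⟨h1, h2⟩ := hM.ne_of_mem hx hy hxy
  have h3 := hM.fst_ne_snd hx hx
  have h4 := hM.fst_ne_snd hx hy
  have h5 := hM.fst_ne_snd hy hx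
  have h6 := hM.fst_ne_snd hy hy
  simp only at hp hp' hq hq' h1 h2 h3 h4 h5 h6
  have hy' : (p', q') ∈ M.erase (p, q) := (List.mem_erase_of_ne (Ne.symm hxy)).2 hy
  have hM1 := hM.erase hx
  have hM2 := hM1.erase hy'
  set N := (M.erase (p, q)).erase (p', q') with hN
  set τ := swap p p' * swap q q' with hτ
  have t1 : τ p = p' := by
    rw [hτ, Perm.mul_apply, swap_apply_of_ne_of_ne h3 h4, swap_apply_left]
  have t2 : τ p' = p := by
    rw [hτ, Perm.mul_apply, swap_apply_of_ne_of_ne h5 h6, swap_apply_right]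
  have t3 : τ q = q' := by
    rw [hτ, Perm.mul_apply, swap_apply_left, swap_apply_of_ne_of_ne h4.symm h6.symm]
  have t4 : τ q' = q := by
    rw [hτ, Perm.mul_apply, swap_apply_right, swap_apply_of_ne_of_ne h3.symm h5.symm]
  have hNτ : N.map (Prod.map τ τ) = N := by
    conv_rhs => rw [← List.map_id N]
    refine List.map_congr_left fun z hz => ?_
    have hz1 := List.mem_of_mem_erase hz
    have hz2 := List.mem_of_mem_erase hz1
    obtain ⟨a1, a2⟩ := hM.disjoint hx z hz1
    obtain ⟨b1, b2⟩ := hM1.disjoint hy' z hz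
    refine Prod.ext ?_ ?_
    · rw [Prod.map_fst, hτ, Perm.mul_apply, swap_apply_of_ne_of_ne (hM.fst_ne_snd hz2 hx)
        (hM.fst_ne_snd hz2 hy), swap_apply_of_ne_of_ne a1 b1]; rfl
    · rw [Prod.map_snd, hτ, Perm.mul_apply, swap_apply_of_ne_of_ne a2 b2,
      swap_apply_of_ne_of_ne (hM.fst_ne_snd hx hz2).symm (hM.fst_ne_snd hy hz2).symm]; rfl
  have hd := perm_diag (ω := ω) (A := A) hM2 τ κ
  rw [hNτ] at hd
  obtain ⟨z, hz⟩ := diag_eq_sgl (ω := ω) hM2 hκ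
  rw [diag_front hM hx, diag_front hM hx, diag_front hM1 hy', diag_front hM1 hy', ← hN, ← hd]
  have c := arc_comm (ω := ω) (A := A) h3 h6 h1 h4 h5.symm h2
  obtain ⟨z1, hz1⟩ := arc_sgl (ω := ω) h6 z
  obtain ⟨z2, hz2⟩ := arc_sgl (ω := ω) h3 z
  have a1 := arc_arc (ω := ω) h4 h2.symm h3 (hq'.trans hq.symm) z1
  have a2 := arc_arc (ω := ω) h4.symm h1 h6.symm (hp.trans hp'.symm) z2
  rw [arc_symm h4.symm, arc_symm h6.symm, ← hz2, ← End.mul_apply (arc ω A p' q'), ← c] at a2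
  rw [← hz1, ← End.mul_apply (arc ω A p q) (arc ω A p' q')] at a1
  have a3 := a1.symm.trans a2
  have e : perm ω A τ * (arc ω A p' q' * arc ω A p q) = arc ω A p q * arc ω A p' q' * perm ω A τ := by
    rw [← mul_assoc, perm_arc τ h6, t2, t4, mul_assoc, perm_arc τ h3, t1, t3, mul_assoc]
  rw [hz]
  change (arc ω A p q * arc ω A p' q' * perm ω A τ) (sgl ω A B z) =
    (arc ω A p q * arc ω A p' q') (sgl ω A B z)
  rw [← e, ← c, End.mul_apply, hτ, map_mul, End.mul_apply, swap_comm q q', a3,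
    ← End.mul_apply, ← map_mul, swap_mul_self, map_one]
  rfl

theorem IsValue_exchange {M : List (Pos × Pos)} (hM : IsCaps B M)
    {κ w : Perm Pos} {x y : Pos × Pos} (hx : x ∈ M)
    (hy : y ∈ M) (h : IsValue A B M κ w) :
    IsValue A B M (swap x.1 y.1 * swap x.2 y.2 * κ) w := by
  have e : ∀ j, (swap x.1 y.1 * swap x.2 y.2 * κ)⁻¹ j =
      κ⁻¹ (swap x.2 y.2 (swap x.1 y.1 j)) := fun j => by
    rw [mul_inv_rev, mul_inv_rev, swap_inv, swap_inv]; rfl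
  have hne : ∀ {p q}, B p = 1 → B q = -1 → p ≠ q := fun hp hq e => by
    rw [e, hq] at hp; exact absurd hp (by decide)
  have px := hM.plus x hx
  have py := hM.plus y hy
  have mx := hM.minus x hx
  have my := hM.minus y hy
  refine ⟨fun p hp hpM => ?_, fun q hq hqM => ?_, h.cup, fun z hz => ?_⟩
  · rw [e, swap_apply_of_ne_of_ne (hpM x hx).symm (hpM y hy).symm,
    swap_apply_of_ne_of_ne (hne hp mx) (hne hp my), h.plus p hp hpM]
  · rw [e, swap_apply_of_ne_of_ne (hne px hq).symm (hne py hq).symm,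
    swap_apply_of_ne_of_ne (hqM x hx).symm (hqM y hy).symm, h.minus q hq hqM]
  · have e1 : ∀ {p}, B p = 1 → swap x.2 y.2 p = p := fun hp =>
      swap_apply_of_ne_of_ne (hne hp mx) (hne hp my)
    have e2 : ∀ {q}, B q = -1 → swap x.1 y.1 q = q := fun hq =>
      swap_apply_of_ne_of_ne (hne px hq).symm (hne py hq).symm
    rw [e, e, e2 (hM.minus z hz)]
    by_cases hzx : z = x
    · rw [hzx, swap_apply_left, swap_apply_left, e1 py, h.cap y hy]
    by_cases hzy : z = y
    · rw [hzy, swap_apply_right, swap_apply_right, e1 px, h.cap x hx]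
    obtain ⟨a1, a2⟩ := hM.ne_of_mem hz hx hzx
    obtain ⟨b1, b2⟩ := hM.ne_of_mem hz hy hzy
    rw [swap_apply_of_ne_of_ne a1 b1, swap_apply_of_ne_of_ne a2 b2, e1 (hM.plus z hz), h.cap z hz]

theorem diag_eq_of_isValue {M M' : List (Pos × Pos)}
    {κ κ' w : Perm Pos} (hM : IsCaps B M) (hM' : IsCaps B M') (hκ : κ • A = B)
    (hκ' : κ' • A = B) (h : IsValue A B M κ w) (h' : IsValue A B M' κ' w) :
    diag ω A M κ = diag ω A M' κ' := by
  have ha := Seq.inv_apply_of_smul hκ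
  have ha' := Seq.inv_apply_of_smul hκ'
  induction M generalizing M' κ' w with
  | nil =>
    rcases M' with _ | ⟨x, M'⟩
    · congr 1
      refine inv_injective (ext fun j => ?_)
      rcases B.eq_one_or j with hj | hj
      · have := (h.plus j hj (by simp)).trans (h'.plus j hj (by simp)).symm
        exact A.label.injective (w.injective this)
      · have := (h.minus j hj (by simp)).symm.trans (h'.minus j hj (by simp))
        exact A.label.injective this
    · have e1 := h'.cup x List.mem_cons_self
      have hx := hM'.minus x List.mem_cons_self
      rw [h.minus _ hx (by simp)] at e1
      exact absurd e1.symm (Seq.label_ne (hM'.plus x List.mem_cons_self) ((ha _).trans hx))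
  | cons x M ih =>
    obtain ⟨p, q⟩ := x
    have hp : B p = 1 := hM.plus _ List.mem_cons_self
    have hq : B q = -1 := hM.minus _ List.mem_cons_self
    have c1 := h.cup _ List.mem_cons_self
    have c2 := h.cap _ List.mem_cons_self
    simp only at c1 c2
    have hx : (p, q) ∈ M' := by
      by_cases hq' : ∀ x ∈ M', x.2 ≠ q
      · rw [h'.minus q hq hq'] at c1
        exact absurd c1.symm (Seq.label_ne hp ((ha' _).trans hq))
      · push Not at hq'
        obtain ⟨x, hx, rfl⟩ := hq'
        rw [h'.cup x hx] at c1
        rw [← B.label.injective c1]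
        exact hx
    obtain ⟨y, hy, hy1⟩ : ∃ y ∈ M', y.1 = κ' (κ⁻¹ p) := by
      by_contra hno
      push Not at hno
      have hB : B (κ' (κ⁻¹ p)) = 1 := by rw [← ha', show κ'⁻¹ (κ' (κ⁻¹ p)) = κ⁻¹ p by simp, ha, hp]
      have := h'.plus _ hB hno
      rw [show κ'⁻¹ (κ' (κ⁻¹ p)) = κ⁻¹ p by simp, c2] at this
      exact Seq.label_ne hB ((ha q).trans hq) this.symm
    have hy2 : κ'⁻¹ y.2 = κ⁻¹ q := by
      have := h'.cap y hy
      rw [hy1, show κ'⁻¹ (κ' (κ⁻¹ p)) = κ⁻¹ p by simp, c2] at this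
      exact (A.label.injective this).symm
    have hV := IsValue_exchange hM' hx hy h'
    rw [← diag_exchange hM' hκ' hx hy]
    have hκ'' : (swap p y.1 * swap q y.2 * κ') • A = B := by
      rw [mul_smul, mul_smul, hκ', swap_smul_of_eq (hq.trans (hM'.minus y hy).symm),
        swap_smul_of_eq (hp.trans (hM'.plus y hy).symm)]
    have hq'' : (swap p y.1 * swap q y.2 * κ')⁻¹ q = κ⁻¹ q := by
      rw [mul_inv_rev, mul_inv_rev, swap_inv, swap_inv, Perm.mul_apply,
        Perm.mul_apply, swap_apply_of_ne_of_ne (hM'.fst_ne_snd hx hx).symm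
        (hM'.fst_ne_snd hy hx).symm, swap_apply_left, hy2]
    have hP := List.perm_cons_erase hx
    have h1 := h.tail hκ hM
    have h2 := (hV.perm_list hP).tail hκ'' (hM'.perm hP)
    simp only at hκ'' hq'' h2 ⊢
    rw [hq''] at h2
    rw [diag_cons, diag_front hM' hx]
    exact congrArg _ (ih hM.tail (hM'.erase hx) hκ'' h1 h2 (Seq.inv_apply_of_smul hκ''))

theorem exists_isValue (h : 0 < r + t) {M : List (Pos × Pos)}
    {κ : Perm Pos} (hM : IsCaps B M) (hκ : κ • A = B) :
    ∃ w, IsValue A B M κ w ∧ val ω h A B (diag ω A M κ) = Hecke.g (Alg r t) w := by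
  induction M with
  | nil =>
    have e : ∀ j, (relabel A κ).1 (A.label (κ⁻¹ j)) = B.label j := fun j => by
      rw [relabel_label, hκ]; simp
    have hlt : ∀ j, (A.label (κ⁻¹ j)).val < r ↔ B j = 1 := fun j => by
      rw [A.label_lt_iff, Seq.inv_apply_of_smul hκ]
    refine ⟨leftPart (relabel A κ) * (rightPart (relabel A κ))⁻¹,
      ⟨fun p hp _ => ?_, fun q hq _ => ?_, by simp, by simp⟩, ?_⟩
    · rw [Perm.mul_apply, (Perm.inv_eq_iff_eq).2 (rightPart_of_lt _ ((hlt p).2 hp)).symm,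
      leftPart_of_lt _ ((hlt p).2 hp), e]
    · have hq' : ¬ (A.label (κ⁻¹ q)).val < r := fun e => by
        rw [hlt, hq] at e; exact absurd e (by decide)
      rw [Perm.mul_apply, (Perm.inv_eq_iff_eq).2
        ((rightPart_of_le (relabel A κ) hq').trans (e q)).symm, leftPart_of_le _ hq']
    · rw [diag_nil, val_perm h κ hκ.symm]
      change Hecke.g (Alg r t) _ * ((1 : Alg r t) * Hecke.g (Alg r t) _) = _
      rw [one_mul, ← map_mul]
  | cons x M ih =>
    obtain ⟨p, q⟩ := x
    obtain ⟨w, hw, hv⟩ := ih hM.tail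
    have hp : B p = 1 := hM.plus _ List.mem_cons_self
    have hq : B q = -1 := hM.minus _ List.mem_cons_self
    refine ⟨_, hw.swap_mul hκ hM, ?_⟩
    obtain ⟨z, hz⟩ := diag_eq_sgl (ω := ω) hM.tail hκ
    have hB : B p ≠ B q := by rw [hp, hq]; decide
    have hwq := hw.minus q hq hM.head_ne.2
    rw [diag_cons, hz, val_arc h hB, ← val_sgl h, ← hz, hv, CapSystem.capOf, if_pos hp]
    have hne : w (B.label q) ≠ B.label p := by
      rw [hwq]
      exact (Seq.label_ne hp ((Seq.inv_apply_of_smul hκ q).trans hq)).symm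
    refine (Hecke.capOp_g (A := Alg r t) (ω := ω) (le_last h) hne).trans ?_
    rw [hwq]

end Tot

end

section
open Equiv Module MvPolynomial Pre Hecke AffineHecke

namespace Tot

variable {ω : ℕ → ℂ} {A B : Seq r t} (h : 0 < r + t)

theorem dotL_degLT (k : Pos) (T : Finset Pos) {n : ℕ} {a : Alg r t}
    (ha : a ∈ degLT Pos n) : (sys ω h).dotL k T a ∈ degLT Pos (n + 1) := by
  have := add_mem (degLT_mono n.le_succ (dotL_sub_leadL ω (le_last h) k T ha))
    (leadL_mem k ha)
  rwa [sub_add_cancel] at this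

theorem dotR_degLT (k : Pos) (T : Finset Pos) {n : ℕ} {a : Alg r t}
    (ha : a ∈ degLT Pos n) : (sys ω h).dotR k T a ∈ degLT Pos (n + 1) := by
  have := add_mem (degLT_mono n.le_succ (dotR_sub_leadR ω (le_last h) k T ha))
    (leadR_mem k ha)
  rwa [sub_add_cancel] at this

theorem val_mem_degLT {n : ℕ} {v : Tot ω A} (hv : v ∈ fil ω A n) (B : Seq r t) :
    val ω h A B v ∈ degLT Pos n := by
  have key : ∀ m v, IsWord ω A m v → ∀ B, val ω h A B v ∈ degLT Pos (m + 1) := by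
    intro m v hv
    have zero : ∀ {C : Seq r t} (z : Mor ω A C) (m : ℕ), val ω h A C (sgl ω A C z) ∈
        degLT Pos m → ∀ B, val ω h A B (sgl ω A C z) ∈ degLT Pos m :=
      fun {C} z m hz B => by
        by_cases e : B = C
        · rw [e]; exact hz
        · rw [val_sgl_of_ne h e]; exact Submodule.zero_mem _
    induction hv with
    | one =>
      refine zero _ _ ?_
      rw [val_sgl]
      change (1 : Alg r t) ∈ _
      have := g_mem_degLT (A := Alg r t) (1 : Perm Pos) one_pos
      rwa [map_one] at this
    | s i hv ih =>
      obtain ⟨C, z, rfl⟩ := hv.eq_sgl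
      obtain ⟨z', hz'⟩ := perm_sgl (ω := ω) (refl i) rfl z
      rw [← perm_refl, hz']
      refine zero _ _ ?_
      rw [← hz', val_perm h _ rfl, ← val_sgl h]
      exact g_mul_degLT _ (degLT_mul_g _ (ih C))
    | e i hv ih =>
      obtain ⟨C, z, rfl⟩ := hv.eq_sgl
      by_cases hC : C (lo i) = C (hi i)
      · intro B
        rw [E_sgl_of_eq hC, map_zero]
        exact Submodule.zero_mem _
      · obtain ⟨z', hz'⟩ := arc_sgl (ω := ω) (lo_lt_hi i).ne z
        rw [← arc_lo_hi, hz']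
        refine zero _ _ ?_
        rw [← hz', val_arc h hC, ← val_sgl h, CapSystem.capOf]
        split_ifs
        · exact capOp_degLT ω (le_last h) _ _ (ih C)
        · exact capOp_degLT ω (le_last h) _ _ (ih C)
    | y j _ ih =>
      intro B
      rw [val_Y, CapSystem.dotOp]
      split_ifs
      · exact dotL_degLT h _ _ (ih B)
      · exact dotR_degLT h _ _ (ih B)
  induction hv using Submodule.span_induction with
  | mem v hv =>
    obtain ⟨m, hm, hv⟩ := hv
    exact degLT_mono hm (key m v hv B)
  | zero => rw [map_zero]; exact Submodule.zero_mem _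
  | add v w _ _ hv hw => rw [map_add]; exact Submodule.add_mem _ hv hw
  | smul c v _ hv => rw [map_smul]; exact Submodule.smul_mem _ c hv

variable (ω A) in
/-- Diagrams with dots in normal position, together with the permutation of their strands and the
labels of their dots. -/
def IsKey (B : Seq r t) (v : Tot ω A) (w : Perm Pos) (s : List Pos) : Prop :=
  ∃ (L b : List Pos) (M : List (Pos × Pos)) (κ : Perm Pos),
    (∀ q ∈ L, B q = -1) ∧ (∀ j ∈ b, A j = 1) ∧ IsCaps B M ∧ κ • A = B ∧ IsValue A B M κ w ∧
      val ω h A B (diag ω A M κ) = g (Alg r t) w ∧ s = L.map B.label ++ b.map A.label ∧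
      v = (L.map (Y ω A)).prod ((b.map (Yr ω A)).prod (diag ω A M κ))

theorem IsForm.exists_isKey {n : ℕ} {v : Tot ω A} (hv : IsForm ω A B n v) :
    ∃ w s, IsKey ω A h B v w s ∧ s.length = n := by
  obtain ⟨L, b, _, hL, hb, ⟨M, κ, hM, hκ, rfl⟩, hn, rfl⟩ := hv
  obtain ⟨w, hw, hw'⟩ := exists_isValue (ω := ω) h hM hκ
  exact ⟨w, _, ⟨L, b, M, κ, hL, hb, hM, hκ, hw, hw', rfl, rfl⟩, by simpa using hn⟩

theorem prod_eq_of_perm {L L' : List Pos} (hL : L.Perm L')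
    {f : Pos → End ℂ (Tot ω A)} (hf : ∀ i j, f i * f j = f j * f i) :
    (L.map f).prod = (L'.map f).prod :=
  (hL.map f).prod_eq' (List.pairwise_map.2 (List.pairwise_of_forall fun i j => hf i j))

theorem IsKey.eq {v v' : Tot ω A} {w : Perm Pos} {s s' : List Pos}
    (hv : IsKey ω A h B v w s) (hv' : IsKey ω A h B v' w s') (hs : s.Perm s') : v = v' := by
  obtain ⟨L, b, M, κ, hL, hb, hM, hκ, hw, _, rfl, rfl⟩ := hv
  obtain ⟨L', b', M', κ', hL', hb', hM', hκ', hw', _, rfl, rfl⟩ := hv'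
  have hlt : ∀ L : List Pos, (∀ q ∈ L, B q = -1) → ∀ x ∈ L.map B.label, ¬ x.val < r := by
    intro L hL x hx
    obtain ⟨q, hq, rfl⟩ := List.mem_map.1 hx
    rw [B.label_lt_iff, hL q hq]; decide
  have hlt' : ∀ b : List Pos, (∀ j ∈ b, A j = 1) → ∀ x ∈ b.map A.label, x.val < r := by
    intro L hL x hx
    obtain ⟨q, hq, rfl⟩ := List.mem_map.1 hx
    rw [A.label_lt_iff, hL q hq]
  have e1 : ∀ L b : List Pos, (∀ q ∈ L, B q = -1) → (∀ j ∈ b, A j = 1) →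
      (L.map B.label ++ b.map A.label).filter (fun x => decide (x.val < r)) = b.map A.label := by
    intro L b hL hb
    rw [List.filter_append, List.filter_eq_nil_iff.2 fun x hx => by simpa using hlt L hL x hx,
      List.filter_eq_self.2 fun x hx => by simpa using hlt' b hb x hx, List.nil_append]
  have e2 : ∀ L b : List Pos, (∀ q ∈ L, B q = -1) → (∀ j ∈ b, A j = 1) →
      (L.map B.label ++ b.map A.label).filter (fun x => decide (¬ x.val < r)) = L.map B.label := by
    intro L b hL hb
    rw [List.filter_append, List.filter_eq_self.2 fun x hx => by simpa using hlt L hL x hx,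
      List.filter_eq_nil_iff.2 fun x hx => by simpa using hlt' b hb x hx, List.append_nil]
  have f1 := hs.filter (fun x : Pos => decide (x.val < r))
  have f2 := hs.filter (fun x : Pos => decide (¬ x.val < r))
  rw [e1 L b hL hb, e1 L' b' hL' hb', List.map_perm_map_iff A.label.injective] at f1
  rw [e2 L b hL hb, e2 L' b' hL' hb', List.map_perm_map_iff B.label.injective] at f2
  rw [diag_eq_of_isValue hM hM' hκ hκ' hw hw', prod_eq_of_perm f1 Yr_comm, prod_eq_of_perm f2 Y_comm]

theorem IsKey.lead {v : Tot ω A} {w : Perm Pos} {s : List Pos} (hv : IsKey ω A h B v w s) :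
    val ω h A B v - g (Alg r t) w * pol (Alg r t) (monomial (Multiset.toFinsupp (s : Multiset Pos)) 1) ∈
      degLT Pos s.length := by
  obtain ⟨L, b, M, κ, hL, hb, hM, hκ, -, hw, rfl, rfl⟩ := hv
  have hdeg : ∀ s : List Pos, (Multiset.toFinsupp (s : Multiset Pos)).degree = s.length := by
    intro s
    rw [Finsupp.degree_apply]
    exact (Finsupp.card_toMultiset _).symm.trans (by simp)
  have step : ∀ (k : Pos) (T : Finset Pos) (a : Alg r t) (s : List Pos),
      a - g (Alg r t) w * pol (Alg r t) (monomial (Multiset.toFinsupp (s : Multiset Pos)) 1) ∈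
        degLT Pos s.length →
      (sys ω h).dotR k T a -
        g (Alg r t) w * pol (Alg r t) (monomial (Multiset.toFinsupp ((k :: s : List Pos) : Multiset Pos)) 1) ∈
        degLT Pos (k :: s).length := by
    intro k T a s hs
    have h1 := dotR_degLT (ω := ω) h k T hs
    have h2 := dotR_sub_leadR ω (le_last h) k T
      (mem_degLT_of (A := Alg r t) (n := s.length + 1) w (by rw [hdeg s]; exact Nat.lt_succ_self _))
    rw [leadR_apply, X_mul_monomial', ← Multiset.toFinsupp_singleton, ← Multiset.toFinsupp_add] at h2
    have h3 := add_mem h1 h2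
    rw [map_sub] at h3
    convert h3 using 1
    · rfl
    · exact (sub_add_sub_cancel (G := Alg r t) _ _ _).symm
  induction L with
  | nil =>
    induction b with
    | nil =>
      change val ω h A B (diag ω A M κ) - _ ∈ _
      rw [hw]
      change g (Alg r t) w - g (Alg r t) w * pol (Alg r t) 1 ∈ _
      rw [map_one, mul_one, sub_self]
      exact zero_mem _
    | cons j b ih =>
      rw [List.map_nil, List.nil_append, List.map_cons, List.map_cons, List.prod_cons, List.map_nil,
        List.prod_nil, End.one_apply, End.mul_apply, val_Yr, CapSystem.inert,
        if_pos (hb j List.mem_cons_self)]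
      exact step _ _ _ _ (ih fun q hq => hb q (List.mem_cons_of_mem _ hq))
  | cons q L ih =>
    have hq := hL q List.mem_cons_self
    rw [List.map_cons, List.map_cons, List.prod_cons, End.mul_apply, val_Y, CapSystem.dotOp,
      if_neg (by rw [hq]; decide), List.cons_append]
    exact step _ _ _ _ (ih fun q hq => hL q (List.mem_cons_of_mem _ hq))

theorem IsKey.eq_sgl {v : Tot ω A} {w : Perm Pos} {s : List Pos}
    (hv : IsKey ω A h B v w s) : ∃ z, v = sgl ω A B z := by
  obtain ⟨L, b, M, κ, hL, hb, hM, hκ, -, -, -, rfl⟩ := hv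
  exact IsForm.eq_sgl ⟨L, b, _, hL, hb, ⟨M, κ, hM, hκ, rfl⟩, rfl, rfl⟩

theorem mem_fil_of_val {n : ℕ} {v : Tot ω A} (hv : v ∈ fil ω A (n + 1))
    (hd : ∀ B, val ω h A B v ∈ degLT Pos n) : v ∈ fil ω A n := by
  have hle : fil ω A (n + 1) ≤ Submodule.span ℂ {v | ∃ B, IsForm ω A B n v} ⊔ fil ω A n := by
    refine Submodule.span_le.2 ?_
    rintro x ⟨m, hm, hx⟩
    rcases Nat.lt_succ_iff_lt_or_eq.1 hm with hm | rfl
    · exact Submodule.mem_sup_right (hx.mem hm)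
    · obtain ⟨B, hB⟩ := hx.mem_forms
      have hsub : {v | IsForm ω A B m v} ⊆ {v | ∃ B, IsForm ω A B m v} := fun v hv => ⟨B, hv⟩
      exact (sup_le_sup_right (Submodule.span_mono hsub) _ : forms ω A B m ≤ _) hB
  obtain ⟨u, hu, f, hf, rfl⟩ := Submodule.mem_sup.1 (hle hv)
  obtain ⟨c, hc, rfl⟩ := Submodule.mem_span_set.1 hu
  suffices c = 0 by rw [this, Finsupp.sum_zero_index, zero_add]; exact hf
  by_contra hne
  obtain ⟨F, hF⟩ := Finsupp.support_nonempty_iff.2 hne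
  obtain ⟨B, hFB⟩ := hc hF
  obtain ⟨w, s, hk, hs⟩ := hFB.exists_isKey h
  let φ : Tot ω A →ₗ[ℂ] ℂ := MvPolynomial.lcoeff ℂ (Multiset.toFinsupp (s : Multiset Pos)) ∘ₗ LinearMap.proj w ∘ₗ
    coeff ∘ₗ val ω h A B
  have hdeg : n ≤ (Multiset.toFinsupp (↑s : Multiset Pos)).degree := by
    rw [Finsupp.degree_apply, ← hs]
    exact le_of_eq ((Finsupp.card_toMultiset _).symm.trans (by simp)).symm
  have hφ : ∀ u, val ω h A B u ∈ degLT Pos n → φ u = 0 := fun u hu =>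
    mem_degLT_iff.1 hu w _ hdeg
  have hlead : ∀ {F' w' s'}, IsKey ω A h B F' w' s' → s'.length = n →
      φ F' = MvPolynomial.coeff (Multiset.toFinsupp (s : Multiset Pos))
        ((Pi.single w' (monomial (Multiset.toFinsupp (s' : Multiset Pos)) 1) : Perm Pos →
          MvPolynomial Pos ℂ) w) := fun {F' w' s'} hk' hs' => by
    have h1 := IsKey.lead h hk'
    rw [hs'] at h1
    have h2 := mem_degLT_iff.1 h1 w _ hdeg
    rw [map_sub, Pi.sub_apply, MvPolynomial.coeff_sub, coeff_apply, sub_eq_zero] at h2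
    exact h2
  have h0 : φ (c.sum fun v r => r • v) = 0 := by
    have := hφ _ (hd B)
    rwa [map_add, hφ f (val_mem_degLT h hf B), add_zero] at this
  rw [Finsupp.sum, map_sum, Finset.sum_eq_single F] at h0
  · rw [map_smul, hlead hk hs, Pi.single_eq_same, coeff_monomial, if_pos rfl, smul_eq_mul,
    mul_one] at h0
    exact Finsupp.mem_support_iff.1 hF h0
  · intro F' hF' hFF'
    rw [map_smul]
    suffices φ F' = 0 by rw [this, smul_zero]
    obtain ⟨B', hFB'⟩ := hc hF'
    obtain ⟨w', s', hk', hs'⟩ := hFB'.exists_isKey h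
    by_cases hB : B' = B
    · subst hB
      rw [hlead hk' hs']
      by_cases hw : w = w'
      · subst hw
        rw [Pi.single_eq_same, coeff_monomial, if_neg]
        intro e
        exact hFF' (hk'.eq h hk (Multiset.coe_eq_coe.1 (Multiset.toFinsupp.injective e)))
      · rw [Pi.single_eq_of_ne hw, MvPolynomial.coeff_zero]
    · obtain ⟨z, rfl⟩ := hk'.eq_sgl
      refine hφ _ ?_
      rw [val_sgl_of_ne h (Ne.symm hB)]
      exact zero_mem _
  · intro hF'
    exact absurd hF hF'

end Tot

end

section
open Equiv MvPolynomial Pre Hecke AffineHecke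

theorem polyMap_X_mul (ω : ℕ → ℂ) (A : Seq r t) (j : Pos) (p : R r t) :
    polyMap ω A (X j * p) = Mor.act ω (Pre.y A j) (polyMap ω A p) := by
  rw [map_mul, polyMap_X]
  rfl

theorem polyMap_mul_X (ω : ℕ → ℂ) (A : Seq r t) (j : Pos) (p : R r t) :
    polyMap ω A (p * X j) = Mor.coact ω (Pre.y A j) (polyMap ω A p) := by
  rw [map_mul, polyMap_X]
  rfl

namespace Tot

/-- Renaming the variables by the labels of the positions, with signs. -/
def unlabel (A : Seq r t) : R r t →ₐ[ℂ] R r t :=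
  aeval fun k => (A (A.label.symm k) : ℂ) • X (A.label.symm k)

theorem unlabel_X (A : Seq r t) (j : Pos) : unlabel A (X (A.label j)) = (A j : ℂ) • X j := by
  rw [unlabel, aeval_X, symm_apply_apply]

theorem unlabel_surjective (A : Seq r t) : Function.Surjective (unlabel A) := by
  rw [← AlgHom.range_eq_top, eq_top_iff, ← MvPolynomial.adjoin_range_X, Algebra.adjoin_le_iff]
  rintro _ ⟨j, rfl⟩
  refine ⟨(A j : ℂ) • X (A.label j), ?_⟩
  change unlabel A _ = _
  rw [map_smul, unlabel_X, smul_smul, ← Int.cast_mul, CapSystem.seq_sq, Int.cast_one, one_smul]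

/-- The polynomials in the signed letters `y`. -/
def poly (ω : ℕ → ℂ) (A : Seq r t) : R r t →ₗ[ℂ] Tot ω A where
  toFun p := sgl ω A A (polyMap ω A (unlabel A p))
  map_add' p q := by rw [map_add, map_add]; exact map_add (sgl ω A A) _ _
  map_smul' c p := by rw [map_smul, map_smul]; exact map_smul (sgl ω A A) _ _

variable {ω : ℕ → ℂ} {A : Seq r t}

theorem poly_apply (p : R r t) : poly ω A p = sgl ω A A (polyMap ω A (unlabel A p)) := rfl

theorem poly_one : poly ω A 1 = sgl ω A A (Mor.mk ω (Pre.id A)) := by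
  rw [poly_apply, map_one, map_one]
  rfl

theorem Y_poly (j : Pos) (p : R r t) : Y ω A j (poly ω A p) = poly ω A (X (A.label j) * p) := by
  rw [poly_apply, Y_sgl, poly_apply, map_mul, unlabel_X, smul_mul_assoc, map_smul (polyMap ω A)]
  refine congrArg (sgl ω A A) ?_
  rw [polyMap_X_mul, ← Int.cast_smul_eq_zsmul ℂ]
  rfl

theorem Yr_poly (j : Pos) (p : R r t) : Yr ω A j (poly ω A p) = poly ω A (X (A.label j) * p) := by
  rw [poly_apply, Yr_sgl, poly_apply, map_mul, unlabel_X, smul_mul_assoc, map_smul (polyMap ω A)]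
  refine congrArg (sgl ω A A) ?_
  rw [mul_comm, polyMap_mul_X, ← Int.cast_smul_eq_zsmul ℂ]
  rfl

theorem monomial_cons (k : Pos) (s : Multiset Pos) :
    (monomial (Multiset.toFinsupp (k ::ₘ s)) 1 : R r t) = X k * monomial (Multiset.toFinsupp s) 1 := by
  rw [X_mul_monomial', ← Multiset.toFinsupp_singleton, ← Multiset.toFinsupp_add]
  rfl

theorem degree_toFinsupp (s : Multiset Pos) : (Multiset.toFinsupp s).degree = s.card := by
  rw [Finsupp.degree_apply]
  exact (Finsupp.card_toMultiset _).symm.trans (by simp)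

theorem poly_monomial_mem (s : Multiset Pos) :
    poly ω A (monomial (Multiset.toFinsupp s) 1) ∈ fil ω A (s.card + 1) := by
  induction s using Multiset.induction with
  | empty =>
    rw [map_zero]
    change poly ω A 1 ∈ _
    rw [poly_one]
    exact IsWord.one.mem (by omega)
  | cons k s ih =>
    obtain ⟨j, rfl⟩ := A.label.surjective k
    rw [monomial_cons, ← Y_poly, Multiset.card_cons]
    exact Y_mem_op j _ _ ih

theorem map_mem_of_monomial {V : Type*} [AddCommGroup V] [Module ℂ V] (φ : R r t →ₗ[ℂ] V)
    {n : ℕ} {K : Submodule ℂ V}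
    (hφ : ∀ s : Multiset Pos, s.card < n → φ (monomial (Multiset.toFinsupp s) 1) ∈ K)
    {p : R r t} (hp : ∀ a : Pos →₀ ℕ, n ≤ a.degree → MvPolynomial.coeff a p = 0) : φ p ∈ K := by
  rw [p.as_sum, map_sum]
  refine sum_mem fun a ha => ?_
  have e : (monomial a (MvPolynomial.coeff a p) : R r t) = MvPolynomial.coeff a p • monomial a 1 := by
    rw [smul_monomial, smul_eq_mul, mul_one]
  obtain ⟨s, rfl⟩ := Multiset.toFinsupp.surjective a
  rw [e, map_smul]
  refine Submodule.smul_mem _ _ (hφ s ?_)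
  by_contra hs
  exact mem_support_iff.1 ha (hp _ (by rw [degree_toFinsupp]; omega))

theorem poly_mem_fil {n : ℕ} {p : R r t}
    (hp : ∀ a : Pos →₀ ℕ, n + 1 ≤ a.degree → MvPolynomial.coeff a p = 0) :
    poly ω A p ∈ fil ω A (n + 1) :=
  map_mem_of_monomial _ (fun s hs => fil_mono (by omega) (poly_monomial_mem s)) hp

/-- Multiplication by `y_k`, on the left or on the right, up to terms of lower degree. -/
def lead (b : Prop) [Decidable b] (k : Pos) : Module.End ℂ (Alg r t) :=
  if b then leadL (Alg r t) k else leadR (Alg r t) k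

theorem lead_apply (b : Prop) [Decidable b] (k : Pos) (w : Perm Pos) (f : R r t) :
    lead b k (g (Alg r t) w * pol (Alg r t) f) =
      g (Alg r t) w * pol (Alg r t) (X (if b then w⁻¹ k else k) * f) := by
  rw [lead]
  split_ifs
  · exact leadL_apply k w f
  · exact leadR_apply k w f

theorem dotOp_sub_lead (h : 0 < r + t) (k : Pos) {n : ℕ} {a : Alg r t} (ha : a ∈ degLT Pos n) :
    (sys ω h).dotOp A (A.label.symm k) a - lead (k.val < r) k a ∈ degLT Pos n := by
  obtain ⟨j, rfl⟩ := A.label.surjective k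
  simp only [CapSystem.dotOp, lead, symm_apply_apply, A.label_lt_iff]
  split_ifs
  · exact dotL_sub_leadL ω (le_last h) _ _ ha
  · exact dotR_sub_leadR ω (le_last h) _ _ ha

theorem inert_sub_lead (h : 0 < r + t) (k : Pos) {n : ℕ} {a : Alg r t} (ha : a ∈ degLT Pos n) :
    (sys ω h).inert A (A.label.symm k) a - lead (¬ k.val < r) k a ∈ degLT Pos n := by
  obtain ⟨j, rfl⟩ := A.label.surjective k
  simp only [CapSystem.inert, lead, symm_apply_apply, A.label_lt_iff, ite_not]
  split_ifs
  · exact dotR_sub_leadR ω (le_last h) _ _ ha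
  · exact dotL_sub_leadL ω (le_last h) _ _ ha

theorem lead_of_mul {b : Pos → Prop} [DecidablePred b] {w : Perm Pos}
    {φ : R r t →ₗ[ℂ] Alg r t} {D : Pos → Module.End ℂ (Alg r t)} (h1 : φ 1 = g (Alg r t) w)
    (hφ : ∀ k p, φ (X k * p) = D k (φ p))
    (hD : ∀ k n, ∀ a ∈ degLT Pos n, D k a - lead (b k) k a ∈ degLT Pos n)
    {n : ℕ} {p : R r t} (hp : ∀ a : Pos →₀ ℕ, n + 1 ≤ a.degree → MvPolynomial.coeff a p = 0) :
    φ p - g (Alg r t) w * pol (Alg r t) (rename (fun k => if b k then w⁻¹ k else k) p) ∈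
      degLT Pos n := by
  refine map_mem_of_monomial (φ - LinearMap.mulLeft ℂ (g (Alg r t) w) ∘ₗ (pol (Alg r t)).toLinearMap ∘ₗ
    (rename fun k => if b k then w⁻¹ k else k).toLinearMap) (fun s hs => ?_) hp
  suffices H : ∀ s : Multiset Pos,
      φ (monomial (Multiset.toFinsupp s) 1) - g (Alg r t) w * pol (Alg r t)
        (rename (fun k => if b k then w⁻¹ k else k) (monomial (Multiset.toFinsupp s) 1)) ∈
          degLT Pos s.card ∧
      g (Alg r t) w * pol (Alg r t)
        (rename (fun k => if b k then w⁻¹ k else k) (monomial (Multiset.toFinsupp s) 1)) ∈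
          degLT Pos (s.card + 1) from degLT_mono (by omega) (H s).1
  intro s
  induction s using Multiset.induction with
  | empty =>
    rw [map_zero]
    change φ 1 - g (Alg r t) w * pol (Alg r t) (rename _ (1 : R r t)) ∈ _ ∧
      g (Alg r t) w * pol (Alg r t) (rename _ (1 : R r t)) ∈ _
    rw [h1, map_one (rename _), map_one (pol (Alg r t)), mul_one, sub_self]
    refine ⟨Submodule.zero_mem _, ?_⟩
    have := mem_degLT_of (A := Alg r t) (n := 1) (a := 0) w (by rw [map_zero]; exact one_pos)
    rwa [show (monomial 0 1 : R r t) = 1 from rfl, map_one, mul_one] at this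
  | cons k s ih =>
    have lm : ∀ n, ∀ a ∈ degLT Pos n, lead (b k) k a ∈ degLT Pos (n + 1) := by
      intro n a ha
      rw [lead]
      split_ifs
      · exact leadL_mem k ha
      · exact leadR_mem k ha
    rw [monomial_cons, hφ, map_mul, rename_X, ← lead_apply, Multiset.card_cons]
    refine ⟨?_, lm _ _ ih.2⟩
    have h2 := add_mem (degLT_mono (Nat.le_succ _) (hD k _ _ ih.1)) (lm _ _ ih.1)
    have h3 := add_mem h2 (hD k _ _ ih.2)
    rwa [sub_add_cancel, map_sub, sub_add_sub_cancel] at h3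

theorem evMor_comp (h : 0 < r + t) (g : Mor ω C D) (f : Mor ω B C) :
    evMor ω h (Mor.comp g f) = evMor ω h g * evMor ω h f := by
  induction g using Quotient.inductionOn
  induction f using Quotient.inductionOn
  rfl

/-- The operators of polynomials, applied to a vector. -/
def evPoly (h : 0 < r + t) (A : Seq r t) (v : Alg r t) : R r t →ₗ[ℂ] Alg r t :=
  LinearMap.applyₗ v ∘ₗ evMor ω h ∘ₗ LinearMap.proj A ∘ₗ poly ω A

theorem evPoly_apply (h : 0 < r + t) (v : Alg r t) (p : R r t) :
    evPoly (ω := ω) h A v p = evMor ω h (polyMap ω A (unlabel A p)) v := by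
  change evMor ω h (poly ω A p A) v = _
  rw [poly_apply, sgl_self]

theorem evPoly_one (h : 0 < r + t) (v : Alg r t) : evPoly (ω := ω) h A v 1 = v := by
  change evMor ω h (poly ω A 1 A) v = v
  rw [poly_one, sgl_self]
  rfl

theorem evPoly_X_mul (h : 0 < r + t) (v : Alg r t) (k : Pos) (p : R r t) :
    evPoly (ω := ω) h A v (X k * p) = (sys ω h).dotOp A (A.label.symm k) (evPoly (ω := ω) h A v p) := by
  obtain ⟨j, rfl⟩ := A.label.surjective k
  rw [symm_apply_apply]
  change evMor ω h (poly ω A _ A) v = _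
  rw [← Y_poly]
  change evMor ω h (A j • Mor.act ω (Pre.y A j) (poly ω A p A)) v = _
  rw [map_zsmul, evMor_act, CapSystem.ev_y, smul_mul_assoc, smul_smul, CapSystem.seq_sq, one_smul]
  rfl

theorem val_poly (h : 0 < r + t) (p : R r t) :
    val ω h A A (poly ω A p) = evPoly (ω := ω) h A 1 p := rfl

theorem val_poly_sub (h : 0 < r + t) {n : ℕ} {p : R r t}
    (hp : ∀ a : Pos →₀ ℕ, n + 1 ≤ a.degree → MvPolynomial.coeff a p = 0) :
    val ω h A A (poly ω A p) - pol (Alg r t) p ∈ degLT Pos n := by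
  have := lead_of_mul (b := fun k => k.val < r) (w := 1) ((evPoly_one (ω := ω) (A := A) h 1).trans (map_one (g (Alg r t))).symm)
    (evPoly_X_mul h 1) (fun k n a ha => dotOp_sub_lead h k ha) hp
  rw [map_one, one_mul] at this
  simp only [inv_one, Perm.one_apply, ite_self] at this
  rwa [show (fun k : Pos => k) = _root_.id from rfl, rename_id_apply] at this

theorem coeff_pol (p : R r t) : coeff (pol (Alg r t) p) = Pi.single (1 : Perm Pos) p := by
  rw [← coeff_apply (A := Alg r t), map_one, one_mul]

theorem poly_injective (h : 0 < r + t) : Function.Injective (poly ω A) := by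
  rw [injective_iff_map_eq_zero]
  intro p hp
  by_contra hne
  have h1 := val_poly_sub (ω := ω) (A := A) h (n := p.totalDegree) (p := p)
    fun a ha => coeff_eq_zero_of_totalDegree_lt (by
      rw [Finsupp.degree_apply] at ha; exact ha)
  rw [hp, map_zero, zero_sub, neg_mem_iff, mem_degLT_iff] at h1
  obtain ⟨a, ha, hd⟩ := Finset.exists_mem_eq_sup p.support (support_nonempty.2 hne) fun s => s.sum fun _ e => e
  have := h1 1 a (by rw [Finsupp.degree_apply]; exact hd.le)
  rw [coeff_pol, Pi.single_eq_same] at this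
  exact mem_support_iff.1 ha this

end Tot

theorem polyMap_injective (ω : ℕ → ℂ) (A : Seq r t) (h : 0 < r + t) :
    Function.Injective (polyMap ω A) := by
  intro p q hpq
  obtain ⟨p, rfl⟩ := Tot.unlabel_surjective A p
  obtain ⟨q, rfl⟩ := Tot.unlabel_surjective A q
  rw [Tot.poly_injective (ω := ω) (A := A) h (congrArg (Tot.sgl ω A A) hpq)]

theorem coeff_eq_zero_of_mul_X_sub {i j : Pos} (hij : i ≠ j) {n : ℕ} {p : R r t}
    (hp : ∀ a : Pos →₀ ℕ, n + 1 ≤ a.degree → MvPolynomial.coeff a p = 0)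
    (hX : ∀ a : Pos →₀ ℕ, n + 1 ≤ a.degree → MvPolynomial.coeff a ((X i - X j) * p) = 0)
    (a : Pos →₀ ℕ) (ha : n ≤ a.degree) : MvPolynomial.coeff a p = 0 := by
  rcases ha.lt_or_eq with ha | rfl
  · exact hp a ha
  suffices H : ∀ m, ∀ b : Pos →₀ ℕ, b.degree = a.degree → b j = m → MvPolynomial.coeff b p = 0 from
    H _ a rfl rfl
  intro m
  induction m with
  | zero =>
    intro b hb hbj
    have := hX (Finsupp.single i 1 + b) (by rw [map_add, Finsupp.degree_single]; omega)
    rwa [sub_mul, coeff_sub, coeff_X_mul, coeff_X_mul', if_neg, sub_zero] at this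
    rw [Finsupp.notMem_support_iff, Finsupp.add_apply, Finsupp.single_eq_of_ne hij.symm, hbj, add_zero]
  | succ m ih =>
    intro b hb hbj
    have hle : Finsupp.single j 1 ≤ b := by
      rw [Finsupp.single_le_iff]; omega
    obtain ⟨c, rfl⟩ := exists_add_of_le hle
    have h1 := ih (Finsupp.single i 1 + c) (by
      rw [map_add, Finsupp.degree_single] at hb ⊢; exact hb) (by
      rw [Finsupp.add_apply, Finsupp.single_eq_same] at hbj
      rw [Finsupp.add_apply, Finsupp.single_eq_of_ne hij.symm]; omega)
    have := hX (Finsupp.single i 1 + (Finsupp.single j 1 + c)) (by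
      rw [map_add, hb, Finsupp.degree_single]; omega)
    rwa [sub_mul, coeff_sub, coeff_X_mul, add_left_comm, coeff_X_mul, h1, sub_zero] at this

namespace Tot

variable {ω : ℕ → ℂ} {A : Seq r t} (h : 0 < r + t)

include h in
theorem exists_poly_of_commute {n : ℕ} {z : Mor ω A A} (hz : sgl ω A A z ∈ fil ω A n)
    (hy : ∀ j, Y ω A j (sgl ω A A z) = Yr ω A j (sgl ω A A z)) : ∃ p, sgl ω A A z = poly ω A p := by
  induction n generalizing z with
  | zero =>
    rw [fil_zero, Submodule.mem_bot] at hz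
    exact ⟨0, by rw [hz, map_zero]⟩
  | succ n ih =>
    have hH := val_mem_degLT h hz A
    have hlead : ∀ k : Pos, leadL (Alg r t) k (val ω h A A (sgl ω A A z)) -
        leadR (Alg r t) k (val ω h A A (sgl ω A A z)) ∈ degLT Pos (n + 1) := by
      intro k
      obtain ⟨j, rfl⟩ := A.label.surjective k
      have e := congrArg (val ω h A A) (hy j)
      rw [val_Y, val_Yr] at e
      have key : ∀ T T' : Finset Pos, (sys ω h).dotL (A.label j) T (val ω h A A (sgl ω A A z)) =
          (sys ω h).dotR (A.label j) T' (val ω h A A (sgl ω A A z)) →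
          leadL (Alg r t) (A.label j) (val ω h A A (sgl ω A A z)) -
            leadR (Alg r t) (A.label j) (val ω h A A (sgl ω A A z)) ∈ degLT Pos (n + 1) := by
        intro T T' e
        have h1 := sub_mem (dotR_sub_leadR ω (le_last h) (A.label j) T' hH)
          (dotL_sub_leadL ω (le_last h) (A.label j) T hH)
        have e' : (capSystem (A := Alg r t) ω (le_last h)).dotL (A.label j) T (val ω h A A (sgl ω A A z)) =
          (capSystem (A := Alg r t) ω (le_last h)).dotR (A.label j) T' (val ω h A A (sgl ω A A z)) := e
        rwa [e', sub_sub_sub_cancel_left] at h1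
      rw [CapSystem.dotOp, CapSystem.inert] at e
      split_ifs at e
      · exact key _ _ e
      · exact key _ _ e.symm
    set p := coeff (val ω h A A (sgl ω A A z)) (1 : Perm Pos) with hpdef
    have hp := mem_degLT_iff.1 hH 1
    let u : Mor ω A A := polyMap ω A (unlabel A p)
    have hsub : sgl ω A A z - poly ω A p = sgl ω A A (z - u) :=
      (map_sub (sgl ω A A) _ _).symm
    obtain ⟨q, hq⟩ := ih (z := z - u) (by
      rw [← hsub]
      refine mem_fil_of_val h (sub_mem hz (poly_mem_fil hp)) fun B => ?_
      by_cases hB : B = A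
      · subst hB
        have h1 := val_poly_sub (ω := ω) (A := B) h hp
        have h2 : val ω h B B (sgl ω B B z) - pol (Alg r t) p ∈ degLT Pos n := by
          rw [mem_degLT_iff]
          intro w a ha
          rw [map_sub, Pi.sub_apply, coeff_pol, MvPolynomial.coeff_sub]
          by_cases hw : w = 1
          · subst hw
            rw [Pi.single_eq_same, sub_self]
          · rw [Pi.single_eq_of_ne hw, MvPolynomial.coeff_zero, sub_zero]
            obtain ⟨k, hk⟩ : ∃ k, w⁻¹ k ≠ k := by
              by_contra! hk
              exact hw (inv_eq_one.1 (ext hk))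
            refine coeff_eq_zero_of_mul_X_sub hk (mem_degLT_iff.1 hH w) (fun b hb => ?_) a ha
            have := mem_degLT_iff.1 (hlead k) w b hb
            rwa [map_sub, Pi.sub_apply, coeff_leadL, coeff_leadR, ← sub_mul] at this
        have := sub_mem h2 h1
        rwa [sub_sub_sub_cancel_right, ← map_sub] at this
      · rw [hsub, val_sgl_of_ne h hB]
        exact zero_mem _) (fun j => by
      rw [← hsub, map_sub, map_sub, hy, Y_poly, Yr_poly])
    exact ⟨p + q, by rw [map_add, ← hq, ← hsub, add_sub_cancel]⟩

end Tot

theorem exists_polyMap_of_commute {ω : ℕ → ℂ} (h : 0 < r + t) {z : Mor ω A A}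
    (hy : ∀ j, Mor.act ω (Pre.y A j) z = Mor.coact ω (Pre.y A j) z) : ∃ p, polyMap ω A p = z := by
  obtain ⟨n, hn⟩ := Tot.exists_mem_fil z
  obtain ⟨p, hp⟩ := Tot.exists_poly_of_commute h hn fun j => by rw [Tot.Y_sgl, Tot.Yr_sgl, hy]
  refine ⟨Tot.unlabel A p, ?_⟩
  have := congrFun hp A
  rw [Tot.sgl_self, Tot.poly_apply, Tot.sgl_self] at this
  exact this.symm

end

section
open Equiv Module Algebra MvPolynomial Tot Pre Hecke AffineHecke

/-- A polynomial in the variables other than `y_i`, `y_j`, plus a multiple of `y_i + y_j`. -/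
def IsDecomposed (i j : Pos) (p : R r t) : Prop :=
  ∃ a ∈ adjoin ℂ (X '' {i, j}ᶜ : Set (R r t)), ∃ g, p = a + (X i + X j) * g

namespace IsDecomposed

variable {i j : Fin (r + t)} {p : R r t}

theorem symm (hp : IsDecomposed i j p) : IsDecomposed j i p := by
  obtain ⟨a, ha, g, rfl⟩ := hp
  exact ⟨a, by rwa [Set.pair_comm], g, by rw [add_comm (X i)]⟩

theorem rename (hp : IsDecomposed i j p) (σ : Perm Pos) :
    IsDecomposed (σ i) (σ j) (MvPolynomial.rename σ p) := by
  obtain ⟨a, ha, g, rfl⟩ := hp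
  refine ⟨MvPolynomial.rename σ a, ?_, MvPolynomial.rename σ g, by simp⟩
  have : MvPolynomial.rename σ a ∈ (adjoin ℂ (X '' {i, j}ᶜ)).map (MvPolynomial.rename (R := ℂ) σ) :=
    ⟨a, ha, rfl⟩
  rw [AlgHom.map_adjoin] at this
  refine adjoin_mono ?_ this
  rintro _ ⟨_, ⟨k, hk, rfl⟩, rfl⟩
  exact ⟨σ k, by simpa using hk, (rename_X _ _).symm⟩

end IsDecomposed

theorem dvd_sub_of_algHom {c : R r t} (φ ψ : R r t →ₐ[ℂ] R r t) (h : ∀ k, c ∣ φ (X k) - ψ (X k)) (p : R r t) :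
    c ∣ φ p - ψ p := by
  have : (Ideal.Quotient.mkₐ ℂ (Ideal.span {c})).comp φ = (Ideal.Quotient.mkₐ ℂ (Ideal.span {c})).comp ψ :=
    algHom_ext fun k => Ideal.Quotient.eq.2 (Ideal.mem_span_singleton.2 (h k))
  exact Ideal.mem_span_singleton.1 (Ideal.Quotient.eq.1 (DFunLike.congr_fun this p))

theorem algHom_mem {S : Type*} [CommRing S] [Algebra ℂ S] (φ : R r t →ₐ[ℂ] S) {K : Subalgebra ℂ S}
    (h : ∀ k, φ (X k) ∈ K) (p : R r t) : φ p ∈ K := by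
  have : (⊤ : Subalgebra ℂ (R r t)) ≤ K.comap φ := by
    rw [← MvPolynomial.adjoin_range_X, adjoin_le_iff]
    rintro _ ⟨k, rfl⟩
    exact h k
  exact this mem_top

/-- Setting two variables to zero. -/
def kill (i j : Pos) : R r t →ₐ[ℂ] R r t :=
  aeval fun k => if k = i ∨ k = j then 0 else X k

theorem kill_X (i j k : Pos) : kill i j (X k) = if k = i ∨ k = j then 0 else X k := aeval_X _ k

theorem kill_mem (i j : Pos) (p : R r t) : kill i j p ∈ adjoin ℂ (X '' {i, j}ᶜ : Set (R r t)) := by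
  refine algHom_mem _ (fun k => ?_) p
  rw [kill_X]
  split_ifs with hk
  · exact Subalgebra.zero_mem _
  · exact subset_adjoin ⟨k, by simpa using hk, rfl⟩

theorem qCancellation_iff {i j : Pos} (hij : i ≠ j) {p : R r t} :
    QCancellation i j p ↔ IsDecomposed i j p := by
  constructor
  · intro h
    change _ = kill i j p at h
    obtain ⟨g, hg⟩ := dvd_sub_of_algHom (c := X i + X j) (AlgHom.id ℂ _)
      (aeval fun k => if k = j then -X i else X k) (fun k => by
        rw [aeval_X, AlgHom.id_apply]
        split_ifs with hk
        · rw [hk, sub_neg_eq_add, add_comm (X j)]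
        · rw [sub_self]; exact dvd_zero _) p
    rw [h, AlgHom.id_apply] at hg
    exact ⟨_, kill_mem i j p, g, by rw [← hg, add_sub_cancel]⟩
  · rintro ⟨a, ha, g, rfl⟩
    rw [QCancellation, map_add, map_add, map_mul, map_mul, map_add, map_add, aeval_X, aeval_X, aeval_X,
      aeval_X, if_neg hij, if_pos rfl, if_pos (Or.inl rfl), if_pos (Or.inr rfl), add_neg_cancel, zero_mul,
      add_zero, add_zero, zero_mul, add_zero]
    refine AlgHom.eqOn_adjoin_iff.2 ?_ ha
    rintro _ ⟨k, hk, rfl⟩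
    rw [Set.mem_compl_iff, Set.mem_insert_iff, Set.mem_singleton_iff] at hk
    simp only [aeval_X]
    rw [if_neg fun e => hk (Or.inr e), if_neg hk]

theorem eq_zero_of_rename {k l : Pos} (hkl : k ≠ l) {q : R r t}
    (h1 : rename (fun x => if x = k then l else x) q = q) (h0 : kill k l q = 0)
    (hq : ∀ n, (∀ a : Pos →₀ ℕ, n + 1 ≤ a.degree → MvPolynomial.coeff a q = 0) →
      ∀ a : Pos →₀ ℕ, n ≤ a.degree →
        MvPolynomial.coeff a (q - rename (fun x => if x = l then k else x) q) = 0) : q = 0 := by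
  by_contra hne
  have hd := hq q.totalDegree fun a ha => coeff_eq_zero_of_totalDegree_lt (by
    rw [Finsupp.degree_apply] at ha; exact ha)
  let K : Submodule ℂ (R r t) :=
    { carrier := {p | ∀ a : Pos →₀ ℕ, q.totalDegree ≤ a.degree → MvPolynomial.coeff a p = 0}
      add_mem' := fun hp hp' a ha => by rw [MvPolynomial.coeff_add, hp a ha, hp' a ha, add_zero]
      zero_mem' := fun a _ => MvPolynomial.coeff_zero a
      smul_mem' := fun c p hp a ha => by rw [MvPolynomial.coeff_smul, hp a ha, smul_zero] }
  let φ : R r t →ₐ[ℂ] R r t := aeval fun x => if x = k then 0 else X x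
  have hφ : ∀ s : Multiset Pos, φ (monomial (Multiset.toFinsupp s) 1) = 0 ∨
      φ (monomial (Multiset.toFinsupp s) 1) = monomial (Multiset.toFinsupp s) 1 := by
    intro s
    induction s using Multiset.induction with
    | empty => exact Or.inr (by rw [map_zero]; exact map_one φ)
    | cons x s ih =>
      rw [monomial_cons, map_mul]
      rcases ih with ih | ih
      · exact Or.inl (by rw [ih, mul_zero])
      · rw [ih, aeval_X]
        split_ifs
        · exact Or.inl (zero_mul _)
        · exact Or.inr rfl
  have hK := map_mem_of_monomial φ.toLinearMap (K := K) (fun s hs => by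
    rcases hφ s with e | e
    · rw [AlgHom.toLinearMap_apply, e]
      exact K.zero_mem
    · rw [AlgHom.toLinearMap_apply, e]
      intro a ha
      rw [coeff_monomial, if_neg]
      rintro rfl
      rw [degree_toFinsupp] at ha
      omega) hd
  have e1 : φ.comp (rename fun x => if x = k then l else x) = rename fun x => if x = k then l else x :=
    algHom_ext fun x => by
      rw [AlgHom.comp_apply, rename_X, aeval_X, if_neg]
      split_ifs with hx
      · exact hkl.symm
      · exact hx
  have e2 : φ.comp (rename fun x => if x = l then k else x) = kill k l := algHom_ext fun x => by
    rw [AlgHom.comp_apply, rename_X, aeval_X, kill_X]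
    split_ifs <;> simp_all
  have e3 := DFunLike.congr_fun e1 q
  have e4 := DFunLike.congr_fun e2 q
  rw [AlgHom.comp_apply, h1] at e3
  rw [AlgHom.comp_apply, h0] at e4
  rw [AlgHom.toLinearMap_apply, map_sub, e3, e4, sub_zero] at hK
  obtain ⟨a, ha, hd⟩ := Finset.exists_mem_eq_sup q.support (support_nonempty.2 hne) fun s => s.sum fun _ e => e
  exact mem_support_iff.1 ha (hK a (by rw [Finsupp.degree_apply]; exact hd.le))

theorem swap_inv_side {k l : Pos} (hk : k.val < r) (hl : ¬ l.val < r) :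
    ((fun z : Pos => if z.val < r then (swap k l)⁻¹ z else z) = fun z => if z = k then l else z) ∧
      (fun z : Pos => if ¬ z.val < r then (swap k l)⁻¹ z else z) =
        fun z => if z = l then k else z := by
  constructor <;>
  · funext z
    rw [swap_inv]
    rcases eq_or_ne z k with rfl | h1
    · rw [swap_apply_left]; grind
    rcases eq_or_ne z l with rfl | h2
    · rw [swap_apply_right]; grind
    rw [swap_apply_of_ne_of_ne h1 h2]; grind

theorem isDecomposed_of_commute {ω : ℕ → ℂ} (h : 0 < r + t) {x y : Pos} (hx : B x = 1)
    (hy : B y = -1) {e : VVB ω B}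
    (he : evMor ω h (A := B) (B := B) e 1 = g (Alg r t) (swap (B.label x) (B.label y)))
    (hD : ∀ p, IsDecomposed x y p → Commute (polyMap ω B p) e) {p : R r t}
    (hp : Commute (polyMap ω B p) e) : IsDecomposed x y p := by
  obtain ⟨p, rfl⟩ := unlabel_surjective B p
  have hk : (B.label x).val < r := (B.label_lt_iff x).2 hx
  have hl : ¬ (B.label y).val < r := by rw [B.label_lt_iff, hy]; decide
  have hkl : B.label x ≠ B.label y := fun e => hl (e ▸ hk)
  set k := B.label x with hkd
  set l := B.label y with hld
  set m : R r t →ₐ[ℂ] R r t := rename fun x => if x = k then l else x with hm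
  have mX : ∀ x, m (X x) = X (if x = k then l else x) := fun x => rename_X _ x
  have hdec : ∀ p, IsDecomposed x y (unlabel B (p - (m p - kill k l (m p)))) := by
    intro p
    obtain ⟨g, hg⟩ := dvd_sub_of_algHom (c := X k - X l) (AlgHom.id ℂ _) m (fun z => by
      rw [AlgHom.id_apply, mX]
      split_ifs with hz
      · rw [hz]
      · rw [sub_self]; exact dvd_zero _) p
    refine ⟨unlabel B (kill k l (m p)), ?_, unlabel B g, ?_⟩
    · refine algHom_mem ((unlabel B).comp (kill k l)) (fun z => ?_) (m p)
      obtain ⟨j, rfl⟩ := B.label.surjective z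
      rw [AlgHom.comp_apply, kill_X]
      split_ifs with hz
      · rw [map_zero]; exact Subalgebra.zero_mem _
      · rw [unlabel_X]
        have hj : j ∈ ({x, y}ᶜ : Set Pos) := ?_
        · exact Subalgebra.smul_mem _ (subset_adjoin (Set.mem_image_of_mem X hj)) _
        rintro (rfl | rfl)
        · exact hz (Or.inl rfl)
        · exact hz (Or.inr rfl)
    · have e1 : unlabel B (X k - X l) = X x + X y := by
        rw [map_sub, unlabel_X, unlabel_X, hx, hy]; simp
      rw [← e1, ← map_mul, ← hg, ← map_add, AlgHom.id_apply]
      congr 1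
      ring
  suffices H : m p - kill k l (m p) = 0 by
    have := hdec p
    rwa [H, sub_zero] at this
  set q := m p - kill k l (m p) with hqd
  have hq : Commute (polyMap ω B (unlabel B q)) e := by
    have := hp.sub_left (hD _ (hdec p))
    rwa [← map_sub, ← map_sub, sub_sub_cancel] at this
  have mm : m.comp m = m := algHom_ext fun z => by
    rw [AlgHom.comp_apply, mX, mX]
    split_ifs <;> simp_all
  have mk : m.comp (kill k l) = kill k l := algHom_ext fun z => by
    rw [AlgHom.comp_apply, kill_X]
    split_ifs with hz
    · exact map_zero m
    · rw [mX, if_neg fun e => hz (Or.inl e)]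
  have kk : (kill k l).comp (kill k l) = kill k l := algHom_ext fun z => by
    rw [AlgHom.comp_apply, kill_X]
    split_ifs with hz
    · exact map_zero _
    · rw [kill_X, if_neg hz]
  have mq : rename (fun z => if z = k then l else z) q = q := by
    change m q = q
    have e1 := DFunLike.congr_fun mm p
    have e2 := DFunLike.congr_fun mk (m p)
    rw [AlgHom.comp_apply] at e1 e2
    rw [hqd, map_sub, e1, e2]
  refine eq_zero_of_rename hkl mq ?_ fun n hn a ha => ?_
  · have e1 := DFunLike.congr_fun kk (m p)
    rw [AlgHom.comp_apply] at e1
    rw [hqd, map_sub, e1, sub_self]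
  · have h1 := lead_of_mul (b := fun k => k.val < r) (evPoly_one (ω := ω) (A := B) h _)
      (evPoly_X_mul h (g (Alg r t) (swap k l))) (fun k n a ha => dotOp_sub_lead h k ha) hn
    have h2 := lead_of_mul (b := fun k => ¬ k.val < r) (w := swap k l)
      (φ := evMor ω h (A := B) (B := B) e ∘ₗ evPoly (ω := ω) h B 1)
      (by rw [LinearMap.comp_apply, evPoly_one, he])
      (D := fun k => (sys ω h).inert B (B.label.symm k))
      (fun z p => by
        obtain ⟨j, rfl⟩ := B.label.surjective z
        rw [LinearMap.comp_apply, LinearMap.comp_apply, symm_apply_apply, ← val_poly, ← Yr_poly,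
          val_Yr, ← End.mul_apply, ← End.mul_apply, (inert_commute_evMor h B j _).eq]
        rfl)
      (fun k n a ha => inert_sub_lead h k ha) hn
    have h3 : evPoly (ω := ω) h B (g (Alg r t) (swap k l)) q =
        (evMor ω h (A := B) (B := B) e ∘ₗ evPoly (ω := ω) h B 1) q := by
      rw [LinearMap.comp_apply, evPoly_apply, evPoly_apply, ← he, ← End.mul_apply,
        ← End.mul_apply, ← evMor_comp, ← evMor_comp]
      exact congrArg (fun z => evMor ω h (A := B) (B := B) z 1) hq.eq
    rw [h3] at h1
    have h4 := mem_degLT_iff.1 (sub_mem h2 h1) (swap k l) a ha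
    rw [sub_sub_sub_cancel_left, map_sub, coeff_apply, coeff_apply, Pi.sub_apply, Pi.single_eq_same,
      Pi.single_eq_same] at h4
    obtain ⟨f1, f2⟩ := swap_inv_side hk hl
    rwa [f1, f2, mq] at h4

end

section
open Equiv MvPolynomial Pre CategoryTheory

variable (ω : ℕ → ℂ) {A B C : Seq r t}

/-- The morphism of a formal morphism. -/
def hom (f : Pre B C) : (Cat.mk B : Cat r t ω) ⟶ Cat.mk C := Mor.mk ω f

variable (B) in
/-- The endomorphism of a polynomial. -/
def pm (p : R r t) : (Cat.mk B : Cat r t ω) ⟶ Cat.mk B := polyMap ω B p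

variable {ω}

theorem hom_of {f g : Pre B C} (h : DefRel ω f g) : hom ω f = hom ω g := Quotient.sound (Rel.of h)

theorem hom_mul (g : Pre B C) (f : Pre A B) : hom ω (g ⬝ f) = hom ω f ≫ hom ω g := rfl

theorem hom_add (f g : Pre B C) : hom ω (Pre.add f g) = hom ω f + hom ω g := rfl

theorem hom_smul (c : ℂ) (f : Pre B C) : hom ω (Pre.smul c f) = c • hom ω f := rfl

theorem hom_id : hom ω (Pre.id B) = 𝟙 _ := rfl

theorem hom_zero : hom ω (Pre.zero B C) = 0 := rfl

theorem hom_sub (f g : Pre B C) : hom ω (Pre.sub f g) = hom ω f - hom ω g := by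
  rw [Pre.sub, hom_add, hom_smul, neg_one_smul, sub_eq_add_neg]

theorem hom_y (j : Pos) : hom ω (Pre.y B j) = pm ω B (X j) := (polyMap_X ω B j).symm

theorem pm_mul (p q : R r t) : pm ω B (p * q) = pm ω B p ≫ pm ω B q := by
  rw [mul_comm]; exact map_mul (polyMap ω B) q p

theorem pm_add (p q : R r t) : pm ω B (p + q) = pm ω B p + pm ω B q := map_add (polyMap ω B) p q

theorem pm_sub (p q : R r t) : pm ω B (p - q) = pm ω B p - pm ω B q := map_sub (polyMap ω B) p q

theorem pm_one : pm ω B 1 = 𝟙 _ := map_one (polyMap ω B)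

theorem pm_zero : pm ω B 0 = 0 := map_zero (polyMap ω B)

theorem pm_C (c : ℂ) : pm ω B (MvPolynomial.C c) = c • 𝟙 _ := by
  rw [← pm_one, C_eq_smul_one]; exact map_smul (polyMap ω B) c 1

theorem pm_comm (p q : R r t) : pm ω B p ≫ pm ω B q = pm ω B q ≫ pm ω B p := by
  rw [← pm_mul, mul_comm, pm_mul]

theorem pm_comp_of_mem {f : (Cat.mk B : Cat r t ω) ⟶ Cat.mk C} {c : R r t} {σ : Pos → Pos}
    {J : Set Pos}
    (hf : ∀ j ∈ J, pm ω B (X j) ≫ f ≫ pm ω C c = f ≫ pm ω C (X (σ j) * c)) {p : R r t}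
    (hp : p ∈ Algebra.adjoin ℂ (X '' J : Set (R r t))) :
    pm ω B p ≫ f ≫ pm ω C c = f ≫ pm ω C (rename σ p * c) := by
  induction hp using Algebra.adjoin_induction with
  | mem p hp =>
    obtain ⟨j, hj, rfl⟩ := hp
    rw [hf j hj, rename_X]
  | algebraMap a =>
    rw [MvPolynomial.algebraMap_eq, rename_C, pm_C, pm_mul, pm_C, Linear.smul_comp, Linear.smul_comp,
      Category.id_comp, Category.id_comp, Linear.comp_smul]
  | add p q _ _ hp hq =>
    rw [pm_add, Preadditive.add_comp, hp, hq, map_add, add_mul, pm_add, Preadditive.comp_add]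
  | mul p q _ _ hp hq =>
    rw [pm_mul, Category.assoc, hq, mul_comm, pm_mul, ← Category.assoc f, ← Category.assoc, hp, map_mul,
      mul_right_comm, pm_mul (B := C) _ (rename σ q), Category.assoc]

theorem mem_adjoin_X_univ (p : R r t) : p ∈ Algebra.adjoin ℂ (X '' Set.univ : Set (R r t)) := by
  rw [Set.image_univ, MvPolynomial.adjoin_range_X]; exact Algebra.mem_top

variable {i : Fin (r + t - 1)}

theorem refl_apply_lo : refl i (lo i) = hi i := swap_apply_left _ _

theorem refl_apply_hi : refl i (hi i) = lo i := swap_apply_right _ _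

theorem refl_apply_of_ne {j : Pos} (h : j ≠ lo i) (h' : j ≠ hi i) : refl i j = j :=
  swap_apply_of_ne_of_ne h h'

theorem rename_refl_of_mem {a : R r t} (ha : a ∈ Algebra.adjoin ℂ (X '' {lo i, hi i}ᶜ : Set (R r t))) :
    rename (refl i) a = a := by
  refine AlgHom.eqOn_adjoin_iff (ψ := AlgHom.id ℂ _).2 ?_ ha
  rintro _ ⟨k, hk, rfl⟩
  rw [Set.mem_compl_iff, Set.mem_insert_iff, Set.mem_singleton_iff, not_or] at hk
  rw [rename_X, refl_apply_of_ne hk.1 hk.2]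
  rfl

theorem y_comp_isS {f : Pre B C} (hf : IsS i f) {j : Pos} (h : j ≠ lo i) (h' : j ≠ hi i) :
    pm ω B (X j) ≫ hom ω f = hom ω f ≫ pm ω C (X j) := by
  rw [← hom_y, ← hom_y]; exact hom_of (DefRel.s_y_far h h' hf)

theorem pm_comp_isE {f : Pre B C} (hf : IsE i f) {a : R r t}
    (ha : a ∈ Algebra.adjoin ℂ (X '' {lo i, hi i}ᶜ : Set (R r t))) (p q : R r t) :
    pm ω B (a + (X (lo i) + X (hi i)) * p) ≫ hom ω f = hom ω f ≫ pm ω C (a + (X (lo i) + X (hi i)) * q) := by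
  have h1 : pm ω B (X (lo i) + X (hi i)) ≫ hom ω f = 0 := by
    rw [pm_add, ← hom_y, ← hom_y]; exact hom_of (DefRel.e_y_add hf)
  have h2 : hom ω f ≫ pm ω C (X (lo i) + X (hi i)) = 0 := by
    rw [pm_add, ← hom_y, ← hom_y]; exact hom_of (DefRel.y_add_e hf)
  have h3 := pm_comp_of_mem (ω := ω) (f := hom ω f) (c := 1) (σ := refl i) (J := {lo i, hi i}ᶜ) (fun j hj => by
    rw [Set.mem_compl_iff, Set.mem_insert_iff, Set.mem_singleton_iff, not_or] at hj
    rw [refl_apply_of_ne hj.1 hj.2, mul_one, pm_one, Category.comp_id, ← hom_y, ← hom_y]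
    exact hom_of (DefRel.e_y_far hj.1 hj.2 hf)) ha
  rw [rename_refl_of_mem ha, mul_one, pm_one, Category.comp_id] at h3
  rw [pm_add, Preadditive.add_comp, mul_comm, pm_mul, Category.assoc, h1, pm_add, Preadditive.comp_add, pm_mul,
    ← Category.assoc _ _ (pm ω C q), h2, h3, Limits.comp_zero, Limits.zero_comp]

theorem y_comp_sHat (hB : B (lo i) ≠ B (hi i)) :
    pm ω B (X (lo i)) ≫ hom ω (.gen (.sHat B i hB)) = hom ω (.gen (.sHat B i hB)) ≫ pm ω _ (X (hi i)) +
        hom ω (.gen (.eHat B i hB)) ∧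
      pm ω B (X (hi i)) ≫ hom ω (.gen (.sHat B i hB)) = hom ω (.gen (.sHat B i hB)) ≫ pm ω _ (X (lo i)) -
        hom ω (.gen (.eHat B i hB)) := by
  have h1 := hom_of (ω := ω) (DefRel.sHat_y (IsSHat.sHat B hB) (IsEHat.eHat B hB))
  have h2 := hom_of (ω := ω) (DefRel.sHat_y' (IsSHat.sHat B hB) (IsEHat.eHat B hB))
  rw [hom_sub, hom_mul, hom_mul, hom_y, hom_y] at h1 h2
  rw [hom_smul, neg_one_smul] at h2
  exact ⟨by rw [← h1, add_sub_cancel], by rw [sub_eq_add_neg, ← h2, add_sub_cancel]⟩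

theorem pm_comp_sHat_comp (hB : B (lo i) ≠ B (hi i)) (p : R r t) :
    pm ω B p ≫ hom ω (.gen (.sHat B i hB)) ≫ pm ω _ (X (lo i) + X (hi i)) =
      hom ω (.gen (.sHat B i hB)) ≫ pm ω _ (rename (refl i) p * (X (lo i) + X (hi i))) := by
  have h0 : hom ω (.gen (.eHat B i hB)) ≫ pm ω _ (X (lo i) + X (hi i)) = 0 := by
    rw [pm_add, ← hom_y, ← hom_y]; exact hom_of (DefRel.y_add_e (IsE.eHat B hB))
  refine pm_comp_of_mem (fun j _ => ?_) (mem_adjoin_X_univ p)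
  obtain ⟨h1, h2⟩ := y_comp_sHat (ω := ω) hB
  rw [← Category.assoc]
  by_cases hj : j = lo i
  · rw [hj, h1, refl_apply_lo, Preadditive.add_comp, h0, add_zero, Category.assoc, pm_mul]
  by_cases hj' : j = hi i
  · rw [hj', h2, refl_apply_hi, Preadditive.sub_comp, h0, sub_zero, Category.assoc, pm_mul]
  · rw [y_comp_isS (IsS.sHat B hB) hj hj', refl_apply_of_ne hj hj', Category.assoc, pm_mul]

theorem pm_comp_sHat (hB : B (lo i) ≠ B (hi i)) {p : R r t} (hp : IsDecomposed (lo i) (hi i) p) :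
    pm ω B p ≫ hom ω (.gen (.sHat B i hB)) = hom ω (.gen (.sHat B i hB)) ≫ pm ω _ (rename (refl i) p) := by
  obtain ⟨a, ha, g, rfl⟩ := hp
  obtain ⟨h1, h2⟩ := y_comp_sHat (ω := ω) hB
  have h3 := pm_comp_of_mem (ω := ω) (f := hom ω (.gen (.sHat B i hB))) (c := 1) (σ := refl i)
    (J := {lo i, hi i}ᶜ) (fun j hj => by
      rw [Set.mem_compl_iff, Set.mem_insert_iff, Set.mem_singleton_iff, not_or] at hj
      rw [refl_apply_of_ne hj.1 hj.2, mul_one, pm_one, Category.comp_id,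
        y_comp_isS (IsS.sHat B hB) hj.1 hj.2]) ha
  rw [mul_one, pm_one, Category.comp_id] at h3
  have h4 : pm ω B (X (lo i) + X (hi i)) ≫ hom ω (.gen (.sHat B i hB)) =
      hom ω (.gen (.sHat B i hB)) ≫ pm ω _ (X (lo i) + X (hi i)) := by
    rw [pm_add, Preadditive.add_comp, h1, h2, pm_add, Preadditive.comp_add]
    abel
  rw [map_add, pm_add, Preadditive.add_comp, h3, mul_comm, pm_mul, Category.assoc, h4, pm_comp_sHat_comp,
    pm_add (p := rename (refl i) a), Preadditive.comp_add, map_mul, map_add, rename_X, rename_X, refl_apply_lo, refl_apply_hi, add_comm (X (hi i))]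

theorem exists_pm_comp_s (hB : B (lo i) = B (hi i)) (p : R r t) :
    ∃ q, (X (lo i) - X (hi i)) * q = rename (refl i) p - p ∧
      pm ω B p ≫ hom ω (.gen (.s B i hB)) = hom ω (.gen (.s B i hB)) ≫ pm ω B (rename (refl i) p) + pm ω B q := by
  have h1 := hom_of (ω := ω) (DefRel.s_y B i hB)
  have h2 := hom_of (ω := ω) (DefRel.s_y' B i hB)
  rw [hom_sub, hom_mul, hom_mul, hom_y, hom_y] at h1 h2
  rw [hom_smul, neg_one_smul, hom_id, ← pm_one] at h1
  rw [hom_id, ← pm_one] at h2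
  induction p using MvPolynomial.induction_on with
  | C a =>
    exact ⟨0, by rw [rename_C, sub_self, mul_zero], by
      rw [rename_C, pm_C, pm_zero, Linear.smul_comp, Linear.comp_smul, Category.id_comp, Category.comp_id,
        add_zero]⟩
  | add p q hp hq =>
    obtain ⟨p', hp, hp'⟩ := hp
    obtain ⟨q', hq, hq'⟩ := hq
    refine ⟨p' + q', by rw [mul_add, hp, hq, map_add]; ring, ?_⟩
    rw [pm_add, Preadditive.add_comp, hp', hq', map_add, pm_add, pm_add, Preadditive.comp_add]
    abel
  | mul_X p j hp =>
    obtain ⟨q, hq, hq'⟩ := hp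
    have key : ∀ e : R r t, pm ω B (X j) ≫ hom ω (.gen (.s B i hB)) =
        hom ω (.gen (.s B i hB)) ≫ pm ω B (X (refl i j)) + pm ω B e →
        (X (lo i) - X (hi i)) * e = X (refl i j) - X j →
        ∃ q, (X (lo i) - X (hi i)) * q = rename (refl i) (p * X j) - p * X j ∧
          pm ω B (p * X j) ≫ hom ω (.gen (.s B i hB)) =
            hom ω (.gen (.s B i hB)) ≫ pm ω B (rename (refl i) (p * X j)) + pm ω B q := by
      intro e he he'
      refine ⟨e * rename (refl i) p + X j * q, ?_, ?_⟩
      · rw [map_mul, rename_X]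
        linear_combination rename (refl i) p * he' + X j * hq
      · rw [mul_comm p, pm_mul, Category.assoc, hq', Preadditive.comp_add, ← Category.assoc, he,
        Preadditive.add_comp, Category.assoc, ← pm_mul, ← pm_mul, ← pm_mul, add_assoc, ← pm_add, map_mul,
        rename_X]
    by_cases hj : j = lo i
    · subst hj
      refine key (-1) ?_ ?_
      · rw [refl_apply_lo, ← zero_sub, pm_sub, pm_zero, zero_sub, ← h1, add_sub_cancel]
      · rw [refl_apply_lo]; ring
    by_cases hj' : j = hi i
    · subst hj'
      refine key 1 ?_ ?_
      · rw [refl_apply_hi, ← h2, add_sub_cancel]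
      · rw [refl_apply_hi]; ring
    · refine key 0 ?_ ?_
      · rw [y_comp_isS (IsS.s B hB) hj hj', refl_apply_of_ne hj hj', pm_zero, add_zero]
      · rw [refl_apply_of_ne hj hj', mul_zero, sub_self]

theorem X_lo_sub_X_hi_ne_zero : (X (lo i) - X (hi i) : R r t) ≠ 0 :=
  sub_ne_zero.2 fun e => (lo_lt_hi i).ne (X_injective e)

theorem pm_comp_s (hB : B (lo i) = B (hi i)) {p : R r t} (hp : rename (refl i) p = p) :
    pm ω B p ≫ hom ω (.gen (.s B i hB)) = hom ω (.gen (.s B i hB)) ≫ pm ω B p := by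
  obtain ⟨q, h1, h2⟩ := exists_pm_comp_s (ω := ω) hB p
  rw [hp, sub_self, mul_eq_zero, or_iff_right X_lo_sub_X_hi_ne_zero] at h1
  rw [h2, hp, h1, pm_zero, add_zero]

theorem pm_comp_hom {P : Seq r t → R r t} (hP : ∀ (σ : Perm Pos) B, P (σ • B) = rename σ (P B))
    (hD : ∀ (B : Seq r t) (i : Fin (r + t - 1)), B (lo i) ≠ B (hi i) → IsDecomposed (lo i) (hi i) (P B))
    (f : Pre B C) : pm ω B (P B) ≫ hom ω f = hom ω f ≫ pm ω C (P C) := by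
  induction f with
  | gen g =>
    cases g with
    | y i => change pm ω _ _ ≫ hom ω (Pre.y _ i) = hom ω (Pre.y _ i) ≫ _; rw [hom_y, pm_comm]
    | s i h =>
      have := congrArg P (refl_smul_of_eq h)
      rw [hP] at this
      exact pm_comp_s h this
    | e i h =>
      obtain ⟨a, ha, g, e⟩ := hD _ i h
      rw [e]; exact pm_comp_isE (IsE.e _ h) ha g g
    | sHat i h => rw [hP, pm_comp_sHat h (hD _ i h)]
    | eHat i h =>
      obtain ⟨a, ha, g, e⟩ := hD _ i h
      rw [hP, e, map_add, map_mul, map_add, rename_X, rename_X, rename_refl_of_mem ha, refl_apply_lo, refl_apply_hi, add_comm (X (hi i))]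
      exact pm_comp_isE (IsE.eHat _ h) ha g _
  | id A => rw [hom_id, Category.id_comp, Category.comp_id]
  | mul g f hg hf => rw [hom_mul, ← Category.assoc, hf, Category.assoc, hg, Category.assoc]
  | zero => rw [hom_zero, Limits.comp_zero, Limits.zero_comp]
  | add f g hf hg => rw [hom_add, Preadditive.comp_add, Preadditive.add_comp, hf, hg]
  | smul c f hf => rw [hom_smul, Linear.comp_smul, Linear.smul_comp, hf]

end

section
open Equiv MvPolynomial Pre CategoryTheory

variable {ω : ℕ → ℂ} {A B C : Seq r t} {i : Fin (r + t - 1)}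

theorem pm_injective (h : 0 < r + t) {p q : R r t} (e : pm ω B p = pm ω B q) : p = q :=
  polyMap_injective ω B h e

theorem hom_comp_hom {f : Pre B C} {g : Pre C B} (hf : IsS i f) (hg : IsS i g) :
    hom ω f ≫ hom ω g = 𝟙 _ := hom_of (DefRel.s_sq hf hg)

theorem mul_eq_of_s_comp (h : 0 < r + t) (hB : B (lo i) = B (hi i)) {p q : R r t}
    (e : hom ω (.gen (.s B i hB)) ≫ pm ω B p = pm ω B q) : (X (hi i) - X (lo i)) * q = p := by
  have h1 := hom_of (ω := ω) (DefRel.s_y B i hB)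
  rw [hom_sub, hom_mul, hom_mul, hom_y, hom_y, hom_smul, neg_one_smul, hom_id, sub_eq_iff_eq_add] at h1
  have h2 := congrArg (pm ω B (X (lo i)) ≫ ·) e
  simp only [← Category.assoc, h1] at h2
  rw [Preadditive.add_comp, Preadditive.neg_comp, Category.id_comp, Category.assoc, pm_comm, ← Category.assoc, e,
    ← pm_mul, ← pm_mul, neg_add_eq_sub, ← pm_sub] at h2
  linear_combination pm_injective h h2

theorem eq_rename_of_comp (h : 0 < r + t) {f : Pre B C} (hf : IsS i f) {p q : R r t}
    (e : pm ω B p ≫ hom ω f = hom ω f ≫ pm ω C q) : q = rename (refl i) p := by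
  cases hf with
  | s hB =>
    have hs := IsS.s B hB
    obtain ⟨q', -, h1⟩ := exists_pm_comp_s (ω := ω) hB p
    rw [e, ← sub_eq_iff_eq_add', ← Preadditive.comp_sub, ← pm_sub] at h1
    have h2 := congrArg (hom ω (.gen (.s B i hB)) ≫ ·) h1
    simp only [← Category.assoc] at h2
    rw [hom_comp_hom hs hs, Category.id_comp] at h2
    have h3 := mul_eq_of_s_comp h hB h1
    have h4 := mul_eq_of_s_comp h hB h2.symm
    have h5 : ((X (hi i) - X (lo i)) * (X (hi i) - X (lo i)) - 1) * (q - rename (refl i) p) = 0 := by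
      linear_combination (X (hi i) - X (lo i)) * h4 + h3
    rcases mul_eq_zero.1 h5 with h6 | h6
    · have := congrArg (MvPolynomial.eval 0) h6
      simp at this
    · exact sub_eq_zero.1 h6
  | sHat hB =>
    obtain ⟨g, hg⟩ := exists_isS i (refl_smul_refl_smul i B).symm
    have h1 := pm_comp_sHat_comp (ω := ω) hB p
    rw [← Category.assoc, e, Category.assoc, ← pm_mul] at h1
    have h2 := congrArg (hom ω g ≫ ·) h1
    simp only [← Category.assoc] at h2
    rw [hom_comp_hom hg (IsS.sHat B hB), Category.id_comp, Category.id_comp] at h2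
    refine mul_right_cancel₀ (fun h0 => ?_) (pm_injective h h2)
    have := congrArg (MvPolynomial.eval (Pi.single (lo i) 1)) h0
    rw [map_add, eval_X, eval_X, Pi.single_eq_same, Pi.single_eq_of_ne (lo_lt_hi i).ne', map_zero] at this
    norm_num at this

theorem central_conj {X Y : Cat r t ω} (e : X ≅ Y) {u : X ⟶ X} (hu : ∀ g : X ⟶ X, u ≫ g = g ≫ u) (g : Y ⟶ Y) :
    (e.inv ≫ u ≫ e.hom) ≫ g = g ≫ e.inv ≫ u ≫ e.hom := by
  have := congrArg (fun v => e.inv ≫ v ≫ e.hom) (hu (e.hom ≫ g ≫ e.inv))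
  simpa using this

theorem exists_iso_of_central (h : 0 < r + t) (σ : Perm Pos) (hC : C = σ • B) {p : R r t}
    (hp : ∀ g, pm ω B p ≫ g = g ≫ pm ω B p) :
    ∃ e : (Cat.mk B : Cat r t ω) ≅ Cat.mk C, e.inv ≫ pm ω B p ≫ e.hom = pm ω C (rename σ p) := by
  induction σ using refl_induction generalizing B C p with
  | h1 =>
    obtain rfl : C = B := by rw [hC, one_smul]
    exact ⟨Iso.refl _, by simp⟩
  | hmul v w hv hw =>
    obtain ⟨e, he⟩ := hw rfl hp
    obtain ⟨e', he'⟩ := hv (hC.trans (mul_smul v w B)) (he ▸ central_conj e hp)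
    refine ⟨e ≪≫ e', ?_⟩
    rw [Perm.coe_mul, ← rename_rename, ← he', ← he]
    simp
  | hrefl i =>
    obtain ⟨f, hf⟩ := exists_isS i hC
    obtain ⟨g, hg⟩ := exists_isS i (show B = refl i • C by rw [hC, refl_smul_refl_smul])
    let e : (Cat.mk B : Cat r t ω) ≅ Cat.mk C := ⟨hom ω f, hom ω g, hom_comp_hom hf hg, hom_comp_hom hg hf⟩
    obtain ⟨q, hq⟩ := exists_polyMap_of_commute h (A := C) (z := e.inv ≫ pm ω B p ≫ e.hom)
      fun j => central_conj e hp (hom ω (Pre.y C j))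
    refine ⟨e, ?_⟩
    rw [← eq_rename_of_comp h hf (q := q) (ω := ω) (p := p)]
    · exact hq.symm
    · have : pm ω C q = e.inv ≫ pm ω B p ≫ e.hom := hq
      rw [this]
      exact (e.hom_inv_id_assoc _).symm

theorem evMor_e (h : 0 < r + t) (hB : B (lo i) ≠ B (hi i)) :
    evMor ω h (A := B) (B := B) (hom ω (.gen (.e B i hB))) 1 =
      Hecke.g (Alg r t) (swap (B.label (lo i)) (B.label (hi i))) := by
  have hne : B.label (lo i) ≠ B.label (hi i) := fun e => hB (congrArg B (B.label.injective e))
  change (sys ω h).ev (Pre.gen (Gen.e B i hB)) 1 = _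
  rw [CapSystem.ev_isE _ (IsE.e _ hB), CapSystem.capOf]
  split_ifs
  · exact sys_cap_one h hne
  · rw [sys_cap_one_comm, sys_cap_one h hne]

theorem isDecomposed_of_central (h : 0 < r + t) (hB : B (lo i) ≠ B (hi i)) {p : R r t}
    (hp : ∀ g, pm ω B p ≫ g = g ≫ pm ω B p) : IsDecomposed (lo i) (hi i) p := by
  have hD : ∀ p, IsDecomposed (lo i) (hi i) p →
      Commute (polyMap ω B p) (hom ω (.gen (.e B i hB)) : VVB ω B) := by
    rintro _ ⟨a, ha, g, rfl⟩
    exact (pm_comp_isE (IsE.e B hB) ha g g).symm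
  have hp' : Commute (polyMap ω B p) (hom ω (.gen (.e B i hB)) : VVB ω B) := (hp _).symm
  rcases B.eq_one_or (lo i) with hx | hx
  · exact isDecomposed_of_commute h hx ((B.eq_one_or (hi i)).resolve_left fun e => hB (hx.trans e.symm))
      (evMor_e h hB) hD hp'
  · refine (isDecomposed_of_commute h ((B.eq_one_or (hi i)).resolve_right fun e => hB (hx.trans e.symm)) hx
      ?_ (fun p hp => hD p hp.symm) hp').symm
    rw [evMor_e h hB, swap_comm]

theorem isDecomposed_of_isInvariant {p : R r t}
    (hp : IsInvariant (MulAction.stabilizer (Perm Pos) A) p) {i j i' j' : Pos}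
    (hij : A i ≠ A j) (hi : A i = A i') (hj : A j = A j') (hD : IsDecomposed i j p) : IsDecomposed i' j' p := by
  have key : ∀ {x x' i j : Pos}, A x = A x' → IsDecomposed i j p →
      IsDecomposed (swap x x' i) (swap x x' j) p := fun {x x' i j} hx hD => by
    have := hD.rename (swap x x')
    rwa [hp _ (swap_smul_of_eq hx)] at this
  have h1 := key hi hD
  rw [swap_apply_left] at h1
  have e : A (swap i i' j) = A j := by rw [← Seq.swap_smul_apply, swap_smul_of_eq hi]
  have h2 := key (e.trans hj) h1
  rwa [swap_apply_left, swap_apply_of_ne_of_ne] at h2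
  · exact fun h => hij (hi.trans ((congrArg A h).trans e))
  · exact fun h => hij (hi.trans ((congrArg A h).trans hj.symm))

theorem exists_smul_eq (A B : Seq r t) : ∃ σ : Perm Pos, σ • A = B := by
  obtain ⟨v, hv⟩ := A.2
  obtain ⟨w, hw⟩ := B.2
  refine ⟨w⁻¹ * v, Subtype.ext (funext fun x => ?_)⟩
  change A.1 ((w⁻¹ * v)⁻¹ x) = B.1 x
  rw [hv, hw]
  simp

theorem exists_family {p : R r t} (hp : IsInvariant (MulAction.stabilizer (Perm Pos) A) p) :
    ∃ P : Seq r t → R r t, ∀ σ : Perm Pos, P (σ • A) = rename σ p := by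
  choose τ hτ using exists_smul_eq A
  refine ⟨fun B => rename (τ B) p, fun σ => ?_⟩
  have h1 := hτ (σ • A)
  change rename (τ (σ • A)) p = _
  generalize τ (σ • A) = τ at h1 ⊢
  have h2 := hp (σ⁻¹ * τ) (by rw [MulAction.mem_stabilizer_iff, mul_smul, h1, inv_smul_smul])
  conv_rhs => rw [← h2, rename_rename, ← Perm.coe_mul, mul_inv_cancel_left]

theorem polyMap_mem_center {p : R r t} (hp : IsInvariant (MulAction.stabilizer (Perm Pos) A) p)
    {i j : Pos} (hij : A i ≠ A j) (hD : IsDecomposed i j p) (f : Pre A A) :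
    pm ω A p ≫ hom ω f = hom ω f ≫ pm ω A p := by
  obtain ⟨P, hP⟩ := exists_family hp
  have hPA : P A = p := by
    have := hP 1
    rwa [one_smul, Perm.coe_one, rename_id_apply] at this
  have := pm_comp_hom (ω := ω) (P := P) (fun σ B => ?_) (fun B k hB => ?_) f
  · rwa [hPA] at this
  · obtain ⟨τ, rfl⟩ := exists_smul_eq A B
    rw [← mul_smul, hP, hP, rename_rename, Perm.coe_mul]
  · obtain ⟨τ, rfl⟩ := exists_smul_eq A B
    rw [Seq.smul_apply, Seq.smul_apply] at hB
    rw [hP]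
    have key : IsDecomposed (τ⁻¹ (lo k)) (τ⁻¹ (hi k)) p := by
      have h1 := A.eq_one_or
      by_cases e : A i = A (τ⁻¹ (lo k))
      · refine isDecomposed_of_isInvariant hp hij e ?_ hD
        rcases h1 i with a | a <;> rcases h1 j with b | b <;> rcases h1 (τ⁻¹ (hi k)) with c | c <;> simp_all
      · refine (isDecomposed_of_isInvariant hp hij ?_ ?_ hD).symm <;>
        rcases h1 i with a | a <;> rcases h1 j with b | b <;> rcases h1 (τ⁻¹ (hi k)) with c | c <;>
          rcases h1 (τ⁻¹ (lo k)) with d | d <;> simp_all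
    have := key.rename τ
    rwa [← Perm.mul_apply, ← Perm.mul_apply, mul_inv_cancel] at this

theorem exists_of_mem_center (h : 0 < r + t) {z : VVB ω A} (hz : ∀ g : VVB ω A, g * z = z * g) :
    ∃ p, IsInvariant (MulAction.stabilizer (Perm Pos) A) p ∧
      (∀ {i j : Pos}, A i ≠ A j → IsDecomposed i j p) ∧ polyMap ω A p = z := by
  obtain ⟨p, rfl⟩ := exists_polyMap_of_commute h (z := z) fun j => hz (yElt ω A j)
  have hp : ∀ g, pm ω A p ≫ g = g ≫ pm ω A p := hz
  refine ⟨p, fun w hw => ?_, fun {i j} hij => ?_, rfl⟩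
  · obtain ⟨e, he⟩ := exists_iso_of_central h w hw.symm hp
    rw [hp, e.inv_hom_id_assoc] at he
    exact (pm_injective h he).symm
  · obtain ⟨σ, k, -, rfl, rfl⟩ := Tot.exists_perm_adj (fun e => hij (congrArg A e) : i ≠ j)
    obtain ⟨e, he⟩ := exists_iso_of_central h σ⁻¹ rfl hp
    have h1 := isDecomposed_of_central h (i := k) (p := rename (σ⁻¹ : Perm Pos) p)
      (B := σ⁻¹ • A) (ω := ω) (by rwa [Seq.smul_apply, Seq.smul_apply, inv_inv]) (he ▸ central_conj e hp)
    have := h1.rename σ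
    rwa [rename_rename, ← Perm.coe_mul, mul_inv_cancel, Perm.coe_one, rename_id_apply] at this

end

end

end WalledBrauer

theorem corollary4 (r t : ℕ) (ω : ℕ → ℂ) (A : WalledBrauer.Seq r t) (i j : Fin (r + t))
    (hij : A i ≠ A j) :
    Function.Injective (WalledBrauer.polyMap ω A) ∧ ∀ z : WalledBrauer.VVB ω A,
        z ∈ Subalgebra.center ℂ (WalledBrauer.VVB ω A) ↔ ∃ p : WalledBrauer.R r t,
            WalledBrauer.IsInvariant (MulAction.stabilizer (Equiv.Perm (Fin (r + t))) A) p ∧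
              WalledBrauer.QCancellation i j p ∧ WalledBrauer.polyMap ω A p = z := by
  have h : 0 < r + t := i.pos
  have hne : i ≠ j := fun e => hij (congrArg A e)
  refine ⟨WalledBrauer.polyMap_injective ω A h, fun z => ?_⟩
  rw [Subalgebra.mem_center_iff]
  constructor
  · intro hz
    obtain ⟨p, hp, hD, e⟩ := WalledBrauer.exists_of_mem_center h hz
    exact ⟨p, hp, (WalledBrauer.qCancellation_iff hne).2 (hD hij), e⟩
  · rintro ⟨p, hp, hq, rfl⟩ g
    induction g using Quotient.inductionOn with
    | h f => exact WalledBrauer.polyMap_mem_center hp hij ((WalledBrauer.qCancellation_iff hne).1 hq) f
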